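/- **Setting.** Let $d$ be a constant, $P\subset\mathbb{R}^d$ a set of $n\ge 2$ points, $\mu:P\to\mathbb{R}$ a supply function with $\sum_{p\in P}\mu(p)=0$, and $\varepsilon_0=2^{-k}$ with $k\in\mathbb{N}$. A *transportation map* is a $\tau:P\times P\to\mathbb{R}_{\ge0}$ with $\sum_{r}\tau(q,r)-\sum_{p}\tau(p,q)=\mu(q)$ for all $q\in P$; its cost is $\sum_{p,q}\tau(p,q)\,\|q-p\|_2$. *Quadtree.* For a finite point set $S$ let $\Delta_S$ be the side length of a minimum bounding axis-parallel square of $S$. A shifted square of $S$ is a square of side length $3\Delta_S$, concentric with a minimum bounding square of $S$, translated by a vector of $[0,\Delta_S)^d$. A conditionally-compressed quadtree $T^*$ over $P$ has as root a shifted square of $P$. A cell $C$ of side length $\Delta_C$ with point set $P'\subseteq P$ is treated as follows (squares are half-open). If $|P'|=1$, it is a leaf. If $|P'|>1$ and $\Delta_{P'}<\varepsilon_0\Delta_C/(3n^8)$, its only child is a shifted square of $P'$, with point set $P'$. Otherwise its children are those of the $2^d$ squares of side length $\Delta_C/2$ evenly dividing $C$ that contain a point of $P'$. Each cell is also divided into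 $\varepsilon_0^{-d}$ squares of side length $\varepsilon_0\Delta_C$; those that contain a point are its subcells. Assume that every cell created by the second rule lies within one subcell of its parent cell; then every subcell $\tilde C$ of a non-root cell lies in a unique subcell of the parent cell, its parent subcell. *Sparse graph.* $G^*=(V^*,E^*)$ has as vertices the points of $P$ and one net point at the center of every subcell. Its edges join any two net points of the same cell, every net point to the net point of its parent subcell (its parent net point), and every $p\in P$ to the net point of the smallest subcell containing $p$. Let $A$ be the vertex-edge incidence matrix for an arbitrary orientation $\vec E$ of $E^*$. Let $\hat f\in\mathbb{R}^{\vec E}$ be a flow on $G^*$ with divergence $(A\hat f)_p=\mu(p)$ at $p\in P$ and $0$ at the net points (in particular, $\hat f$ may be an approximately optimal such flow), and let $\|\hat f\|_{\vec E}=\sum_{(u,v)\in\vec E}|\hat f_{(u,v)}|\,\|v-u\|_2$. *Rerouting algorithm.* Extend $f=\hat f$ to all pairs of vertices, with $f_{(v,u)}=-f_{(u,v)}$ and $f=0$ off the edges. Every net point $v$ has two ordered sequences (prefix split trees) $pt(v)$, $nt(v)$ of weighted nodes, each of which represents a point. Initially $nt(v)$ has a node of weight $f_{(p,v)}$ for every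 $p\in P$ with $f_{(p,v)}>0$, and $pt(v)$ has a node of weight $f_{(v,p)}$ for every $p\in P$ with $f_{(v,p)}>0$. From then on, flow between $v$ and points of $P$ is represented only by the nodes. $\mathrm{PrefixSplit}(S,t)$ removes from $S$ and returns its maximal prefix of total weight at most $t$; if this weight is less than $t$, it first splits the next node in two so that the part returned weighs exactly $t$. Take the cells $C$ in postorder, and the net points $v$ of $C$ in any order. Let $M$ be the set of the net points of $C$ and their parent net points. For each $v$: 1. while there are $u,w\in M$ with $f_{(v,w)}>0>f_{(v,u)}$, let $\delta=\min\{f_{(u,v)},f_{(v,w)}\}$, add $\delta$ to $f_{(u,w)}$, and subtract $\delta$ from $f_{(u,v)}$ and $f_{(v,w)}$; 2. while there is $u\in M$ with $f_{(u,v)}>0$, put $\mathrm{PrefixSplit}(pt(v),f_{(u,v)})$ in front of $pt(u)$ and set $f_{(u,v)}=0$; 3. while there is $w\in M$ with $f_{(v,w)}>0$, put $\mathrm{PrefixSplit}(nt(v),f_{(v,w)})$ in front of $nt(w)$ and set $f_{(v,w)}=0$; 4. while $pt(v)$ and $nt(v)$ are both nonempty, take a node of some $p$ in $nt(v)$ and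 a node of some $q$ in $pt(v)$, let $\delta$ be the smaller of their weights, add $\delta$ to $f_{(p,q)}$, subtract $\delta$ from both weights, and delete the nodes whose weight is then $0$. Finally $\tau(p,q)=\max\{f_{(p,q)},0\}$ for $p,q\in P$. **Lemma.** However the choices left open are made, the algorithm terminates, and $\tau$ is a transportation map of cost at most $\|\hat f\|_{\vec E}$. The algorithm can be implemented to run in $O(n\,\varepsilon_0^{-2d}\log^2(n/\varepsilon_0))$ time, with a constant depending only on $d$. Precisely, there is a program for the real RAM (integer and real arrays, initially zero outside the input; addition, subtraction and comparison of integers; field operations and comparison of reals; no floor function; unit cost per operation) with the following property. Given $T^*$ (the parents of the cells), the cells and parents of the net points, and the list of oriented edges of $G^*$ with the values of $\hat f$, the program halts within that many operations and leaves in memory the list of all pairs $(p,q)$ with $\tau(p,q)>0$ and their values, without repetition, for the outcome $\tau$ of some run of the algorithm. -/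

import Mathlib

/-!
Contents: half-open cells and the conditionally-compressed quadtree of a finite point set,
the sparse graph built on it, minimum cost flow, the rerouting algorithm as a nondeterministic
transition system whose prefix split trees are sequences of weighted nodes, and a real RAM
(integer and real arrays, no floor function) with an explicit count of elementary operations.
-/

namespace TransportRecovery

open Finset

/-! ### Cells and the conditionally-compressed quadtree -/

/-- An axis-parallel `d`-dimensional square, given by its lowest corner and its side length. -/
@[ext] structure Cell (d : ℕ) where
  corner : Fin d → ℝ
  side : ℝ

namespace Cell

variable {d : ℕ}

/-- The points of a cell. Cells are half-open, so that the pieces of an even division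
partition the cell. -/
def region (C : Cell d) : Set (EuclideanSpace ℝ (Fin d)) :=
  {y | ∀ i, C.corner i ≤ y i ∧ y i < C.corner i + C.side}

/-- The piece with index `j` in the even division of `C` into `m ^ d` squares. -/
noncomputable def piece (C : Cell d) (m : ℕ) (j : Fin d → Fin m) : Cell d where
  corner i := C.corner i + (j i : ℝ) * (C.side / m)
  side := C.side / m

noncomputable def center (C : Cell d) : EuclideanSpace ℝ (Fin d) :=
  WithLp.toLp 2 fun i => C.corner i + C.side / 2

end Cell

/-- The parameter `ε₀`, whose inverse is a power of two. -/
noncomputable def eps (k : ℕ) : ℝ := ((2 : ℝ) ^ k)⁻¹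

section Quadtree

variable {n d : ℕ}

/-- The closed square with lowest corner `b` and side length `D` contains the points in `S`. -/
def InSquare (P : Fin n → EuclideanSpace ℝ (Fin d)) (S : Finset (Fin n))
    (b : Fin d → ℝ) (D : ℝ) : Prop :=
  ∀ p ∈ S, ∀ i, b i ≤ P p i ∧ P p i ≤ b i + D

/-- The side length of a minimum bounding square of the points in `S`. -/
noncomputable def boundingSide (P : Fin n → EuclideanSpace ℝ (Fin d)) (S : Finset (Fin n)) : ℝ :=
  sInf {D : ℝ | ∃ b, InSquare P S b D}

/-- `C` is a possible outcome of the random shift: if `b` is the lowest corner of a minimum bounding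
square of side length `D` of the points in `S`, then `C` is the concentric square of side length
`3 * D` translated by a vector of `[0, D) ^ d`. -/
def IsShiftedSquare (P : Fin n → EuclideanSpace ℝ (Fin d)) (S : Finset (Fin n))
    (C : Cell d) : Prop :=
  ∃ b s : Fin d → ℝ, InSquare P S b (boundingSide P S) ∧
    (∀ i, 0 ≤ s i ∧ s i < boundingSide P S) ∧
    C.side = 3 * boundingSide P S ∧
    ∀ i, C.corner i = b i - boundingSide P S + s i

/-- The test that triggers compression at a cell `C` whose points are those in `S`. -/
def Compresses (P : Fin n → EuclideanSpace ℝ (Fin d)) (k : ℕ) (S : Finset (Fin n))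
    (C : Cell d) : Prop :=
  boundingSide P S < eps k * C.side / (3 * (n : ℝ) ^ 8)

open Classical in
/-- A conditionally-compressed quadtree over the points `P`, for some outcome of all the random
shifts. Its cells are numbered arbitrarily; `pts c` is the set of points over which the subtree at
`c` is built. -/
structure Quadtree (P : Fin n → EuclideanSpace ℝ (Fin d)) (k : ℕ) where
  numCells : ℕ
  cell : Fin numCells → Cell d
  pts : Fin numCells → Finset (Fin n)
  parent : Fin numCells → Option (Fin numCells)
  root : Fin numCells
  parent_root : parent root = none
  reaches_root : ∀ c, Relation.ReflTransGen (fun a b => parent a = some b) c root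
  pts_root : pts root = univ
  cell_root : IsShiftedSquare P univ (cell root)
  /-- A cell with one point is a leaf. -/
  rule_leaf : ∀ c, #(pts c) = 1 → ∀ a, parent a ≠ some c
  /-- A cell whose points are very close together has as its only child the root of a quadtree
  over the same points with an independently shifted root square. -/
  rule_compress : ∀ c, 1 < #(pts c) → Compresses P k (pts c) (cell c) →
    (∃! a, parent a = some c) ∧
    ∀ a, parent a = some c → pts a = pts c ∧ IsShiftedSquare P (pts c) (cell a)
  /-- Any other cell is divided into `2 ^ d` squares, and those that contain a point become its
  children. -/
  rule_split : ∀ c, 1 < #(pts c) → ¬ Compresses P k (pts c) (cell c) →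
    (∀ a, parent a = some c → ∃ h : Fin d → Fin 2, cell a = (cell c).piece 2 h ∧
      pts a = {p ∈ pts c | P p ∈ ((cell c).piece 2 h).region} ∧ (pts a).Nonempty) ∧
    ∀ h : Fin d → Fin 2, (∃ p ∈ pts c, P p ∈ ((cell c).piece 2 h).region) →
      ∃! a, parent a = some c ∧ cell a = (cell c).piece 2 h

variable {P : Fin n → EuclideanSpace ℝ (Fin d)} {k : ℕ}

/-- The root cell of every compressed (independently shifted) subtree lies within one of the
`ε₀⁻ᵈ` regions of its parent cell. -/
def Quadtree.Nested (T : Quadtree P k) : Prop :=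
  ∀ c a, T.parent a = some c → 1 < #(T.pts c) → Compresses P k (T.pts c) (T.cell c) →
    ∃ j : Fin d → Fin (2 ^ k), (T.cell a).region ⊆ ((T.cell c).piece (2 ^ k) j).region

/-! ### The sparse graph -/

/-- Subcells: the regions, among the `ε₀⁻ᵈ` regions of side length `ε₀ * side` of a cell, that
contain a point. Every subcell carries one net point, so this is also the type of net points. -/
def Net (T : Quadtree P k) : Type :=
  {s : Fin T.numCells × (Fin d → Fin (2 ^ k)) //
    ∃ p ∈ T.pts s.1, P p ∈ ((T.cell s.1).piece (2 ^ k) s.2).region}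

namespace Net

variable {T : Quadtree P k}

/-- The quadtree cell to which a subcell belongs. -/
def owner (s : Net T) : Fin T.numCells := s.1.1

/-- The subcell itself. -/
noncomputable def subcell (s : Net T) : Cell d := (T.cell s.1.1).piece (2 ^ k) s.1.2

/-- `t` is the parent subcell of `s`; its net point is the parent net point of that of `s`. -/
def IsParent (s t : Net T) : Prop :=
  T.parent s.owner = some t.owner ∧ s.subcell.region ⊆ t.subcell.region

/-- `s` is the smallest subcell that contains the point `p`. -/
def IsSmallest (p : Fin n) (s : Net T) : Prop :=
  P p ∈ s.subcell.region ∧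
    ∀ t : Net T, P p ∈ t.subcell.region → s.subcell.side ≤ t.subcell.side

/-- With `C` the cell of `v`: `u` is a net point of `C` or the parent of a net point of `C`. -/
def Near (v u : Net T) : Prop :=
  u.owner = v.owner ∨ ∃ s : Net T, s.owner = v.owner ∧ s.IsParent u

end Net

/-- The vertices of the sparse graph: the input points and the net points. -/
abbrev Vert (T : Quadtree P k) : Type := Fin n ⊕ Net T

/-- The location of a vertex; net points are the centers of their subcells. -/
noncomputable def location (T : Quadtree P k) : Vert T → EuclideanSpace ℝ (Fin d)
  | .inl p => P p
  | .inr s => s.subcell.center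

/-- The sparse graph: a clique on the net points of every cell, an edge between every net point and
its parent net point, and an edge between every input point and the net point of the smallest
subcell that contains it. -/
def sparseGraph (T : Quadtree P k) : SimpleGraph (Vert T) :=
  SimpleGraph.fromRel fun u v =>
    match u, v with
    | .inr s, .inr t => s.owner = t.owner ∨ s.IsParent t
    | .inl p, .inr s => Net.IsSmallest p s
    | _, _ => False

end Quadtree

/-! ### Flows and transportation maps -/

section Flow

variable {V : Type*} {m : ℕ}

/-- The list `E` contains every edge of `G` exactly once, in an arbitrary orientation. -/
def IsOrientation (G : SimpleGraph V) (E : Fin m → V × V) : Prop :=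
  (∀ e, G.Adj (E e).1 (E e).2) ∧ ∀ u v, G.Adj u v → ∃! e, E e = (u, v) ∨ E e = (v, u)

open Classical in
/-- The vertex-edge incidence matrix. -/
noncomputable def incidence (E : Fin m → V × V) : Matrix V (Fin m) ℝ :=
  Matrix.of fun u e => if u = (E e).1 then 1 else if u = (E e).2 then -1 else 0

open Classical in
/-- The flow from `u` to `v` for arbitrary ordered pairs: antisymmetric, and zero off the edges. -/
noncomputable def flowBetween (E : Fin m → V × V) (f : Fin m → ℝ) (u v : V) : ℝ :=
  ∑ e, ((if E e = (u, v) then f e else 0) - (if E e = (v, u) then f e else 0))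

/-- The cost (norm) of a flow, for vertices with locations in Euclidean space. -/
noncomputable def flowCost {d : ℕ} (loc : V → EuclideanSpace ℝ (Fin d)) (E : Fin m → V × V)
    (f : Fin m → ℝ) : ℝ :=
  ∑ e, |f e| * dist (loc (E e).1) (loc (E e).2)

variable {n d : ℕ}

/-- The divergences of the flow instance: supplies at the input points, zero at the net points. -/
def demand {N : Type*} (μ : Fin n → ℝ) : Fin n ⊕ N → ℝ
  | .inl p => μ p
  | .inr _ => 0

def IsTransportationMap (μ : Fin n → ℝ) (τ : Fin n → Fin n → ℝ) : Prop :=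
  (∀ p q, 0 ≤ τ p q) ∧ ∀ q, ∑ r, τ q r - ∑ p, τ p q = μ q

noncomputable def transportCost (P : Fin n → EuclideanSpace ℝ (Fin d))
    (τ : Fin n → Fin n → ℝ) : ℝ :=
  ∑ p, ∑ q, τ p q * dist (P p) (P q)

end Flow

/-! ### The rerouting algorithm -/

/-- `PrefixSplit` on a sequence of weighted nodes: splits off the maximal prefix of total weight at
most `t`, splitting the next node in two if the prefix weighs less than `t`. The first component
is the part split off, the second is what remains. -/
noncomputable def prefixSplit {α : Type*} : List (α × ℝ) → ℝ → List (α × ℝ) × List (α × ℝ)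
  | [], _ => ([], [])
  | (p, a) :: L, t =>
    if a ≤ t then ((p, a) :: (prefixSplit L (t - a)).1, (prefixSplit L (t - a)).2)
    else if 0 < t then ([(p, t)], (p, a - t) :: L)
    else ([], (p, a) :: L)

open Classical in
/-- Increases the flow from `u` to `w` by `δ` (and so decreases that from `w` to `u`). -/
noncomputable def addFlow {V : Type*} (f : V → V → ℝ) (u w : V) (δ : ℝ) : V → V → ℝ :=
  fun a b => f a b + (if a = u ∧ b = w then δ else 0) - (if a = w ∧ b = u then δ else 0)

/-- The four loops executed for every net point. -/
inductive Phase where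
  | cancel
  | pull
  | push
  | pair

section Algorithm

variable {n d : ℕ} {P : Fin n → EuclideanSpace ℝ (Fin d)} {k : ℕ}

/-- A configuration. `todo` lists the net points still to be processed; its head is being processed,
in the loop `phase`. Flow between two net points and between two input points is stored
explicitly; the flow from a net point `v` to a point `p` is implicit: the total weight of the nodes
of `p` in `pt v` minus the total weight of the nodes of `p` in `nt v`. -/
structure Config (T : Quadtree P k) where
  todo : List (Net T)
  phase : Phase
  netFlow : Net T → Net T → ℝ
  pointFlow : Fin n → Fin n → ℝ
  pt : Net T → List (Fin n × ℝ)
  nt : Net T → List (Fin n × ℝ)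

/-- `PostorderForest T rs L`: `L` is the concatenation of postorder traversals of the subtrees of `T`
at the cells of the list `rs`, for some order of the children at every cell. -/
inductive PostorderForest (T : Quadtree P k) :
    List (Fin T.numCells) → List (Fin T.numCells) → Prop
  | nil : PostorderForest T [] []
  | cons {c : Fin T.numCells} {children rs L L' : List (Fin T.numCells)} :
      children.Nodup → (∀ a, a ∈ children ↔ T.parent a = some c) →
      PostorderForest T children L → PostorderForest T rs L' →
      PostorderForest T (c :: rs) (L ++ c :: L')

/-- An order in which the net points may be processed: the cells are taken in postorder, and the
net points of a cell in any order. -/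
def IsProcessingOrder (T : Quadtree P k) (todo : List (Net T)) : Prop :=
  ∃ (cells : List (Fin T.numCells)) (blocks : List (List (Net T))),
    PostorderForest T [T.root] cells ∧
    List.Forall₂ (fun c B => B.Nodup ∧ ∀ s : Net T, s ∈ B ↔ s.owner = c) cells blocks ∧
    todo = blocks.flatten

/-- The configurations in which the algorithm may start on the flow `f`: a point `p` that sends flow
to `v` has one node in `nt v`, a point that receives flow from `v` has one node in `pt v`, and the
weight of the node is the amount of the flow. -/
def Config.IsInitial {T : Quadtree P k} {m : ℕ} (E : Fin m → Vert T × Vert T) (f : Fin m → ℝ)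
    (c : Config T) : Prop :=
  IsProcessingOrder T c.todo ∧ c.phase = .cancel ∧
  (∀ u v, c.netFlow u v = flowBetween E f (.inr u) (.inr v)) ∧
  (∀ p q, c.pointFlow p q = 0) ∧
  (∀ v, (c.nt v).Nodup ∧
    ∀ p w, (p, w) ∈ c.nt v ↔ w = flowBetween E f (.inl p) (.inr v) ∧ 0 < w) ∧
  (∀ v, (c.pt v).Nodup ∧
    ∀ p w, (p, w) ∈ c.pt v ↔ w = flowBetween E f (.inr v) (.inl p) ∧ 0 < w)

open Classical in
/-- One step of the algorithm: one iteration of a loop, or the exit from a loop. All choices that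
the algorithm leaves open are nondeterministic. -/
inductive Step {T : Quadtree P k} : Config T → Config T → Prop
  /-- `u` sends flow to `v`, and `v` sends flow to `w`: route it directly from `u` to `w`. -/
  | cancel {v : Net T} {rest : List (Net T)} {f : Net T → Net T → ℝ} {g : Fin n → Fin n → ℝ}
      {pt nt : Net T → List (Fin n × ℝ)} (u w : Net T) (δ : ℝ) :
      v.Near u → v.Near w → 0 < f v w → f v u < 0 → δ = min (f u v) (f v w) →
      Step ⟨v :: rest, .cancel, f, g, pt, nt⟩
        ⟨v :: rest, .cancel, addFlow (addFlow (addFlow f u w δ) u v (-δ)) v w (-δ), g, pt, nt⟩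
  | cancel_exit {v : Net T} {rest : List (Net T)} {f : Net T → Net T → ℝ}
      {g : Fin n → Fin n → ℝ} {pt nt : Net T → List (Fin n × ℝ)} :
      (¬ ∃ u w, v.Near u ∧ v.Near w ∧ 0 < f v w ∧ f v u < 0) →
      Step ⟨v :: rest, .cancel, f, g, pt, nt⟩ ⟨v :: rest, .pull, f, g, pt, nt⟩
  /-- `u` sends flow to `v`: move a prefix of `pt v` of that weight to the front of `pt u`. -/
  | pull {v : Net T} {rest : List (Net T)} {f : Net T → Net T → ℝ} {g : Fin n → Fin n → ℝ}
      {pt nt : Net T → List (Fin n × ℝ)} (u : Net T) (S : List (Fin n × ℝ) × List (Fin n × ℝ)) :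
      v.Near u → 0 < f u v → S = prefixSplit (pt v) (f u v) →
      Step ⟨v :: rest, .pull, f, g, pt, nt⟩
        ⟨v :: rest, .pull, addFlow f u v (-f u v), g,
          Function.update (Function.update pt v S.2) u (S.1 ++ pt u), nt⟩
  | pull_exit {v : Net T} {rest : List (Net T)} {f : Net T → Net T → ℝ}
      {g : Fin n → Fin n → ℝ} {pt nt : Net T → List (Fin n × ℝ)} :
      (¬ ∃ u, v.Near u ∧ 0 < f u v) →
      Step ⟨v :: rest, .pull, f, g, pt, nt⟩ ⟨v :: rest, .push, f, g, pt, nt⟩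
  /-- `v` sends flow to `w`: move a prefix of `nt v` of that weight to the front of `nt w`. -/
  | push {v : Net T} {rest : List (Net T)} {f : Net T → Net T → ℝ} {g : Fin n → Fin n → ℝ}
      {pt nt : Net T → List (Fin n × ℝ)} (w : Net T) (S : List (Fin n × ℝ) × List (Fin n × ℝ)) :
      v.Near w → 0 < f v w → S = prefixSplit (nt v) (f v w) →
      Step ⟨v :: rest, .push, f, g, pt, nt⟩
        ⟨v :: rest, .push, addFlow f v w (-f v w), g, pt,
          Function.update (Function.update nt v S.2) w (S.1 ++ nt w)⟩
  | push_exit {v : Net T} {rest : List (Net T)} {f : Net T → Net T → ℝ}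
      {g : Fin n → Fin n → ℝ} {pt nt : Net T → List (Fin n × ℝ)} :
      (¬ ∃ w, v.Near w ∧ 0 < f v w) →
      Step ⟨v :: rest, .push, f, g, pt, nt⟩ ⟨v :: rest, .pair, f, g, pt, nt⟩
  /-- A node of `p` in `nt v` and a node of `q` in `pt v`: send the smaller of the two weights
  directly from `p` to `q`, and delete the nodes whose weight becomes zero. -/
  | pair {v : Net T} {rest : List (Net T)} {f : Net T → Net T → ℝ} {g : Fin n → Fin n → ℝ}
      {pt nt : Net T → List (Fin n × ℝ)} (p q : Fin n) (a b δ : ℝ)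
      (A B A' B' : List (Fin n × ℝ)) :
      nt v = A ++ (p, a) :: B → pt v = A' ++ (q, b) :: B' → δ = min a b →
      Step ⟨v :: rest, .pair, f, g, pt, nt⟩
        ⟨v :: rest, .pair, f, addFlow g p q δ,
          Function.update pt v (if b - δ = 0 then A' ++ B' else A' ++ (q, b - δ) :: B'),
          Function.update nt v (if a - δ = 0 then A ++ B else A ++ (p, a - δ) :: B)⟩
  | pair_exit {v : Net T} {rest : List (Net T)} {f : Net T → Net T → ℝ}
      {g : Fin n → Fin n → ℝ} {pt nt : Net T → List (Fin n × ℝ)} :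
      nt v = [] ∨ pt v = [] →
      Step ⟨v :: rest, .pair, f, g, pt, nt⟩ ⟨rest, .cancel, f, g, pt, nt⟩

/-- The map returned by the algorithm: the positive part of the flow between input points. -/
noncomputable def Config.result {T : Quadtree P k} (c : Config T) : Fin n → Fin n → ℝ :=
  fun p q => if 0 < c.pointFlow p q then c.pointFlow p q else 0

end Algorithm

/-! ### A real RAM with an explicit operation count -/

/-- The memory: countably many arrays of natural numbers and of real numbers. (A program uses only
finitely many of them; a scalar variable is entry `0` of an array.) -/
structure Store where
  nat : ℕ → ℕ → ℕ
  real : ℕ → ℕ → ℝ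

/-- Expressions for natural numbers: constants, array access, addition, truncated subtraction. -/
inductive NExp where
  | lit (c : ℕ)
  | get (a : ℕ) (i : NExp)
  | add (x y : NExp)
  | sub (x y : NExp)

/-- Expressions for real numbers: constants, array access and field operations. There is no
conversion of real numbers to integers. -/
inductive RExp where
  | zero
  | one
  | get (a : ℕ) (i : NExp)
  | add (x y : RExp)
  | sub (x y : RExp)
  | mul (x y : RExp)
  | div (x y : RExp)

/-- Tests. -/
inductive BExp where
  | nle (x y : NExp)
  | rle (x y : RExp)
  | neg (b : BExp)
  | conj (b c : BExp)

/-- Programs. -/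
inductive Cmd where
  | skip
  | nset (a : ℕ) (i e : NExp)
  | rset (a : ℕ) (i : NExp) (e : RExp)
  | seq (x y : Cmd)
  | ite (b : BExp) (x y : Cmd)
  | loop (b : BExp) (x : Cmd)

def NExp.eval (s : Store) : NExp → ℕ
  | lit c => c
  | get a i => s.nat a (i.eval s)
  | add x y => x.eval s + y.eval s
  | sub x y => x.eval s - y.eval s

noncomputable def RExp.eval (s : Store) : RExp → ℝ
  | zero => 0
  | one => 1
  | get a i => s.real a (i.eval s)
  | add x y => x.eval s + y.eval s
  | sub x y => x.eval s - y.eval s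
  | mul x y => x.eval s * y.eval s
  | div x y => x.eval s / y.eval s

def BExp.holds (s : Store) : BExp → Prop
  | nle x y => x.eval s ≤ y.eval s
  | rle x y => x.eval s ≤ y.eval s
  | neg b => ¬ b.holds s
  | conj b c => b.holds s ∧ c.holds s

/-- The number of elementary operations in the evaluation of an expression. -/
def NExp.cost : NExp → ℕ
  | lit _ => 1
  | get _ i => 1 + i.cost
  | add x y => 1 + x.cost + y.cost
  | sub x y => 1 + x.cost + y.cost

def RExp.cost : RExp → ℕ
  | zero => 1
  | one => 1
  | get _ i => 1 + i.cost
  | add x y => 1 + x.cost + y.cost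
  | sub x y => 1 + x.cost + y.cost
  | mul x y => 1 + x.cost + y.cost
  | div x y => 1 + x.cost + y.cost

def BExp.cost : BExp → ℕ
  | nle x y => 1 + x.cost + y.cost
  | rle x y => 1 + x.cost + y.cost
  | neg b => 1 + b.cost
  | conj b c => 1 + b.cost + c.cost

def Store.setNat (s : Store) (a i x : ℕ) : Store :=
  { s with nat := Function.update s.nat a (Function.update (s.nat a) i x) }

def Store.setReal (s : Store) (a i : ℕ) (x : ℝ) : Store :=
  { s with real := Function.update s.real a (Function.update (s.real a) i x) }

/-- `Exec x s s' t`: started in the memory `s`, the program `x` halts with the memory `s'` after `t`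
elementary operations. -/
inductive Exec : Cmd → Store → Store → ℕ → Prop
  | skip (s : Store) : Exec .skip s s 1
  | nset (a : ℕ) (i e : NExp) (s : Store) :
      Exec (.nset a i e) s (s.setNat a (i.eval s) (e.eval s)) (1 + i.cost + e.cost)
  | rset (a : ℕ) (i : NExp) (e : RExp) (s : Store) :
      Exec (.rset a i e) s (s.setReal a (i.eval s) (e.eval s)) (1 + i.cost + e.cost)
  | seq {x y : Cmd} {s s' s'' : Store} {t t' : ℕ} :
      Exec x s s' t → Exec y s' s'' t' → Exec (.seq x y) s s'' (t + t')
  | ite_true {b : BExp} {x y : Cmd} {s s' : Store} {t : ℕ} :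
      b.holds s → Exec x s s' t → Exec (.ite b x y) s s' (1 + b.cost + t)
  | ite_false {b : BExp} {x y : Cmd} {s s' : Store} {t : ℕ} :
      ¬ b.holds s → Exec y s s' t → Exec (.ite b x y) s s' (1 + b.cost + t)
  | loop_true {b : BExp} {x : Cmd} {s s' s'' : Store} {t t' : ℕ} :
      b.holds s → Exec x s s' t → Exec (.loop b x) s' s'' t' →
      Exec (.loop b x) s s'' (1 + b.cost + t + t')
  | loop_false {b : BExp} {x : Cmd} {s : Store} :
      ¬ b.holds s → Exec (.loop b x) s s (1 + b.cost)

section Encoding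

variable {n d : ℕ} {P : Fin n → EuclideanSpace ℝ (Fin d)} {k : ℕ}

open Classical in
/-- The parent net point, if there is one. -/
noncomputable def Net.parent? {T : Quadtree P k} (s : Net T) : Option (Net T) :=
  if h : ∃ t, s.IsParent t then some h.choose else none

/-- The identifier of a vertex: first the input points, then the net points. -/
def vertexId {T : Quadtree P k} {K : ℕ} (num : Net T ≃ Fin K) : Vert T → ℕ
  | .inl p => p
  | .inr s => n + num s

/-- The input memory, for an arbitrary numbering of the net points. Array `0` holds the numbers of
points, cells, net points and edges. Arrays `1`, `2`, `3` hold the parent of every cell, the cell of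
every net point, and the parent of every net point (parents are shifted by one, and `0` stands for
no parent). Arrays `4`, `5` hold the tails and heads of the edges, and real array `0` the flow on the
edges. Everything else is zero. -/
noncomputable def inputStore (T : Quadtree P k) {m K : ℕ} (num : Net T ≃ Fin K)
    (E : Fin m → Vert T × Vert T) (f : Fin m → ℝ) : Store where
  nat a i :=
    match a with
    | 0 => match i with
      | 0 => n
      | 1 => T.numCells
      | 2 => K
      | 3 => m
      | _ => 0
    | 1 => if h : i < T.numCells then
        (match T.parent ⟨i, h⟩ with | none => 0 | some c => (c : ℕ) + 1) else 0
    | 2 => if h : i < K then ((num.symm ⟨i, h⟩).owner : ℕ) else 0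
    | 3 => if h : i < K then
        (match (num.symm ⟨i, h⟩).parent? with | none => 0 | some s => (num s : ℕ) + 1) else 0
    | 4 => if h : i < m then vertexId num (E ⟨i, h⟩).1 else 0
    | 5 => if h : i < m then vertexId num (E ⟨i, h⟩).2 else 0
    | _ => 0
  real a i :=
    match a with
    | 0 => if h : i < m then f ⟨i, h⟩ else 0
    | _ => 0

/-- The memory `s` lists the support of `τ`, without repetition: the length of the list is entry `0`
of array `6`, the pairs are in arrays `7` and `8`, and their values are in real array `1`. -/
def Lists (s : Store) (τ : Fin n → Fin n → ℝ) : Prop :=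
  (∀ i < s.nat 6 0, ∃ p q : Fin n, s.nat 7 i = p ∧ s.nat 8 i = q ∧
    τ p q ≠ 0 ∧ s.real 1 i = τ p q) ∧
  ∀ p q : Fin n, τ p q ≠ 0 → ∃! i, i < s.nat 6 0 ∧ s.nat 7 i = p ∧ s.nat 8 i = q

end Encoding

end TransportRecovery

open TransportRecovery

/-! Correctness. A configuration represents a flow on all pairs of vertices: explicit between two
net points and between two input points, implicit in the nodes of the sequences between a net point
and an input point. `Inv` records that this flow keeps the prescribed divergences and costs at most
`flowCost`. Every rerouting step replaces flow along two consecutive segments by flow along the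
direct one, so the triangle inequality keeps the cost from growing (`Inv.cancel`, `Inv.pull_step`,
`Inv.push_step`, `Inv.pair_step`). When `v` is processed, the child cells are finished, so `v` has
flow only to net points of its own cell and of the parent cell (`Inv.near_head`). The first loop
leaves flow of one sign at `v`. Conservation then makes the sequence heavy enough to be split
exactly (`Inv.weight_pt`, `Inv.weight_nt`). Once no flow to net points is left, the two sequences at
`v` have equal weight, so the last loop empties both (`Inv.pair_exit`). In the end all flow runs
between input points, and its positive part is the map (`Inv.final`). Termination follows from a
lexicographic measure (`measure_lt`): an iteration of the first loop makes a nonzero flow at `v`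
vanish and creates no new one there.

Size. The tree has `O(n log(n/ε₀))` cells. In a chain of cells with the same points, ordinary
division halves the side while the compression test bounds the ratio of the side to the bounding
square, and after a compression no further one happens in the chain (`chainLeft_child`). Branching
is charged to the points (`subtreeBound_children`). A cell has at most `ε₀⁻ᵈ` net points, which
gives `O(ε₀⁻²ᵈ)` edges per cell (`card_edges_le`).

Time. The sequences are stored as binary trees without any balance condition. A split cuts a path
from the root to a leaf and joins the subtrees that hang off it two at a time. As for splay trees, a
potential that sums the logarithms of the numbers of leaves makes the amortized cost logarithmic
(`Rope.comb_pot`, `Rope.split_pot`). A constant share of the potential per inner node prepays the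
last loop, which dissolves the trees. The first loop uses two pointers, so a net point costs one
logarithmic operation per candidate, and there are at most `2 ε₀⁻ᵈ` candidates. Summing over all net
points gives one logarithm from the number of cells and one from the trees.

The program is verified with weakest preconditions that carry time credits (`Cmd.wp`,
`Cmd.wp_loop`). Its memory represents a configuration at every net point, and its loops perform
genuine steps of the algorithm (`netCmd_sim`, `mainCmd_wp`, `rerouteCmd_wp`). -/

namespace TransportRecovery

open Finset

/-! ### Sequences of weighted nodes -/

section Lists

variable {α : Type*}

/-- The sum of `h` over the nodes of a sequence, weighted by the weights of the nodes. -/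
def lin (h : α → ℝ) (l : List (α × ℝ)) : ℝ := (l.map fun x => x.2 * h x.1).sum

@[simp] lemma lin_nil (h : α → ℝ) : lin h [] = 0 := rfl

@[simp] lemma lin_cons (h : α → ℝ) (x : α × ℝ) (l : List (α × ℝ)) :
    lin h (x :: l) = x.2 * h x.1 + lin h l := rfl

@[simp] lemma lin_append (h : α → ℝ) (l l' : List (α × ℝ)) :
    lin h (l ++ l') = lin h l + lin h l' := by
  simp [lin]

/-- The total weight of a sequence. -/
abbrev weight (l : List (α × ℝ)) : ℝ := lin (fun _ => 1) l

def Positive (l : List (α × ℝ)) : Prop := ∀ x ∈ l, 0 < x.2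

lemma Positive.weight_nonneg {l : List (α × ℝ)} (h : Positive l) : 0 ≤ weight l := by
  induction l with
  | nil => simp
  | cons x l ih =>
    have h1 := h x (by simp)
    have h2 := ih fun y hy => h y (by simp [hy])
    simp only [weight, lin_cons] at h2 ⊢
    linarith

/-- Converts equality of the two weights at a net point into emptiness of the second sequence once
the first is exhausted. -/
lemma Positive.eq_nil {l : List (α × ℝ)} (h : Positive l) (h0 : weight l ≤ 0) : l = [] := by
  cases l with
  | nil => rfl
  | cons x l =>
    have h1 := h x (by simp)
    have h2 : 0 ≤ weight l := Positive.weight_nonneg fun y hy => h y (by simp [hy])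
    simp only [weight, lin_cons] at h0 h2
    linarith

lemma Positive.append {l l' : List (α × ℝ)} (h : Positive l) (h' : Positive l') :
    Positive (l ++ l') := by
  intro x hx
  rcases List.mem_append.1 hx with hx | hx
  exacts [h x hx, h' x hx]

/-- Splitting a node divides its weight without changing its point. Keeping `h` arbitrary serves
three purposes: `h = 1` gives total weights, the indicator of a point gives its divergence, and the
distance to a net point gives the cost. -/
lemma prefixSplit_lin (h : α → ℝ) (l : List (α × ℝ)) (t : ℝ) :
    lin h (prefixSplit l t).1 + lin h (prefixSplit l t).2 = lin h l := by
  induction l generalizing t with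
  | nil => simp [prefixSplit]
  | cons x l ih =>
    obtain ⟨p, a⟩ := x
    unfold prefixSplit
    split_ifs with h1 h2
    · have := ih (t - a)
      simp only [lin_cons]
      linarith
    · simp only [lin_cons, lin_nil]
      ring
    · simp

lemma prefixSplit_positive {l : List (α × ℝ)} (hl : Positive l) (t : ℝ) :
    Positive (prefixSplit l t).1 ∧ Positive (prefixSplit l t).2 := by
  induction l generalizing t with
  | nil => simp [prefixSplit, Positive]
  | cons x l ih =>
    obtain ⟨p, a⟩ := x
    have hl' : Positive l := fun y hy => hl y (by simp [hy])
    have ha : 0 < a := hl (p, a) (by simp)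
    unfold prefixSplit
    split_ifs with h1 h2
    · obtain ⟨i1, i2⟩ := ih hl' (t - a)
      refine ⟨?_, i2⟩
      intro y hy
      rcases List.mem_cons.1 hy with rfl | hy
      exacts [ha, i1 y hy]
    · refine ⟨by intro y hy; simp at hy; subst hy; exact h2, ?_⟩
      intro y hy
      rcases List.mem_cons.1 hy with rfl | hy
      · simp only; linarith
      · exact hl' y hy
    · exact ⟨by simp [Positive], hl⟩

/-- The bound on `t` is essential: for larger `t` the whole sequence is returned. Conservation of
flow supplies it in the algorithm. -/
lemma prefixSplit_weight {l : List (α × ℝ)} (hl : Positive l) {t : ℝ} (h0 : 0 ≤ t)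
    (h1 : t ≤ weight l) : weight (prefixSplit l t).1 = t := by
  induction l generalizing t with
  | nil => simp [prefixSplit] at h1 ⊢; linarith
  | cons x l ih =>
    obtain ⟨p, a⟩ := x
    have hl' : Positive l := fun y hy => hl y (by simp [hy])
    simp only [weight, lin_cons] at h1 ih
    unfold prefixSplit
    split_ifs with h2 h3
    · have := ih hl' (t := t - a) (by linarith) (by linarith)
      simp only [weight, lin_cons, this]
      ring
    · simp [weight]
    · simp only [weight, lin_nil]; linarith

end Lists

/-! ### Flows on a vertex set -/

section AddFlow

open Classical

variable {V : Type*}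

lemma addFlow_apply (f : V → V → ℝ) (u w : V) (δ : ℝ) (a b : V) :
    addFlow f u w δ a b =
      f a b + (if a = u ∧ b = w then δ else 0) - (if a = w ∧ b = u then δ else 0) := rfl

lemma addFlow_anti {f : V → V → ℝ} (hf : ∀ a b, f a b = - f b a) (u w : V) (δ : ℝ) (a b : V) :
    addFlow f u w δ a b = - addFlow f u w δ b a := by
  simp only [addFlow_apply, hf a b, and_comm (a := b = u), and_comm (a := b = w)]
  ring

lemma addFlow_sum [Fintype V] (f : V → V → ℝ) (u w : V) (δ : ℝ) (a : V) :
    ∑ b, addFlow f u w δ a b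
      = ∑ b, f a b + (if a = u then δ else 0) - (if a = w then δ else 0) := by
  simp only [addFlow_apply, sum_sub_distrib, sum_add_distrib, ite_and]
  by_cases h1 : a = u <;> by_cases h2 : a = w <;> simp [h1, h2]

/-- Twice the cost of an antisymmetric flow. -/
noncomputable def pairCost [Fintype V] (D : V → V → ℝ) (f : V → V → ℝ) : ℝ :=
  ∑ a, ∑ b, |f a b| * D a b

/-- Only the entries at `(u, w)` and `(w, u)` change, and by antisymmetry both change their absolute
value by the same amount; hence the factor two. -/
lemma pairCost_addFlow [Fintype V] {D : V → V → ℝ} (hD : ∀ a b, D a b = D b a)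
    (hD0 : ∀ a, D a a = 0) {f : V → V → ℝ} (hf : ∀ a b, f a b = - f b a) (u w : V) (δ : ℝ) :
    pairCost D (addFlow f u w δ) = pairCost D f + 2 * ((|f u w + δ| - |f u w|) * D u w) := by
  -- On the diagonal the two corrections cancel, and the distance is zero.
  by_cases huw : u = w
  · subst huw
    have : addFlow f u u δ = f := by
      funext a b
      simp [addFlow_apply]
    rw [this, hD0]
    ring
  have key : ∀ a b, |addFlow f u w δ a b| * D a b = |f a b| * D a b
      + ((if a = u then (if b = w then (|f u w + δ| - |f u w|) * D u w else 0) else 0)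
      + (if a = w then (if b = u then (|f u w + δ| - |f u w|) * D u w else 0) else 0)) := by
    intro a b
    rw [addFlow_apply]
    by_cases h1 : a = u
    · subst h1
      by_cases h2 : b = w
      · subst h2
        simp [huw]
        ring
      · simp [h2, huw]
    · by_cases h2 : a = w
      · subst h2
        by_cases h3 : b = u
        · subst h3
          have e : |-f b a - δ| = |f b a + δ| := by rw [← abs_neg]; ring_nf
          simp [h1, e, hf a b, hD a b]
          ring
        · simp [h1, h3]
      · simp [h1, h2]
  unfold pairCost
  simp only [key, sum_add_distrib]
  simp
  ring

end AddFlow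

/-! ### Invariants of the rerouting algorithm -/

section Invariants

open Classical

variable {n d : ℕ} {P : Fin n → EuclideanSpace ℝ (Fin d)} {k : ℕ} {T : Quadtree P k}

instance : Finite (Net T) := by
  unfold Net
  infer_instance

noncomputable instance : Fintype (Net T) := Fintype.ofFinite _

/-- `F` may depend on the index, since the same weighted node costs a different amount at a
different net point. -/
lemma sum_update_update {ι β : Type*} [Fintype ι] (F : ι → β → ℝ) (g : ι → β) {u v : ι}
    (huv : u ≠ v) (a b : β) :
    ∑ x, F x (Function.update (Function.update g v a) u b x)
      = ∑ x, F x (g x) + (F v a - F v (g v)) + (F u b - F u (g u)) := by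
  have key : ∀ x, F x (Function.update (Function.update g v a) u b x)
      = F x (g x) + (if x = v then F v a - F v (g v) else 0)
        + (if x = u then F u b - F u (g u) else 0) := by
    intro x
    by_cases h1 : x = u
    · subst h1; simp [huv]
    · by_cases h2 : x = v
      · subst h2; simp [h1]
      · simp [h1, h2]
  simp only [key, sum_add_distrib]
  simp

lemma sum_update {ι β : Type*} [Fintype ι] (F : ι → β → ℝ) (g : ι → β) (v : ι) (a : β) :
    ∑ x, F x (Function.update g v a x) = ∑ x, F x (g x) + (F v a - F v (g v)) := by
  have key : ∀ x, F x (Function.update g v a x)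
      = F x (g x) + (if x = v then F v a - F v (g v) else 0) := by
    intro x
    by_cases h2 : x = v
    · subst h2; simp
    · simp [h2]
  simp only [key, sum_add_distrib]
  simp

/-- Every net point comes after the net points of the children of its cell. -/
structure ChildrenFirst (order : List (Net T)) : Prop where
  mem : ∀ v, v ∈ order
  before : ∀ (D : List (Net T)) (v : Net T) (rest : List (Net T)), order = D ++ v :: rest →
    ∀ u : Net T, T.parent u.owner = some v.owner → u ∈ D

noncomputable def netDist (u v : Net T) : ℝ := dist (location T (.inr u)) (location T (.inr v))

noncomputable def pointDist (v : Net T) (p : Fin n) : ℝ := dist (P p) (location T (.inr v))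

/-- The cost of the flow represented by a configuration. -/
noncomputable def Config.cost (c : Config T) : ℝ :=
  (pairCost netDist c.netFlow + pairCost (fun p q => dist (P p) (P q)) c.pointFlow) / 2
    + ∑ v, lin (pointDist v) (c.pt v) + ∑ v, lin (pointDist v) (c.nt v)

/-- The indicator function of a point. -/
noncomputable def ind (p q : Fin n) : ℝ := if q = p then 1 else 0

/-- What holds in every configuration that is reachable from an initial one. -/
structure Inv (μ : Fin n → ℝ) (B : ℝ) (order : List (Net T)) (c : Config T) : Prop where
  done : ∃ D, order = D ++ c.todo ∧
    ∀ v ∈ D, (∀ u, c.netFlow v u = 0) ∧ c.pt v = [] ∧ c.nt v = []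
  anti : ∀ u v, c.netFlow u v = - c.netFlow v u
  near : ∀ u v, c.netFlow u v ≠ 0 → u.Near v ∨ v.Near u
  posPt : ∀ v, Positive (c.pt v)
  posNt : ∀ v, Positive (c.nt v)
  netBal : ∀ v, ∑ u, c.netFlow v u + weight (c.pt v) - weight (c.nt v) = 0
  pointAnti : ∀ p q, c.pointFlow p q = - c.pointFlow q p
  pointBal : ∀ p, ∑ q, c.pointFlow p q + ∑ v, lin (ind p) (c.nt v) - ∑ v, lin (ind p) (c.pt v)
    = μ p
  cost_le : c.cost ≤ B
  pull : ∀ v rest, c.todo = v :: rest → c.phase = .pull →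
    (∀ u, 0 ≤ c.netFlow v u) ∨ ∀ u, c.netFlow v u ≤ 0
  push : ∀ v rest, c.todo = v :: rest → c.phase = .push → ∀ u, 0 ≤ c.netFlow v u
  pair : ∀ v rest, c.todo = v :: rest → c.phase = .pair → ∀ u, c.netFlow v u = 0

variable {μ : Fin n → ℝ} {B : ℝ} {order : List (Net T)}

lemma netDist_comm (u v : Net T) : netDist u v = netDist v u := dist_comm _ _

lemma netDist_self (u : Net T) : netDist u u = 0 := dist_self _

lemma Inv.self {c : Config T} (h : Inv μ B order c) (v : Net T) : c.netFlow v v = 0 := by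
  have := h.anti v v
  linarith

/-- Flow lives on pairs that are near in one of the two directions. If only `u.Near v` holds, then
`u` lies in a child of the cell of `v`, hence is already processed and has no flow. So the exit
tests, which look only at `Near` net points, speak of all flow at `v`. -/
lemma Inv.near_head (ho : ChildrenFirst order) {c : Config T} (h : Inv μ B order c) {v : Net T}
    {rest : List (Net T)} (hv : c.todo = v :: rest) {u : Net T} (hu : c.netFlow v u ≠ 0) :
    v.Near u := by
  rcases h.near v u hu with h1 | h1
  · exact h1
  · rcases h1 with h1 | ⟨s, hs, hp⟩
    · exact Or.inl h1.symm
    · exfalso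
      obtain ⟨D, hD, h2⟩ := h.done
      rw [hv] at hD
      have := ho.before D v rest hD u (by rw [← hs]; exact hp.1)
      apply hu
      rw [h.anti, (h2 u this).1 v, neg_zero]

/-- Both net points lie in the cell of `v` or in its parent cell. Hence they share a cell, or one
lies in the parent cell as the parent of some net point in the cell of the other. This keeps the
field `near` of `Inv` alive when flow is bypassed. -/
lemma near_of_near {v u w : Net T} (hu : v.Near u) (hw : v.Near w) : u.Near w ∨ w.Near u := by
  rcases hu with hu | ⟨s, hs, hp⟩
  · left
    unfold Net.Near
    rw [hu]
    exact hw
  · rcases hw with hw | ⟨s', hs', hp'⟩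
    · right
      unfold Net.Near
      rw [hw]
      exact Or.inr ⟨s, hs, hp⟩
    · left
      left
      have h1 := hp.1
      have h2 := hp'.1
      rw [hs] at h1
      rw [hs', h1] at h2
      exact (Option.some.inj h2).symm

/-- The detour from `u` through `v` to `w` is replaced by the direct pair: the balance at `v`, `u`
and `w` is unaffected, and the triangle inequality controls the cost. -/
lemma Inv.cancel {v : Net T} {rest : List (Net T)}
    {f : Net T → Net T → ℝ} {g : Fin n → Fin n → ℝ} {pt nt : Net T → List (Fin n × ℝ)}
    {u w : Net T} {δ : ℝ} (h : Inv μ B order ⟨v :: rest, .cancel, f, g, pt, nt⟩)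
    (hu : v.Near u) (hw : v.Near w) (h1 : 0 < f v w) (h2 : f v u < 0)
    (hδ : δ = min (f u v) (f v w)) :
    Inv μ B order ⟨v :: rest, .cancel,
      addFlow (addFlow (addFlow f u w δ) u v (-δ)) v w (-δ), g, pt, nt⟩ := by
  have hanti : ∀ a b, f a b = - f b a := h.anti
  have hself : ∀ a, f a a = 0 := h.self
  have huv : 0 < f u v := by rw [hanti]; linarith
  have hδ0 : 0 < δ := hδ ▸ lt_min huv h1
  have hδu : δ ≤ f u v := hδ ▸ min_le_left _ _
  have hδw : δ ≤ f v w := hδ ▸ min_le_right _ _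
  have nuv : u ≠ v := by rintro rfl; rw [hself] at huv; exact lt_irrefl _ huv
  have nvw : v ≠ w := by rintro rfl; rw [hself] at h1; exact lt_irrefl _ h1
  have nuw : u ≠ w := by rintro rfl; linarith
  have a1 := addFlow_anti hanti u w δ
  have a2 := addFlow_anti a1 u v (-δ)
  have a3 := addFlow_anti a2 v w (-δ)
  refine ⟨?_, a3, ?_, h.posPt, h.posNt, ?_, h.pointAnti, h.pointBal, ?_, ?_, ?_, ?_⟩
  · obtain ⟨D, hD, hd⟩ := h.done
    refine ⟨D, hD, fun x hx => ⟨fun y => ?_, (hd x hx).2⟩⟩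
    -- A processed net point carries no flow, whereas `u`, `v` and `w` do, so its row is untouched.
    have hx0 : ∀ y, f x y = 0 := (hd x hx).1
    have xu : x ≠ u := by rintro rfl; rw [hx0] at huv; exact lt_irrefl _ huv
    have xv : x ≠ v := by rintro rfl; rw [hx0] at h1; exact lt_irrefl _ h1
    have xw : x ≠ w := by rintro rfl; rw [hanti, hx0] at h1; simp at h1
    simp [addFlow_apply, xu, xv, xw, hx0]
  · intro x y hxy
    by_contra hcon
    have hf0 : f x y = 0 := by
      by_contra hne
      exact hcon (h.near x y hne)
    have hf1 : f y x = 0 := by rw [hanti, hf0, neg_zero]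
    have huw := near_of_near hu hw
    apply hxy
    have e1 : ¬ (x = u ∧ y = w) := by rintro ⟨rfl, rfl⟩; exact hcon huw
    have e2 : ¬ (x = w ∧ y = u) := by rintro ⟨rfl, rfl⟩; exact hcon huw.symm
    have e3 : ¬ (x = u ∧ y = v) := by rintro ⟨rfl, rfl⟩; exact hcon (.inr hu)
    have e4 : ¬ (x = v ∧ y = u) := by rintro ⟨rfl, rfl⟩; exact hcon (.inl hu)
    have e5 : ¬ (x = v ∧ y = w) := by rintro ⟨rfl, rfl⟩; exact hcon (.inl hw)
    have e6 : ¬ (x = w ∧ y = v) := by rintro ⟨rfl, rfl⟩; exact hcon (.inr hw)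
    simp [addFlow_apply, e1, e2, e3, e4, e5, e6, hf0]
  · intro x
    have := h.netBal x
    simp only at this
    simp only [addFlow_sum]
    split_ifs <;> linarith
  · refine le_trans ?_ h.cost_le
    unfold Config.cost
    simp only
    have e1 := pairCost_addFlow netDist_comm netDist_self hanti u w δ
    have e2 := pairCost_addFlow netDist_comm netDist_self a1 u v (-δ)
    have e3 := pairCost_addFlow netDist_comm netDist_self a2 v w (-δ)
    -- The three pairs are distinct, so each update meets the original value of its entry.
    have v2 : addFlow f u w δ u v = f u v := by simp [addFlow_apply, nvw, nuw]
    have v3 : addFlow (addFlow f u w δ) u v (-δ) v w = f v w := by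
      simp [addFlow_apply, nuv.symm, nvw, nuw.symm, nvw.symm]
    rw [v2] at e2
    rw [v3] at e3
    rw [e3, e2, e1]
    -- Only an inequality here: earlier flow from `w` to `u` may be cancelled. On the other two
    -- pairs the decrease is exactly `δ`.
    have t1 : |f u w + δ| - |f u w| ≤ δ := by
      have := abs_add_le (f u w) δ
      rw [abs_of_pos hδ0] at this
      linarith
    have t2 : |f u v + -δ| - |f u v| = -δ := by
      rw [abs_of_pos huv, abs_of_nonneg (by linarith)]; ring
    have t3 : |f v w + -δ| - |f v w| = -δ := by
      rw [abs_of_pos h1, abs_of_nonneg (by linarith)]; ring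
    rw [t2, t3]
    have tri : netDist u w ≤ netDist u v + netDist v w := dist_triangle _ _ _
    have hd : 0 ≤ netDist u w := dist_nonneg
    have m1 := mul_le_mul_of_nonneg_right t1 hd
    have m2 := mul_le_mul_of_nonneg_left tri hδ0.le
    linarith
  · intro _ _ _ hp; exact nomatch hp
  · intro _ _ _ hp; exact nomatch hp
  · intro _ _ _ hp; exact nomatch hp

lemma Inv.cancel_exit (ho : ChildrenFirst order) {v : Net T} {rest : List (Net T)}
    {f : Net T → Net T → ℝ} {g : Fin n → Fin n → ℝ} {pt nt : Net T → List (Fin n × ℝ)}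
    (h : Inv μ B order ⟨v :: rest, .cancel, f, g, pt, nt⟩)
    (hex : ¬ ∃ u w, v.Near u ∧ v.Near w ∧ 0 < f v w ∧ f v u < 0) :
    Inv μ B order ⟨v :: rest, .pull, f, g, pt, nt⟩ := by
  refine ⟨h.done, h.anti, h.near, h.posPt, h.posNt, h.netBal, h.pointAnti, h.pointBal,
    h.cost_le, ?_, fun _ _ _ hp => (nomatch hp), fun _ _ _ hp => (nomatch hp)⟩
  rintro v' rest' hv -
  obtain ⟨rfl, rfl⟩ := List.cons.inj hv
  by_contra! hcon
  obtain ⟨⟨u, hu⟩, w, hw⟩ := hcon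
  exact hex ⟨u, w, h.near_head ho rfl hu.ne, h.near_head ho rfl hw.ne', hw, hu⟩

/-- As `u` sends flow to `v`, the sign alternative says that all net points do or are idle. What
enters `v` must leave it to input points, so `pt v` weighs at least the total inflow from net
points. -/
lemma Inv.weight_pt {v : Net T} {rest : List (Net T)} {f : Net T → Net T → ℝ}
    {g : Fin n → Fin n → ℝ} {pt nt : Net T → List (Fin n × ℝ)} {u : Net T}
    (h : Inv μ B order ⟨v :: rest, .pull, f, g, pt, nt⟩) (h1 : 0 < f u v) :
    f u v ≤ weight (pt v) := by
  have hneg : ∀ x, f v x ≤ 0 := by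
    rcases h.pull v rest rfl rfl with h2 | h2
    · have := h2 u
      have e : f v u = - f u v := h.anti v u
      simp only at this
      linarith
    · exact h2
  have e : f u v = - f v u := h.anti u v
  have hb : ∑ x, f v x + weight (pt v) - weight (nt v) = 0 := h.netBal v
  have hs : ∑ x, f v x ≤ f v u := by
    have := sum_le_sum (s := univ.erase u) (f := fun x => f v x) (g := fun _ => 0)
      (fun x _ => hneg x)
    rw [← add_sum_erase univ (fun x => f v x) (mem_univ u)]
    simp only [sum_const_zero] at this
    linarith
  have := (h.posNt v).weight_nonneg
  simp only at this
  linarith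

/-- Here all flow at `v` to net points is outgoing, and conservation says that it is supplied by `nt
v`. -/
lemma Inv.weight_nt {v : Net T} {rest : List (Net T)} {f : Net T → Net T → ℝ}
    {g : Fin n → Fin n → ℝ} {pt nt : Net T → List (Fin n × ℝ)} {w : Net T}
    (h : Inv μ B order ⟨v :: rest, .push, f, g, pt, nt⟩) :
    f v w ≤ weight (nt v) := by
  have hneg : ∀ x, 0 ≤ f v x := h.push v rest rfl rfl
  have hb : ∑ x, f v x + weight (pt v) - weight (nt v) = 0 := h.netBal v
  have hs : f v w ≤ ∑ x, f v x := single_le_sum (fun x _ => hneg x) (mem_univ w)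
  have := (h.posPt v).weight_nonneg
  simp only at this
  linarith

/-- The triangle inequality for every node. The extra term is what the cleared flow between `u` and
`v` used to cost, so moving nodes is free. -/
lemma lin_move_le {l : List (Fin n × ℝ)} (hl : Positive l) (u v : Net T) :
    lin (pointDist u) l ≤ lin (pointDist v) l + weight l * netDist u v := by
  induction l with
  | nil => simp
  | cons x l ih =>
    have h1 := hl x (by simp)
    have h2 := ih fun y hy => hl y (by simp [hy])
    have tri : pointDist u x.1 ≤ pointDist v x.1 + netDist u v := by
      have := dist_triangle (P x.1) (location T (.inr v)) (location T (.inr u))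
      rw [dist_comm (location T (.inr v))] at this
      exact this
    have := mul_le_mul_of_nonneg_left tri h1.le
    simp only [weight, lin_cons] at *
    linarith

lemma addFlow_clear_apply {f : Net T → Net T → ℝ} (hanti : ∀ a b, f a b = - f b a) {u v : Net T}
    (huv : u ≠ v) (a b : Net T) :
    addFlow f u v (- f u v) a b
      = if (a = u ∧ b = v) ∨ (a = v ∧ b = u) then 0 else f a b := by
  rw [addFlow_apply]
  by_cases h1 : a = u ∧ b = v
  · obtain ⟨rfl, rfl⟩ := h1
    simp [huv]
  · by_cases h2 : a = v ∧ b = u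
    · obtain ⟨rfl, rfl⟩ := h2
      have := hanti a b
      simp [huv.symm]
      linarith
    · simp [h1, h2]

/-- The flow from `u` to `v` continues from `v` to the points of the prefix; afterwards it goes to
them directly from `u`. The balances at `u` and `v` agree because the prefix weighs exactly the
cleared flow. -/
lemma Inv.pull_step {v : Net T} {rest : List (Net T)}
    {f : Net T → Net T → ℝ} {g : Fin n → Fin n → ℝ} {pt nt : Net T → List (Fin n × ℝ)}
    {u : Net T} {S : List (Fin n × ℝ) × List (Fin n × ℝ)}
    (h : Inv μ B order ⟨v :: rest, .pull, f, g, pt, nt⟩)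
    (h1 : 0 < f u v) (hS : S = prefixSplit (pt v) (f u v)) :
    Inv μ B order ⟨v :: rest, .pull, addFlow f u v (- f u v), g,
      Function.update (Function.update pt v S.2) u (S.1 ++ pt u), nt⟩ := by
  have hanti : ∀ a b, f a b = - f b a := h.anti
  have hself : ∀ a, f a a = 0 := h.self
  have nuv : u ≠ v := by rintro rfl; rw [hself] at h1; exact lt_irrefl _ h1
  -- Exactness of the split is where conservation enters; a shorter prefix would lose flow.
  have hw : weight S.1 = f u v := by
    rw [hS]; exact prefixSplit_weight (h.posPt v) h1.le (h.weight_pt h1)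
  have hlin : ∀ φ, lin φ S.1 + lin φ S.2 = lin φ (pt v) := fun φ => by
    rw [hS]; exact prefixSplit_lin φ _ _
  obtain ⟨pS1, pS2⟩ : Positive S.1 ∧ Positive S.2 := by
    rw [hS]; exact prefixSplit_positive (h.posPt v) _
  have hu0 : ¬ ∀ y, f u y = 0 := fun hc => by rw [hc] at h1; exact lt_irrefl _ h1
  have hv0 : ¬ ∀ y, f v y = 0 := fun hc => by rw [hanti, hc] at h1; simp at h1
  refine ⟨?_, addFlow_anti hanti _ _ _, ?_, ?_, h.posNt, ?_, h.pointAnti, ?_, ?_, ?_,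
    fun _ _ _ hp => (nomatch hp), fun _ _ _ hp => (nomatch hp)⟩
  · obtain ⟨D, hD, hd⟩ := h.done
    refine ⟨D, hD, fun x hx => ?_⟩
    have hx0 : ∀ y, f x y = 0 := (hd x hx).1
    have xu : x ≠ u := by rintro rfl; exact hu0 hx0
    have xv : x ≠ v := by rintro rfl; exact hv0 hx0
    refine ⟨fun y => ?_, ?_, (hd x hx).2.2⟩
    · simp [addFlow_clear_apply hanti nuv, xu, xv, hx0]
    · simpa [xu, xv] using (hd x hx).2.1
  · intro x y hxy
    simp only [addFlow_clear_apply hanti nuv] at hxy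
    split_ifs at hxy with hc
    · simp at hxy
    · exact h.near x y hxy
  · intro x
    simp only
    by_cases hx : x = u
    · subst hx
      simp only [Function.update_self]
      exact pS1.append (h.posPt _)
    · by_cases hx' : x = v
      · subst hx'; simpa [hx] using pS2
      · simpa [hx, hx'] using h.posPt x
  · intro x
    have := h.netBal x
    have e := hlin (fun _ => 1)
    simp only [weight] at this hw e ⊢
    rw [addFlow_sum]
    by_cases hx : x = u
    · subst hx
      simp only [Function.update_self, lin_append, nuv, if_true, if_false]
      linarith
    · by_cases hx' : x = v
      · subst hx'
        simp only [Function.update_self, Function.update_of_ne hx, hx, if_true, if_false]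
        linarith
      · simp only [Function.update_of_ne hx, Function.update_of_ne hx', hx, hx', if_false]
        linarith
  · intro p
    have := h.pointBal p
    have e := sum_update_update (fun _ l => lin (ind p) l) pt nuv S.2 (S.1 ++ pt u)
    have := hlin (ind p)
    simp only [lin_append] at *
    linarith
  · refine le_trans ?_ h.cost_le
    unfold Config.cost
    simp only
    rw [pairCost_addFlow netDist_comm netDist_self hanti,
      sum_update_update (fun x l => lin (pointDist x) l) pt nuv S.2 (S.1 ++ pt u)]
    have e := hlin (pointDist v)
    have mv := lin_move_le pS1 u v
    rw [hw] at mv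
    have : |f u v + -f u v| - |f u v| = - f u v := by
      rw [add_neg_cancel, abs_zero, abs_of_pos h1]; ring
    rw [this]
    simp only [lin_append]
    linarith
  · rintro v' rest' hv -
    obtain ⟨rfl, rfl⟩ := List.cons.inj hv
    simp only [addFlow_clear_apply hanti nuv]
    refine (h.pull v rest rfl rfl).imp (fun h2 x => ?_) (fun h2 x => ?_)
    · split_ifs
      exacts [le_rfl, h2 x]
    · split_ifs
      exacts [le_rfl, h2 x]

lemma Inv.push_step {v : Net T} {rest : List (Net T)}
    {f : Net T → Net T → ℝ} {g : Fin n → Fin n → ℝ} {pt nt : Net T → List (Fin n × ℝ)}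
    {w : Net T} {S : List (Fin n × ℝ) × List (Fin n × ℝ)}
    (h : Inv μ B order ⟨v :: rest, .push, f, g, pt, nt⟩)
    (h1 : 0 < f v w) (hS : S = prefixSplit (nt v) (f v w)) :
    Inv μ B order ⟨v :: rest, .push, addFlow f v w (- f v w), g, pt,
      Function.update (Function.update nt v S.2) w (S.1 ++ nt w)⟩ := by
  have hanti : ∀ a b, f a b = - f b a := h.anti
  have hself : ∀ a, f a a = 0 := h.self
  have nvw : v ≠ w := by rintro rfl; rw [hself] at h1; exact lt_irrefl _ h1
  have hw : weight S.1 = f v w := by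
    rw [hS]; exact prefixSplit_weight (h.posNt v) h1.le h.weight_nt
  have hlin : ∀ φ, lin φ S.1 + lin φ S.2 = lin φ (nt v) := fun φ => by
    rw [hS]; exact prefixSplit_lin φ _ _
  obtain ⟨pS1, pS2⟩ : Positive S.1 ∧ Positive S.2 := by
    rw [hS]; exact prefixSplit_positive (h.posNt v) _
  have hv0 : ¬ ∀ y, f v y = 0 := fun hc => by rw [hc] at h1; exact lt_irrefl _ h1
  have hw0 : ¬ ∀ y, f w y = 0 := fun hc => by rw [hanti, hc] at h1; simp at h1
  refine ⟨?_, addFlow_anti hanti _ _ _, ?_, h.posPt, ?_, ?_, h.pointAnti, ?_, ?_,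
    fun _ _ _ hp => (nomatch hp), ?_, fun _ _ _ hp => (nomatch hp)⟩
  · obtain ⟨D, hD, hd⟩ := h.done
    refine ⟨D, hD, fun x hx => ?_⟩
    have hx0 : ∀ y, f x y = 0 := (hd x hx).1
    have xw : x ≠ w := by rintro rfl; exact hw0 hx0
    have xv : x ≠ v := by rintro rfl; exact hv0 hx0
    refine ⟨fun y => ?_, (hd x hx).2.1, ?_⟩
    · simp [addFlow_clear_apply hanti nvw, xw, xv, hx0]
    · simpa [xw, xv] using (hd x hx).2.2
  · intro x y hxy
    simp only [addFlow_clear_apply hanti nvw] at hxy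
    split_ifs at hxy with hc
    · simp at hxy
    · exact h.near x y hxy
  · intro x
    simp only
    by_cases hx : x = w
    · subst hx
      simp only [Function.update_self]
      exact pS1.append (h.posNt _)
    · by_cases hx' : x = v
      · subst hx'; simpa [hx] using pS2
      · simpa [hx, hx'] using h.posNt x
  · intro x
    have := h.netBal x
    have e := hlin (fun _ => 1)
    simp only [weight] at this hw e ⊢
    rw [addFlow_sum]
    by_cases hx : x = w
    · subst hx
      simp only [Function.update_self, lin_append, nvw.symm, if_true, if_false]
      linarith
    · by_cases hx' : x = v
      · subst hx'
        simp only [Function.update_self, Function.update_of_ne hx, hx, if_true, if_false]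
        linarith
      · simp only [Function.update_of_ne hx, Function.update_of_ne hx', hx, hx', if_false]
        linarith
  · intro p
    have := h.pointBal p
    have e := sum_update_update (fun _ l => lin (ind p) l) nt nvw.symm S.2 (S.1 ++ nt w)
    have := hlin (ind p)
    simp only [lin_append] at *
    linarith
  · refine le_trans ?_ h.cost_le
    unfold Config.cost
    simp only
    rw [pairCost_addFlow netDist_comm netDist_self hanti,
      sum_update_update (fun x l => lin (pointDist x) l) nt nvw.symm S.2 (S.1 ++ nt w)]
    have e := hlin (pointDist v)
    have mv := lin_move_le pS1 w v
    rw [hw, netDist_comm] at mv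
    have : |f v w + -f v w| - |f v w| = - f v w := by
      rw [add_neg_cancel, abs_zero, abs_of_pos h1]; ring
    rw [this]
    simp only [lin_append]
    linarith
  · rintro v' rest' hv - x
    obtain ⟨rfl, rfl⟩ := List.cons.inj hv
    simp only [addFlow_clear_apply hanti nvw]
    split_ifs
    exacts [le_rfl, h.push v rest rfl rfl x]

/-- Reducing the weight of one node. -/
lemma lin_reduce (φ : Fin n → ℝ) (A B : List (Fin n × ℝ)) (p : Fin n) (a δ : ℝ) :
    lin φ (if a - δ = 0 then A ++ B else A ++ (p, a - δ) :: B)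
      = lin φ (A ++ (p, a) :: B) - δ * φ p := by
  split_ifs with h
  · have : a = δ := by linarith
    simp only [lin_append, lin_cons, this]
    ring
  · simp only [lin_append, lin_cons]
    ring

lemma positive_reduce {A B : List (Fin n × ℝ)} {p : Fin n} {a δ : ℝ}
    (h : Positive (A ++ (p, a) :: B)) (hδ : δ ≤ a) :
    Positive (if a - δ = 0 then A ++ B else A ++ (p, a - δ) :: B) := by
  split_ifs with h0
  · intro x hx
    refine h x ?_
    simp only [List.mem_append, List.mem_cons] at hx ⊢
    tauto
  · intro x hx
    simp only [List.mem_append, List.mem_cons] at hx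
    rcases hx with hx | rfl | hx
    · exact h x (by simp [hx])
    · exact lt_of_le_of_ne (by simp only; linarith) (Ne.symm h0)
    · exact h x (by simp [hx])

/-- Flow from `p` through `v` to `q` becomes direct. The node weights lost at `v` reappear in the
explicit flow of `p` and `q`, and the two distances to `v` bound the distance between the points. -/
lemma Inv.pair_step {v : Net T} {rest : List (Net T)}
    {f : Net T → Net T → ℝ} {g : Fin n → Fin n → ℝ} {pt nt : Net T → List (Fin n × ℝ)}
    {p q : Fin n} {a b δ : ℝ} {C D C' D' : List (Fin n × ℝ)}
    (h : Inv μ B order ⟨v :: rest, .pair, f, g, pt, nt⟩)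
    (hn : nt v = C ++ (p, a) :: D) (hp : pt v = C' ++ (q, b) :: D') (hδ : δ = min a b) :
    Inv μ B order ⟨v :: rest, .pair, f, addFlow g p q δ,
      Function.update pt v (if b - δ = 0 then C' ++ D' else C' ++ (q, b - δ) :: D'),
      Function.update nt v (if a - δ = 0 then C ++ D else C ++ (p, a - δ) :: D)⟩ := by
  have ganti : ∀ x y, g x y = - g y x := h.pointAnti
  have pN : Positive (nt v) := h.posNt v
  have pP : Positive (pt v) := h.posPt v
  have ha : 0 < a := pN (p, a) (by simp [hn])
  have hb : 0 < b := pP (q, b) (by simp [hp])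
  have hδ0 : 0 < δ := hδ ▸ lt_min ha hb
  have lN := fun φ : Fin n → ℝ => lin_reduce φ C D p a δ
  have lP := fun φ : Fin n → ℝ => lin_reduce φ C' D' q b δ
  rw [← hn] at lN
  rw [← hp] at lP
  have rN := positive_reduce (hn ▸ pN) (hδ ▸ min_le_left a b)
  have rP := positive_reduce (hp ▸ pP) (hδ ▸ min_le_right a b)
  generalize (if b - δ = 0 then C' ++ D' else C' ++ (q, b - δ) :: D') = X at *
  generalize (if a - δ = 0 then C ++ D else C ++ (p, a - δ) :: D) = Y at *
  refine ⟨?_, h.anti, h.near, ?_, ?_, ?_, addFlow_anti ganti _ _ _, ?_, ?_,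
    fun _ _ _ hp => (nomatch hp), fun _ _ _ hp => (nomatch hp), ?_⟩
  · obtain ⟨D, hD, hd⟩ := h.done
    refine ⟨D, hD, fun x hx => ?_⟩
    have xv : x ≠ v := by
      rintro rfl
      have : nt x = [] := (hd x hx).2.2
      simp [hn] at this
    simpa [xv] using hd x hx
  · intro x
    by_cases hx : x = v
    · subst hx; simpa using rP
    · simpa [hx] using h.posPt x
  · intro x
    by_cases hx : x = v
    · subst hx; simpa using rN
    · simpa [hx] using h.posNt x
  · intro x
    have := h.netBal x
    simp only [weight] at *
    by_cases hx : x = v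
    · subst hx
      simp only [Function.update_self, lN, lP]
      linarith
    · simpa only [Function.update_of_ne hx] using this
  · intro x
    have := h.pointBal x
    simp only at this ⊢
    rw [addFlow_sum, sum_update (fun _ l => lin (ind x) l), sum_update (fun _ l => lin (ind x) l),
      lN, lP]
    simp only [ind, eq_comm (a := x)]
    split_ifs <;> linarith
  · refine le_trans ?_ h.cost_le
    unfold Config.cost
    simp only
    rw [pairCost_addFlow (fun x y => dist_comm (P x) (P y)) (fun x => dist_self _) ganti,
      sum_update (fun x l => lin (pointDist x) l), sum_update (fun x l => lin (pointDist x) l),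
      lN, lP]
    have t1 : |g p q + δ| - |g p q| ≤ δ := by
      have := abs_add_le (g p q) δ
      rw [abs_of_pos hδ0] at this
      linarith
    have tri : dist (P p) (P q) ≤ pointDist v p + pointDist v q := by
      have := dist_triangle (P p) (location T (.inr v)) (P q)
      rwa [dist_comm (location T (.inr v)) (P q)] at this
    have m1 := mul_le_mul_of_nonneg_right t1 (dist_nonneg (x := P p) (y := P q))
    have m2 := mul_le_mul_of_nonneg_left tri hδ0.le
    linarith
  · rintro v' rest' hv -
    exact h.pair v' rest' hv rfl

/-- With no flow left between `v` and net points, the balance at `v` says that `pt v` and `nt v`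
weigh the same. So when one is exhausted, the other is too, and `v` may join the finished net
points. -/
lemma Inv.pair_exit {v : Net T} {rest : List (Net T)}
    {f : Net T → Net T → ℝ} {g : Fin n → Fin n → ℝ} {pt nt : Net T → List (Fin n × ℝ)}
    (h : Inv μ B order ⟨v :: rest, .pair, f, g, pt, nt⟩) (hex : nt v = [] ∨ pt v = []) :
    Inv μ B order ⟨rest, .cancel, f, g, pt, nt⟩ ∧ nt v = [] ∧ pt v = [] := by
  have hf : ∀ u, f v u = 0 := h.pair v rest rfl rfl
  have hb : ∑ x, f v x + weight (pt v) - weight (nt v) = 0 := h.netBal v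
  have pN : Positive (nt v) := h.posNt v
  have pP : Positive (pt v) := h.posPt v
  simp only [hf, sum_const_zero] at hb
  have hboth : nt v = [] ∧ pt v = [] := by
    rcases hex with h1 | h1
    · refine ⟨h1, pP.eq_nil ?_⟩
      rw [h1] at hb
      simp only [weight, lin_nil] at hb ⊢
      linarith
    · refine ⟨pN.eq_nil ?_, h1⟩
      rw [h1] at hb
      simp only [weight, lin_nil] at hb ⊢
      linarith
  refine ⟨⟨?_, h.anti, h.near, h.posPt, h.posNt, h.netBal, h.pointAnti, h.pointBal,
    h.cost_le, fun _ _ _ hp => (nomatch hp), fun _ _ _ hp => (nomatch hp),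
    fun _ _ _ hp => (nomatch hp)⟩, hboth⟩
  obtain ⟨D, hD, hd⟩ := h.done
  refine ⟨D ++ [v], by simpa using hD, fun x hx => ?_⟩
  rcases List.mem_append.1 hx with hx | hx
  · exact hd x hx
  · obtain rfl := List.mem_singleton.1 hx
    exact ⟨hf, hboth.2, hboth.1⟩

lemma Inv.step (ho : ChildrenFirst order) {c c' : Config T} (h : Inv μ B order c)
    (hs : Step c c') : Inv μ B order c' := by
  cases hs with
  | cancel u w δ hu hw h1 h2 hδ => exact h.cancel hu hw h1 h2 hδ
  | cancel_exit hex => exact h.cancel_exit ho hex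
  | pull u S hu h1 hS => exact h.pull_step h1 hS
  | @pull_exit v rest f g pt nt hex =>
    refine ⟨h.done, h.anti, h.near, h.posPt, h.posNt, h.netBal, h.pointAnti, h.pointBal,
      h.cost_le, fun _ _ _ hp => (nomatch hp), ?_, fun _ _ _ hp => (nomatch hp)⟩
    rintro v' rest' hv - u
    obtain ⟨rfl, rfl⟩ := List.cons.inj hv
    by_contra! hcon
    -- The exit test sees only near net points, which by `near_head` are all that matter.
    refine hex ⟨u, h.near_head ho rfl hcon.ne, ?_⟩
    have := h.anti u v
    simp only at this hcon
    linarith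
  | push w S hw h1 hS => exact h.push_step h1 hS
  | @push_exit v rest f g pt nt hex =>
    refine ⟨h.done, h.anti, h.near, h.posPt, h.posNt, h.netBal, h.pointAnti, h.pointBal,
      h.cost_le, fun _ _ _ hp => (nomatch hp), fun _ _ _ hp => (nomatch hp), ?_⟩
    rintro v' rest' hv - u
    obtain ⟨rfl, rfl⟩ := List.cons.inj hv
    have h0 := h.push v rest rfl rfl u
    by_contra hcon
    exact hex ⟨u, h.near_head ho rfl hcon, lt_of_le_of_ne h0 (Ne.symm hcon)⟩
  | pair p q a b δ C D C' D' hn hp hδ => exact h.pair_step hn hp hδ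
  | pair_exit hex => exact (h.pair_exit hex).1

lemma Inv.reachable (ho : ChildrenFirst order) {c c' : Config T} (h : Inv μ B order c)
    (hs : Relation.ReflTransGen Step c c') : Inv μ B order c' := by
  induction hs with
  | refl => exact h
  | tail _ hs ih => exact ih.step ho hs

/-- The algorithm gets stuck only when no net points are left. -/
lemma todo_eq_nil {c : Config T} (hc : ∀ c', ¬ Step c c') : c.todo = [] := by
  obtain ⟨todo, phase, f, g, pt, nt⟩ := c
  cases todo with
  | nil => rfl
  | cons v rest =>
    exfalso
    cases phase with
    | cancel =>
      by_cases h : ∃ u w, v.Near u ∧ v.Near w ∧ 0 < f v w ∧ f v u < 0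
      · obtain ⟨u, w, hu, hw, h1, h2⟩ := h
        exact hc _ (.cancel u w _ hu hw h1 h2 rfl)
      · exact hc _ (.cancel_exit h)
    | pull =>
      by_cases h : ∃ u, v.Near u ∧ 0 < f u v
      · obtain ⟨u, hu, h1⟩ := h
        exact hc _ (.pull u _ hu h1 rfl)
      · exact hc _ (.pull_exit h)
    | push =>
      by_cases h : ∃ w, v.Near w ∧ 0 < f v w
      · obtain ⟨u, hu, h1⟩ := h
        exact hc _ (.push u _ hu h1 rfl)
      · exact hc _ (.push_exit h)
    | pair =>
      by_cases h : nt v = [] ∨ pt v = []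
      · exact hc _ (.pair_exit h)
      · push Not at h
        obtain ⟨⟨p, a⟩, L, hL⟩ := List.exists_cons_of_ne_nil h.1
        obtain ⟨⟨q, b⟩, L', hL'⟩ := List.exists_cons_of_ne_nil h.2
        exact hc _ (.pair p q a b _ [] L [] L' hL hL' rfl)

lemma result_anti {c : Config T} (h : ∀ p q, c.pointFlow p q = - c.pointFlow q p) (p q : Fin n) :
    c.result p q - c.result q p = c.pointFlow p q := by
  unfold Config.result
  have := h p q
  split_ifs <;> linarith

/-- Together with `result_anti` this says that the result is the positive part of an antisymmetric
function: differences recover the flow, sums its absolute value. -/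
lemma result_add {c : Config T} (h : ∀ p q, c.pointFlow p q = - c.pointFlow q p) (p q : Fin n) :
    c.result p q + c.result q p = |c.pointFlow p q| := by
  unfold Config.result
  have := h p q
  split_ifs with h1 h2 h2
  · linarith
  · rw [abs_of_pos h1]; linarith
  · rw [abs_of_neg (by linarith)]; linarith
  · have : c.pointFlow p q = 0 := by linarith
    simp [this]

/-- All net points are finished, so both the balance and the cost reduce to the flow between input
points. -/
lemma Inv.final (ho : ChildrenFirst order) {c : Config T} (h : Inv μ B order c)
    (hc : c.todo = []) :
    IsTransportationMap μ c.result ∧ transportCost P c.result ≤ B := by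
  obtain ⟨D, hD, hd⟩ := h.done
  rw [hc, List.append_nil] at hD
  subst hD
  have hpt : ∀ v, c.pt v = [] := fun v => (hd v (ho.mem v)).2.1
  have hnt : ∀ v, c.nt v = [] := fun v => (hd v (ho.mem v)).2.2
  refine ⟨⟨fun p q => ?_, fun q => ?_⟩, ?_⟩
  · unfold Config.result
    split_ifs with h1
    exacts [h1.le, le_rfl]
  · have := h.pointBal q
    simp only [hpt, hnt, lin_nil, sum_const_zero, add_zero, sub_zero] at this
    rw [← this, ← sum_sub_distrib]
    exact sum_congr rfl fun r _ => result_anti h.pointAnti q r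
  · refine le_trans ?_ h.cost_le
    have e : c.cost = (pairCost netDist c.netFlow
        + pairCost (fun p q => dist (P p) (P q)) c.pointFlow) / 2 := by
      simp [Config.cost, hpt, hnt]
    have e2 : pairCost netDist c.netFlow = 0 := by
      unfold pairCost
      refine sum_eq_zero fun v _ => sum_eq_zero fun u _ => ?_
      simp [(hd v (ho.mem v)).1 u]
    -- The symmetrized sum counts each unordered pair twice, which the halving in `Config.cost`
    -- undoes.
    have e3 : pairCost (fun p q => dist (P p) (P q)) c.pointFlow
        = 2 * transportCost P c.result := by
      unfold pairCost transportCost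
      have : ∑ p, ∑ q, c.result p q * dist (P p) (P q)
          = ∑ p, ∑ q, c.result q p * dist (P p) (P q) := by
        rw [sum_comm]
        simp only [dist_comm]
      rw [two_mul]
      nth_rewrite 2 [this]
      simp only [← sum_add_distrib, ← add_mul, result_add h.pointAnti]
    rw [e, e2, e3]
    linarith

end Invariants

section Termination

open Classical

variable {n d : ℕ} {P : Fin n → EuclideanSpace ℝ (Fin d)} {k : ℕ} {T : Quadtree P k}

/-! ### Termination -/

def Phase.rank : Phase → ℕ
  | .cancel => 3
  | .pull => 2
  | .push => 1
  | .pair => 0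

/-- The number of iterations left in the current loop, at most. -/
noncomputable def Config.iterations (c : Config T) : ℕ :=
  match c.todo, c.phase with
  | [], _ => 0
  | v :: _, .cancel => #{u | c.netFlow v u ≠ 0}
  | v :: _, .pull => #{u | 0 < c.netFlow u v}
  | v :: _, .push => #{u | 0 < c.netFlow v u}
  | v :: _, .pair => (c.pt v).length + (c.nt v).length

lemma card_filter_lt {ι : Type*} [Fintype ι] {p q : ι → Prop} [DecidablePred p]
    [DecidablePred q] (h : ∀ x, p x → q x) {y : ι}
    (hq : q y) (hp : ¬ p y) : #{x | p x} < #{x | q x} := by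
  refine card_lt_card (Finset.ssubset_iff_subset_ne.2 ⟨fun x hx => ?_, fun he => ?_⟩)
  · simp only [mem_filter, mem_univ, true_and] at hx ⊢
    exact h x hx
  · have : y ∈ ({x | q x} : Finset ι) := by simp [hq]
    rw [← he] at this
    simp [hp] at this

lemma length_reduce (A B : List (Fin n × ℝ)) (p : Fin n) (a δ : ℝ) :
    (if a - δ = 0 then A ++ B else A ++ (p, a - δ) :: B).length
      ≤ (A ++ (p, a) :: B).length ∧
    (a - δ = 0 → (if a - δ = 0 then A ++ B else A ++ (p, a - δ) :: B).length
      < (A ++ (p, a) :: B).length) := by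
  split_ifs with h <;> simp [h]

def Config.Anti (c : Config T) : Prop := ∀ u v, c.netFlow u v = - c.netFlow v u

lemma step_anti {c c' : Config T} (h : c.Anti) (hs : Step c c') : c'.Anti := by
  cases hs with
  | cancel u w δ hu hw h1 h2 hδ =>
    exact addFlow_anti (addFlow_anti (addFlow_anti h u w δ) u _ (-δ)) _ w (-δ)
  | cancel_exit hex => exact h
  | pull u S hu h1 hS => exact addFlow_anti h _ _ _
  | pull_exit hex => exact h
  | push w S hw h1 hS => exact addFlow_anti h _ _ _
  | push_exit hex => exact h
  | pair p q a b δ C D C' D' hn hp hδ => exact h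
  | pair_exit hex => exact h

/-- The measure that decreases lexicographically. -/
noncomputable def Config.measure (c : Config T) : ℕ ×ₗ ℕ ×ₗ ℕ :=
  toLex (c.todo.length, toLex (c.phase.rank, c.iterations))

/-- Leaving a loop lowers the rank or shortens `todo`. Inside a loop, each iteration clears one flow
at `v` or deletes one node. Antisymmetry of the flow is all that is needed, not the full invariant.
-/
lemma measure_lt {c c' : Config T} (h : c.Anti) (hs : Step c c') : c'.measure < c.measure := by
  cases hs with
  | @cancel v rest f g pt nt u w δ hu hw h1 h2 hδ =>
    have hanti : ∀ a b, f a b = - f b a := h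
    have hself : ∀ a, f a a = 0 := fun a => by have := h a a; simp only at this; linarith
    have huv : 0 < f u v := by rw [hanti]; linarith
    have nuv : u ≠ v := by rintro rfl; rw [hself] at huv; exact lt_irrefl _ huv
    have nvw : v ≠ w := by rintro rfl; rw [hself] at h1; exact lt_irrefl _ h1
    have nuw : u ≠ w := by rintro rfl; linarith
    -- The new flow between `u` and `w` does not touch the row of `v`; there only the entries of `u`
    -- and `w` shrink, and the one attaining the minimum becomes zero.
    have row : ∀ x, addFlow (addFlow (addFlow f u w δ) u v (-δ)) v w (-δ) v x
        = f v x + (if x = u then δ else 0) - (if x = w then δ else 0) := by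
      intro x
      simp only [addFlow_apply, nuv.symm, nvw, false_and, true_and, if_false]
      split_ifs <;> linarith
    refine Prod.Lex.toLex_lt_toLex.2 (Or.inr ⟨rfl, Prod.Lex.toLex_lt_toLex.2 (Or.inr ⟨rfl, ?_⟩)⟩)
    simp only [Config.iterations, row]
    have hsub : ∀ x, f v x + (if x = u then δ else 0) - (if x = w then δ else 0) ≠ 0 →
        f v x ≠ 0 := by
      intro x hx
      split_ifs at hx with e1 e2 e2
      · subst e1; exact h2.ne
      · subst e1; exact h2.ne
      · subst e2; exact h1.ne'
      · simpa using hx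
    rcases le_total (f u v) (f v w) with hle | hle
    · refine card_filter_lt hsub (y := u) h2.ne ?_
      rw [min_eq_left hle] at hδ
      simp [nuw, hδ, hanti v u]
    · refine card_filter_lt hsub (y := w) h1.ne' ?_
      rw [min_eq_right hle] at hδ
      simp [nuw.symm, hδ]
  | cancel_exit hex =>
    exact Prod.Lex.toLex_lt_toLex.2 (Or.inr ⟨rfl, Prod.Lex.toLex_lt_toLex.2 (Or.inl (by
      simp [Phase.rank]))⟩)
  | @pull v rest f g pt nt u S hu h1 hS =>
    have hself : ∀ a, f a a = 0 := fun a => by have := h a a; simp only at this; linarith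
    have nuv : u ≠ v := by rintro rfl; rw [hself] at h1; exact lt_irrefl _ h1
    refine Prod.Lex.toLex_lt_toLex.2 (Or.inr ⟨rfl, Prod.Lex.toLex_lt_toLex.2 (Or.inr ⟨rfl, ?_⟩)⟩)
    simp only [Config.iterations, addFlow_clear_apply h nuv]
    refine card_filter_lt (y := u) (fun x hx => ?_) h1 (by simp)
    split_ifs at hx
    · exact absurd hx (lt_irrefl _)
    · exact hx
  | pull_exit hex =>
    exact Prod.Lex.toLex_lt_toLex.2 (Or.inr ⟨rfl, Prod.Lex.toLex_lt_toLex.2 (Or.inl (by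
      simp [Phase.rank]))⟩)
  | @push v rest f g pt nt w S hu h1 hS =>
    have hself : ∀ a, f a a = 0 := fun a => by have := h a a; simp only at this; linarith
    have nvw : v ≠ w := by rintro rfl; rw [hself] at h1; exact lt_irrefl _ h1
    refine Prod.Lex.toLex_lt_toLex.2 (Or.inr ⟨rfl, Prod.Lex.toLex_lt_toLex.2 (Or.inr ⟨rfl, ?_⟩)⟩)
    simp only [Config.iterations, addFlow_clear_apply h nvw]
    refine card_filter_lt (y := w) (fun x hx => ?_) h1 (by simp)
    split_ifs at hx
    · exact absurd hx (lt_irrefl _)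
    · exact hx
  | push_exit hex =>
    exact Prod.Lex.toLex_lt_toLex.2 (Or.inr ⟨rfl, Prod.Lex.toLex_lt_toLex.2 (Or.inl (by
      simp [Phase.rank]))⟩)
  | @pair v rest f g pt nt p q a b δ C D C' D' hn hp hδ =>
    refine Prod.Lex.toLex_lt_toLex.2 (Or.inr ⟨rfl, Prod.Lex.toLex_lt_toLex.2 (Or.inr ⟨rfl, ?_⟩)⟩)
    simp only [Config.iterations, Function.update_self, hn, hp]
    obtain ⟨n1, n2⟩ := length_reduce C D p a δ
    obtain ⟨p1, p2⟩ := length_reduce C' D' q b δ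
    rcases le_total a b with hle | hle
    · rw [min_eq_left hle] at hδ
      have := n2 (by rw [hδ]; ring)
      omega
    · rw [min_eq_right hle] at hδ
      have := p2 (by rw [hδ]; ring)
      omega
  | pair_exit hex =>
    exact Prod.Lex.toLex_lt_toLex.2 (Or.inl (by simp))

lemma acc_of_anti (c : Config T) (h : c.Anti) : Acc (fun c' c => Step c c') c := by
  induction hm : c.measure using WellFoundedLT.induction generalizing c with
  | _ x ih =>
    subst hm
    exact ⟨_, fun c' hs => ih _ (measure_lt h hs) c' (step_anti h hs) rfl⟩

/-! ### Postorder -/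

lemma PostorderForest.closed {rs L : List (Fin T.numCells)} (h : PostorderForest T rs L) :
    (∀ c ∈ rs, c ∈ L) ∧ ∀ c ∈ L, ∀ a, T.parent a = some c → a ∈ L := by
  induction h with
  | nil => simp
  | @cons c children rs L L' hn hc h1 h2 ih1 ih2 =>
    constructor
    · intro x hx
      rcases List.mem_cons.1 hx with rfl | hx
      · simp
      · simp [ih2.1 x hx]
    · intro x hx a ha
      simp only [List.mem_append, List.mem_cons] at hx ⊢
      rcases hx with hx | rfl | hx
      · exact Or.inl (ih1.2 x hx a ha)
      · exact Or.inl (ih1.1 a ((hc a).2 ha))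
      · exact Or.inr (Or.inr (ih2.2 x hx a ha))

/-- The subtrees of the children of a cell are traversed in the segment directly in front of it, so
its children precede every occurrence of the cell. -/
lemma PostorderForest.before {rs L : List (Fin T.numCells)} (h : PostorderForest T rs L) :
    ∀ L₁ c L₂, L = L₁ ++ c :: L₂ → ∀ a, T.parent a = some c → a ∈ L₁ := by
  induction h with
  | nil => simp
  | @cons c children rs L L' hn hc h1 h2 ih1 ih2 =>
    intro L₁ x L₂ he a ha
    rcases List.append_eq_append_iff.1 he with ⟨M, rfl, hM⟩ | ⟨M, rfl, hM⟩
    · cases M with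
      | nil =>
        obtain ⟨rfl, -⟩ := List.cons.inj hM
        simpa using h1.closed.1 a ((hc a).2 ha)
      | cons y M =>
        obtain ⟨rfl, h5⟩ := List.cons.inj hM
        have := ih2 M x L₂ h5 a ha
        simp [this]
    · cases M with
      | nil =>
        obtain ⟨rfl, -⟩ := List.cons.inj hM
        simpa using h1.closed.1 a ((hc a).2 ha)
      | cons y M =>
        obtain ⟨rfl, -⟩ := List.cons.inj hM
        exact ih1 L₁ x M rfl a ha

lemma PostorderForest.mem {L : List (Fin T.numCells)} (h : PostorderForest T [T.root] L)
    (c : Fin T.numCells) : c ∈ L := by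
  have hr := T.reaches_root c
  induction hr using Relation.ReflTransGen.head_induction_on with
  | refl => exact h.closed.1 _ (by simp)
  | head hab _ ih => exact h.closed.2 _ ih _ hab

/-- Lifts a position in the concatenated blocks to a position in the list of cells, whose earlier
cells have all their net points in front. -/
lemma childrenFirst_aux {cells : List (Fin T.numCells)} {blocks : List (List (Net T))}
    (h : List.Forall₂ (fun c B => B.Nodup ∧ ∀ s : Net T, s ∈ B ↔ s.owner = c) cells blocks) :
    (∀ v : Net T, v.owner ∈ cells → v ∈ blocks.flatten) ∧
    ∀ D v rest, blocks.flatten = D ++ v :: rest →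
      ∃ L₁ L₂, cells = L₁ ++ v.owner :: L₂ ∧ ∀ u : Net T, u.owner ∈ L₁ → u ∈ D := by
  induction h with
  | nil => simp
  | @cons c B cells blocks hB hrest ih =>
    constructor
    · intro v hv
      rcases List.mem_cons.1 hv with hv | hv
      · simp [(hB.2 v).2 hv]
      · simp only [List.flatten_cons, List.mem_append]
        exact Or.inr (ih.1 v hv)
    · intro D v rest he
      rw [List.flatten_cons] at he
      have hleft : v ∈ B → ∃ L₁ L₂, c :: cells = L₁ ++ v.owner :: L₂ ∧
          ∀ u : Net T, u.owner ∈ L₁ → u ∈ D := fun hv =>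
        ⟨[], cells, by simp [(hB.2 v).1 hv], by simp⟩
      have hright : ∀ M, D = B ++ M → blocks.flatten = M ++ v :: rest →
          ∃ L₁ L₂, c :: cells = L₁ ++ v.owner :: L₂ ∧
          ∀ u : Net T, u.owner ∈ L₁ → u ∈ D := by
        rintro M rfl hM
        obtain ⟨L₁, L₂, h1, h2⟩ := ih.2 M v rest hM
        refine ⟨c :: L₁, L₂, by simp [h1], fun u hu => ?_⟩
        rcases List.mem_cons.1 hu with hu | hu
        · simp [(hB.2 u).2 hu]
        · simp [h2 u hu]
      rcases List.append_eq_append_iff.1 he with ⟨M, h1, h2⟩ | ⟨M, h1, h2⟩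
      · exact hright M h1 h2
      · cases M with
        | nil => exact hright [] (by simpa using h1.symm) (by simpa using h2.symm)
        | cons y M =>
          obtain ⟨rfl, -⟩ := List.cons.inj h2
          exact hleft (by simp [h1])

lemma IsProcessingOrder.childrenFirst {order : List (Net T)} (h : IsProcessingOrder T order) :
    ChildrenFirst order := by
  obtain ⟨cells, blocks, hp, hb, rfl⟩ := h
  obtain ⟨h1, h2⟩ := childrenFirst_aux hb
  refine ⟨fun v => h1 v (hp.mem _), fun D v rest he u hu => ?_⟩
  obtain ⟨L₁, L₂, h3, h4⟩ := h2 D v rest he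
  exact h4 u (hp.before L₁ _ L₂ h3 _ hu)

/-! ### Initial configurations -/

variable {m : ℕ} {E : Fin m → Vert T × Vert T} {f : Fin m → ℝ}

section Between

variable {V : Type*} {E : Fin m → V × V}

lemma flowBetween_anti (u v : V) : flowBetween E f u v = - flowBetween E f v u := by
  unfold flowBetween
  rw [← sum_neg_distrib]
  exact sum_congr rfl fun e _ => by ring

lemma flowBetween_sum [Fintype V] (hE : ∀ e, (E e).1 ≠ (E e).2) (v : V) :
    ∑ u, flowBetween E f v u = (incidence E).mulVec f v := by
  unfold flowBetween incidence Matrix.mulVec dotProduct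
  rw [sum_comm]
  refine sum_congr rfl fun e _ => ?_
  have h1 : ∀ u, (E e = (v, u)) ↔ ((E e).2 = u ∧ v = (E e).1) := fun u => by
    rw [Prod.ext_iff]; simp only; tauto
  have h2 : ∀ u, (E e = (u, v)) ↔ ((E e).1 = u ∧ v = (E e).2) := fun u => by
    rw [Prod.ext_iff]; simp only; tauto
  simp only [sum_sub_distrib, h1, h2, ite_and, sum_ite_eq, mem_univ, if_true, Matrix.of_apply]
  have := hE e
  by_cases h3 : v = (E e).1
  · have h4 : ¬ v = (E e).2 := fun h4 => this (h3.symm.trans h4)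
    simp [h3, this]
  · by_cases h4 : v = (E e).2 <;> simp [h3, h4]
    simp [← h4, h3]

lemma flowBetween_ne_zero {u v : V} (h : flowBetween E f u v ≠ 0) :
    ∃ e, E e = (u, v) ∨ E e = (v, u) := by
  by_contra! hcon
  apply h
  unfold flowBetween
  exact sum_eq_zero fun e _ => by simp [hcon e]

/-- Every edge is seen in both orders, hence the factor two. Only an inequality is claimed because
no assumption excludes several edges on the same pair. -/
lemma pairCost_flowBetween_le [Fintype V] (D : V → V → ℝ) (hD : ∀ a b, D a b = D b a)
    (hD0 : ∀ a b, 0 ≤ D a b) :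
    pairCost D (flowBetween E f) ≤ 2 * ∑ e, |f e| * D (E e).1 (E e).2 := by
  have h1 : ∀ u v, |flowBetween E f u v| * D u v
      ≤ ∑ e, ((if E e = (u, v) then |f e| * D u v else 0)
        + (if E e = (v, u) then |f e| * D u v else 0)) := by
    intro u v
    unfold flowBetween
    refine (mul_le_mul_of_nonneg_right (abs_sum_le_sum_abs _ _) (hD0 u v)).trans ?_
    rw [sum_mul]
    refine sum_le_sum fun e _ => ?_
    refine (mul_le_mul_of_nonneg_right (abs_sub _ _) (hD0 u v)).trans (le_of_eq ?_)
    split_ifs <;> simp [add_mul]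
  unfold pairCost
  refine (sum_le_sum fun u _ => sum_le_sum fun v _ => h1 u v).trans (le_of_eq ?_)
  have h2 : ∀ e, ∑ u, ∑ v, ((if E e = (u, v) then |f e| * D u v else 0)
        + (if E e = (v, u) then |f e| * D u v else 0)) = 2 * (|f e| * D (E e).1 (E e).2) := by
    intro e
    obtain ⟨x, y⟩ := E e
    simp only [Prod.mk.injEq, sum_add_distrib, ite_and]
    simp [hD y x, two_mul]
  rw [mul_sum, ← sum_congr rfl fun e _ => h2 e]
  simp_rw [sum_comm (s := univ (α := V)) (t := univ (α := Fin m))]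

end Between

/-- A list without repetition with one node for every point with a positive value. -/
lemma lin_eq_sum {l : List (Fin n × ℝ)} {w : Fin n → ℝ} (hl : l.Nodup)
    (h : ∀ p a, (p, a) ∈ l ↔ a = w p ∧ 0 < a) (φ : Fin n → ℝ) :
    lin φ l = ∑ p, max (w p) 0 * φ p := by
  have e : l.toFinset = (univ.filter fun p => 0 < w p).image fun p => (p, w p) := by
    ext ⟨p, a⟩
    simp only [List.mem_toFinset, h, mem_image, mem_filter, mem_univ, true_and, Prod.mk.injEq]
    constructor
    · rintro ⟨rfl, h1⟩
      exact ⟨p, h1, rfl, rfl⟩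
    · rintro ⟨q, h1, rfl, rfl⟩
      exact ⟨rfl, h1⟩
  unfold lin
  rw [← List.sum_toFinset _ hl, e, sum_image (fun p _ q _ h => (Prod.mk.inj h).1), sum_filter]
  refine sum_congr rfl fun p _ => ?_
  split_ifs with h1
  · rw [max_eq_left h1.le]
  · rw [max_eq_right (not_lt.1 h1), zero_mul]

lemma max_sub_max (x : ℝ) : max x 0 - max (-x) 0 = x := by
  rcases le_total x 0 with h | h
  · rw [max_eq_right h, max_eq_left (by linarith)]; ring
  · rw [max_eq_left h, max_eq_right (by linarith)]; ring

lemma max_add_max (x : ℝ) : max x 0 + max (-x) 0 = |x| := by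
  rcases le_total x 0 with h | h
  · rw [max_eq_right h, max_eq_left (by linarith), abs_of_nonpos h]; ring
  · rw [max_eq_left h, max_eq_right (by linarith), abs_of_nonneg h]; ring

lemma adj_inl {p q : Fin n} : ¬ (sparseGraph T).Adj (.inl p) (.inl q) := by
  simp [sparseGraph]

lemma adj_inr {s t : Net T} (h : (sparseGraph T).Adj (.inr s) (.inr t)) : s.Near t ∨ t.Near s := by
  simp only [sparseGraph, SimpleGraph.fromRel_adj] at h
  rcases h.2 with (h | h) | (h | h)
  · exact Or.inl (Or.inl h.symm)
  · exact Or.inl (Or.inr ⟨s, rfl, h⟩)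
  · exact Or.inl (Or.inl h)
  · exact Or.inr (Or.inr ⟨t, rfl, h⟩)

/-- The sequences hold the positive and the negative part of the flow between points and net points.
Their difference gives the divergences and their sum the absolute value, hence the cost. No edge
joins two input points, so nothing is lost by starting with zero flow there. -/
lemma Config.IsInitial.inv {μ : Fin n → ℝ} (hE : IsOrientation (sparseGraph T) E)
    (hf : (incidence E).mulVec f = demand μ) {c : Config T} (h : c.IsInitial E f) :
    Inv μ (flowCost (location T) E f) c.todo c := by
  obtain ⟨horder, hphase, hnet, hpoint, hnt, hpt⟩ := h
  have hne : ∀ e, (E e).1 ≠ (E e).2 := fun e => (hE.1 e).ne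
  have lN : ∀ v φ, lin φ (c.nt v) = ∑ p, max (flowBetween E f (.inl p) (.inr v)) 0 * φ p :=
    fun v φ => lin_eq_sum (hnt v).1 (hnt v).2 φ
  have lP : ∀ v φ, lin φ (c.pt v) = ∑ p, max (- flowBetween E f (.inl p) (.inr v)) 0 * φ p := by
    intro v φ
    rw [lin_eq_sum (hpt v).1 (hpt v).2 φ]
    simp only [flowBetween_anti (Sum.inr v)]
  have hpp : ∀ p q : Fin n, flowBetween E f (Sum.inl p) (Sum.inl q) = 0 := by
    intro p q
    by_contra hcon
    obtain ⟨e, he | he⟩ := flowBetween_ne_zero hcon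
    · have := hE.1 e
      rw [he] at this
      exact adj_inl this
    · have := hE.1 e
      rw [he] at this
      exact adj_inl this
  have hbal : ∀ x, ∑ q, flowBetween E f x (Sum.inl q) + ∑ u, flowBetween E f x (Sum.inr u)
      = demand μ x := by
    intro x
    rw [← hf, ← flowBetween_sum hne, Fintype.sum_sum_type]
  refine ⟨⟨[], rfl, by simp⟩, ?_, ?_, ?_, ?_, ?_, ?_, ?_, ?_, ?_, ?_, ?_⟩
  · intro u v
    rw [hnet, hnet, flowBetween_anti]
  · intro u v huv
    rw [hnet] at huv
    obtain ⟨e, he | he⟩ := flowBetween_ne_zero huv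
    · have := hE.1 e
      rw [he] at this
      exact adj_inr this
    · have := hE.1 e
      rw [he] at this
      exact (adj_inr this).symm
  · rintro v ⟨p, w⟩ hx
    exact (((hpt v).2 p w).1 hx).2
  · rintro v ⟨p, w⟩ hx
    exact (((hnt v).2 p w).1 hx).2
  · intro v
    have hb := hbal (.inr v)
    have e : ∑ q, flowBetween E f (Sum.inr v) (Sum.inl q) = weight (c.pt v) - weight (c.nt v) := by
      simp only [weight, lN, lP, ← sum_sub_distrib, mul_one]
      refine sum_congr rfl fun p _ => ?_
      have := max_sub_max (flowBetween E f (Sum.inl p) (Sum.inr v))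
      rw [flowBetween_anti]
      linarith
    simp only [demand] at hb
    simp only [hnet]
    linarith
  · intro p q
    simp [hpoint]
  · intro p
    have hb := hbal (.inl p)
    simp only [hpp, sum_const_zero, zero_add, demand] at hb
    simp only [hpoint, sum_const_zero, zero_add, lN, lP, ← sum_sub_distrib, ind]
    rw [← hb]
    refine sum_congr rfl fun v _ => ?_
    simp only [mul_ite, mul_one, mul_zero, sum_sub_distrib, sum_ite_eq', mem_univ, if_true,
      max_sub_max]
  · have hc := pairCost_flowBetween_le (E := E) (f := f)
      (fun a b => dist (location T a) (location T b)) (fun a b => dist_comm _ _)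
      (fun a b => dist_nonneg)
    have e1 : pairCost netDist c.netFlow
        = ∑ u : Net T, ∑ v : Net T, |flowBetween E f (.inr u) (.inr v)|
          * dist (location T (.inr u)) (location T (.inr v)) := by
      simp only [pairCost, hnet, netDist]
    have e2 : pairCost (fun p q => dist (P p) (P q)) c.pointFlow = 0 := by
      simp [pairCost, hpoint]
    have e3 : ∑ v, lin (pointDist v) (c.pt v) + ∑ v, lin (pointDist v) (c.nt v)
        = ∑ p, ∑ v : Net T, |flowBetween E f (.inl p) (.inr v)|
          * dist (location T (.inl p)) (location T (.inr v)) := by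
      rw [sum_comm, ← sum_add_distrib]
      refine sum_congr rfl fun v _ => ?_
      rw [lN, lP, ← sum_add_distrib]
      refine sum_congr rfl fun p _ => ?_
      rw [← max_add_max]
      simp only [pointDist, location]
      ring
    have e4 : ∑ p, ∑ v : Net T, |flowBetween E f (.inr v) (.inl p)|
          * dist (location T (.inr v)) (location T (.inl p))
        = ∑ p, ∑ v : Net T, |flowBetween E f (.inl p) (.inr v)|
          * dist (location T (.inl p)) (location T (.inr v)) := by
      refine sum_congr rfl fun p _ => sum_congr rfl fun v _ => ?_
      rw [flowBetween_anti, abs_neg, dist_comm]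
    unfold pairCost at hc
    simp only [Fintype.sum_sum_type, hpp, abs_zero, zero_mul, sum_const_zero, zero_add,
      sum_add_distrib] at hc
    rw [sum_comm (f := fun (v : Net T) (p : Fin n) => |flowBetween E f (.inr v) (.inl p)|
          * dist (location T (.inr v)) (location T (.inl p))), e4, ← e3, ← e1] at hc
    unfold Config.cost flowCost
    rw [e2]
    linarith
  all_goals
    intro v rest _ hp
    rw [hphase] at hp
    exact nomatch hp

lemma run_correct {μ : Fin n → ℝ} (hE : IsOrientation (sparseGraph T) E)
    (hf : (incidence E).mulVec f = demand μ) {c₀ : Config T} (h : c₀.IsInitial E f) :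
    Acc (fun c' c => Step c c') c₀ ∧
      ∀ c, Relation.ReflTransGen Step c₀ c → (∀ c', ¬ Step c c') →
        c.todo = [] ∧ IsTransportationMap μ c.result ∧
          transportCost P c.result ≤ flowCost (location T) E f := by
  have hi := h.inv hE hf
  refine ⟨acc_of_anti c₀ hi.anti, fun c hc hfin => ?_⟩
  have ht := todo_eq_nil hfin
  have ho := h.1.childrenFirst
  exact ⟨ht, (hi.reachable ho hc).final ho ht⟩

end Termination

/-! ### Geometry of cells -/

section Cells

variable {d : ℕ}

lemma Cell.piece_region_subset {C : Cell d} (hC : 0 < C.side) {m : ℕ} (j : Fin d → Fin m) :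
    (C.piece m j).region ⊆ C.region := by
  intro y hy i
  have hm : (0 : ℝ) < m := by exact_mod_cast (j i).pos
  have h1 := hy i
  have hs : 0 < C.side / m := by positivity
  simp only [Cell.piece] at h1
  have h2 : ((j i : ℕ) : ℝ) + 1 ≤ m := by exact_mod_cast (j i).isLt
  have h3 : (((j i : ℕ) : ℝ) + 1) * (C.side / m) ≤ m * (C.side / m) :=
    mul_le_mul_of_nonneg_right h2 hs.le
  have h4 : m * (C.side / m) = C.side := by field_simp
  have h5 : 0 ≤ ((j i : ℕ) : ℝ) * (C.side / m) := by positivity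
  constructor <;> nlinarith

lemma Cell.piece_unique {C : Cell d} (hC : 0 < C.side) {m : ℕ} {j j' : Fin d → Fin m}
    {y : EuclideanSpace ℝ (Fin d)} (h : y ∈ (C.piece m j).region)
    (h' : y ∈ (C.piece m j').region) : j = j' := by
  funext i
  have hm : (0 : ℝ) < m := by exact_mod_cast (j i).pos
  have h1 := h i
  have h2 := h' i
  have hs : 0 < C.side / m := by positivity
  simp only [Cell.piece] at h1 h2
  have h3 : ((j i : ℕ) : ℝ) * (C.side / m) < ((j' i : ℕ) + 1 : ℝ) * (C.side / m) := by linarith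
  have h4 : ((j' i : ℕ) : ℝ) * (C.side / m) < ((j i : ℕ) + 1 : ℝ) * (C.side / m) := by linarith
  have h5 := lt_of_mul_lt_mul_right h3 hs.le
  have h6 := lt_of_mul_lt_mul_right h4 hs.le
  norm_cast at h5 h6
  omega

lemma Cell.exists_piece {C : Cell d} (hC : 0 < C.side) {m : ℕ} (hm : 0 < m)
    {y : EuclideanSpace ℝ (Fin d)} (hy : y ∈ C.region) :
    ∃ j : Fin d → Fin m, y ∈ (C.piece m j).region := by
  have hm' : (0 : ℝ) < m := by exact_mod_cast hm
  have hs : 0 < C.side / m := by positivity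
  have hlt : ∀ i, ⌊(y i - C.corner i) / (C.side / m)⌋₊ < m := by
    intro i
    have h1 := hy i
    rw [Nat.floor_lt (div_nonneg (by linarith) hs.le), div_lt_iff₀ hs]
    have : m * (C.side / m) = C.side := by field_simp
    linarith
  refine ⟨fun i => ⟨_, hlt i⟩, fun i => ?_⟩
  have h1 := hy i
  have h2 := Nat.floor_le (div_nonneg (sub_nonneg.2 h1.1) hs.le)
  have h3 := Nat.lt_floor_add_one ((y i - C.corner i) / (C.side / m))
  rw [le_div_iff₀ hs] at h2
  rw [div_lt_iff₀ hs] at h3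
  simp only [Cell.piece]
  constructor <;> linarith

end Cells

/-! ### Counting cells, net points and edges. -/

section Counting

open Classical

variable {n d : ℕ} {P : Fin n → EuclideanSpace ℝ (Fin d)} {k : ℕ} {T : Quadtree P k}

lemma eps_pos (k : ℕ) : 0 < eps k := by unfold eps; positivity

lemma eps_le_one (k : ℕ) : eps k ≤ 1 := by
  unfold eps
  exact inv_le_one_of_one_le₀ (one_le_pow₀ (by norm_num))

/-- In dimension zero every real number would be an admissible side length and the infimum would
carry no information; two distinct points exclude this. -/
lemma dim_pos (hn : 2 ≤ n) (hP : Function.Injective P) : 0 < d := by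
  by_contra hd
  obtain rfl : d = 0 := by omega
  have := @hP ⟨0, by omega⟩ ⟨1, by omega⟩ (Subsingleton.elim _ _)
  simp at this

lemma boundingSide_le (hd : 0 < d) {S : Finset (Fin n)} (hS : S.Nonempty) {b : Fin d → ℝ} {D : ℝ}
    (h : InSquare P S b D) : boundingSide P S ≤ D := by
  refine csInf_le ⟨0, ?_⟩ ⟨b, h⟩
  rintro D' ⟨b', h'⟩
  obtain ⟨p, hp⟩ := hS
  have := h' p hp ⟨0, hd⟩
  linarith

lemma boundingSide_pos (hP : Function.Injective P) {S : Finset (Fin n)} (hS : 1 < #S) :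
    0 < boundingSide P S := by
  obtain ⟨p, hp, q, hq, hpq⟩ := one_lt_card.1 hS
  have : ∃ i, P p i ≠ P q i := by
    by_contra! hcon
    exact hpq (hP (by ext i; exact hcon i))
  obtain ⟨i, hi⟩ := this
  have hpos : 0 < |P p i - P q i| := abs_pos.2 (sub_ne_zero.2 hi)
  refine lt_of_lt_of_le hpos (le_csInf ?_ ?_)
  · refine ⟨2 * ∑ p, ∑ i, |P p i|, fun _ => - ∑ p, ∑ i, |P p i|, fun p _ i => ?_⟩
    have h1 : |P p i| ≤ ∑ p, ∑ i, |P p i| :=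
      (single_le_sum (f := fun i => |P p i|) (fun i _ => abs_nonneg _) (mem_univ i)).trans
        (single_le_sum (f := fun p => ∑ i, |P p i|)
          (fun p _ => sum_nonneg fun i _ => abs_nonneg _) (mem_univ p))
    have := abs_le.1 h1
    constructor <;> linarith
  · rintro D ⟨b, hb⟩
    have h1 := hb p hp i
    have h2 := hb q hq i
    exact abs_le.2 ⟨by linarith, by linarith⟩

/-- The square has a margin of one bounding side on each side, and the shift is strictly smaller, so
the half-open boundary causes no loss. -/
lemma IsShiftedSquare.mem_region {S : Finset (Fin n)} {C : Cell d} (h : IsShiftedSquare P S C)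
    {p : Fin n} (hp : p ∈ S) : P p ∈ C.region := by
  obtain ⟨b, s, h1, h2, h3, h4⟩ := h
  intro i
  have := h1 p hp i
  have := h2 i
  rw [h3, h4]
  constructor <;> linarith

/-- What holds for every cell of a quadtree. -/
structure Sound (T : Quadtree P k) (c : Fin T.numCells) : Prop where
  side_pos : 0 < (T.cell c).side
  nonempty : (T.pts c).Nonempty
  mem_pts : ∀ p, p ∈ T.pts c ↔ P p ∈ (T.cell c).region

lemma Sound.card_of_parent {c a : Fin T.numCells} (h : Sound T c) (ha : T.parent a = some c) :
    1 < #(T.pts c) := by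
  have h1 := h.nonempty.card_pos
  rcases Nat.lt_or_ge 1 #(T.pts c) with h2 | h2
  · exact h2
  · exact absurd ha (T.rule_leaf c (by omega) a)

/-- Since `ε₀ ≤ 1 ≤ n ^ 8`, the test forces the new square, of side three bounding sides, to be
smaller than the compressed cell. -/
lemma compresses_side (hn : 2 ≤ n) {S : Finset (Fin n)} {C : Cell d} (hC : 0 < C.side)
    (h : Compresses P k S C) : 3 * boundingSide P S < C.side := by
  unfold Compresses at h
  have hn8 : (1 : ℝ) ≤ (n : ℝ) ^ 8 := one_le_pow₀ (by exact_mod_cast (by omega : 1 ≤ n))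
  rw [lt_div_iff₀ (by positivity)] at h
  have h1 : eps k * C.side ≤ 1 * C.side := mul_le_mul_of_nonneg_right (eps_le_one k) hC.le
  by_cases h2 : boundingSide P S ≤ 0
  · linarith
  · push Not at h2
    have : boundingSide P S * 3 * 1 ≤ boundingSide P S * 3 * (n : ℝ) ^ 8 :=
      mul_le_mul_of_nonneg_left hn8 (by positivity)
    linarith

/-- Induction from the root along the parent relation. The nesting assumption is needed for a
compressed child: its shifted square might otherwise contain points outside the point set of its
parent. -/
lemma sound (hn : 2 ≤ n) (hP : Function.Injective P) (hT : T.Nested) (c : Fin T.numCells) :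
    Sound T c := by
  have hr := T.reaches_root c
  induction hr using Relation.ReflTransGen.head_induction_on with
  | refl =>
    have hcard : 1 < #(T.pts T.root) := by simp [T.pts_root]; omega
    have h1 : IsShiftedSquare P (T.pts T.root) (T.cell T.root) := by
      rw [T.pts_root]; exact T.cell_root
    refine ⟨?_, card_pos.1 (by omega), fun p => ⟨fun hp => h1.mem_region hp, fun _ => ?_⟩⟩
    · obtain ⟨b, s, -, -, h3, -⟩ := h1
      rw [h3]
      have := boundingSide_pos hP hcard
      linarith
    · simp [T.pts_root]
  | @head a c hac _ ih =>
    have hcard := ih.card_of_parent hac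
    by_cases hc : Compresses P k (T.pts c) (T.cell c)
    · obtain ⟨h1, h2⟩ := (T.rule_compress c hcard hc).2 a hac
      rw [← h1] at h2
      refine ⟨?_, h1 ▸ ih.nonempty, fun p => ⟨fun hp => h2.mem_region hp, fun hp => ?_⟩⟩
      · obtain ⟨b, s, -, -, h3, -⟩ := h2
        rw [h3, h1]
        have := boundingSide_pos hP hcard
        linarith
      · obtain ⟨j, hj⟩ := hT c a hac hcard hc
        rw [h1, ih.mem_pts]
        exact Cell.piece_region_subset ih.side_pos j (hj hp)
    · obtain ⟨h, h1, h2, h3⟩ := (T.rule_split c hcard hc).1 a hac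
      refine ⟨?_, h3, fun p => ?_⟩
      · rw [h1]
        have := ih.side_pos
        simp only [Cell.piece]
        positivity
      · rw [h2, h1, mem_filter, ih.mem_pts]
        exact ⟨fun h => h.2, fun h => ⟨Cell.piece_region_subset ih.side_pos _ h, h⟩⟩

/-- Gives well-foundedness of the tree and shows that the smallest subcell around a point cannot
belong to an inner cell. -/
lemma side_lt (hn : 2 ≤ n) (hP : Function.Injective P) (hT : T.Nested) {a c : Fin T.numCells}
    (hac : T.parent a = some c) : (T.cell a).side < (T.cell c).side := by
  have hs := sound hn hP hT c
  have hcard := hs.card_of_parent hac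
  by_cases hc : Compresses P k (T.pts c) (T.cell c)
  · obtain ⟨-, b, s, -, -, h3, -⟩ := (T.rule_compress c hcard hc).2 a hac
    rw [h3]
    exact compresses_side hn hs.side_pos hc
  · obtain ⟨h, h1, -⟩ := (T.rule_split c hcard hc).1 a hac
    rw [h1]
    have := hs.side_pos
    simp only [Cell.piece]
    push_cast
    linarith

lemma boundingSide_le_side (hn : 2 ≤ n) (hP : Function.Injective P) (hT : T.Nested)
    (c : Fin T.numCells) : boundingSide P (T.pts c) ≤ (T.cell c).side := by
  have hs := sound hn hP hT c
  refine boundingSide_le (dim_pos hn hP) hs.nonempty (b := (T.cell c).corner) fun p hp i => ?_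
  have := (hs.mem_pts p).1 hp i
  exact ⟨this.1, this.2.le⟩

/-- An upper bound for the number of cells in a chain of cells with the same points. -/
noncomputable def chainBound (n k : ℕ) : ℝ := 4 + Real.logb 2 (3 * (n : ℝ) ^ 8 / eps k)

/-- An upper bound for the number of cells with the same points in the subtree of a cell. -/
noncomputable def chainLeft (T : Quadtree P k) (c : Fin T.numCells) : ℝ :=
  if #(T.pts c) = 1 then 1
  else if Compresses P k (T.pts c) (T.cell c) then 4
  else 1 + Real.logb 2 ((T.cell c).side / boundingSide P (T.pts c))

/-- An upper bound for the number of cells in the subtree of a cell. -/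
noncomputable def subtreeBound (T : Quadtree P k) (c : Fin T.numCells) : ℝ :=
  2 * chainBound n k * (#(T.pts c) - 1) + chainLeft T c

lemma four_le_chainBound (hn : 2 ≤ n) : 4 ≤ chainBound n k := by
  have h1 : (1 : ℝ) ≤ (n : ℝ) ^ 8 := one_le_pow₀ (by exact_mod_cast (by omega : 1 ≤ n))
  have h2 : 1 ≤ 3 * (n : ℝ) ^ 8 / eps k := by
    rw [le_div_iff₀ (eps_pos k)]
    have := eps_le_one k
    linarith
  have := Real.logb_nonneg (b := 2) (by norm_num) h2
  unfold chainBound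
  linarith

lemma one_le_chainLeft (hn : 2 ≤ n) (hP : Function.Injective P) (hT : T.Nested)
    (c : Fin T.numCells) : 1 ≤ chainLeft T c := by
  unfold chainLeft
  have hpos := (sound hn hP hT c).nonempty.card_pos
  split_ifs with h1 h2
  · exact le_rfl
  · norm_num
  · have h3 : 0 < boundingSide P (T.pts c) := boundingSide_pos hP (by omega)
    have := Real.logb_nonneg (b := 2) (by norm_num)
      ((one_le_div h3).2 (boundingSide_le_side hn hP hT c))
    linarith

lemma chainLeft_le (hn : 2 ≤ n) (hP : Function.Injective P) (hT : T.Nested)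
    (c : Fin T.numCells) : chainLeft T c ≤ chainBound n k := by
  have h4 := four_le_chainBound (n := n) (k := k) hn
  unfold chainLeft
  have hs := sound hn hP hT c
  have hpos := hs.nonempty.card_pos
  split_ifs with h1 h2
  · linarith
  · exact h4
  · have h3 : 0 < boundingSide P (T.pts c) := boundingSide_pos hP (by omega)
    have hn0 : (0 : ℝ) < n := by exact_mod_cast (by omega : 0 < n)
    have h5 : (T.cell c).side / boundingSide P (T.pts c) ≤ 3 * (n : ℝ) ^ 8 / eps k := by
      unfold Compresses at h2
      rw [not_lt, div_le_iff₀ (by positivity)] at h2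
      rw [div_le_div_iff₀ h3 (eps_pos k)]
      linarith
    have := Real.logb_le_logb_of_le (b := 2) (by norm_num) (div_pos hs.side_pos h3) h5
    unfold chainBound
    linarith

lemma pts_disjoint (hn : 2 ≤ n) (hP : Function.Injective P) (hT : T.Nested)
    {a b c : Fin T.numCells} (ha : T.parent a = some c) (hb : T.parent b = some c) (hab : a ≠ b) :
    Disjoint (T.pts a) (T.pts b) := by
  have hs := sound hn hP hT c
  have hcard := hs.card_of_parent ha
  by_cases hc : Compresses P k (T.pts c) (T.cell c)
  · exact absurd ((T.rule_compress c hcard hc).1.unique ha hb) hab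
  · obtain ⟨h, h1, h2, h3⟩ := (T.rule_split c hcard hc).1 a ha
    obtain ⟨h', h1', h2', -⟩ := (T.rule_split c hcard hc).1 b hb
    rw [disjoint_left]
    intro p hp hp'
    rw [h2, mem_filter] at hp
    rw [h2', mem_filter] at hp'
    obtain rfl := Cell.piece_unique hs.side_pos hp.2 hp'.2
    exact hab (((T.rule_split c hcard hc).2 h ⟨p, hp⟩).unique ⟨ha, h1⟩ ⟨hb, h1'⟩)

lemma pts_subset (hn : 2 ≤ n) (hP : Function.Injective P) (hT : T.Nested)
    {a c : Fin T.numCells} (ha : T.parent a = some c) : T.pts a ⊆ T.pts c := by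
  have hs := sound hn hP hT c
  have hcard := hs.card_of_parent ha
  by_cases hc : Compresses P k (T.pts c) (T.cell c)
  · rw [((T.rule_compress c hcard hc).2 a ha).1]
  · obtain ⟨h, h1, h2, h3⟩ := (T.rule_split c hcard hc).1 a ha
    rw [h2]
    exact filter_subset _ _

/-- An ordinary division halves the side and lowers the logarithm by one. A compression starts a new
square whose ratio to the bounding square is three. From a cell that does not compress, smaller
cells with the same points do not compress either, so a chain has at most one compression. -/
lemma chainLeft_child (hn : 2 ≤ n) (hP : Function.Injective P) (hT : T.Nested)
    {a c : Fin T.numCells} (ha : T.parent a = some c) (he : T.pts a = T.pts c) :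
    1 + chainLeft T a ≤ chainLeft T c := by
  have hs := sound hn hP hT c
  have hcard := hs.card_of_parent ha
  have hb := boundingSide_pos hP hcard
  have hn8 : (1 : ℝ) ≤ (n : ℝ) ^ 8 := one_le_pow₀ (by exact_mod_cast (by omega : 1 ≤ n))
  have hn0 : (0 : ℝ) < n := by exact_mod_cast (by omega : 0 < n)
  unfold chainLeft
  have hne : ¬ #(T.pts c) = 1 := by omega
  simp only [he, if_neg hne]
  by_cases hc : Compresses P k (T.pts c) (T.cell c)
  · obtain ⟨-, b, s, -, -, h3, -⟩ := (T.rule_compress c hcard hc).2 a ha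
    have h1 : ¬ Compresses P k (T.pts c) (T.cell a) := by
      unfold Compresses
      rw [h3, not_lt, div_le_iff₀ (by positivity)]
      have e1 := eps_le_one k
      have : eps k * (3 * boundingSide P (T.pts c)) ≤ 1 * (3 * boundingSide P (T.pts c)) :=
        mul_le_mul_of_nonneg_right e1 (by positivity)
      have : boundingSide P (T.pts c) * 3 * 1 ≤ boundingSide P (T.pts c) * 3 * (n : ℝ) ^ 8 :=
        mul_le_mul_of_nonneg_left hn8 (by positivity)
      linarith
    rw [if_neg h1, if_pos hc, h3]
    have h4 : 3 * boundingSide P (T.pts c) / boundingSide P (T.pts c) = 3 := by field_simp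
    rw [h4]
    -- The value `4` at a compressing cell is this bound, plus one for the child and one for the
    -- cell itself.
    have : Real.logb 2 3 ≤ 2 := by
      rw [Real.logb_le_iff_le_rpow (by norm_num) (by norm_num)]
      norm_num
    linarith
  · obtain ⟨h, h1, -⟩ := (T.rule_split c hcard hc).1 a ha
    have hside : (T.cell a).side = (T.cell c).side / 2 := by rw [h1]; simp [Cell.piece]
    have h2 : ¬ Compresses P k (T.pts c) (T.cell a) := by
      unfold Compresses at hc ⊢
      rw [not_lt] at hc ⊢
      refine le_trans ?_ hc
      rw [hside]
      have := hs.side_pos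
      have := eps_pos k
      gcongr
      linarith
    rw [if_neg h2, if_neg hc, hside]
    have h3 : (T.cell c).side / 2 / boundingSide P (T.pts c)
        = (T.cell c).side / boundingSide P (T.pts c) / 2 := by ring
    rw [h3, Real.logb_div (div_pos hs.side_pos hb).ne' (by norm_num), Real.logb_self_eq_one
      (by norm_num)]
    linarith

/-- Either a child has all the points, and the chain term drops by one; or the children have fewer
points each. In the second case the bound of a child is at most `2 * B * #pts - B`, and two children
release `2 * B`, as does the loss of a point for a single child. Here `B` is `chainBound n k`. -/
lemma subtreeBound_children (hn : 2 ≤ n) (hP : Function.Injective P) (hT : T.Nested)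
    {c : Fin T.numCells} {children : List (Fin T.numCells)} (hd : children.Nodup)
    (hc : ∀ a, a ∈ children ↔ T.parent a = some c) :
    1 + (children.map (subtreeBound T)).sum ≤ subtreeBound T c := by
  have hs := sound hn hP hT c
  have hB := four_le_chainBound (n := n) (k := k) hn
  have hcard : (1 : ℝ) ≤ #(T.pts c) := by exact_mod_cast hs.nonempty.card_pos
  have hl := one_le_chainLeft hn hP hT c
  by_cases hex : ∃ a, T.parent a = some c ∧ T.pts a = T.pts c
  · obtain ⟨a, ha, he⟩ := hex
    -- A sibling would have a nonempty point set that is disjoint from all points of `c`.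
    have hone : children = [a] := by
      refine List.perm_singleton.1 ((List.perm_ext_iff_of_nodup hd (by simp)).2 fun b => ?_)
      rw [hc, List.mem_singleton]
      constructor
      · intro hb
        by_contra hab
        have h1 := pts_disjoint hn hP hT ha hb (Ne.symm hab)
        rw [he] at h1
        have h2 := disjoint_self.1 (h1.mono_left (pts_subset hn hP hT hb))
        exact (sound hn hP hT b).nonempty.ne_empty h2
      · rintro rfl; exact ha
    rw [hone]
    have := chainLeft_child hn hP hT ha he
    simp only [List.map_cons, List.map_nil, List.sum_cons, List.sum_nil, subtreeBound, he]
    linarith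
  · push Not at hex
    have h1 : (children.map (subtreeBound T)).sum
        ≤ ∑ a ∈ children.toFinset, (2 * chainBound n k * #(T.pts a) - chainBound n k) := by
      rw [← List.sum_toFinset _ hd]
      refine sum_le_sum fun a _ => ?_
      have := chainLeft_le hn hP hT a
      unfold subtreeBound
      linarith
    have h2 : ∑ a ∈ children.toFinset, (#(T.pts a) : ℝ) ≤ #(T.pts c) := by
      rw [← Nat.cast_sum, ← card_biUnion]
      · refine Nat.cast_le.2 (card_le_card (biUnion_subset.2 fun a ha => ?_))
        exact pts_subset hn hP hT ((hc a).1 (List.mem_toFinset.1 ha))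
      · intro a ha b hb hab
        exact pts_disjoint hn hP hT ((hc a).1 (List.mem_toFinset.1 ha))
          ((hc b).1 (List.mem_toFinset.1 hb)) hab
    rw [sum_sub_distrib, ← mul_sum, sum_const, nsmul_eq_mul] at h1
    have e : subtreeBound T c = 2 * chainBound n k * (#(T.pts c) - 1) + chainLeft T c := rfl
    rw [e]
    have h3 := mul_le_mul_of_nonneg_left h2 (by linarith : 0 ≤ 2 * chainBound n k)
    have hm : 0 ≤ 2 * chainBound n k * (#(T.pts c) - 1) :=
      mul_nonneg (by linarith) (by linarith)
    rcases Nat.lt_or_ge 1 #children.toFinset with h4 | h4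
    · have h5 : (2 : ℝ) ≤ #children.toFinset := by exact_mod_cast h4
      have h6 := mul_le_mul_of_nonneg_right h5 (by linarith : 0 ≤ chainBound n k)
      linarith
    · rcases Nat.le_one_iff_eq_zero_or_eq_one.1 h4 with h5 | h5
      · have : children = [] := by simpa using h5
        subst this
        simp only [List.map_nil, List.sum_nil]
        linarith
      · obtain ⟨a, ha⟩ := card_eq_one.1 h5
        have hac : T.parent a = some c := by
          rw [← hc, ← List.mem_toFinset, ha]; simp
        have h6 : #(T.pts a) + 1 ≤ #(T.pts c) :=
          card_lt_card (Finset.ssubset_iff_subset_ne.2 ⟨pts_subset hn hP hT hac, hex a hac⟩)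
        have h7 : (#(T.pts a) : ℝ) + 1 ≤ #(T.pts c) := by exact_mod_cast h6
        have h8 := mul_le_mul_of_nonneg_left h7 (by linarith : 0 ≤ 2 * chainBound n k)
        rw [h5, ha, sum_singleton] at h1
        push_cast at h1
        linarith

lemma PostorderForest.length_le (hn : 2 ≤ n) (hP : Function.Injective P) (hT : T.Nested)
    {rs L : List (Fin T.numCells)} (h : PostorderForest T rs L) :
    (L.length : ℝ) ≤ (rs.map (subtreeBound T)).sum := by
  induction h with
  | nil => simp
  | @cons c children rs L L' hd hc h1 h2 ih1 ih2 =>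
    have := subtreeBound_children hn hP hT hd hc
    simp only [List.length_append, List.length_cons, List.map_cons, List.sum_cons]
    push_cast
    linarith

lemma PostorderForest.length_root_le (hn : 2 ≤ n) (hP : Function.Injective P) (hT : T.Nested)
    {L : List (Fin T.numCells)} (h : PostorderForest T [T.root] L) :
    (L.length : ℝ) ≤ 2 * n * chainBound n k := by
  have h1 := h.length_le hn hP hT
  have h2 := chainLeft_le hn hP hT T.root
  have hB := four_le_chainBound (n := n) (k := k) hn
  simp only [List.map_cons, List.map_nil, List.sum_cons, List.sum_nil, subtreeBound, T.pts_root,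
    card_univ, Fintype.card_fin] at h1
  linarith

lemma PostorderForest.numCells_le {L : List (Fin T.numCells)}
    (h : PostorderForest T [T.root] L) : T.numCells ≤ L.length := by
  have h1 : (univ : Finset (Fin T.numCells)) ⊆ L.toFinset := fun c _ =>
    List.mem_toFinset.2 (h.mem c)
  have := (card_le_card h1).trans (List.toFinset_card_le L)
  simpa using this

/-- Well-founded recursion over cells combined with list induction over forests; stated for an
abstract predicate `Post`. -/
lemma exists_postorder {N : ℕ} {r : Fin N → Fin N → Prop} (hr : WellFounded r)
    {ch : Fin N → List (Fin N)} (hch : ∀ c, ∀ a ∈ ch c, r a c)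
    {Post : List (Fin N) → List (Fin N) → Prop} (hnil : Post [] [])
    (hcons : ∀ c rs L L', Post (ch c) L → Post rs L' → Post (c :: rs) (L ++ c :: L')) :
    ∀ rs, ∃ L, Post rs L := by
  have hlist : ∀ rs : List (Fin N), (∀ c ∈ rs, ∃ L, Post (ch c) L) → ∃ L, Post rs L := by
    intro rs
    induction rs with
    | nil => intro _; exact ⟨[], hnil⟩
    | cons c rs ih =>
      intro h
      obtain ⟨L, hL⟩ := h c (by simp)
      obtain ⟨L', hL'⟩ := ih fun x hx => h x (by simp [hx])
      exact ⟨_, hcons c rs L L' hL hL'⟩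
  have hcell : ∀ c, ∃ L, Post (ch c) L := fun c =>
    hr.induction (C := fun c => ∃ L, Post (ch c) L) c
      fun c ih => hlist _ fun a ha => ih a (hch c a ha)
  exact fun rs => hlist rs fun c _ => hcell c

lemma parent_wellFounded (hn : 2 ≤ n) (hP : Function.Injective P) (hT : T.Nested) :
    WellFounded fun a c => T.parent a = some c := by
  let r : Fin T.numCells → Fin T.numCells → Prop := fun a c => (T.cell a).side < (T.cell c).side
  have : IsTrans _ r := ⟨fun a b c h h' => lt_trans (a := (T.cell a).side) h h'⟩
  have : Std.Irrefl r := ⟨fun a => lt_irrefl _⟩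
  have hr : WellFounded r := Finite.wellFounded_of_trans_of_irrefl r
  exact Subrelation.wf (fun h => side_lt hn hP hT h) hr

/-! ### Sizes of the sparse graph -/

lemma card_owner_le (c : Fin T.numCells) :
    Fintype.card {s : Net T // s.owner = c} ≤ (2 ^ k) ^ d := by
  have hinj : Function.Injective fun s : {s : Net T // s.owner = c} => s.1.1.2 := by
    rintro ⟨s, hs⟩ ⟨t, ht⟩ hst
    have h : s.1 = t.1 := Prod.ext (hs.trans ht.symm) hst
    exact Subtype.ext (Subtype.ext h)
  have := Fintype.card_le_of_injective _ hinj
  simpa using this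

lemma card_net_le : Fintype.card (Net T) ≤ T.numCells * (2 ^ k) ^ d := by
  have hinj : Function.Injective fun s : Net T => s.1 := fun s t hst => Subtype.ext hst
  have := Fintype.card_le_of_injective _ hinj
  simpa using this

/-- If the owner had several points, a child containing `p` would have a smaller side and hence a
smaller subcell around `p`. So the edges at input points belong to cells with one point, which lets
the cell determine the point. -/
lemma IsSmallest.pts_owner (hn : 2 ≤ n) (hP : Function.Injective P) (hT : T.Nested) {p : Fin n}
    {s : Net T} (h : Net.IsSmallest p s) : T.pts s.owner = {p} := by
  have hs := sound hn hP hT s.owner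
  have hp : p ∈ T.pts s.owner := (hs.mem_pts p).2 (Cell.piece_region_subset hs.side_pos _ h.1)
  rcases Nat.lt_or_ge 1 #(T.pts s.owner) with h1 | h1
  · exfalso
    have hchild : ∃ a, T.parent a = some s.owner ∧ p ∈ T.pts a := by
      by_cases hc : Compresses P k (T.pts s.owner) (T.cell s.owner)
      · obtain ⟨a, ha, -⟩ := (T.rule_compress _ h1 hc).1
        exact ⟨a, ha, by rw [((T.rule_compress _ h1 hc).2 a ha).1]; exact hp⟩
      · obtain ⟨j, hj⟩ := Cell.exists_piece hs.side_pos (m := 2) (by norm_num)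
          ((hs.mem_pts p).1 hp)
        obtain ⟨a, ⟨ha, ha'⟩, -⟩ := (T.rule_split _ h1 hc).2 j ⟨p, hp, hj⟩
        exact ⟨a, ha, ((sound hn hP hT a).mem_pts p).2 (ha' ▸ hj)⟩
    obtain ⟨a, ha, hpa⟩ := hchild
    have hsa := sound hn hP hT a
    obtain ⟨j, hj⟩ := Cell.exists_piece hsa.side_pos (m := 2 ^ k) (by positivity)
      ((hsa.mem_pts p).1 hpa)
    have h2 := h.2 ⟨(a, j), p, hpa, hj⟩ hj
    have h3 := side_lt hn hP hT ha
    simp only [Net.subcell, Cell.piece] at h2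
    have h4 : (0 : ℝ) < ((2 ^ k : ℕ) : ℝ) := by positivity
    rw [div_le_div_iff_of_pos_right h4] at h2
    exact absurd h3 (not_lt.2 h2)
  · have h2 : #(T.pts s.owner) = 1 := by
      have := card_pos.2 ⟨p, hp⟩
      omega
    obtain ⟨q, hq⟩ := card_eq_one.1 h2
    rw [hq] at hp ⊢
    rw [mem_singleton.1 hp]

/-- Edges are coded injectively by a kind, a cell and two subcell indices. -/
lemma card_edges_le (hn : 2 ≤ n) (hP : Function.Injective P) (hT : T.Nested) {m : ℕ}
    {E : Fin m → Vert T × Vert T} (hE : IsOrientation (sparseGraph T) E) :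
    m ≤ 5 * (T.numCells * ((2 ^ k) ^ d * (2 ^ k) ^ d)) := by
  let J := Fin d → Fin (2 ^ k)
  -- The five kinds are pairs within a cell, edges to a parent net point in either orientation, and
  -- edges at a point in either orientation. The parent cell and the point need no place in the
  -- code: the cell determines both.
  let R : Fin 5 × Fin T.numCells × J × J → Vert T × Vert T → Prop := fun x e =>
    (x.1 = 0 ∧ ∃ s t : Net T, e = (.inr s, .inr t) ∧
      s.1 = (x.2.1, x.2.2.1) ∧ t.1 = (x.2.1, x.2.2.2)) ∨
    (x.1 = 1 ∧ ∃ s t : Net T, e = (.inr s, .inr t) ∧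
      s.1 = (x.2.1, x.2.2.1) ∧ T.parent x.2.1 = some t.1.1 ∧ t.1.2 = x.2.2.2) ∨
    (x.1 = 2 ∧ ∃ s t : Net T, e = (.inr t, .inr s) ∧
      s.1 = (x.2.1, x.2.2.1) ∧ T.parent x.2.1 = some t.1.1 ∧ t.1.2 = x.2.2.2) ∨
    (x.1 = 3 ∧ ∃ (p : Fin n) (s : Net T), e = (.inl p, .inr s) ∧
      s.1 = (x.2.1, x.2.2.1) ∧ T.pts x.2.1 = {p}) ∨
    (x.1 = 4 ∧ ∃ (p : Fin n) (s : Net T), e = (.inr s, .inl p) ∧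
      s.1 = (x.2.1, x.2.2.1) ∧ T.pts x.2.1 = {p})
  have hR : ∀ x e e', R x e → R x e' → e = e' := by
    rintro x e e' h h'
    have hnet : ∀ (s s' : Net T) y, s.1 = y → s'.1 = y → s = s' :=
      fun s s' y h h' => Subtype.ext (h.trans h'.symm)
    have hpar : ∀ (t t' : Net T) (o : Option (Fin T.numCells)) (j : J), o = some t.1.1 →
        t.1.2 = j → o = some t'.1.1 → t'.1.2 = j → t = t' := fun t t' o j h1 h2 h3 h4 =>
      Subtype.ext (Prod.ext (Option.some.inj (h1.symm.trans h3)) (h2.trans h4.symm))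
    rcases h with ⟨i, s, t, rfl, h1, h2⟩ | ⟨i, s, t, rfl, h1, h2, h3⟩ | ⟨i, s, t, rfl, h1, h2, h3⟩ |
      ⟨i, p, s, rfl, h1, h2⟩ | ⟨i, p, s, rfl, h1, h2⟩ <;>
    rcases h' with ⟨i', s', t', rfl, h1', h2'⟩ | ⟨i', s', t', rfl, h1', h2', h3'⟩ |
      ⟨i', s', t', rfl, h1', h2', h3'⟩ | ⟨i', p', s', rfl, h1', h2'⟩ | ⟨i', p', s', rfl, h1', h2'⟩
    all_goals first
      | exact absurd (i.symm.trans i') (by decide)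
      | rw [hnet s s' _ h1 h1', hnet t t' _ h2 h2']
      | rw [hnet s s' _ h1 h1', hpar t t' _ _ h2 h3 h2' h3']
      | rw [hnet s s' _ h1 h1', singleton_injective (h2.symm.trans h2')]
  have hex : ∀ e, ∃ x, R x (E e) := by
    intro e
    have ha := hE.1 e
    generalize E e = x at ha ⊢
    obtain ⟨u, v⟩ := x
    simp only [sparseGraph, SimpleGraph.fromRel_adj] at ha
    rcases u with p | s <;> rcases v with q | t
    · simp at ha
    · exact ⟨(3, t.1.1, t.1.2, t.1.2), .inr (.inr (.inr (.inl
        ⟨rfl, p, t, rfl, rfl, IsSmallest.pts_owner hn hP hT (by simpa using ha)⟩)))⟩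
    · exact ⟨(4, s.1.1, s.1.2, s.1.2), .inr (.inr (.inr (.inr
        ⟨rfl, q, s, rfl, rfl, IsSmallest.pts_owner hn hP hT (by simpa using ha)⟩)))⟩
    · rcases ha.2 with (h | h) | (h | h)
      · exact ⟨(0, s.1.1, s.1.2, t.1.2), .inl ⟨rfl, s, t, rfl, rfl, Prod.ext h.symm rfl⟩⟩
      · exact ⟨(1, s.1.1, s.1.2, t.1.2), .inr (.inl ⟨rfl, s, t, rfl, rfl, h.1, rfl⟩)⟩
      · exact ⟨(0, s.1.1, s.1.2, t.1.2), .inl ⟨rfl, s, t, rfl, rfl, Prod.ext h rfl⟩⟩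
      · exact ⟨(2, t.1.1, t.1.2, s.1.2), .inr (.inr (.inl ⟨rfl, t, s, rfl, rfl, h.1, rfl⟩))⟩
  choose g hg using hex
  have hinj : Function.Injective g := by
    intro e e' h
    have h1 : E e = E e' := hR (g e) _ _ (hg e) (h ▸ hg e')
    have := hE.2 _ _ (hE.1 e)
    -- An edge occurs only once in the list, so equal endpoints mean equal indices.
    exact this.unique (Or.inl rfl) (Or.inl h1.symm)
  have := Fintype.card_le_of_injective g hinj
  simpa [J, Fintype.card_prod] using this

end Counting

/-! ### Reasoning about programs with time credits -/

section Logic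

/-- `c.wp Q s b`: started in `s` with `b` time credits, `c` halts, and `Q` holds of the final
memory and the number of credits left. -/
def Cmd.wp : Cmd → (Store → ℝ → Prop) → Store → ℝ → Prop
  | .skip, Q, s, b => Q s (b - 1)
  | .nset a i e, Q, s, b => Q (s.setNat a (i.eval s) (e.eval s)) (b - ((1 + i.cost + e.cost : ℕ) : ℝ))
  | .rset a i e, Q, s, b => Q (s.setReal a (i.eval s) (e.eval s)) (b - ((1 + i.cost + e.cost : ℕ) : ℝ))
  | .seq x y, Q, s, b => x.wp (y.wp Q) s b
  | .ite c x y, Q, s, b => (c.holds s → x.wp Q s (b - ((1 + c.cost : ℕ) : ℝ))) ∧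
      (¬ c.holds s → y.wp Q s (b - ((1 + c.cost : ℕ) : ℝ)))
  | .loop c x, Q, s, b => ∃ s' t, Exec (.loop c x) s s' t ∧ Q s' (b - (t : ℝ))

/-- The program writes to the natural number array `a`. -/
def Cmd.modNat : Cmd → ℕ → Bool
  | .skip, _ => false
  | .nset a _ _, x => x == a
  | .rset _ _ _, _ => false
  | .seq c d, x => c.modNat x || d.modNat x
  | .ite _ c d, x => c.modNat x || d.modNat x
  | .loop _ c, x => c.modNat x

/-- The program writes to the real array `a`. -/
def Cmd.modReal : Cmd → ℕ → Bool
  | .skip, _ => false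
  | .nset _ _ _, _ => false
  | .rset a _ _, x => x == a
  | .seq c d, x => c.modReal x || d.modReal x
  | .ite _ c d, x => c.modReal x || d.modReal x
  | .loop _ c, x => c.modReal x

/-- The memories agree on the arrays to which the program does not write. -/
structure SameOff (c : Cmd) (s s' : Store) : Prop where
  nat : ∀ a, c.modNat a = false → s'.nat a = s.nat a
  real : ∀ a, c.modReal a = false → s'.real a = s.real a

lemma SameOff.refl (c : Cmd) (s : Store) : SameOff c s s := ⟨fun _ _ => rfl, fun _ _ => rfl⟩

lemma SameOff.trans {c : Cmd} {s s' s'' : Store} (h : SameOff c s s') (h' : SameOff c s' s'') :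
    SameOff c s s'' :=
  ⟨fun a ha => (h'.nat a ha).trans (h.nat a ha), fun a ha => (h'.real a ha).trans (h.real a ha)⟩

lemma SameOff.of_exec {c : Cmd} {s s' : Store} {t : ℕ} (h : Exec c s s' t) : SameOff c s s' := by
  induction h with
  | skip s => exact .refl _ _
  | nset a i e s =>
    refine ⟨fun x hx => ?_, fun _ _ => rfl⟩
    have : x ≠ a := by simpa [Cmd.modNat] using hx
    simp [Store.setNat, this]
  | rset a i e s =>
    refine ⟨fun _ _ => rfl, fun x hx => ?_⟩
    have : x ≠ a := by simpa [Cmd.modReal] using hx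
    simp [Store.setReal, this]
  | seq _ _ ih1 ih2 =>
    refine ⟨fun x hx => ?_, fun x hx => ?_⟩
    · simp only [Cmd.modNat, Bool.or_eq_false_iff] at hx
      rw [ih2.nat x hx.2, ih1.nat x hx.1]
    · simp only [Cmd.modReal, Bool.or_eq_false_iff] at hx
      rw [ih2.real x hx.2, ih1.real x hx.1]
  | ite_true _ _ ih =>
    refine ⟨fun x hx => ?_, fun x hx => ?_⟩
    · simp only [Cmd.modNat, Bool.or_eq_false_iff] at hx
      exact ih.nat x hx.1
    · simp only [Cmd.modReal, Bool.or_eq_false_iff] at hx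
      exact ih.real x hx.1
  | ite_false _ _ ih =>
    refine ⟨fun x hx => ?_, fun x hx => ?_⟩
    · simp only [Cmd.modNat, Bool.or_eq_false_iff] at hx
      exact ih.nat x hx.2
    · simp only [Cmd.modReal, Bool.or_eq_false_iff] at hx
      exact ih.real x hx.2
  | loop_true _ _ _ ih1 ih2 =>
    exact ⟨fun x hx => (ih2.nat x hx).trans (ih1.nat x hx),
      fun x hx => (ih2.real x hx).trans (ih1.real x hx)⟩
  | loop_false _ => exact .refl _ _

/-- Turns a proof with credits into an execution. The credits left are real numbers, so the actual
time is bounded by showing that this remainder is nonnegative. -/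
lemma Cmd.wp_iff (c : Cmd) (Q : Store → ℝ → Prop) (s : Store) (b : ℝ) :
    c.wp Q s b → ∃ s' t, Exec c s s' t ∧ Q s' (b - (t : ℝ)) := by
  induction c generalizing Q s b with
  | skip => intro h; exact ⟨s, 1, .skip s, by simpa [Cmd.wp] using h⟩
  | nset a i e => intro h; exact ⟨_, _, .nset a i e s, h⟩
  | rset a i e => intro h; exact ⟨_, _, .rset a i e s, h⟩
  | seq x y ih1 ih2 =>
    intro h
    obtain ⟨s', t, h1, h2⟩ := ih1 _ _ _ h
    obtain ⟨s'', t', h3, h4⟩ := ih2 _ _ _ h2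
    refine ⟨s'', _, .seq h1 h3, ?_⟩
    push_cast
    rwa [← sub_sub]
  | ite c x y ih1 ih2 =>
    intro h
    by_cases hc : c.holds s
    · obtain ⟨s', t, h1, h2⟩ := ih1 _ _ _ (h.1 hc)
      refine ⟨s', _, .ite_true hc h1, ?_⟩
      push_cast at h2 ⊢
      rwa [← sub_sub]
    · obtain ⟨s', t, h1, h2⟩ := ih2 _ _ _ (h.2 hc)
      refine ⟨s', _, .ite_false hc h1, ?_⟩
      push_cast at h2 ⊢
      rwa [← sub_sub]
  | loop c x ih => exact id

lemma Cmd.wp_of_exec (c : Cmd) {Q : Store → ℝ → Prop} {s s' : Store} {b : ℝ} {t : ℕ}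
    (h : Exec c s s' t) (hQ : Q s' (b - (t : ℝ))) : c.wp Q s b := by
  induction h generalizing Q b with
  | skip s => simpa [Cmd.wp] using hQ
  | nset a i e s => exact hQ
  | rset a i e s => exact hQ
  | seq _ _ ih1 ih2 =>
    refine ih1 (ih2 ?_)
    push_cast at hQ
    rwa [sub_sub]
  | ite_true hc _ ih =>
    refine ⟨fun _ => ih ?_, fun h => absurd hc h⟩
    push_cast at hQ ⊢
    rwa [sub_sub]
  | ite_false hc _ ih =>
    refine ⟨fun h => absurd h hc, fun _ => ih ?_⟩
    push_cast at hQ ⊢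
    rwa [sub_sub]
  | loop_true hc h1 h2 => exact ⟨_, _, .loop_true hc h1 h2, hQ⟩
  | loop_false hc => exact ⟨_, _, .loop_false hc, hQ⟩

/-- The rule of consequence, which also provides the arrays that remain the same. -/
lemma Cmd.wp_conseq {c : Cmd} {R Q : Store → ℝ → Prop} {s : Store} {b : ℝ} (h : c.wp R s b)
    (hQ : ∀ s' b', SameOff c s s' → R s' b' → Q s' b') : c.wp Q s b := by
  obtain ⟨s', t, h1, h2⟩ := c.wp_iff R s b h
  exact c.wp_of_exec h1 (hQ _ _ (.of_exec h1) h2)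

/-- The rule for loops. -/
lemma Cmd.wp_loop {c : BExp} {x : Cmd} {Q : Store → ℝ → Prop} {s₀ : Store} {b₀ : ℝ}
    (Inv : Store → ℝ → Prop) (h0 : Inv s₀ b₀)
    (hpos : ∀ s b, Inv s b → 0 ≤ b)
    (hstep : ∀ s b, SameOff x s₀ s → Inv s b → c.holds s →
      x.wp Inv s (b - ((1 + c.cost : ℕ) : ℝ)))
    (hexit : ∀ s b, SameOff x s₀ s → Inv s b → ¬ c.holds s →
      Q s (b - ((1 + c.cost : ℕ) : ℝ))) :
    (Cmd.loop c x).wp Q s₀ b₀ := by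
  -- Every iteration spends at least one credit and the invariant keeps the balance nonnegative, so
  -- induction on a natural bound for the credits also proves termination.
  have key : ∀ N : ℕ, ∀ (s : Store) (b : ℝ), b < N → SameOff x s₀ s → Inv s b →
      ∃ s' t, Exec (.loop c x) s s' t ∧ Q s' (b - (t : ℝ)) := by
    intro N
    induction N with
    | zero =>
      intro s b hb _ hI
      have := hpos s b hI
      push_cast at hb
      linarith
    | succ N ih =>
      intro s b hb hs hI
      by_cases hc : c.holds s
      · obtain ⟨s', t, h1, h2⟩ := x.wp_iff _ _ _ (hstep s b hs hI hc)
        have hb' : b - ((1 + c.cost : ℕ) : ℝ) - (t : ℝ) < N := by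
          push_cast at hb ⊢
          have e1 : (0 : ℝ) ≤ c.cost := Nat.cast_nonneg _
          have e2 : (0 : ℝ) ≤ t := Nat.cast_nonneg _
          linarith
        obtain ⟨s'', t', h3, h4⟩ := ih s' _ hb' (hs.trans (.of_exec h1)) h2
        refine ⟨s'', _, .loop_true hc h1 h3, ?_⟩
        push_cast at h4 ⊢
        convert h4 using 1
        ring
      · exact ⟨s, _, .loop_false hc, hexit s b hs hI hc⟩
  obtain ⟨N, hN⟩ := exists_nat_gt b₀
  exact key N s₀ b₀ hN (.refl _ _) h0

/-- Sequences of commands. -/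
def block : List Cmd → Cmd
  | [] => .skip
  | [c] => c
  | c :: d :: l => .seq c (block (d :: l))

/-- A scalar variable. -/
abbrev var (a : ℕ) : NExp := .get a (.lit 0)

abbrev setVar (a : ℕ) (e : NExp) : Cmd := .nset a (.lit 0) e

abbrev rvar (a : ℕ) : RExp := .get a (.lit 0)

abbrev setRvar (a : ℕ) (e : RExp) : Cmd := .rset a (.lit 0) e

@[simp] lemma Store.setNat_nat (s : Store) (a i x b j : ℕ) :
    (s.setNat a i x).nat b j = if b = a ∧ j = i then x else s.nat b j := by
  unfold Store.setNat
  by_cases h : b = a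
  · subst h
    by_cases h' : j = i
    · subst h'; simp
    · simp [h']
  · simp [h]

@[simp] lemma Store.setNat_real (s : Store) (a i x : ℕ) : (s.setNat a i x).real = s.real := rfl

@[simp] lemma Store.setReal_nat (s : Store) (a i : ℕ) (x : ℝ) : (s.setReal a i x).nat = s.nat := rfl

@[simp] lemma Store.setReal_real (s : Store) (a i : ℕ) (x : ℝ) (b j : ℕ) :
    (s.setReal a i x).real b j = if b = a ∧ j = i then x else s.real b j := by
  unfold Store.setReal
  by_cases h : b = a
  · subst h
    by_cases h' : j = i
    · subst h'; simp
    · simp [h']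
  · simp [h]

end Logic

/-! ### Ropes -/

/-- A binary tree that represents a sequence of weighted nodes. -/
inductive Rope where
  | leaf (p : ℕ) (w : ℝ)
  | node (l r : Rope)

namespace Rope

def leaves : Rope → ℕ
  | leaf _ _ => 1
  | node l r => l.leaves + r.leaves

noncomputable def wt : Rope → ℝ
  | leaf _ w => w
  | node l r => l.wt + r.wt

/-- The sequence; leaves without weight stand for no node. -/
noncomputable def toList : Rope → List (ℕ × ℝ)
  | leaf p w => if w ≤ 0 then [] else [(p, w)]
  | node l r => l.toList ++ r.toList

def Nonneg : Rope → Prop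
  | leaf _ w => 0 ≤ w
  | node l r => l.Nonneg ∧ r.Nonneg

lemma toList_node (l r : Rope) : (node l r).toList = l.toList ++ r.toList := rfl

lemma leaves_pos (t : Rope) : 0 < t.leaves := by
  induction t with
  | leaf => simp [leaves]
  | node l r h1 h2 => simp [leaves, h1]

lemma positive_toList (t : Rope) : Positive t.toList := by
  induction t with
  | leaf p w =>
    unfold toList
    split_ifs with h
    · simp [Positive]
    · intro x hx
      simp only [List.mem_singleton] at hx
      subst hx
      exact not_le.1 h
  | node l r h1 h2 => exact h1.append h2

lemma weight_toList {t : Rope} (h : t.Nonneg) : weight t.toList = t.wt := by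
  induction t with
  | leaf p w =>
    unfold toList
    split_ifs with h0
    · simp only [weight, lin_nil, wt]
      exact le_antisymm h h0
    · simp [weight, wt]
  | node l r h1 h2 =>
    have e1 := h1 h.1
    have e2 := h2 h.2
    simp only [weight] at e1 e2
    simp [toList, weight, wt, e1, e2]

lemma length_toList_le (t : Rope) : t.toList.length ≤ t.leaves := by
  induction t with
  | leaf p w => unfold toList; split_ifs <;> simp [leaves]
  | node l r h1 h2 => simp only [toList, leaves, List.length_append]; omega

/-- The path to the leaf that contains the position `t` of the sequence: the leaf, the position in
the leaf, and the subtrees that hang off the path on the left and on the right, from the bottom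
to the top. -/
noncomputable def descend : Rope → ℝ → (ℕ × ℝ × ℝ) × List Rope × List Rope
  | leaf p w, t => ((p, w, t), [], [])
  | node l r, t =>
    if t ≤ l.wt then ((l.descend t).1, (l.descend t).2.1, (l.descend t).2.2 ++ [r])
    else ((r.descend (t - l.wt)).1, (r.descend (t - l.wt)).2.1 ++ [l], (r.descend (t - l.wt)).2.2)

/-- A node with its children in either order. -/
def join (flip : Bool) (a b : Rope) : Rope := if flip then node b a else node a b

/-- Joins subtrees along a spine, two at a time. -/
def comb (flip : Bool) : Rope → List Rope → Rope
  | s, [] => s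
  | s, [x] => join flip x s
  | s, y :: x :: L => comb flip (join flip (join flip x y) s) L

/-- Splits a rope at position `t`. -/
noncomputable def split (r : Rope) (t : ℝ) : Rope × Rope :=
  (comb false (leaf (r.descend t).1.1 (r.descend t).1.2.2) (r.descend t).2.1,
    comb true (leaf (r.descend t).1.1 ((r.descend t).1.2.1 - (r.descend t).1.2.2))
      (r.descend t).2.2)

/-- The list runs from the bottom of the path to the top, so subtrees on the left appear in the
sequence in reverse order. -/
lemma comb_false_toList (s : Rope) (L : List Rope) :
    (comb false s L).toList = (L.reverse.map toList).flatten ++ s.toList := by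
  induction s, L using comb.induct false with
  | case1 s => simp [comb]
  | case2 s x => simp [comb, join, toList]
  | case3 s y x L ih =>
    rw [comb, ih]
    simp [join, toList]

lemma comb_true_toList (s : Rope) (L : List Rope) :
    (comb true s L).toList = s.toList ++ (L.map toList).flatten := by
  induction s, L using comb.induct true with
  | case1 s => simp [comb]
  | case2 s x => simp [comb, join, toList]
  | case3 s y x L ih =>
    rw [comb, ih]
    simp [join, toList]

lemma comb_nonneg (flip : Bool) (s : Rope) (L : List Rope) (hs : s.Nonneg)
    (hL : ∀ x ∈ L, x.Nonneg) : (comb flip s L).Nonneg := by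
  induction s, L using comb.induct flip with
  | case1 s => exact hs
  | case2 s x =>
    have := hL x (by simp)
    cases flip <;> simp [comb, join, Nonneg, hs, this]
  | case3 s y x L ih =>
    have h1 := hL x (by simp)
    have h2 := hL y (by simp)
    refine ih ?_ fun z hz => hL z (by simp [hz])
    cases flip <;> simp [join, Nonneg, hs, h1, h2]

lemma comb_leaves (flip : Bool) (s : Rope) (L : List Rope) :
    (comb flip s L).leaves = s.leaves + (L.map leaves).sum := by
  induction s, L using comb.induct flip with
  | case1 s => simp [comb]
  | case2 s x => cases flip <;> simp [comb, join, leaves]; omega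
  | case3 s y x L ih =>
    rw [comb, ih]
    cases flip <;> simp [join, leaves] <;> omega

lemma descend_nonneg {r : Rope} (hr : r.Nonneg) (t : ℝ) :
    (∀ x ∈ (r.descend t).2.1, x.Nonneg) ∧ ∀ x ∈ (r.descend t).2.2, x.Nonneg := by
  induction r generalizing t with
  | leaf p w => simp [descend]
  | node l r h1 h2 =>
    unfold descend
    split_ifs with h
    · refine ⟨(h1 hr.1 t).1, fun x hx => ?_⟩
      rcases List.mem_append.1 hx with hx | hx
      · exact (h1 hr.1 t).2 x hx
      · rw [List.mem_singleton.1 hx]; exact hr.2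
    · refine ⟨fun x hx => ?_, (h2 hr.2 _).2⟩
      rcases List.mem_append.1 hx with hx | hx
      · exact (h2 hr.2 _).1 x hx
      · rw [List.mem_singleton.1 hx]; exact hr.1

lemma descend_bounds {r : Rope} (hr : r.Nonneg) {t : ℝ} (h0 : 0 ≤ t) (h1 : t ≤ r.wt) :
    0 ≤ (r.descend t).1.2.2 ∧ (r.descend t).1.2.2 ≤ (r.descend t).1.2.1 := by
  induction r generalizing t with
  | leaf p w => exact ⟨h0, h1⟩
  | node l r ih1 ih2 =>
    unfold descend
    split_ifs with h
    · exact ih1 hr.1 h0 h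
    · simp only [wt] at h1
      exact ih2 hr.2 (by linarith) (by linarith)

/-- The leaves are the one at the end of the path and those of the subtrees hanging off it. -/
lemma descend_leaves (r : Rope) (t : ℝ) :
    1 + ((r.descend t).2.1.map leaves).sum + ((r.descend t).2.2.map leaves).sum = r.leaves := by
  induction r generalizing t with
  | leaf p w => simp [descend, leaves]
  | node l r ih1 ih2 =>
    unfold descend
    split_ifs with h
    · have := ih1 t
      simp [leaves]
      omega
    · have := ih2 (t - l.wt)
      simp [leaves]
      omega

end Rope

/-- A split either stays inside the first part or swallows it. Both forms hold at the boundary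
because nodes have positive weight. -/
lemma prefixSplit_append {α : Type*} {L₁ L₂ : List (α × ℝ)} (h1 : Positive L₁) (h2 : Positive L₂)
    {t : ℝ} :
    (t ≤ weight L₁ → prefixSplit (L₁ ++ L₂) t
      = ((prefixSplit L₁ t).1, (prefixSplit L₁ t).2 ++ L₂)) ∧
    (weight L₁ ≤ t → prefixSplit (L₁ ++ L₂) t
      = (L₁ ++ (prefixSplit L₂ (t - weight L₁)).1, (prefixSplit L₂ (t - weight L₁)).2)) := by
  induction L₁ generalizing t with
  | nil =>
    refine ⟨fun ht => ?_, fun _ => by simp⟩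
    simp only [weight, lin_nil] at ht
    cases L₂ with
    | nil => simp [prefixSplit]
    | cons x L =>
      obtain ⟨p, a⟩ := x
      have : 0 < a := h2 (p, a) (by simp)
      simp only [List.nil_append, prefixSplit]
      rw [if_neg (by linarith), if_neg (by linarith)]
  | cons x L ih =>
    obtain ⟨p, a⟩ := x
    have hL : Positive L := fun y hy => h1 y (by simp [hy])
    have h0 := hL.weight_nonneg
    simp only [weight] at ih h0
    simp only [weight, lin_cons, List.cons_append, prefixSplit, mul_one]
    constructor
    · intro ht
      split_ifs with h3 h4
      · rw [(ih hL).1 (by linarith)]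
      · rfl
      · rfl
    · intro ht
      rw [if_pos (by linarith), (ih hL).2 (by linarith)]
      simp [sub_sub]

namespace Rope

lemma prefixSplit_toList {r : Rope} (hr : r.Nonneg) {t : ℝ} (h0 : 0 ≤ t) (h1 : t ≤ r.wt) :
    prefixSplit r.toList t
      = ((((r.descend t).2.1.reverse.map toList).flatten
          ++ (leaf (r.descend t).1.1 (r.descend t).1.2.2).toList),
        (leaf (r.descend t).1.1 ((r.descend t).1.2.1 - (r.descend t).1.2.2)).toList
          ++ ((r.descend t).2.2.map toList).flatten) := by
  induction r generalizing t with
  | leaf p w =>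
    simp only [wt] at h1
    simp only [descend, toList, List.reverse_nil, List.map_nil, List.flatten_nil, List.nil_append,
      List.append_nil]
    -- A leaf of weight zero stands for no node, and neither does either half of it.
    by_cases hw : w ≤ 0
    · have : t = 0 := by linarith
      simp [hw, this, prefixSplit]
    · rw [if_neg hw]
      simp only [prefixSplit]
      by_cases hwt : w ≤ t
      · have : t = w := le_antisymm h1 hwt
        subst this
        simp [hw]
      · by_cases ht : t ≤ 0
        · have : t = 0 := le_antisymm ht h0
          subst this
          simp [hw]
        · have h2 : ¬ w - t ≤ 0 := by linarith
          simp [hwt, ht, not_le.1 ht, h2]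
  | node l r ih1 ih2 =>
    have e := weight_toList hr.1
    have key := prefixSplit_append l.positive_toList r.positive_toList (t := t)
    rw [e] at key
    simp only [wt] at h1
    unfold descend
    split_ifs with h
    · rw [toList_node, key.1 h, ih1 hr.1 h0 h]
      simp
    · rw [toList_node, key.2 (by linarith), ih2 hr.2 (by linarith) (by linarith)]
      simp

lemma split_toList {r : Rope} (hr : r.Nonneg) {t : ℝ} (h0 : 0 ≤ t) (h1 : t ≤ r.wt) :
    ((r.split t).1.toList, (r.split t).2.toList) = prefixSplit r.toList t := by
  rw [prefixSplit_toList hr h0 h1]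
  simp only [split, comb_false_toList, comb_true_toList]

lemma split_nonneg {r : Rope} (hr : r.Nonneg) {t : ℝ} (h0 : 0 ≤ t) (h1 : t ≤ r.wt) :
    (r.split t).1.Nonneg ∧ (r.split t).2.Nonneg := by
  have hb := descend_bounds hr h0 h1
  have hn := descend_nonneg hr t
  exact ⟨comb_nonneg _ _ _ hb.1 hn.1, comb_nonneg _ _ _ (sub_nonneg.2 hb.2) hn.2⟩

/-- Only the leaf at the cut is doubled; halves of weight zero are kept as leaves so that this count
is exact. -/
lemma split_leaves (r : Rope) (t : ℝ) :
    (r.split t).1.leaves + (r.split t).2.leaves = r.leaves + 1 := by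
  have := descend_leaves r t
  simp only [split, comb_leaves, leaves]
  omega

/-! ### Amortized analysis of splitting -/

/-- The potential of a rope. -/
noncomputable def pot (α γ : ℝ) : Rope → ℝ
  | leaf _ _ => 0
  | node l r => l.pot α γ + r.pot α γ + (α * Real.logb 2 (l.leaves + r.leaves) + γ)

/-- A lower bound for the potential of the nodes of a spine. -/
noncomputable def spine (α γ : ℝ) : ℝ → List Rope → ℝ
  | _, [] => 0
  | b, x :: L => α * Real.logb 2 (b + x.leaves) + γ + spine α γ (b + x.leaves) L

/-- The inequality `4 * x * y ≤ (x + y) ^ 2` in logarithmic form, the source of the gain in the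
analysis of splay trees. -/
lemma logb_add_logb_le {x y : ℝ} (hx : 0 < x) (hy : 0 < y) :
    Real.logb 2 x + Real.logb 2 y + 2 ≤ 2 * Real.logb 2 (x + y) := by
  have h4 : Real.logb 2 4 = 2 := by
    rw [Real.logb_eq_iff_rpow_eq (by norm_num) (by norm_num) (by norm_num)]
    norm_num
  have h1 : Real.logb 2 (x * y * 4) ≤ Real.logb 2 ((x + y) ^ 2) := by
    refine Real.logb_le_logb_of_le (by norm_num) (by positivity) ?_
    nlinarith [sq_nonneg (x - y)]
  rw [Real.logb_mul (by positivity) (by norm_num), Real.logb_mul hx.ne' hy.ne', h4,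
    Real.logb_pow] at h1
  push_cast at h1
  linarith

lemma logb_mono {x y : ℝ} (hx : 0 < x) (h : x ≤ y) : Real.logb 2 x ≤ Real.logb 2 y :=
  Real.logb_le_logb_of_le (by norm_num) hx h

lemma cast_leaves_pos (t : Rope) : (0 : ℝ) < t.leaves := by exact_mod_cast t.leaves_pos

lemma pot_join (α γ : ℝ) (flip : Bool) (a b : Rope) :
    (join flip a b).pot α γ
      = a.pot α γ + b.pot α γ + (α * Real.logb 2 (a.leaves + b.leaves) + γ) := by
  cases flip
  · simp [join, pot]
  · simp [join, pot, add_comm (b.leaves : ℝ), add_comm (b.pot α γ)]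

lemma leaves_join (flip : Bool) (a b : Rope) :
    (join flip a b).leaves = a.leaves + b.leaves := by
  cases flip <;> simp [join, leaves, add_comm]

lemma spine_append (α γ b : ℝ) (L : List Rope) (x : Rope) :
    spine α γ b (L ++ [x]) = spine α γ b L
      + (α * Real.logb 2 (b + ((L.map leaves).sum : ℕ) + x.leaves) + γ) := by
  induction L generalizing b with
  | nil => simp [spine]
  | cons y L ih =>
    simp only [List.cons_append, spine, ih, List.map_cons, List.sum_cons]
    push_cast
    ring_nf

/-- A node of the path has at least as many leaves as its hanging subtree, those below it on the
same side, and the final leaf together. So the potential of the path pays for the spines on both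
sides separately. -/
lemma descend_pot {α γ : ℝ} (hα : 0 ≤ α) (r : Rope) (t : ℝ) :
    ((r.descend t).2.1.map (pot α γ)).sum + ((r.descend t).2.2.map (pot α γ)).sum
      + spine α γ 1 (r.descend t).2.1 + spine α γ 1 (r.descend t).2.2 ≤ r.pot α γ := by
  induction r generalizing t with
  | leaf p w => simp [descend, spine, pot]
  | node l r ih1 ih2 =>
    unfold descend
    split_ifs with h
    · have h1 := ih1 t
      have h2 : (1 : ℝ) + (((l.descend t).2.2.map leaves).sum : ℕ) + r.leaves
          ≤ l.leaves + r.leaves := by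
        have := descend_leaves l t
        have : 1 + ((l.descend t).2.2.map leaves).sum + r.leaves ≤ l.leaves + r.leaves := by omega
        exact_mod_cast this
      have h3 := mul_le_mul_of_nonneg_left
        (logb_mono (by have := cast_leaves_pos r; positivity) h2) hα
      simp only [List.map_append, List.sum_append, List.map_cons, List.map_nil, List.sum_cons,
        List.sum_nil, spine_append, pot]
      linarith
    · have h1 := ih2 (t - l.wt)
      have h2 : (1 : ℝ) + (((r.descend (t - l.wt)).2.1.map leaves).sum : ℕ) + l.leaves
          ≤ l.leaves + r.leaves := by
        have := descend_leaves r (t - l.wt)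
        have : 1 + ((r.descend (t - l.wt)).2.1.map leaves).sum + l.leaves
          ≤ l.leaves + r.leaves := by omega
        exact_mod_cast this
      have h3 := mul_le_mul_of_nonneg_left
        (logb_mono (by have := cast_leaves_pos l; positivity) h2) hα
      simp only [List.map_append, List.sum_append, List.map_cons, List.map_nil, List.sum_cons,
        List.sum_nil, spine_append, pot]
      linarith

/-- Joining `x`, `y` and `s` replaces the ranks of `s + y` and `s + y + x` leaves by those of `x +
y` and `s + y + x`. By `logb_add_logb_le` each such round releases `2 * α` credits up to twice the
growth of the rank of `s`. These growths telescope; joining along the path one at a time would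
release nothing. -/
lemma comb_pot {α γ : ℝ} (hα : 0 ≤ α) (flip : Bool) (s : Rope) (L : List Rope) :
    (comb flip s L).pot α γ + α * (L.length - 1)
      ≤ s.pot α γ + (L.map (pot α γ)).sum + spine α γ s.leaves L
        + 2 * α * (Real.logb 2 (comb flip s L).leaves - Real.logb 2 s.leaves) := by
  induction s, L using comb.induct flip with
  | case1 s => simp [comb, spine, hα]
  | case2 s x =>
    have hs := cast_leaves_pos s
    have hx := cast_leaves_pos x
    have h1 : Real.logb 2 s.leaves ≤ Real.logb 2 (s.leaves + x.leaves) := logb_mono hs (by linarith)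
    have h2 := mul_le_mul_of_nonneg_left h1 hα
    simp only [comb, pot_join, leaves_join, spine, List.map_cons, List.map_nil, List.sum_cons,
      List.sum_nil, List.length_singleton]
    push_cast
    rw [add_comm (x.leaves : ℝ)]
    linarith
  | case3 s y x L ih =>
    have hs := cast_leaves_pos s
    have hx := cast_leaves_pos x
    have hy := cast_leaves_pos y
    rw [comb]
    simp only [pot_join, leaves_join] at ih
    simp only [spine, List.map_cons, List.sum_cons, List.length_cons]
    push_cast at ih ⊢
    have e : (x.leaves : ℝ) + y.leaves + s.leaves = s.leaves + y.leaves + x.leaves := by ring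
    rw [e] at ih
    have h1 := logb_add_logb_le (add_pos hx hy) hs
    rw [e] at h1
    have h2 : Real.logb 2 s.leaves ≤ Real.logb 2 (s.leaves + y.leaves) := logb_mono hs (by linarith)
    have h3 := mul_le_mul_of_nonneg_left h1 hα
    have h4 := mul_le_mul_of_nonneg_left h2 hα
    linarith

/-- The amortized cost of splitting is logarithmic. -/
lemma split_pot {α γ : ℝ} (hα : 0 ≤ α) (r : Rope) (t : ℝ) :
    (r.split t).1.pot α γ + (r.split t).2.pot α γ
        + α * ((r.descend t).2.1.length + (r.descend t).2.2.length)
      ≤ r.pot α γ + 2 * α + 4 * α * Real.logb 2 (r.leaves + 1) := by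
  have h1 := comb_pot (γ := γ) hα false
    (leaf (r.descend t).1.1 (r.descend t).1.2.2) (r.descend t).2.1
  have h2 := comb_pot (γ := γ) hα true
    (leaf (r.descend t).1.1 ((r.descend t).1.2.1 - (r.descend t).1.2.2)) (r.descend t).2.2
  have h3 := descend_pot (γ := γ) hα r t
  change (r.split t).1.pot α γ + _ ≤ _ + 2 * α * (Real.logb 2 (r.split t).1.leaves - _) at h1
  change (r.split t).2.pot α γ + _ ≤ _ + 2 * α * (Real.logb 2 (r.split t).2.leaves - _) at h2
  -- Both parts have at most `r.leaves + 1` leaves, so the two rank terms add up to four times `α`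
  -- times a logarithm.
  have h4 := split_leaves r t
  have h5 : ((r.split t).1.leaves : ℝ) ≤ r.leaves + 1 := by
    have : (r.split t).1.leaves ≤ r.leaves + 1 := by omega
    exact_mod_cast this
  have h6 : ((r.split t).2.leaves : ℝ) ≤ r.leaves + 1 := by
    have : (r.split t).2.leaves ≤ r.leaves + 1 := by omega
    exact_mod_cast this
  have h7 := mul_le_mul_of_nonneg_left (logb_mono (cast_leaves_pos _) h5) hα
  have h8 := mul_le_mul_of_nonneg_left (logb_mono (cast_leaves_pos _) h6) hα
  simp only [leaves, pot, Nat.cast_one, Real.logb_one] at h1 h2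
  linarith

end Rope

/-! ### Programs for ropes -/

section RopePrograms

@[simp] lemma wp_skip (Q : Store → ℝ → Prop) (s : Store) (b : ℝ) :
    Cmd.skip.wp Q s b = Q s (b - 1) := rfl

@[simp] lemma wp_nset (a : ℕ) (i e : NExp) (Q : Store → ℝ → Prop) (s : Store) (b : ℝ) :
    (Cmd.nset a i e).wp Q s b
      = Q (s.setNat a (i.eval s) (e.eval s)) (b - ((1 + i.cost + e.cost : ℕ) : ℝ)) := rfl

@[simp] lemma wp_rset (a : ℕ) (i : NExp) (e : RExp) (Q : Store → ℝ → Prop) (s : Store) (b : ℝ) :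
    (Cmd.rset a i e).wp Q s b
      = Q (s.setReal a (i.eval s) (e.eval s)) (b - ((1 + i.cost + e.cost : ℕ) : ℝ)) := rfl

@[simp] lemma wp_seq (x y : Cmd) (Q : Store → ℝ → Prop) (s : Store) (b : ℝ) :
    (Cmd.seq x y).wp Q s b = x.wp (y.wp Q) s b := rfl

@[simp] lemma wp_ite (c : BExp) (x y : Cmd) (Q : Store → ℝ → Prop) (s : Store) (b : ℝ) :
    (Cmd.ite c x y).wp Q s b = ((c.holds s → x.wp Q s (b - ((1 + c.cost : ℕ) : ℝ))) ∧
      (¬ c.holds s → y.wp Q s (b - ((1 + c.cost : ℕ) : ℝ)))) := rfl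

attribute [simp] block NExp.eval RExp.eval BExp.holds NExp.cost RExp.cost BExp.cost

/-- The memories agree on the nodes of ropes below `N`. -/
def Agree (s s' : Store) (N : ℕ) : Prop :=
  ∀ i < N, s'.nat 18 i = s.nat 18 i ∧ s'.nat 19 i = s.nat 19 i ∧ s'.nat 20 i = s.nat 20 i ∧
    s'.real 3 i = s.real 3 i

lemma Agree.trans {s s' s'' : Store} {N N' : ℕ} (h : Agree s s' N) (h' : Agree s' s'' N')
    (hN : N ≤ N') : Agree s s'' N := by
  intro i hi
  obtain ⟨a1, a2, a3, a4⟩ := h i hi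
  obtain ⟨b1, b2, b3, b4⟩ := h' i (hi.trans_le hN)
  exact ⟨b1.trans a1, b2.trans a2, b3.trans a3, b4.trans a4⟩

/-- The rope is stored at the address `i`, with all its nodes below `N`. Array `18` holds the left
children, shifted by one, arrays `19` and `20` the right children and the points of the leaves,
and real array `3` the weights. -/
def Rope.At (s : Store) (N : ℕ) : Rope → ℕ → Prop
  | .leaf p w, i => i < N ∧ s.nat 18 i = 0 ∧ s.nat 20 i = p ∧ s.real 3 i = w
  | .node l r, i => i < N ∧ (∃ j, s.nat 18 i = j + 1 ∧ l.At s N j) ∧ r.At s N (s.nat 19 i) ∧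
      s.real 3 i = l.wt + r.wt

lemma Rope.At.wt_eq {s : Store} {N : ℕ} {t : Rope} {i : ℕ} (h : t.At s N i) :
    s.real 3 i = t.wt := by
  cases t
  exacts [h.2.2.2, h.2.2.2]

/-- Ropes are persistent: allocation only writes at the next free address, so ropes may share
subtrees, and old ones survive whatever is built later. -/
lemma Rope.At.mono {s s' : Store} {N N' : ℕ} {t : Rope} {i : ℕ} (h : t.At s N i)
    (ha : Agree s s' N) (hN : N ≤ N') : t.At s' N' i := by
  induction t generalizing i with
  | leaf p w =>
    obtain ⟨h1, h2, h3, h4⟩ := h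
    obtain ⟨a1, a2, a3, a4⟩ := ha i h1
    exact ⟨h1.trans_le hN, a1.trans h2, a3.trans h3, a4.trans h4⟩
  | node l r ih1 ih2 =>
    obtain ⟨h1, ⟨j, h2, h3⟩, h4, h5⟩ := h
    obtain ⟨a1, a2, a3, a4⟩ := ha i h1
    exact ⟨h1.trans_le hN, ⟨j, a1.trans h2, ih1 h3⟩, a2 ▸ ih2 h4, a4.trans h5⟩

/-- A stack of ropes, from top to bottom. -/
def StackAt (s : Store) (N : ℕ) (st : ℕ → ℕ) : List Rope → Prop
  | [] => True
  | t :: L => t.At s N (st L.length) ∧ StackAt s N st L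

lemma StackAt.mono {s s' : Store} {N N' : ℕ} {st st' : ℕ → ℕ} {L : List Rope}
    (h : StackAt s N st L) (ha : Agree s s' N) (hN : N ≤ N')
    (hst : ∀ i < L.length, st' i = st i) : StackAt s' N' st' L := by
  induction L with
  | nil => trivial
  | cons t L ih =>
    refine ⟨?_, ih h.2 fun i hi => hst i (by simp; omega)⟩
    rw [hst _ (by simp)]
    exact h.1.mono ha hN

/-- Stores the join of the ropes at the addresses in `46` and `47`, and returns its address in
`48`. The next free address is in `40`. -/
def mkNode : Cmd := block [
  .nset 18 (var 40) (.add (var 46) (.lit 1)),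
  .nset 19 (var 40) (var 47),
  .rset 3 (var 40) (.add (.get 3 (var 46)) (.get 3 (var 47))),
  setVar 48 (var 40),
  setVar 40 (.add (var 40) (.lit 1))]

/-- Stores a leaf for the point in `46` whose weight is in `8`. -/
def mkLeaf : Cmd := block [
  .nset 18 (var 40) (.lit 0),
  .nset 20 (var 40) (var 46),
  .rset 3 (var 40) (rvar 8),
  setVar 48 (var 40),
  setVar 40 (.add (var 40) (.lit 1))]

lemma mkNode_wp {s : Store} {b : ℝ} {N : ℕ} {t₁ t₂ : Rope} (hN : s.nat 40 0 = N)
    (h1 : t₁.At s N (s.nat 46 0)) (h2 : t₂.At s N (s.nat 47 0)) :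
    mkNode.wp (fun s' b' => s'.nat 40 0 = N + 1 ∧ s'.nat 48 0 = N ∧
      (Rope.node t₁ t₂).At s' (N + 1) N ∧ Agree s s' N ∧ b - 40 ≤ b') s b := by
  simp [mkNode, hN]
  have ha : ∀ s' : Store, (s'.nat 18 N = s.nat 46 0 + 1) → (s'.nat 19 N = s.nat 47 0) →
      (s'.real 3 N = s.real 3 (s.nat 46 0) + s.real 3 (s.nat 47 0)) → Agree s s' N →
      (Rope.node t₁ t₂).At s' (N + 1) N ∧ Agree s s' N := by
    intro s' e1 e2 e3 e4
    refine ⟨⟨by omega, ⟨_, e1, h1.mono e4 (by omega)⟩, e2 ▸ h2.mono e4 (by omega), ?_⟩, e4⟩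
    rw [e3, h1.wt_eq, h2.wt_eq]
  rw [← and_assoc]
  refine ⟨ha _ ?_ ?_ ?_ ?_, ?_⟩
  · simp
  · simp
  · simp
  · intro i hi
    simp [hi.ne]
  · linarith

lemma mkLeaf_wp {s : Store} {b : ℝ} {N : ℕ} (hN : s.nat 40 0 = N) :
    mkLeaf.wp (fun s' b' => s'.nat 40 0 = N + 1 ∧ s'.nat 48 0 = N ∧
      (Rope.leaf (s.nat 46 0) (s.real 8 0)).At s' (N + 1) N ∧ Agree s s' N ∧ b - 40 ≤ b') s b := by
  simp [mkLeaf, hN]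
  refine ⟨by simp [Rope.At], fun i hi => by simp [hi.ne], by linarith⟩

@[simp] lemma Store.setNat_nat_of_ne (s : Store) {a b : ℕ} (h : b ≠ a) (i x : ℕ) :
    (s.setNat a i x).nat b = s.nat b := by
  funext j
  simp [h]

@[simp] lemma Store.setReal_real_of_ne (s : Store) {a b : ℕ} (h : b ≠ a) (i : ℕ) (x : ℝ) :
    (s.setReal a i x).real b = s.real b := by
  funext j
  simp [h]

lemma Agree.of_eq {s s' : Store} (h1 : s'.nat 18 = s.nat 18) (h2 : s'.nat 19 = s.nat 19)
    (h3 : s'.nat 20 = s.nat 20) (h4 : s'.real 3 = s.real 3) (N : ℕ) : Agree s s' N :=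
  fun i _ => ⟨by rw [h1], by rw [h2], by rw [h3], by rw [h4]⟩

/-- Walks from the node `41` to the position in real variable `6`, and puts the subtrees to the left
and to the right of the path on the stacks in arrays `22` and `23`. -/
def descendLoop : Cmd :=
  .loop (.nle (.lit 1) (.get 18 (var 41)))
    (.ite (.rle (rvar 6) (.get 3 (.sub (.get 18 (var 41)) (.lit 1))))
      (block [.nset 23 (var 43) (.get 19 (var 41)), setVar 43 (.add (var 43) (.lit 1)),
        setVar 41 (.sub (.get 18 (var 41)) (.lit 1))])
      (block [setRvar 6 (.sub (rvar 6) (.get 3 (.sub (.get 18 (var 41)) (.lit 1)))),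
        .nset 22 (var 42) (.sub (.get 18 (var 41)) (.lit 1)),
        setVar 42 (.add (var 42) (.lit 1)), setVar 41 (.get 19 (var 41))]))

lemma descendLoop_wp {s : Store} {b : ℝ} {N : ℕ} {t : Rope} {τ : ℝ} (ht : t.At s N (s.nat 41 0))
    (hτ : s.real 6 0 = τ) (h42 : s.nat 42 0 = 0) (h43 : s.nat 43 0 = 0)
    (hb : 60 * (((t.descend τ).2.1.length + (t.descend τ).2.2.length : ℕ) : ℝ) + 10 ≤ b) :
    descendLoop.wp (fun s' b' =>
      (Rope.leaf (t.descend τ).1.1 (t.descend τ).1.2.1).At s' N (s'.nat 41 0) ∧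
      s'.real 6 0 = (t.descend τ).1.2.2 ∧
      s'.nat 42 0 = (t.descend τ).2.1.length ∧ s'.nat 43 0 = (t.descend τ).2.2.length ∧
      StackAt s' N (s'.nat 22) (t.descend τ).2.1 ∧ StackAt s' N (s'.nat 23) (t.descend τ).2.2 ∧
      b - 60 * (((t.descend τ).2.1.length + (t.descend τ).2.2.length : ℕ) : ℝ) - 10 ≤ b') s b := by
  -- The descent that remains from the current node, followed by the stacks filled so far, is the
  -- whole descent. The invariant is introduced as an opaque predicate so that simplification does
  -- not unfold it.
  obtain ⟨Inv, hInv⟩ : ∃ Inv : Store → ℝ → Prop, ∀ s' b', Inv s' b' ↔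
    ∃ (r : Rope) (σ : ℝ) (A B : List Rope),
    (t.descend τ).1 = (r.descend σ).1 ∧ (t.descend τ).2.1 = (r.descend σ).2.1 ++ A ∧
    (t.descend τ).2.2 = (r.descend σ).2.2 ++ B ∧ r.At s' N (s'.nat 41 0) ∧ s'.real 6 0 = σ ∧
    s'.nat 42 0 = A.length ∧ s'.nat 43 0 = B.length ∧ StackAt s' N (s'.nat 22) A ∧
    StackAt s' N (s'.nat 23) B ∧
    60 * (((r.descend σ).2.1.length + (r.descend σ).2.2.length : ℕ) : ℝ) + 10 ≤ b' ∧
    b - 60 * ((A.length + B.length : ℕ) : ℝ) ≤ b' := ⟨_, fun _ _ => Iff.rfl⟩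
  refine Cmd.wp_loop Inv ((hInv _ _).2
    ⟨t, τ, [], [], rfl, by simp, by simp, ht, hτ, h42, h43, trivial, trivial, hb, by simp⟩) ?_ ?_ ?_
  · intro s' b' hI
    obtain ⟨r, σ, A, B, -, -, -, -, -, -, -, -, -, h, -⟩ := (hInv _ _).1 hI
    exact le_trans (by positivity) h
  · rintro s' b' - hI hc
    obtain ⟨r, σ, A, B, h1, h2, h3, h4, h5, h6, h7, h8, h9, h10, h11⟩ := (hInv _ _).1 hI
    cases r with
    | leaf p w =>
      simp [h4.2.1] at hc
    | node l r =>
      obtain ⟨-, ⟨j, h12, hl⟩, hr, -⟩ := h4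
      have hw := hl.wt_eq
      have ag : ∀ s'' : Store, s''.nat 18 = s'.nat 18 → s''.nat 19 = s'.nat 19 →
        s''.nat 20 = s'.nat 20 → s''.real 3 = s'.real 3 → Agree s' s'' N :=
        fun s'' e1 e2 e3 e4 => Agree.of_eq e1 e2 e3 e4 N
      simp only [Rope.descend] at h1 h2 h3 h10
      simp [h12, h5, hw]
      constructor
      · intro hσ
        simp only [if_pos hσ] at h1 h2 h3 h10
        refine (hInv _ _).2 ⟨l, σ, A, r :: B, h1, h2, by simp [h3], ?_, by simpa using h5,
          by simpa using h6, by simp [h7], ?_, ⟨?_, ?_⟩, ?_, ?_⟩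
        · simpa using hl.mono (ag _ (by simp) (by simp) (by simp) (by simp)) le_rfl
        · simpa using h8.mono (ag _ (by simp) (by simp) (by simp) (by simp)) le_rfl
            (fun _ _ => rfl)
        · simpa [h7] using hr.mono (ag _ (by simp) (by simp) (by simp) (by simp)) le_rfl
        · refine h9.mono (ag _ (by simp) (by simp) (by simp) (by simp)) le_rfl fun i hi => ?_
          simp [h7, hi.ne]
        · simp only [List.length_append, List.length_singleton] at h10
          push_cast at h10 ⊢
          linarith
        · simp only [List.length_cons]
          push_cast at h11 ⊢
          linarith
      · intro hσ
        simp only [if_neg (not_le.2 hσ)] at h1 h2 h3 h10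
        refine (hInv _ _).2 ⟨r, σ - l.wt, l :: A, B, h1, by simp [h2], h3, ?_, by simp,
          by simp [h6], by simpa using h7, ⟨?_, ?_⟩, ?_, ?_, ?_⟩
        · simpa using hr.mono (ag _ (by simp) (by simp) (by simp) (by simp)) le_rfl
        · simpa [h6] using hl.mono (ag _ (by simp) (by simp) (by simp) (by simp)) le_rfl
        · refine h8.mono (ag _ (by simp) (by simp) (by simp) (by simp)) le_rfl fun i hi => ?_
          simp [h6, hi.ne]
        · simpa using h9.mono (ag _ (by simp) (by simp) (by simp) (by simp)) le_rfl
            (fun _ _ => rfl)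
        · simp only [List.length_append, List.length_singleton] at h10
          push_cast at h10 ⊢
          linarith
        · simp only [List.length_cons]
          push_cast at h11 ⊢
          linarith
  · rintro s' b' - hI hc
    obtain ⟨r, σ, A, B, h1, h2, h3, h4, h5, h6, h7, h8, h9, h10, h11⟩ := (hInv _ _).1 hI
    cases r with
    | node l r =>
      obtain ⟨-, ⟨j, h12, hl⟩, hr, -⟩ := h4
      simp [h12] at hc
    | leaf p w =>
      simp only [Rope.descend, List.nil_append] at h1 h2 h3
      rw [h1, h2, h3]
      refine ⟨h4, h5, h6, h7, h8, h9, ?_⟩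
      simp
      push_cast at h11
      linarith

/-- Joins the ropes at two addresses, in either order. -/
def joinCmd (flip : Bool) (x y : NExp) : Cmd := block [
  setVar 46 (if flip then y else x), setVar 47 (if flip then x else y), mkNode]

/-- Joins the rope in `44` or `45` with those on the stack. -/
def combCmd (flip : Bool) : Cmd := block [
  .loop (.nle (.lit 2) (var (if flip then 43 else 42))) (block [
    joinCmd flip (.get (if flip then 23 else 22) (.sub (var (if flip then 43 else 42)) (.lit 2)))
      (.get (if flip then 23 else 22) (.sub (var (if flip then 43 else 42)) (.lit 1))),
    joinCmd flip (var 48) (var (if flip then 45 else 44)),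
    setVar (if flip then 45 else 44) (var 48),
    setVar (if flip then 43 else 42) (.sub (var (if flip then 43 else 42)) (.lit 2))]),
  .ite (.nle (.lit 1) (var (if flip then 43 else 42)))
    (block [joinCmd flip (.get (if flip then 23 else 22) (.lit 0)) (var (if flip then 45 else 44)),
      setVar (if flip then 45 else 44) (var 48)])
    .skip]

/-- The second operand is evaluated after array `46` has been written, hence the assumptions `hx`
and `hy` for the two orders. -/
lemma joinCmd_wp {flip : Bool} {s : Store} {b : ℝ} {N : ℕ} {t₁ t₂ : Rope} {x y : NExp}
    (hN : s.nat 40 0 = N) (h1 : t₁.At s N (x.eval s)) (h2 : t₂.At s N (y.eval s))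
    (hx : ∀ v, x.eval (s.setNat 46 0 v) = x.eval s) (hy : ∀ v, y.eval (s.setNat 46 0 v) = y.eval s)
    (hcx : x.cost ≤ 6) (hcy : y.cost ≤ 6) :
    (joinCmd flip x y).wp (fun s' b' => s'.nat 40 0 = N + 1 ∧ s'.nat 48 0 = N ∧
      (Rope.join flip t₁ t₂).At s' (N + 1) N ∧ Agree s s' N ∧ b - 60 ≤ b') s b := by
  have hcx' : (x.cost : ℝ) ≤ 6 := by exact_mod_cast hcx
  have hcy' : (y.cost : ℝ) ≤ 6 := by exact_mod_cast hcy
  have ag : ∀ u v, Agree s ((s.setNat 46 0 u).setNat 47 0 v) N := fun u v =>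
    Agree.of_eq (by simp) (by simp) (by simp) (by simp) N
  cases flip
  · simp only [joinCmd, block, wp_seq, wp_nset]
    refine Cmd.wp_conseq (mkNode_wp (N := N) (t₁ := t₁) (t₂ := t₂) (by simpa using hN) ?_ ?_) ?_
    · simpa using h1.mono (ag _ _) le_rfl
    · simpa [hy] using h2.mono (ag _ _) le_rfl
    · rintro s' b' - ⟨e1, e2, e3, e4, e5⟩
      refine ⟨e1, e2, e3, (ag _ _).trans e4 le_rfl, ?_⟩
      simp at e5
      linarith
  · simp only [joinCmd, block, wp_seq, wp_nset]
    refine Cmd.wp_conseq (mkNode_wp (N := N) (t₁ := t₂) (t₂ := t₁) (by simpa using hN) ?_ ?_) ?_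
    · simpa using h2.mono (ag _ _) le_rfl
    · simpa [hx] using h1.mono (ag _ _) le_rfl
    · rintro s' b' - ⟨e1, e2, e3, e4, e5⟩
      refine ⟨e1, e2, e3, (ag _ _).trans e4 le_rfl, ?_⟩
      simp at e5
      linarith

lemma combCmd_wp {flip : Bool} {s : Store} {b : ℝ} {N : ℕ} {r : Rope} {L : List Rope}
    (hN : s.nat 40 0 = N) (hr : r.At s N (s.nat (if flip then 45 else 44) 0))
    (hc : s.nat (if flip then 43 else 42) 0 = L.length)
    (hL : StackAt s N (s.nat (if flip then 23 else 22)) L)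
    (hb : 100 * (L.length : ℝ) + 100 ≤ b) :
    (combCmd flip).wp (fun s' b' => ∃ N', N ≤ N' ∧ s'.nat 40 0 = N' ∧
      (Rope.comb flip r L).At s' N' (s'.nat (if flip then 45 else 44) 0) ∧ Agree s s' N ∧
      b - 100 * (L.length : ℝ) - 100 ≤ b') s b := by
  -- The loop follows the recursion of `Rope.comb`: the rope built and the stack left always combine
  -- to the same result.
  obtain ⟨Inv, hInv⟩ : ∃ Inv : Store → ℝ → Prop, ∀ s' b', Inv s' b' ↔
    ∃ (N' : ℕ) (r' : Rope) (L' : List Rope), Rope.comb flip r' L' = Rope.comb flip r L ∧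
    N ≤ N' ∧ s'.nat 40 0 = N' ∧ r'.At s' N' (s'.nat (if flip then 45 else 44) 0) ∧
    s'.nat (if flip then 43 else 42) 0 = L'.length ∧
    StackAt s' N' (s'.nat (if flip then 23 else 22)) L' ∧ Agree s s' N ∧
    b - 100 * (L.length : ℝ) + 100 * (L'.length : ℝ) ≤ b' := ⟨_, fun _ _ => Iff.rfl⟩
  unfold combCmd
  simp only [block, wp_seq]
  refine Cmd.wp_loop Inv ((hInv _ _).2 ⟨N, r, L, rfl, le_rfl, hN, hr, hc, hL,
    Agree.of_eq rfl rfl rfl rfl N, by simp⟩) ?_ ?_ ?_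
  · intro s' b' hI
    obtain ⟨N', r', L', -, -, -, -, -, -, -, h⟩ := (hInv _ _).1 hI
    have : (0 : ℝ) ≤ L'.length := Nat.cast_nonneg _
    linarith
  · rintro s' b' - hI hcond
    obtain ⟨N', r', L', h1, h2, h3, h4, h5, h6, h7, h8⟩ := (hInv _ _).1 hI
    simp only [BExp.holds, NExp.eval, h5] at hcond
    obtain ⟨y, x, L'', rfl⟩ : ∃ y x L'', L' = y :: x :: L'' := by
      match L', hcond with
      | y :: x :: L'', _ => exact ⟨y, x, L'', rfl⟩
    obtain ⟨hy, hx, hL''⟩ := h6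
    simp only [wp_seq]
    refine Cmd.wp_conseq (joinCmd_wp (t₁ := x) (t₂ := y) h3 ?_ ?_ ?_ ?_ ?_ ?_) ?_
    · simpa [h5] using hx
    · simpa [h5] using hy
    · intro v; cases flip <;> simp
    · intro v; cases flip <;> simp
    · simp
    · simp
    rintro s₁ b₁ so ⟨e1, e2, e3, e4, e5⟩
    have o44 : s₁.nat 44 = s'.nat 44 := by cases flip <;> exact so.nat 44 rfl
    have o45 : s₁.nat 45 = s'.nat 45 := by cases flip <;> exact so.nat 45 rfl
    have o42 : s₁.nat 42 = s'.nat 42 := by cases flip <;> exact so.nat 42 rfl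
    have o43 : s₁.nat 43 = s'.nat 43 := by cases flip <;> exact so.nat 43 rfl
    have o22 : s₁.nat 22 = s'.nat 22 := by cases flip <;> exact so.nat 22 rfl
    have o23 : s₁.nat 23 = s'.nat 23 := by cases flip <;> exact so.nat 23 rfl
    rw [wp_seq]
    refine Cmd.wp_conseq (joinCmd_wp (t₁ := Rope.join flip x y) (t₂ := r') e1 ?_ ?_ ?_ ?_ ?_ ?_) ?_
    · simpa [e2] using e3
    · have := h4.mono e4 (Nat.le_succ N')
      cases flip <;> simpa [o44, o45] using this
    · intro v; cases flip <;> simp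
    · intro v; cases flip <;> simp
    · simp
    · simp
    rintro s₂ b₂ so' ⟨f1, f2, f3, f4, f5⟩
    have p42 : s₂.nat 42 = s'.nat 42 := by rw [← o42]; cases flip <;> exact so'.nat 42 rfl
    have p43 : s₂.nat 43 = s'.nat 43 := by rw [← o43]; cases flip <;> exact so'.nat 43 rfl
    have p22 : s₂.nat 22 = s'.nat 22 := by rw [← o22]; cases flip <;> exact so'.nat 22 rfl
    have p23 : s₂.nat 23 = s'.nat 23 := by rw [← o23]; cases flip <;> exact so'.nat 23 rfl
    have g : ∀ s₃ : Store, s₃.nat 18 = s₂.nat 18 → s₃.nat 19 = s₂.nat 19 →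
        s₃.nat 20 = s₂.nat 20 → s₃.real 3 = s₂.real 3 → Agree s₂ s₃ (N' + 1 + 1) :=
      fun s'' e1 e2 e3 e4 => Agree.of_eq e1 e2 e3 e4 _
    have hag := e4.trans f4 (Nat.le_succ N')
    cases flip
    · simp only [Bool.false_eq_true, if_false] at h4 h5 hL'' hInv f3 h8 ⊢
      simp [p42, h5]
      refine (hInv _ _).2 ⟨N' + 1 + 1, _, L'', h1, by omega, by simpa using f1, ?_, by simp, ?_,
        ?_, ?_⟩
      · simpa [f2] using f3.mono (g _ (by simp) (by simp) (by simp) (by simp)) le_rfl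
      · refine (hL''.mono hag (N' := N' + 1 + 1) (by omega) (st' := s₂.nat 22) fun i _ => by
          rw [p22]).mono (g _ (by simp) (by simp) (by simp) (by simp)) le_rfl fun i _ => by simp
      · exact (h7.trans hag h2).trans (g _ (by simp) (by simp) (by simp) (by simp)) (by omega)
      · simp at e5 f5 h8
        linarith
    · simp only [if_true] at h4 h5 hL'' hInv f3 h8 ⊢
      simp [p43, h5]
      refine (hInv _ _).2 ⟨N' + 1 + 1, _, L'', h1, by omega, by simpa using f1, ?_, by simp, ?_,
        ?_, ?_⟩
      · simpa [f2] using f3.mono (g _ (by simp) (by simp) (by simp) (by simp)) le_rfl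
      · refine (hL''.mono hag (N' := N' + 1 + 1) (by omega) (st' := s₂.nat 23) fun i _ => by
          rw [p23]).mono (g _ (by simp) (by simp) (by simp) (by simp)) le_rfl fun i _ => by simp
      · exact (h7.trans hag h2).trans (g _ (by simp) (by simp) (by simp) (by simp)) (by omega)
      · simp at e5 f5 h8
        linarith
  · rintro s' b' - hI hcond
    obtain ⟨N', r', L', h1, h2, h3, h4, h5, h6, h7, h8⟩ := (hInv _ _).1 hI
    simp only [BExp.holds, NExp.eval, h5, not_le] at hcond
    simp only [wp_ite, wp_seq, BExp.holds, NExp.eval, h5]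
    match L', hcond with
    | [], _ =>
      refine ⟨fun h => by simp at h, fun _ => ⟨N', h2, h3, by rw [← h1]; exact h4, h7, ?_⟩⟩
      simp at h8 ⊢
      linarith
    | [x], _ =>
      refine ⟨fun _ => ?_, fun h => by simp at h⟩
      refine Cmd.wp_conseq (joinCmd_wp (t₁ := x) (t₂ := r') h3 ?_ ?_ ?_ ?_ ?_ ?_) ?_
      · simpa using h6.1
      · simpa using h4
      · intro v; cases flip <;> simp
      · intro v; cases flip <;> simp
      · simp
      · simp
      rintro s₁ b₁ so ⟨e1, e2, e3, e4, e5⟩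
      have g : ∀ s₃ : Store, s₃.nat 18 = s₁.nat 18 → s₃.nat 19 = s₁.nat 19 →
          s₃.nat 20 = s₁.nat 20 → s₃.real 3 = s₁.real 3 → Agree s₁ s₃ (N' + 1) :=
        fun s'' e1 e2 e3 e4 => Agree.of_eq e1 e2 e3 e4 _
      have h1' : Rope.comb flip r L = Rope.join flip x r' := by rw [← h1]; rfl
      rw [h1']
      cases flip
      · simp only [Bool.false_eq_true, if_false] at e3 e5 h8 ⊢
        refine ⟨N' + 1, by omega, by simpa using e1, ?_, ?_, ?_⟩
        · simpa [e2] using e3.mono (g _ (by simp) (by simp) (by simp) (by simp)) le_rfl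
        · exact (h7.trans e4 h2).trans (g _ (by simp) (by simp) (by simp) (by simp)) (by omega)
        · simp at e5 h8 ⊢
          linarith
      · simp only [if_true] at e3 e5 h8 ⊢
        refine ⟨N' + 1, by omega, by simpa using e1, ?_, ?_, ?_⟩
        · simpa [e2] using e3.mono (g _ (by simp) (by simp) (by simp) (by simp)) le_rfl
        · exact (h7.trans e4 h2).trans (g _ (by simp) (by simp) (by simp) (by simp)) (by omega)
        · simp at e5 h8 ⊢
          linarith

end RopePrograms

/-! ### Forests of ropes -/

section Forests

/-- Array `21` holds the addresses of the roots of `M` ropes. -/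
def Forest (s : Store) (M : ℕ) (tr : ℕ → Rope) : Prop :=
  ∀ i < M, (tr i).At s (s.nat 40 0) (s.nat 21 i) ∧ (tr i).Nonneg

/-- The credits stored in a forest. -/
noncomputable def forestPot (M : ℕ) (tr : ℕ → Rope) : ℝ := ∑ i ∈ range M, (tr i).pot 160 2000

def forestLeaves (M : ℕ) (tr : ℕ → Rope) : ℕ := ∑ i ∈ range M, (tr i).leaves

lemma Rope.pot_nonneg (t : Rope) : 0 ≤ t.pot 160 2000 := by
  induction t with
  | leaf => exact le_rfl
  | node l r h1 h2 =>
    have h3 : 0 ≤ Real.logb 2 ((l.leaves : ℝ) + r.leaves) := by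
      have e1 : (1 : ℝ) ≤ l.leaves := by exact_mod_cast l.leaves_pos
      have e2 : (1 : ℝ) ≤ r.leaves := by exact_mod_cast r.leaves_pos
      exact Real.logb_nonneg (by norm_num) (by linarith)
    simp only [pot]
    linarith

/-- The constant share of the potential at every inner node, one fewer than there are leaves,
prepays flattening and pairing of the leaves. -/
lemma Rope.leaves_le_pot (t : Rope) : 2000 * (t.leaves : ℝ) ≤ t.pot 160 2000 + 2000 := by
  induction t with
  | leaf => simp [leaves, pot]
  | node l r h1 h2 =>
    have h3 : 0 ≤ Real.logb 2 ((l.leaves : ℝ) + r.leaves) := by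
      have e1 : (1 : ℝ) ≤ l.leaves := by exact_mod_cast l.leaves_pos
      have e2 : (1 : ℝ) ≤ r.leaves := by exact_mod_cast r.leaves_pos
      exact Real.logb_nonneg (by norm_num) (by linarith)
    simp only [pot, leaves]
    push_cast
    linarith

lemma forestPot_nonneg (M : ℕ) (tr : ℕ → Rope) : 0 ≤ forestPot M tr :=
  sum_nonneg fun i _ => (tr i).pot_nonneg

lemma forestPot_update {M : ℕ} {tr : ℕ → Rope} {i : ℕ} (hi : i < M) (t : Rope) :
    forestPot M (Function.update tr i t) = forestPot M tr + t.pot 160 2000 - (tr i).pot 160 2000 := by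
  unfold forestPot
  rw [← add_sum_erase _ _ (mem_range.2 hi), ← add_sum_erase _ _ (mem_range.2 hi)]
  rw [sum_congr rfl fun j hj => by rw [Function.update_of_ne (ne_of_mem_erase hj)]]
  simp
  ring

lemma forestLeaves_update {M : ℕ} {tr : ℕ → Rope} {i : ℕ} (hi : i < M) (t : Rope) :
    forestLeaves M (Function.update tr i t) + (tr i).leaves = forestLeaves M tr + t.leaves := by
  unfold forestLeaves
  rw [← add_sum_erase _ _ (mem_range.2 hi), ← add_sum_erase _ _ (mem_range.2 hi)]
  rw [sum_congr rfl fun j hj => by rw [Function.update_of_ne (ne_of_mem_erase hj)]]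
  simp
  ring

lemma leaves_le_forestLeaves {M : ℕ} {tr : ℕ → Rope} {i : ℕ} (hi : i < M) :
    (tr i).leaves ≤ forestLeaves M tr :=
  single_le_sum (f := fun i => (tr i).leaves) (fun _ _ => Nat.zero_le _) (mem_range.2 hi)

lemma leaves_add_leaves_le {M : ℕ} {tr : ℕ → Rope} {i j : ℕ} (hi : i < M) (hj : j < M)
    (hne : i ≠ j) : (tr i).leaves + (tr j).leaves ≤ forestLeaves M tr := by
  unfold forestLeaves
  rw [← add_sum_erase _ _ (mem_range.2 hi)]
  exact Nat.add_le_add_left (single_le_sum (f := fun i => (tr i).leaves) (fun _ _ => Nat.zero_le _)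
    (mem_erase.2 ⟨hne.symm, mem_range.2 hj⟩)) _

/-- The forest after the first part of the rope in `src`, up to the position `t`, has been put in
front of the rope in `dst`. -/
noncomputable def moved (tr : ℕ → Rope) (src dst : ℕ) (t : ℝ) : ℕ → Rope :=
  Function.update (Function.update tr src ((tr src).split t).2) dst
    (.node ((tr src).split t).1 (tr dst))

lemma forestLeaves_moved {M : ℕ} {tr : ℕ → Rope} {src dst : ℕ} (h1 : src < M) (h2 : dst < M)
    (hne : src ≠ dst) (t : ℝ) : forestLeaves M (moved tr src dst t) = forestLeaves M tr + 1 := by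
  have e1 := forestLeaves_update (tr := tr) h1 ((tr src).split t).2
  have e2 := forestLeaves_update (tr := Function.update tr src ((tr src).split t).2) h2
    (.node ((tr src).split t).1 (tr dst))
  have e3 := Rope.split_leaves (tr src) t
  rw [Function.update_of_ne hne.symm] at e2
  simp only [Rope.leaves] at e2
  unfold moved
  omega

/-- Of the `800 * lam`, four parts of `160 * lam` come from the split and one is the rank of the new
root; `2320` is `2 * 160` from the split plus the constant share of that root. -/
lemma forestPot_moved {M : ℕ} {tr : ℕ → Rope} {src dst : ℕ} (h1 : src < M) (h2 : dst < M)
    (hne : src ≠ dst) (t : ℝ) {lam : ℝ} {Nmax : ℕ} (hN : forestLeaves M tr + 1 ≤ Nmax)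
    (hlam : Real.logb 2 Nmax ≤ lam) :
    forestPot M (moved tr src dst t) + 160 * ((((tr src).descend t).2.1.length
      + ((tr src).descend t).2.2.length : ℕ) : ℝ) ≤ forestPot M tr + 2320 + 800 * lam := by
  have e0 := Rope.split_pot (α := 160) (γ := 2000) (by norm_num) (tr src) t
  have e3 := Rope.split_leaves (tr src) t
  have e4 := leaves_le_forestLeaves (tr := tr) h1
  have e5 := leaves_add_leaves_le (tr := tr) h1 h2 hne
  have e6 := ((tr src).split t).2.leaves_pos
  have l1 : Real.logb 2 ((tr src).leaves + 1) ≤ lam := by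
    refine le_trans (Rope.logb_mono (by positivity) ?_) hlam
    have : (tr src).leaves + 1 ≤ Nmax := by omega
    exact_mod_cast this
  have l2 : Real.logb 2 (((tr src).split t).1.leaves + (tr dst).leaves) ≤ lam := by
    refine le_trans (Rope.logb_mono (add_pos (Rope.cast_leaves_pos _) (Rope.cast_leaves_pos _)) ?_) hlam
    have : ((tr src).split t).1.leaves + (tr dst).leaves ≤ Nmax := by omega
    exact_mod_cast this
  unfold moved
  rw [forestPot_update h2, forestPot_update h1, Function.update_of_ne hne.symm]
  simp only [Rope.pot]
  push_cast
  linarith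

lemma Forest.of_eq {s s' : Store} {M : ℕ} {tr : ℕ → Rope} (h : Forest s M tr)
    (h18 : s'.nat 18 = s.nat 18) (h19 : s'.nat 19 = s.nat 19) (h20 : s'.nat 20 = s.nat 20)
    (h21 : s'.nat 21 = s.nat 21) (h40 : s'.nat 40 = s.nat 40) (h3 : s'.real 3 = s.real 3) :
    Forest s' M tr := by
  intro i hi
  rw [h40, h21]
  exact ⟨(h i hi).1.mono (.of_eq h18 h19 h20 h3 _) le_rfl, (h i hi).2⟩

/-- Puts the first part of the rope in slot `49`, whose weight is in real variable `6`, in front of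
the rope in slot `50`. -/
def moveCmd : Cmd := block [
  setVar 41 (.get 21 (var 49)), setVar 42 (.lit 0), setVar 43 (.lit 0), descendLoop,
  setVar 46 (.get 20 (var 41)), setRvar 8 (rvar 6), mkLeaf, setVar 44 (var 48),
  setRvar 8 (.sub (.get 3 (var 41)) (rvar 6)), mkLeaf, setVar 45 (var 48),
  combCmd false, combCmd true,
  .nset 21 (var 49) (var 45), setVar 46 (var 44), setVar 47 (.get 21 (var 50)), mkNode,
  .nset 21 (var 50) (var 48)]

/-- Each node on the path costs `60` in the descent and `100` in recombination. The sum `160` is the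
coefficient `α` in the potential of forests. -/
lemma moveCmd_wp {s : Store} {b : ℝ} {M : ℕ} {tr : ℕ → Rope} {src dst : ℕ} {t : ℝ}
    (hF : Forest s M tr) (hs : s.nat 49 0 = src) (hd : s.nat 50 0 = dst) (hsM : src < M)
    (hdM : dst < M) (hne : src ≠ dst) (ht : s.real 6 0 = t) (h0 : 0 ≤ t) (h1 : t ≤ (tr src).wt)
    (hb : 160 * ((((tr src).descend t).2.1.length + ((tr src).descend t).2.2.length : ℕ) : ℝ)
      + 600 ≤ b) :
    moveCmd.wp (fun s' b' => Forest s' M (moved tr src dst t) ∧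
      b - 160 * ((((tr src).descend t).2.1.length + ((tr src).descend t).2.2.length : ℕ) : ℝ)
        - 600 ≤ b') s b := by
  obtain ⟨hsplit1, hsplit2⟩ := Rope.split_nonneg (hF src hsM).2 h0 h1
  unfold moved
  simp only [moveCmd, block, wp_seq, wp_nset]
  set D := (tr src).descend t with hD
  push_cast at hb ⊢
  refine Cmd.wp_conseq (descendLoop_wp (t := tr src) (τ := t) (N := s.nat 40 0) ?_ ?_ ?_ ?_ ?_) ?_
  · simpa [hs] using (hF src hsM).1.mono (.of_eq (by simp) (by simp) (by simp) (by simp) _) le_rfl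
  · simpa using ht
  · simp
  · simp
  · push_cast
    simp
    linarith
  rw [← hD]
  rintro s₁ b₁ so₁ ⟨a1, a2, a3, a4, a5, a6, a7⟩
  have p40 : s₁.nat 40 = s.nat 40 := (so₁.nat 40 rfl).trans (by simp)
  have p21 : s₁.nat 21 = s.nat 21 := (so₁.nat 21 rfl).trans (by simp)
  have p49 : s₁.nat 49 = s.nat 49 := (so₁.nat 49 rfl).trans (by simp)
  have p50 : s₁.nat 50 = s.nat 50 := (so₁.nat 50 rfl).trans (by simp)
  have pF : Forest s₁ M tr := hF.of_eq ((so₁.nat 18 rfl).trans (by simp))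
    ((so₁.nat 19 rfl).trans (by simp)) ((so₁.nat 20 rfl).trans (by simp)) p21 p40
    ((so₁.real 3 rfl).trans (by simp))
  set N := s.nat 40 0 with hNdef
  have hN1 : s₁.nat 40 0 = N := by rw [p40]
  obtain ⟨c0, -, c1, c2⟩ := a1

  clear_value N
  simp only [wp_seq, wp_nset, wp_rset]
  refine Cmd.wp_conseq (mkLeaf_wp (N := N) (by simpa using hN1)) ?_
  rintro s₂ b₂ so₂ ⟨d1, d2, d3, d4, d5⟩
  replace d4 : Agree s₁ s₂ N :=
    (Agree.of_eq (by simp) (by simp) (by simp) (by simp) N).trans d4 le_rfl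
  simp [c1, a2] at d3
  have q41 : s₂.nat 41 = s₁.nat 41 := (so₂.nat 41 rfl).trans (by simp)
  have q46 : s₂.nat 46 0 = D.1.1 := by rw [so₂.nat 46 rfl]; simp [c1]
  have q3 : s₂.real 3 (s₁.nat 41 0) = D.1.2.1 := by
    rw [← c2]; exact (d4 _ c0).2.2.2
  have q6 : s₂.real 6 0 = D.1.2.2 := by rw [so₂.real 6 rfl]; simp [a2]
  simp only [wp_seq, wp_nset, wp_rset]
  refine Cmd.wp_conseq (mkLeaf_wp (N := N + 1) (by simpa using d1)) ?_
  rintro s₃ b₃ so₃ ⟨e1, e2, e3, e4, e5⟩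
  replace e4 : Agree s₂ s₃ (N + 1) :=
    (Agree.of_eq (by simp) (by simp) (by simp) (by simp) _).trans e4 le_rfl
  simp [q46, q41, q3, q6] at e3
  have e44 : s₃.nat 44 0 = N := by rw [so₃.nat 44 rfl]; simp [d2]
  replace d3 := d3.mono e4 (Nat.le_succ _)
  have ag13 := d4.trans e4 (Nat.le_succ _)
  have r22 : s₃.nat 22 = s₁.nat 22 :=
    (so₃.nat 22 rfl).trans ((by simp : _ = s₂.nat 22).trans ((so₂.nat 22 rfl).trans (by simp)))
  have r23 : s₃.nat 23 = s₁.nat 23 :=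
    (so₃.nat 23 rfl).trans ((by simp : _ = s₂.nat 23).trans ((so₂.nat 23 rfl).trans (by simp)))
  have r42 : s₃.nat 42 = s₁.nat 42 :=
    (so₃.nat 42 rfl).trans ((by simp : _ = s₂.nat 42).trans ((so₂.nat 42 rfl).trans (by simp)))
  have r43 : s₃.nat 43 = s₁.nat 43 :=
    (so₃.nat 43 rfl).trans ((by simp : _ = s₂.nat 43).trans ((so₂.nat 43 rfl).trans (by simp)))
  have r21 : s₃.nat 21 = s₁.nat 21 :=
    (so₃.nat 21 rfl).trans ((by simp : _ = s₂.nat 21).trans ((so₂.nat 21 rfl).trans (by simp)))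
  have r49 : s₃.nat 49 = s₁.nat 49 :=
    (so₃.nat 49 rfl).trans ((by simp : _ = s₂.nat 49).trans ((so₂.nat 49 rfl).trans (by simp)))
  have r50 : s₃.nat 50 = s₁.nat 50 :=
    (so₃.nat 50 rfl).trans ((by simp : _ = s₂.nat 50).trans ((so₂.nat 50 rfl).trans (by simp)))
  replace a5 : StackAt s₃ (N + 2) (s₃.nat 22) D.2.1 := a5.mono ag13 (by omega) (by simp [r22])
  replace a6 : StackAt s₃ (N + 2) (s₃.nat 23) D.2.2 := a6.mono ag13 (by omega) (by simp [r23])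
  simp only [wp_seq, wp_nset]
  have agx : Agree s₃ (s₃.setNat 45 0 (s₃.nat 48 0)) (N + 1 + 1) :=
    Agree.of_eq (by simp) (by simp) (by simp) (by simp) _
  simp at a7 d5 e5
  have l1 : (0 : ℝ) ≤ D.2.1.length := Nat.cast_nonneg _
  have l2 : (0 : ℝ) ≤ D.2.2.length := Nat.cast_nonneg _
  refine Cmd.wp_conseq (combCmd_wp (flip := false) (N := N + 2) (L := D.2.1) (by simpa using e1)
    (by simpa [e44] using d3.mono agx le_rfl) (by simp [r42, a3])
    (by simpa using a5.mono agx le_rfl (fun _ _ => rfl)) ?_) ?_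
  · simp
    linarith
  rintro s₄ b₄ so₄ ⟨N₄, f1, f2, f3, f4, f5⟩
  replace f4 : Agree s₃ s₄ (N + 2) := agx.trans f4 le_rfl
  simp only [Bool.false_eq_true, if_false] at f3
  have t45 : s₄.nat 45 0 = N + 1 := by rw [so₄.nat 45 rfl]; simp [e2]
  simp only [wp_seq]
  refine Cmd.wp_conseq (combCmd_wp (flip := true) (N := N₄) (L := D.2.2) f2
    (by simpa [t45] using e3.mono f4 f1) (by simp [so₄.nat 43 rfl, r43, a4])
    (by refine a6.mono f4 f1 fun i _ => ?_
        simp [so₄.nat 23 rfl]) ?_) ?_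
  · simp at f5
    linarith
  rintro s₅ b₅ so₅ ⟨N₅, g1, g2, g3, g4, g5⟩
  simp only [if_true] at g3
  have u44 : s₅.nat 44 = s₄.nat 44 := so₅.nat 44 rfl
  have v21 : s₅.nat 21 = s.nat 21 := by
    rw [so₅.nat 21 rfl, so₄.nat 21 rfl, Store.setNat_nat_of_ne _ (by decide), r21, p21]
  have v49 : s₅.nat 49 0 = src := by
    rw [so₅.nat 49 rfl, so₄.nat 49 rfl, Store.setNat_nat_of_ne _ (by decide), r49, p49, hs]
  have v50 : s₅.nat 50 0 = dst := by
    rw [so₅.nat 50 rfl, so₄.nat 50 rfl, Store.setNat_nat_of_ne _ (by decide), r50, p50, hd]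
  have ag : Agree s₁ s₅ N := (ag13.trans f4 (by omega)).trans g4 (by omega)
  -- All old ropes are still intact, including the source, whose subtrees are now shared by the two
  -- parts.
  have old : ∀ i < M, (tr i).At s₅ N₅ (s.nat 21 i) := fun i hi => by
    have := (pF i hi).1
    rw [hN1, p21] at this
    exact this.mono ag (by omega)
  have hS : ((tr src).split t).1.At s₅ N₅ (s₄.nat 44 0) := f3.mono g4 g1
  simp only [wp_seq, wp_nset]
  have agy : ∀ x y z w, Agree s₅ (((s₅.setNat 21 x y).setNat 46 0 z).setNat 47 0 w) N₅ :=
    fun x y z w => Agree.of_eq (by simp) (by simp) (by simp) (by simp) _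
  refine Cmd.wp_conseq (mkNode_wp (N := N₅) (t₁ := ((tr src).split t).1) (t₂ := tr dst)
    (by simpa using g2) ?_ ?_) ?_
  · simpa [u44] using hS.mono (agy _ _ _ _) le_rfl
  · simpa [v49, v50, hne.symm, v21] using (old dst hdM).mono (agy _ _ _ _) le_rfl
  rintro s₆ b₆ so₆ ⟨k1, k2, k3, k4, k5⟩
  replace k4 := (agy _ _ _ _).trans k4 le_rfl
  have w21 : ∀ i, s₆.nat 21 i = if i = src then s₅.nat 45 0 else s.nat 21 i := by
    intro i
    rw [so₆.nat 21 rfl]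
    simp [v49, v21]
  have w50 : s₆.nat 50 0 = dst := by rw [so₆.nat 50 rfl]; simp [v50]
  simp only [wp_nset]
  have agz : ∀ x y, Agree s₆ (s₆.setNat 21 x y) (N₅ + 1) :=
    fun x y => Agree.of_eq (by simp) (by simp) (by simp) (by simp) _
  refine ⟨fun i hi => ?_, ?_⟩
  · simp only [NExp.eval, w50, k2, Store.setNat_nat, k1, w21]
    norm_num
    by_cases hi2 : i = dst
    · subst hi2
      simp only [Function.update_self, if_true]
      exact ⟨k3.mono (agz _ _) le_rfl, hsplit1, (hF i hi).2⟩
    · rw [if_neg hi2, Function.update_of_ne hi2]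
      by_cases hi1 : i = src
      · subst hi1
        simp only [Function.update_self, if_true]
        exact ⟨(g3.mono k4 (Nat.le_succ _)).mono (agz _ _) le_rfl, hsplit2⟩
      · rw [if_neg hi1, Function.update_of_ne hi1]
        exact ⟨((old i hi).mono k4 (Nat.le_succ _)).mono (agz _ _) le_rfl, (hF i hi).2⟩
  · simp at f5 g5 k5 ⊢
    linarith

/-- Moving with amortized accounting. -/
lemma moveCmd_amortized {s : Store} {b : ℝ} {M : ℕ} {tr : ℕ → Rope} {src dst : ℕ} {t : ℝ}
    (hF : Forest s M tr) (hs : s.nat 49 0 = src) (hd : s.nat 50 0 = dst) (hsM : src < M)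
    (hdM : dst < M) (hne : src ≠ dst) (ht : s.real 6 0 = t) (h0 : 0 ≤ t) (h1 : t ≤ (tr src).wt)
    {lam R : ℝ} {Nmax : ℕ} (hN : forestLeaves M tr + 1 ≤ Nmax) (hlam : Real.logb 2 Nmax ≤ lam)
    (hR : 0 ≤ R) (hb : forestPot M tr + (3000 + 800 * lam) + R ≤ b) :
    moveCmd.wp (fun s' b' => Forest s' M (moved tr src dst t) ∧
      forestPot M (moved tr src dst t) + R ≤ b') s b := by
  have h2 := forestPot_moved hsM hdM hne t hN hlam
  have h3 := forestPot_nonneg M (moved tr src dst t)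
  refine Cmd.wp_conseq (moveCmd_wp hF hs hd hsM hdM hne ht h0 h1 (by linarith)) ?_
  rintro s' b' - ⟨h4, h5⟩
  exact ⟨h4, by linarith⟩

end Forests

/-! ### Leaves and sequences -/

section Leaves

/-- Puts a leaf for the point in `46` with the weight in real variable `8` in front of the rope in
slot `49`. -/
def pushLeaf : Cmd := block [
  mkLeaf, setVar 46 (var 48), setVar 47 (.get 21 (var 49)), mkNode, .nset 21 (var 49) (var 48)]

lemma pushLeaf_wp {s : Store} {b : ℝ} {M : ℕ} {tr : ℕ → Rope} {i p : ℕ} {w : ℝ}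
    (hF : Forest s M tr) (hi : s.nat 49 0 = i) (hiM : i < M) (hp : s.nat 46 0 = p)
    (hw : s.real 8 0 = w) (h0 : 0 ≤ w) :
    pushLeaf.wp (fun s' b' => Forest s' M (Function.update tr i (.node (.leaf p w) (tr i))) ∧
      b - 200 ≤ b') s b := by
  simp only [pushLeaf, block, wp_seq]
  refine Cmd.wp_conseq (mkLeaf_wp rfl) ?_
  rintro s₁ b₁ so₁ ⟨a1, a2, a3, a4, a5⟩
  rw [hp, hw] at a3
  have p21 : s₁.nat 21 = s.nat 21 := so₁.nat 21 rfl
  have p49 : s₁.nat 49 = s.nat 49 := so₁.nat 49 rfl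
  set N := s.nat 40 0 with hN
  clear_value N
  simp only [wp_seq, wp_nset]
  have agy : ∀ x y, Agree s₁ ((s₁.setNat 46 0 x).setNat 47 0 y) (N + 1) :=
    fun x y => Agree.of_eq (by simp) (by simp) (by simp) (by simp) _
  have hold : ∀ j < M, (tr j).At s₁ (N + 1) (s.nat 21 j) := fun j hj => by
    have := (hF j hj).1
    rw [← hN] at this
    exact this.mono a4 (Nat.le_succ _)
  refine Cmd.wp_conseq (mkNode_wp (N := N + 1) (t₁ := .leaf p w) (t₂ := tr i) (by simpa using a1)
    ?_ ?_) ?_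
  · simpa [a2] using a3.mono (agy _ _) le_rfl
  · simpa [p49, hi, p21] using (hold i hiM).mono (agy _ _) le_rfl
  rintro s₂ b₂ so₂ ⟨k1, k2, k3, k4, k5⟩
  replace k4 := (agy _ _).trans k4 le_rfl
  have q21 : s₂.nat 21 = s.nat 21 := by rw [so₂.nat 21 rfl]; simp [p21]
  have q49 : s₂.nat 49 0 = i := by rw [so₂.nat 49 rfl]; simp [p49, hi]
  have agz : ∀ x y, Agree s₂ (s₂.setNat 21 x y) (N + 1 + 1) :=
    fun x y => Agree.of_eq (by simp) (by simp) (by simp) (by simp) _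
  simp only [wp_nset]
  refine ⟨fun j hj => ?_, ?_⟩
  · simp only [NExp.eval, q49, k2, Store.setNat_nat, k1, q21]
    norm_num
    by_cases hji : j = i
    · subst hji
      simp only [Function.update_self, if_true]
      exact ⟨k3.mono (agz _ _) le_rfl, h0, (hF j hj).2⟩
    · rw [if_neg hji, Function.update_of_ne hji]
      exact ⟨((hold j hj).mono k4 (Nat.le_succ _)).mono (agz _ _) le_rfl, (hF j hj).2⟩
  · simp at k5 ⊢
    linarith

/-- The first entries of a pair of arrays. -/
def arr₂ (a : ℕ → ℕ) (r : ℕ → ℝ) (c : ℕ) : List (ℕ × ℝ) := (List.range c).map fun i => (a i, r i)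

lemma arr₂_succ (a : ℕ → ℕ) (r : ℕ → ℝ) (c : ℕ) :
    arr₂ a r (c + 1) = arr₂ a r c ++ [(a c, r c)] := by
  simp [arr₂, List.range_succ]

lemma arr₂_congr {a a' : ℕ → ℕ} {r r' : ℕ → ℝ} {c : ℕ} (h : ∀ i < c, a' i = a i)
    (h' : ∀ i < c, r' i = r i) : arr₂ a' r' c = arr₂ a r c := by
  refine List.map_congr_left fun i hi => ?_
  rw [h i (List.mem_range.1 hi), h' i (List.mem_range.1 hi)]

/-- Writes the sequence of the rope at the address in `46` to the arrays `a` and `r`. -/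
def flattenCmd (a r cv : ℕ) : Cmd := block [
  .nset 24 (.lit 0) (var 46), setVar 51 (.lit 1), setVar cv (.lit 0),
  .loop (.nle (.lit 1) (var 51)) (block [
    setVar 51 (.sub (var 51) (.lit 1)), setVar 41 (.get 24 (var 51)),
    .ite (.nle (.lit 1) (.get 18 (var 41)))
      (block [.nset 24 (var 51) (.get 19 (var 41)),
        .nset 24 (.add (var 51) (.lit 1)) (.sub (.get 18 (var 41)) (.lit 1)),
        setVar 51 (.add (var 51) (.lit 2))])
      (.ite (.rle (.get 3 (var 41)) .zero) .skip
        (block [.nset a (var cv) (.get 20 (var 41)), .rset r (var cv) (.get 3 (var 41)),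
          setVar cv (.add (var cv) (.lit 1))]))])]

/-- A stack replaces recursion. The two admissible triples of arrays are fixed, which makes it
decidable that the writes do not interfere. -/
lemma flattenCmd_wp {a r cv : ℕ} (hacv : a = 25 ∧ r = 4 ∧ cv = 52 ∨ a = 26 ∧ r = 5 ∧ cv = 53)
    {s : Store} {b : ℝ} {N : ℕ} {t : Rope} (ht : t.At s N (s.nat 46 0))
    (hb : 200 * (t.leaves : ℝ) + 100 ≤ b) :
    (flattenCmd a r cv).wp (fun s' b' => arr₂ (s'.nat a) (s'.real r) (s'.nat cv 0) = t.toList ∧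
      b - 200 * (t.leaves : ℝ) - 100 ≤ b') s b := by
  -- A stacked rope holds `200 * leaves - 100` credits. Replacing an inner node by its children, or
  -- removing a leaf, releases `100`, enough for one iteration.
  obtain ⟨Inv, hInv⟩ : ∃ Inv : Store → ℝ → Prop, ∀ s' b', Inv s' b' ↔
    ∃ st : List Rope, StackAt s' N (s'.nat 24) st ∧ s'.nat 51 0 = st.length ∧
      arr₂ (s'.nat a) (s'.real r) (s'.nat cv 0) ++ (st.map Rope.toList).flatten = t.toList ∧
      b - 200 * (t.leaves : ℝ) - 50 + (st.map fun x => 200 * (x.leaves : ℝ) - 100).sum ≤ b' :=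
    ⟨_, fun _ _ => Iff.rfl⟩
  have hsum : ∀ st : List Rope, 0 ≤ (st.map fun x => 200 * (x.leaves : ℝ) - 100).sum := by
    intro st
    refine List.sum_nonneg fun x hx => ?_
    obtain ⟨y, -, rfl⟩ := List.mem_map.1 hx
    have : (1 : ℝ) ≤ y.leaves := by exact_mod_cast y.leaves_pos
    linarith
  simp only [flattenCmd, block, wp_seq, wp_nset]
  refine Cmd.wp_loop Inv ((hInv _ _).2 ⟨[t], ⟨?_, trivial⟩, ?_, ?_, ?_⟩) ?_ ?_ ?_
  · rcases hacv with ⟨rfl, rfl, rfl⟩ | ⟨rfl, rfl, rfl⟩ <;>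
    simpa using ht.mono (.of_eq (by simp) (by simp) (by simp) (by simp) _) le_rfl
  · rcases hacv with ⟨rfl, rfl, rfl⟩ | ⟨rfl, rfl, rfl⟩ <;> simp
  · rcases hacv with ⟨rfl, rfl, rfl⟩ | ⟨rfl, rfl, rfl⟩ <;> simp [arr₂]
  · simp
    linarith
  · intro s' b' hI
    obtain ⟨st, -, -, -, h⟩ := (hInv _ _).1 hI
    have := hsum st
    linarith
  · rintro s' b' - hI hc
    obtain ⟨st, h1, h2, h3, h4⟩ := (hInv _ _).1 hI
    have hsN := hsum
    cases st with
    | nil => simp [h2] at hc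
    | cons x st =>
      obtain ⟨hx, hst⟩ := h1
      simp only [List.length_cons] at h2
      simp only [List.map_cons, List.flatten_cons, List.sum_cons] at h3 h4
      cases x with
      | leaf p w =>
        obtain ⟨-, x1, x2, x3⟩ := hx
        simp only [wp_seq, wp_nset, wp_ite, wp_skip, wp_rset]
        rcases hacv with ⟨rfl, rfl, rfl⟩ | ⟨rfl, rfl, rfl⟩
        all_goals
          simp [h2, x1, x2, x3]
          simp only [Rope.leaves] at h4
          push_cast at h4
          constructor
          · intro hw
            refine (hInv _ _).2 ⟨st, hst.mono (.of_eq (by simp) (by simp) (by simp) (by simp) _)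
              le_rfl (by simp), by simp, ?_, by linarith⟩
            simpa [Rope.toList, hw] using h3
          · intro hw
            refine (hInv _ _).2 ⟨st, hst.mono (.of_eq (by simp) (by simp) (by simp) (by simp) _)
              le_rfl (by simp), by simp, ?_, by linarith⟩
            rw [Rope.toList, if_neg (not_le.2 hw)] at h3
            simp [arr₂_succ]
            rw [← h3]
            simp
            exact arr₂_congr (fun i hi => by simp [hi.ne]) (fun i hi => by simp [hi.ne])
      | node u v =>
        obtain ⟨-, ⟨j, x1, hu⟩, hv, -⟩ := hx
        simp only [wp_seq, wp_nset, wp_ite, wp_skip, wp_rset]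
        rcases hacv with ⟨rfl, rfl, rfl⟩ | ⟨rfl, rfl, rfl⟩
        all_goals
          simp [h2, x1]
          simp only [Rope.leaves] at h4
          push_cast at h4
          refine (hInv _ _).2 ⟨u :: v :: st, ⟨?_, ?_, ?_⟩, by simp, ?_, ?_⟩
          · simpa using hu.mono (.of_eq (by simp) (by simp) (by simp) (by simp) _) le_rfl
          · simpa using hv.mono (.of_eq (by simp) (by simp) (by simp) (by simp) _) le_rfl
          · refine hst.mono (.of_eq (by simp) (by simp) (by simp) (by simp) _) le_rfl fun i hi => ?_
            simp [hi.ne, (Nat.lt_succ_of_lt hi).ne]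
          · simpa [Rope.toList] using h3
          · simp only [List.map_cons, List.sum_cons]
            linarith
  · rintro s' b' - hI hc
    obtain ⟨st, h1, h2, h3, h4⟩ := (hInv _ _).1 hI
    cases st with
    | cons x st => simp [h2] at hc
    | nil =>
      simp at h3 h4 ⊢
      exact ⟨h3, by linarith⟩

end Leaves

/-! ### The flow matrix -/

section FlowMatrix

/-- The entry of the flow matrix. Array `10` holds the offsets of its rows. -/
def Store.entry (s : Store) (x y : ℕ) : ℝ := s.real 2 (s.nat 10 x + y)

abbrev entryExp (x y : NExp) : RExp := .get 2 (.add (.get 10 x) y)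

/-- The offsets of the rows of a matrix with `W` rows and columns. -/
def Offsets (s : Store) (W : ℕ) : Prop := ∀ i < W, s.nat 10 i = i * W

/-- Different pairs have different addresses. The machine cannot multiply integers, so row offsets
are tabulated and addresses formed by addition. -/
lemma Offsets.index_eq {s : Store} {W x y x' y' : ℕ} (h : Offsets s W) (hx : x < W) (hx' : x' < W)
    (hy : y < W) (hy' : y' < W) : s.nat 10 x + y = s.nat 10 x' + y' ↔ x = x' ∧ y = y' := by
  rw [h x hx, h x' hx']
  constructor
  · intro e
    have h1 : (x * W + y) / W = x := by
      rw [mul_comm, Nat.mul_add_div (by omega), Nat.div_eq_of_lt hy, add_zero]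
    have h2 : (x' * W + y') / W = x' := by
      rw [mul_comm, Nat.mul_add_div (by omega), Nat.div_eq_of_lt hy', add_zero]
    have : x = x' := by rw [← h1, e, h2]
    subst this
    exact ⟨rfl, by omega⟩
  · rintro ⟨rfl, rfl⟩
    rfl

/-- Increases the flow from the vertex in `55` to that in `56` by the value of real variable `7`. -/
def addEdge : Cmd := block [
  .rset 2 (.add (.get 10 (var 55)) (var 56)) (.add (entryExp (var 55) (var 56)) (rvar 7)),
  .rset 2 (.add (.get 10 (var 56)) (var 55)) (.sub (entryExp (var 56) (var 55)) (rvar 7))]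

lemma addEdge_wp {s : Store} {b : ℝ} {W x y : ℕ} {δ : ℝ} (hW : Offsets s W) (hx : s.nat 55 0 = x)
    (hy : s.nat 56 0 = y) (hδ : s.real 7 0 = δ) (hxW : x < W) (hyW : y < W) :
    addEdge.wp (fun s' b' => (∀ u < W, ∀ v < W, s'.entry u v
      = s.entry u v + (if u = x ∧ v = y then δ else 0) - (if u = y ∧ v = x then δ else 0)) ∧
      b - 40 ≤ b') s b := by
  simp only [addEdge, block, wp_seq, wp_rset]
  refine ⟨fun u hu v hv => ?_, by simp; linarith⟩
  simp [Store.entry, hx, hy, hδ, hW.index_eq hu hxW hv hyW, hW.index_eq hu hyW hv hxW,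
    hW.index_eq hyW hxW hxW hyW]
  by_cases h1 : u = x ∧ v = y
  · by_cases h2 : u = y ∧ v = x
    · have e : y = x := by rw [← h1.2, h2.2]
      simp [h1, e]
    · rw [if_neg h2, if_pos h1, if_pos h1, if_neg h2, h1.1, h1.2]
      ring
  · by_cases h2 : u = y ∧ v = x
    · have h3 : ¬ (y = x ∧ x = y) := by
        rintro ⟨e, -⟩
        exact h1 ⟨h2.1.trans e, h2.2.trans e.symm⟩
      rw [if_pos h2, if_neg h1, if_pos h2, if_neg h3, h2.1, h2.2]
      ring
    · simp [h1, h2]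

end FlowMatrix

/-! ### Linked lists and arrays -/

section Lists

/-- The first entries of an array. -/
def arr (a : ℕ → ℕ) (c : ℕ) : List ℕ := (List.range c).map a

lemma arr_succ (a : ℕ → ℕ) (c : ℕ) : arr a (c + 1) = arr a c ++ [a c] := by
  simp [arr, List.range_succ]

lemma arr_congr {a a' : ℕ → ℕ} {c : ℕ} (h : ∀ i < c, a' i = a i) : arr a' c = arr a c :=
  List.map_congr_left fun i hi => h i (List.mem_range.1 hi)

@[simp] lemma length_arr (a : ℕ → ℕ) (c : ℕ) : (arr a c).length = c := by simp [arr]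

lemma mem_arr {a : ℕ → ℕ} {c x : ℕ} : x ∈ arr a c ↔ ∃ i < c, a i = x := by simp [arr]

/-- The linked list with head `h`; links are shifted by one. -/
def Chain (nx : ℕ → ℕ) : ℕ → List ℕ → Prop
  | h, [] => h = 0
  | h, x :: L => h = x + 1 ∧ Chain nx (nx x) L

lemma Chain.congr {nx nx' : ℕ → ℕ} {h : ℕ} {L : List ℕ} (hc : Chain nx h L)
    (he : ∀ x ∈ L, nx' x = nx x) : Chain nx' h L := by
  induction L generalizing h with
  | nil => exact hc
  | cons x L ih =>
    refine ⟨hc.1, ?_⟩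
    rw [he x (by simp)]
    exact ih hc.2 fun y hy => he y (by simp [hy])

/-- The indices below `i` with key `κ`, in decreasing order. -/
def bucket (key : ℕ → ℕ) (i κ : ℕ) : List ℕ := ((List.range i).filter fun j => key j = κ).reverse

lemma mem_bucket {key : ℕ → ℕ} {i κ j : ℕ} : j ∈ bucket key i κ ↔ j < i ∧ key j = κ := by
  simp [bucket]

lemma bucket_succ (key : ℕ → ℕ) (i κ : ℕ) :
    bucket key (i + 1) κ = if key i = κ then i :: bucket key i κ else bucket key i κ := by
  unfold bucket
  rw [List.range_succ, List.filter_append]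
  split_ifs with h <;> simp [h]

/-- Distributes the indices below the number in entry `j` of array `0` to linked lists according to
their keys in array `ka`. The heads of the lists are in array `ha`, the links in array `na`. -/
def bucketCmd (j ka ha na : ℕ) : Cmd := block [
  setVar 60 (.lit 0),
  .loop (.nle (.add (var 60) (.lit 1)) (.get 0 (.lit j))) (block [
    .nset na (var 60) (.get ha (.get ka (var 60))),
    .nset ha (.get ka (var 60)) (.add (var 60) (.lit 1)),
    setVar 60 (.add (var 60) (.lit 1))])]

/-- New indices go to the front of their list, hence the decreasing order. Indices are stored
shifted by one, so the zero memory is a family of empty lists. -/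
lemma bucketCmd_wp {j ka ha na : ℕ}
    (hj : ka = 1 ∧ ha = 11 ∧ na = 12 ∨ ka = 2 ∧ ha = 13 ∧ na = 14)
    {s : Store} {b : ℝ} (h0 : ∀ κ, s.nat ha κ = 0) (hb : 50 * (s.nat 0 j : ℝ) + 50 ≤ b) :
    (bucketCmd j ka ha na).wp (fun s' b' =>
      (∀ κ, Chain (s'.nat na) (s'.nat ha κ) (bucket (s.nat ka) (s.nat 0 j) κ)) ∧
      b - 50 * (s.nat 0 j : ℝ) - 50 ≤ b') s b := by
  obtain ⟨Inv, hInv⟩ : ∃ Inv : Store → ℝ → Prop, ∀ s' b', Inv s' b' ↔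
    ∃ i ≤ s.nat 0 j, s'.nat 60 0 = i ∧
      (∀ κ, Chain (s'.nat na) (s'.nat ha κ) (bucket (s.nat ka) i κ)) ∧
      b - 50 * (i : ℝ) - 10 ≤ b' := ⟨_, fun _ _ => Iff.rfl⟩
  simp only [bucketCmd, block, wp_seq, wp_nset]
  refine Cmd.wp_loop Inv ((hInv _ _).2 ⟨0, Nat.zero_le _, by simp, ?_, ?_⟩) ?_ ?_ ?_
  · intro κ
    rcases hj with ⟨rfl, rfl, rfl⟩ | ⟨rfl, rfl, rfl⟩ <;> simp [bucket, Chain, h0]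
  · simp
    linarith
  · intro s' b' hI
    obtain ⟨i, hi, -, -, h⟩ := (hInv _ _).1 hI
    have : (i : ℝ) ≤ s.nat 0 j := by exact_mod_cast hi
    linarith
  · rintro s' b' so hI hc
    obtain ⟨i, hi, h1, h2, h3⟩ := (hInv _ _).1 hI
    have e0 : s'.nat 0 = s.nat 0 := by
      rcases hj with ⟨rfl, rfl, rfl⟩ | ⟨rfl, rfl, rfl⟩ <;> exact (so.nat 0 rfl).trans (by simp)
    have ek : s'.nat ka = s.nat ka := by
      rcases hj with ⟨rfl, rfl, rfl⟩ | ⟨rfl, rfl, rfl⟩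
      · exact (so.nat 1 rfl).trans (by simp)
      · exact (so.nat 2 rfl).trans (by simp)
    simp [h1, e0] at hc
    simp only [wp_seq, wp_nset]
    have key : ∀ κ, Chain (Function.update (s'.nat na) i (s'.nat ha (s.nat ka i)))
        (if κ = s.nat ka i then i + 1 else s'.nat ha κ) (bucket (s.nat ka) (i + 1) κ) := by
      intro κ
      -- The link written at `i` does not disturb the old lists, which contain only smaller indices.
      have h4 : ∀ κ', Chain (Function.update (s'.nat na) i (s'.nat ha (s.nat ka i)))
          (s'.nat ha κ') (bucket (s.nat ka) i κ') := fun κ' => (h2 κ').congr fun x hx =>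
        Function.update_of_ne (mem_bucket.1 hx).1.ne _ _
      rw [bucket_succ]
      by_cases hκ : κ = s.nat ka i
      · rw [if_pos hκ, if_pos hκ.symm]
        refine ⟨rfl, ?_⟩
        rw [Function.update_self, ← hκ]
        exact hκ ▸ h4 κ
      · rw [if_neg hκ, if_neg (Ne.symm hκ)]
        exact h4 κ
    refine (hInv _ _).2 ⟨i + 1, by omega, ?_, fun κ => ?_, ?_⟩
    · rcases hj with ⟨rfl, rfl, rfl⟩ | ⟨rfl, rfl, rfl⟩ <;> simp [h1]
    · have e : ∀ {nx nx' : ℕ → ℕ} {h h' : ℕ} {L : List ℕ}, Chain nx h L → nx' = nx → h' = h →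
        Chain nx' h' L := fun hc e1 e2 => e1 ▸ e2 ▸ hc
      refine e (key κ) ?_ ?_
      · funext x
        rcases hj with ⟨rfl, rfl, rfl⟩ | ⟨rfl, rfl, rfl⟩ <;>
        by_cases hx : x = i <;> simp [h1, ek, hx]
      · rcases hj with ⟨rfl, rfl, rfl⟩ | ⟨rfl, rfl, rfl⟩ <;> simp [h1, ek]
    · simp
      linarith
  · rintro s' b' so hI hc
    obtain ⟨i, hi, h1, h2, h3⟩ := (hInv _ _).1 hI
    have e0 : s'.nat 0 = s.nat 0 := by
      rcases hj with ⟨rfl, rfl, rfl⟩ | ⟨rfl, rfl, rfl⟩ <;> exact (so.nat 0 rfl).trans (by simp)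
    simp [h1, e0] at hc
    obtain rfl : i = s.nat 0 j := by omega
    exact ⟨h2, by simp; linarith⟩

/-- Executes `body` for all entries of a linked list, whose head is in `cur`; the entry is in
`x`. -/
def walk (na cur x : ℕ) (body : Cmd) : Cmd :=
  .loop (.nle (.lit 1) (var cur)) (block [
    setVar x (.sub (var cur) (.lit 1)), body, setVar cur (.get na (var x))])

/-- The invariant is indexed by the entries still to be visited. The numbers are exact costs: `11`
for the test and for loading the entry, `5` for following the link, and `5` for the final test. -/
lemma walk_wp {na cur x : ℕ} {body : Cmd} (hna : body.modNat na = false)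
    (hx : body.modNat x = false) (h1 : na ≠ cur) (h2 : na ≠ x)
    (h3 : cur ≠ x) (I : List ℕ → Store → ℝ → Prop)
    (hI : ∀ L s b v, I L s b → I L (s.setNat cur 0 v) b ∧ I L (s.setNat x 0 v) b)
    (hpos : ∀ L s b, I L s b → 0 ≤ b) {L : List ℕ} {s : Store} {b : ℝ} (h0 : I L s b)
    (hL : Chain (s.nat na) (s.nat cur 0) L)
    (hbody : ∀ y L' s' b', SameOff (walk na cur x body) s s' → y :: L' <:+ L → s'.nat x 0 = y →
      I (y :: L') s' b' → body.wp (fun s'' b'' => I L' s'' (b'' - 5)) s' (b' - 11)) :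
    (walk na cur x body).wp (fun s' b' => I [] s' (b' + 5)) s b := by
  obtain ⟨Inv, hInv⟩ : ∃ Inv : Store → ℝ → Prop, ∀ s' b', Inv s' b' ↔
    ∃ L', L' <:+ L ∧ Chain (s'.nat na) (s'.nat cur 0) L' ∧ I L' s' b' := ⟨_, fun _ _ => Iff.rfl⟩
  refine Cmd.wp_loop Inv ((hInv _ _).2 ⟨L, List.suffix_rfl, hL, h0⟩) ?_ ?_ ?_
  · intro s' b' h
    obtain ⟨L', -, -, h⟩ := (hInv _ _).1 h
    exact hpos _ _ _ h
  · intro s' b' so h hc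
    obtain ⟨L', hs, hch, h⟩ := (hInv _ _).1 h
    cases L' with
    | nil =>
      simp only [Chain] at hch
      simp [hch] at hc
    | cons y L' =>
      obtain ⟨hy, hch⟩ := hch
      simp only [block, wp_seq, wp_nset]
      have so' : SameOff (walk na cur x body) s (s'.setNat x 0 y) := by
        refine ⟨fun a ha => ?_, fun a ha => so.real a ha⟩
        have : a ≠ x := by
          rintro rfl
          simp [walk, Cmd.modNat] at ha
        rw [Store.setNat_nat_of_ne _ this]
        exact so.nat a ha
      have e1 : (s'.setNat x ((NExp.lit 0).eval s') (((var cur).sub (.lit 1)).eval s'))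
          = s'.setNat x 0 y := by simp [hy]
      rw [e1]
      have hb := hbody y L' (s'.setNat x 0 y) b' so' hs (by simp) (hI _ _ _ _ h).2
      refine Cmd.wp_conseq (R := fun s'' b'' => I L' s'' (b'' - 5)) ?_ ?_
      · convert hb using 1
        simp
        ring
      intro s₂ b₂ so₂ h4
      refine (hInv _ _).2 ⟨L', (List.suffix_cons y L').trans hs, ?_, ?_⟩
      · have e2 : s₂.nat na = s'.nat na := by
          rw [so₂.nat na hna, Store.setNat_nat_of_ne _ h2]
        have e3 : s₂.nat x 0 = y := by rw [so₂.nat x hx]; simp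
        rw [Store.setNat_nat_of_ne _ h1]
        simpa [e2, e3] using hch
      · have := (hI _ _ _ (s₂.nat na (s₂.nat x 0)) h4).1
        convert this using 1
        simp
        norm_num
  · intro s' b' so h hc
    obtain ⟨L', hs, hch, h⟩ := (hInv _ _).1 h
    cases L' with
    | nil =>
      convert h using 1
      simp
    | cons y L' =>
      simp [hch.1] at hc

end Lists

/-! ### Simulation of the rerouting algorithm -/

section Simulation

variable {n d : ℕ} {P : Fin n → EuclideanSpace ℝ (Fin d)} {k : ℕ} {T : Quadtree P k} {K : ℕ}

def toNat (x : Fin n × ℝ) : ℕ × ℝ := (x.1, x.2)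

/-- The flow matrix holds the flow between net points and that between input points. -/
structure FlowSim (num : Net T ≃ Fin K) (s : Store) (f : Net T → Net T → ℝ)
    (g : Fin n → Fin n → ℝ) : Prop where
  net : ∀ u v, s.entry (n + num u) (n + num v) = f u v
  point : ∀ p q : Fin n, s.entry p q = g p q

/-- The log of the pairs of input points that may have flow between them. -/
structure LogSim (n : ℕ) (s : Store) (g : Fin n → Fin n → ℝ) : Prop where
  lt : ∀ i < s.nat 59 0, s.nat 27 i < n ∧ s.nat 28 i < n
  mem : ∀ p q, g p q ≠ 0 → ∃ i < s.nat 59 0,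
    s.nat 27 i = p ∧ s.nat 28 i = q ∨ s.nat 27 i = q ∧ s.nat 28 i = p

/-- The ropes represent the prefix split trees; the last rope is empty. -/
structure Trees (num : Net T ≃ Fin K) (pt nt : Net T → List (Fin n × ℝ)) (tr : ℕ → Rope) :
    Prop where
  zero : tr (K + K) = .leaf 0 0
  nonneg : ∀ i < K + K + 1, (tr i).Nonneg
  nt : ∀ v, (tr (num v + num v)).toList = (nt v).map toNat
  pt : ∀ v, (tr (num v + num v + 1)).toList = (pt v).map toNat

lemma Store.entry_congr {s s' : Store} (h10 : s'.nat 10 = s.nat 10) (h2 : s'.real 2 = s.real 2)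
    (x y : ℕ) : s'.entry x y = s.entry x y := by
  unfold Store.entry
  rw [h10, h2]

lemma FlowSim.of_eq {num : Net T ≃ Fin K} {s s' : Store} {f : Net T → Net T → ℝ}
    {g : Fin n → Fin n → ℝ} (h : FlowSim num s f g) (h10 : s'.nat 10 = s.nat 10)
    (h2 : s'.real 2 = s.real 2) : FlowSim num s' f g :=
  ⟨fun u v => (Store.entry_congr h10 h2 _ _).trans (h.net u v),
    fun p q => (Store.entry_congr h10 h2 _ _).trans (h.point p q)⟩

lemma LogSim.of_eq {s s' : Store} {g : Fin n → Fin n → ℝ} (h : LogSim n s g)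
    (h59 : s'.nat 59 = s.nat 59) (h27 : s'.nat 27 = s.nat 27) (h28 : s'.nat 28 = s.nat 28) :
    LogSim n s' g := by
  constructor
  · rw [h59, h27, h28]; exact h.lt
  · rw [h59, h27, h28]; exact h.mem

/-- The part of the memory that remains the same while the net point `v` is processed. -/
structure NetCtx (num : Net T ≃ Fin K) (s : Store) (v : Net T) : Prop where
  n_eq : s.nat 0 0 = n
  K_eq : s.nat 0 2 = K
  off : Offsets s (n + K)
  num_eq : s.nat 61 0 = num v
  id_eq : s.nat 62 0 = n + num v
  cand : ∀ i < s.nat 57 0, ∃ u, v.Near u ∧ s.nat 17 i = num u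
  near : ∀ u, v.Near u → ∃ i < s.nat 57 0, s.nat 17 i = num u

variable {num : Net T ≃ Fin K}

lemma num_val_inj {u v : Net T} : (num u : ℕ) = num v ↔ u = v := by
  rw [Fin.val_inj, num.apply_eq_iff_eq]

/-- Net points are numbered from `n` on, so this touches neither the entries between input points
nor those between a point and a net point. -/
lemma addEdge_net {s : Store} {b : ℝ} {f : Net T → Net T → ℝ} {g : Fin n → Fin n → ℝ}
    {u w : Net T} {δ : ℝ} (hoff : Offsets s (n + K)) (hF : FlowSim num s f g)
    (hu : s.nat 55 0 = n + num u) (hw : s.nat 56 0 = n + num w) (hδ : s.real 7 0 = δ) :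
    addEdge.wp (fun s' b' => FlowSim num s' (addFlow f u w δ) g ∧ b - 40 ≤ b') s b := by
  have hlt : ∀ x : Net T, n + (num x : ℕ) < n + K := fun x => by have := (num x).2; omega
  refine Cmd.wp_conseq (addEdge_wp hoff hu hw hδ (hlt u) (hlt w)) ?_
  rintro s' b' - ⟨h1, h2⟩
  refine ⟨⟨fun x y => ?_, fun p q => ?_⟩, h2⟩
  · rw [h1 _ (hlt x) _ (hlt y), hF.net]
    have hadd : ∀ a b : Net T, n + (num a : ℕ) = n + num b ↔ a = b := fun a b => by
      rw [Nat.add_left_cancel_iff, num_val_inj]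
    simp only [addFlow_apply]
    congr! <;> exact hadd _ _
  · have hp := p.2
    have hq := q.2
    rw [h1 _ (by omega) _ (by omega), hF.point, if_neg (by omega), if_neg (by omega)]
    ring

lemma addEdge_point {s : Store} {b : ℝ} {f : Net T → Net T → ℝ} {g : Fin n → Fin n → ℝ}
    {p q : Fin n} {δ : ℝ} (hoff : Offsets s (n + K)) (hF : FlowSim num s f g)
    (hp : s.nat 55 0 = p) (hq : s.nat 56 0 = q) (hδ : s.real 7 0 = δ) :
    addEdge.wp (fun s' b' => FlowSim num s' f (addFlow g p q δ) ∧ b - 40 ≤ b') s b := by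
  have hlt : ∀ x : Net T, n + (num x : ℕ) < n + K := fun x => by have := (num x).2; omega
  have hlt' : ∀ x : Fin n, (x : ℕ) < n + K := fun x => by have := x.2; omega
  refine Cmd.wp_conseq (addEdge_wp hoff hp hq hδ (hlt' p) (hlt' q)) ?_
  rintro s' b' - ⟨h1, h2⟩
  have hp := p.2
  have hq := q.2
  refine ⟨⟨fun x y => ?_, fun x y => ?_⟩, h2⟩
  · rw [h1 _ (hlt x) _ (hlt y), hF.net, if_neg (by omega), if_neg (by omega)]
    ring
  · rw [h1 _ (hlt' x) _ (hlt' y), hF.point]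
    simp only [addFlow_apply, Fin.val_inj]
    congr!

/-! ### The first loop -/

/-- Reroutes flow from the vertex `65` via `62` to `66` past `62`. -/
def bypassCmd : Cmd := block [
  setVar 55 (var 65), setVar 56 (var 66), setRvar 7 (rvar 9), addEdge,
  setVar 56 (var 62), setRvar 7 (.sub .zero (rvar 9)), addEdge,
  setVar 55 (var 62), setVar 56 (var 66), addEdge]

lemma bypassCmd_wp {s : Store} {b : ℝ} {f : Net T → Net T → ℝ} {g : Fin n → Fin n → ℝ}
    {u v w : Net T} {δ : ℝ} (hoff : Offsets s (n + K)) (hF : FlowSim num s f g)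
    (hu : s.nat 65 0 = n + num u) (hw : s.nat 66 0 = n + num w) (hv : s.nat 62 0 = n + num v)
    (hδ : s.real 9 0 = δ) :
    bypassCmd.wp (fun s' b' =>
      FlowSim num s' (addFlow (addFlow (addFlow f u w δ) u v (-δ)) v w (-δ)) g ∧
      b - 180 ≤ b') s b := by
  simp only [bypassCmd, block, wp_seq, wp_nset, wp_rset]
  have hoff' : ∀ {s' : Store}, s'.nat 10 = s.nat 10 → Offsets s' (n + K) := fun h => by
    unfold Offsets; rw [h]; exact hoff
  refine Cmd.wp_conseq (addEdge_net (u := u) (w := w) (δ := δ) (hoff' (by simp))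
    (hF.of_eq (by simp) (by simp)) (by simp [hu]) (by simp [hw]) (by simp [hδ])) ?_
  rintro s₁ b₁ so₁ ⟨h1, c1⟩
  have a10 : s₁.nat 10 = s.nat 10 := (so₁.nat 10 rfl).trans (by simp)
  have a62 : s₁.nat 62 = s.nat 62 := (so₁.nat 62 rfl).trans (by simp)
  have a66 : s₁.nat 66 = s.nat 66 := (so₁.nat 66 rfl).trans (by simp)
  have a9 : s₁.real 9 = s.real 9 := (so₁.real 9 rfl).trans (by simp)
  have a55 : s₁.nat 55 0 = n + num u := by rw [so₁.nat 55 rfl]; simp [hu]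
  simp only [wp_seq, wp_nset, wp_rset]
  refine Cmd.wp_conseq (addEdge_net (u := u) (w := v) (δ := -δ) (hoff' (by simp [a10]))
    (h1.of_eq (by simp) (by simp)) (by simp [a55]) (by simp [a62, hv]) (by simp [a9, hδ])) ?_
  rintro s₂ b₂ so₂ ⟨h2, c2⟩
  have d10 : s₂.nat 10 = s.nat 10 := ((so₂.nat 10 rfl).trans (by simp)).trans a10
  have d62 : s₂.nat 62 = s.nat 62 := ((so₂.nat 62 rfl).trans (by simp)).trans a62
  have d66 : s₂.nat 66 = s.nat 66 := ((so₂.nat 66 rfl).trans (by simp)).trans a66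
  have d7 : s₂.real 7 0 = -δ := by rw [so₂.real 7 rfl]; simp [a9, hδ]
  simp only [wp_seq, wp_nset]
  refine Cmd.wp_conseq (addEdge_net (u := v) (w := w) (δ := -δ) (hoff' (by simp [d10]))
    (h2.of_eq (by simp) (by simp)) (by simp [d62, hv]) (by simp [d66, hw]) (by simp [d7])) ?_
  rintro s₃ b₃ so₃ ⟨h3, c3⟩
  refine ⟨h3, ?_⟩
  simp at c1 c2 c3
  linarith

def cancelCmd : Cmd := block [
  setVar 63 (.lit 0), setVar 64 (.lit 0),
  .loop (.conj (.nle (.add (var 63) (.lit 1)) (var 57)) (.nle (.add (var 64) (.lit 1)) (var 57)))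
    (block [
      setVar 65 (.add (var 0) (.get 17 (var 63))), setVar 66 (.add (var 0) (.get 17 (var 64))),
      .ite (.rle (entryExp (var 65) (var 62)) .zero) (setVar 63 (.add (var 63) (.lit 1)))
        (.ite (.rle (entryExp (var 62) (var 66)) .zero) (setVar 64 (.add (var 64) (.lit 1)))
          (block [
            .ite (.rle (entryExp (var 65) (var 62)) (entryExp (var 62) (var 66)))
              (block [setRvar 9 (entryExp (var 65) (var 62)), setVar 63 (.add (var 63) (.lit 1))])
              (block [setRvar 9 (entryExp (var 62) (var 66)), setVar 64 (.add (var 64) (.lit 1))]),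
            bypassCmd]))])]

variable {μ : Fin n → ℝ} {B : ℝ} {order : List (Net T)}

open Classical in
-- Two pointers search the candidates for a sender and a receiver. The bypass exhausts at least one
-- of the two, so every iteration advances a pointer, and the work is linear, not quadratic, in the
-- number of candidates.
lemma cancelCmd_wp (ho : ChildrenFirst order) {s : Store} {b : ℝ} {v : Net T} {rest : List (Net T)}
    {f : Net T → Net T → ℝ} {g : Fin n → Fin n → ℝ} {pt nt : Net T → List (Fin n × ℝ)}
    (hctx : NetCtx num s v) (hF : FlowSim num s f g)
    (hinv : Inv μ B order ⟨v :: rest, .cancel, f, g, pt, nt⟩) {R : ℝ} (hR : 0 ≤ R)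
    (hb : R + 300 * (2 * (s.nat 57 0 : ℝ)) + 100 ≤ b) :
    cancelCmd.wp (fun s' b' => ∃ f',
      Relation.ReflTransGen Step ⟨v :: rest, .cancel, f, g, pt, nt⟩
        ⟨v :: rest, .pull, f', g, pt, nt⟩ ∧ FlowSim num s' f' g ∧ R ≤ b') s b := by
  -- Candidates before `i` send nothing to `v`, those before `j` receive nothing from it.
  -- Repetitions among the candidates are harmless.
  obtain ⟨LI, hLI⟩ : ∃ LI : Store → ℝ → Prop, ∀ s' b', LI s' b' ↔ ∃ f' i j,
    Relation.ReflTransGen Step ⟨v :: rest, .cancel, f, g, pt, nt⟩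
      ⟨v :: rest, .cancel, f', g, pt, nt⟩ ∧ FlowSim num s' f' g ∧
    s'.nat 63 0 = i ∧ s'.nat 64 0 = j ∧ i ≤ s.nat 57 0 ∧ j ≤ s.nat 57 0 ∧
    (∀ i' < i, ∀ u, s.nat 17 i' = num u → f' u v ≤ 0) ∧
    (∀ j' < j, ∀ w, s.nat 17 j' = num w → 0 ≤ f' w v) ∧
    R + 300 * (2 * (s.nat 57 0 : ℝ) - i - j) + 50 ≤ b' := ⟨_, fun _ _ => Iff.rfl⟩
  simp only [cancelCmd, block, wp_seq, wp_nset]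
  refine Cmd.wp_loop LI ((hLI _ _).2 ⟨f, 0, 0, .refl, hF.of_eq (by simp) (by simp), by simp,
    by simp, Nat.zero_le _, Nat.zero_le _, by simp, by simp, ?_⟩) ?_ ?_ ?_
  · simp
    linarith
  · intro s' b' hI
    obtain ⟨f', i, j, -, -, -, -, hi, hj, -, -, h⟩ := (hLI _ _).1 hI
    have e1 : (i : ℝ) ≤ s.nat 57 0 := by exact_mod_cast hi
    have e2 : (j : ℝ) ≤ s.nat 57 0 := by exact_mod_cast hj
    linarith
  · rintro s' b' so hI hc
    obtain ⟨f', i, j, hreach, hF', h63, h64, hi, hj, hiv, hjv, hb'⟩ := (hLI _ _).1 hI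
    have e0 : s'.nat 0 = s.nat 0 := (so.nat 0 rfl).trans (by simp)
    have e17 : s'.nat 17 = s.nat 17 := (so.nat 17 rfl).trans (by simp)
    have e57 : s'.nat 57 = s.nat 57 := (so.nat 57 rfl).trans (by simp)
    have e62 : s'.nat 62 = s.nat 62 := (so.nat 62 rfl).trans (by simp)
    have e10 : s'.nat 10 = s.nat 10 := (so.nat 10 rfl).trans (by simp)
    simp [h63, h64, e57] at hc
    obtain ⟨hi1, hj1⟩ := hc
    obtain ⟨u, hu, hui⟩ := hctx.cand i (by omega)
    obtain ⟨w, hw, hwj⟩ := hctx.cand j (by omega)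
    have hinv' := hinv.reachable ho hreach
    have hanti : ∀ a b, f' a b = - f' b a := hinv'.anti
    have hself : f' v v = 0 := hinv'.self v
    have en1 : s'.real 2 (s'.nat 10 (n + num u) + (n + num v)) = f' u v := hF'.net u v
    have en2 : s'.real 2 (s'.nat 10 (n + num v) + (n + num w)) = f' v w := hF'.net v w
    simp only [wp_seq, wp_nset, wp_ite, wp_rset]
    simp [e0, hctx.n_eq, h63, h64, e17, hui, hwj, e62, hctx.id_eq, en1, en2]
    refine ⟨fun h1 => ?_, fun h1 => ⟨fun h2 => ?_, fun h2 => ?_⟩⟩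
    · refine (hLI _ _).2 ⟨f', i + 1, j, hreach, hF'.of_eq (by simp) (by simp), by simp,
        by simp [h64], hi1, hj, ?_, hjv, ?_⟩
      · intro i' hi' u' hu'
        rcases Nat.lt_succ_iff_lt_or_eq.1 hi' with h3 | rfl
        · exact hiv i' h3 u' hu'
        · rw [hui, num_val_inj] at hu'
          exact hu' ▸ h1
      · push_cast
        linarith
    · refine (hLI _ _).2 ⟨f', i, j + 1, hreach, hF'.of_eq (by simp) (by simp), by simp [h63],
        by simp, hi, hj1, hiv, ?_, ?_⟩
      · intro j' hj' w' hw'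
        rcases Nat.lt_succ_iff_lt_or_eq.1 hj' with h3 | rfl
        · exact hjv j' h3 w' hw'
        · rw [hwj, num_val_inj] at hw'
          rw [← hw', hanti]
          linarith
      · push_cast
        linarith
    · have huv : u ≠ v := by rintro rfl; linarith
      have hwv : w ≠ v := by rintro rfl; linarith
      have huw : u ≠ w := by
        rintro rfl
        have := hanti u v
        linarith
      have key : ∀ (s₂ : Store) (b₂ : ℝ) (i₂ j₂ : ℕ), s₂.nat 10 = s.nat 10 → s₂.real 2 = s'.real 2 →
          s₂.nat 65 0 = n + num u → s₂.nat 66 0 = n + num w → s₂.nat 62 0 = n + num v →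
          s₂.real 9 0 = min (f' u v) (f' v w) → s₂.nat 63 0 = i₂ → s₂.nat 64 0 = j₂ →
          (i₂ = i + 1 ∧ j₂ = j ∧ f' u v ≤ f' v w ∨ i₂ = i ∧ j₂ = j + 1 ∧ f' v w ≤ f' u v) →
          b' - 100 ≤ b₂ → bypassCmd.wp LI s₂ b₂ := by
        intro s₂ b₂ i₂ j₂ k10 k2 k65 k66 k62 k9 k63 k64 hij hb₂
        refine Cmd.wp_conseq (bypassCmd_wp (f := f') (g := g) (u := u) (v := v) (w := w) ?_
          (hF'.of_eq (k10.trans e10.symm) k2) k65 k66 k62 k9) ?_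
        · unfold Offsets; rw [k10]; exact hctx.off
        rintro s₃ b₃ so₃ ⟨hF₃, hb₃⟩
        -- Flow into `v` changes only at `u` and `w`. As `δ` is at most either flow, no sign is
        -- reversed and the candidates already passed remain settled.
        have hval : ∀ x, addFlow (addFlow (addFlow f' u w (min (f' u v) (f' v w))) u v
            (-min (f' u v) (f' v w))) v w (-min (f' u v) (f' v w)) x v
            = f' x v - (if x = u then min (f' u v) (f' v w) else 0)
              + (if x = w then min (f' u v) (f' v w) else 0) := by
          intro x
          simp only [addFlow_apply, huv.symm, hwv.symm, and_false, if_false, and_true]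
          by_cases hxu : x = u
          · simp [hxu, huw, sub_eq_add_neg]
          · by_cases hxw : x = w <;> simp [hxu, hxw, huw.symm]
        have hstep := hreach.tail (Step.cancel (rest := rest) (pt := pt) (nt := nt) (g := g) u w
          (min (f' u v) (f' v w)) hu hw h2 (by rw [hanti]; linarith) rfl)
        have m1 := min_le_left (f' u v) (f' v w)
        have m2 := min_le_right (f' u v) (f' v w)
        have m3 : 0 < min (f' u v) (f' v w) := lt_min h1 h2
        have hwv' := hanti w v
        refine (hLI _ _).2 ⟨_, i₂, j₂, hstep, hF₃, by rw [so₃.nat 63 rfl, k63],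
          by rw [so₃.nat 64 rfl, k64], by omega, by omega, ?_, ?_, ?_⟩
        · intro i' hi' u' hu'
          rw [hval]
          have hcase : f' u' v ≤ 0 ∨ u' = u ∧ f' u v ≤ f' v w := by
            by_cases h3 : i' < i
            · exact Or.inl (hiv i' h3 u' hu')
            · rcases hij with ⟨a1, a2, a3⟩ | ⟨a1, a2, a3⟩
              · obtain rfl : i' = i := by omega
                rw [hui, num_val_inj] at hu'
                exact Or.inr ⟨hu'.symm, a3⟩
              · omega
          rcases hcase with h3 | ⟨rfl, h3⟩
          · by_cases hxu : u' = u
            · rw [hxu] at h3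
              linarith
            · rw [if_neg hxu]
              by_cases hxw : u' = w
              · rw [if_pos hxw, hxw]
                linarith
              · rw [if_neg hxw]
                linarith
          · rw [if_pos rfl, if_neg huw, min_eq_left h3]
            linarith
        · intro j' hj' w' hw'
          rw [hval]
          have hcase : 0 ≤ f' w' v ∨ w' = w ∧ f' v w ≤ f' u v := by
            by_cases h3 : j' < j
            · exact Or.inl (hjv j' h3 w' hw')
            · rcases hij with ⟨a1, a2, a3⟩ | ⟨a1, a2, a3⟩
              · omega
              · obtain rfl : j' = j := by omega
                rw [hwj, num_val_inj] at hw'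
                exact Or.inr ⟨hw'.symm, a3⟩
          rcases hcase with h3 | ⟨rfl, h3⟩
          · by_cases hxu : w' = u
            · rw [if_pos hxu, hxu, if_neg huw]
              linarith
            · rw [if_neg hxu]
              by_cases hxw : w' = w
              · rw [hxw] at h3
                linarith
              · rw [if_neg hxw]
                linarith
          · rw [if_neg huw.symm, if_pos rfl, min_eq_right h3]
            linarith
        · have : (i₂ : ℝ) + j₂ = i + j + 1 := by
            have : i₂ + j₂ = i + j + 1 := by omega
            exact_mod_cast this
          linarith
      refine ⟨fun h3 => ?_, fun h3 => ?_⟩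
      · refine key _ _ (i + 1) j (by simp [e10]) (by simp) (by simp) (by simp)
          (by simp [e62, hctx.id_eq]) (by simp [h3]) (by simp) (by simp [h64])
          (Or.inl ⟨rfl, rfl, h3⟩) (by linarith)
      · refine key _ _ i (j + 1) (by simp [e10]) (by simp) (by simp) (by simp)
          (by simp [e62, hctx.id_eq]) (by simp [h3.le]) (by simp [h63]) (by simp)
          (Or.inr ⟨rfl, rfl, h3.le⟩) (by linarith)
  · rintro s' b' so hI hc
    obtain ⟨f', i, j, hreach, hF', h63, h64, hi, hj, hiv, hjv, hb'⟩ := (hLI _ _).1 hI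
    have e57 : s'.nat 57 = s.nat 57 := (so.nat 57 rfl).trans (by simp)
    simp only [BExp.holds, NExp.eval, h63, h64, e57] at hc
    have hanti : ∀ a b, f' a b = - f' b a := (hinv.reachable ho hreach).anti
    have e1 : (i : ℝ) ≤ s.nat 57 0 := by exact_mod_cast hi
    have e2 : (j : ℝ) ≤ s.nat 57 0 := by exact_mod_cast hj
    refine ⟨f', hreach.tail (Step.cancel_exit ?_), hF', ?_⟩
    · rintro ⟨u, w, hu, hw, h1, h2⟩
      obtain ⟨i', hi', hui⟩ := hctx.near u hu
      obtain ⟨j', hj', hwj⟩ := hctx.near w hw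
      have a1 := hanti u v
      have a2 := hanti w v
      -- When one pointer has run out, no near net point sends to `v`, or none receives from it;
      -- either way the exit test of the loop holds.
      by_cases h3 : i + 1 ≤ s.nat 57 0
      · have : j = s.nat 57 0 := by
          by_contra hne
          exact hc ⟨h3, by omega⟩
        have := hjv j' (by omega) w hwj
        linarith
      · have := hiv i' (by omega) u hui
        linarith
    · simp
      linarith

end Simulation

/-! ### The second and the third loop -/

section Drain

variable {n d : ℕ} {P : Fin n → EuclideanSpace ℝ (Fin d)} {k : ℕ} {T : Quadtree P k} {K : ℕ}
  {num : Net T ≃ Fin K}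

lemma moved_apply (tr : ℕ → Rope) (src dst : ℕ) (t : ℝ) (i : ℕ) :
    moved tr src dst t i = if i = dst then .node ((tr src).split t).1 (tr dst)
      else if i = src then ((tr src).split t).2 else tr i := by
  unfold moved
  by_cases h1 : i = dst
  · subst h1
    simp
  · rw [Function.update_of_ne h1, if_neg h1]
    by_cases h2 : i = src
    · subst h2
      simp
    · rw [Function.update_of_ne h2, if_neg h2]

lemma prefixSplit_toNat (L : List (Fin n × ℝ)) (t : ℝ) :
    prefixSplit (L.map toNat) t
      = ((prefixSplit L t).1.map toNat, (prefixSplit L t).2.map toNat) := by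
  induction L generalizing t with
  | nil => simp [prefixSplit]
  | cons x L ih =>
    obtain ⟨p, a⟩ := x
    simp only [List.map_cons, toNat, prefixSplit]
    split_ifs
    · have := ih (t - a)
      rw [Prod.ext_iff] at this
      simp only at this
      rw [this.1, this.2]
      simp [toNat]
    · simp [toNat]
    · simp [toNat]

lemma weight_toNat (L : List (Fin n × ℝ)) : weight (L.map toNat) = weight L := by
  simp [weight, lin, toNat, Function.comp_def]

/-- The second loop (with `pull`) and the third loop. -/
def drainCmd (pull : Bool) : Cmd := block [
  setVar 63 (.lit 0),
  .loop (.nle (.add (var 63) (.lit 1)) (var 57)) (block [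
    setVar 65 (.get 17 (var 63)),
    setVar 63 (.add (var 63) (.lit 1)),
    setVar 55 (if pull then .add (var 0) (var 65) else var 62),
    setVar 56 (if pull then var 62 else .add (var 0) (var 65)),
    .ite (.rle (entryExp (var 55) (var 56)) .zero) .skip (block [
      setRvar 6 (entryExp (var 55) (var 56)),
      setVar 49 (.add (.add (var 61) (var 61)) (.lit (if pull then 1 else 0))),
      setVar 50 (.add (.add (var 65) (var 65)) (.lit (if pull then 1 else 0))),
      setRvar 7 (.sub .zero (rvar 6)), addEdge, moveCmd])])]

/-- The second and the third loop differ only in the direction of the flow and in the rope slot. The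
predicate `C` hides which steps have been made, so one argument serves both; each move adds one leaf
and is paid from the share of its candidate. -/
lemma drainCmd_wp (pull : Bool) {s : Store} {b : ℝ} {v : Net T} (hctx : NetCtx num s v)
    {C : (Net T → Net T → ℝ) → (ℕ → Rope) → Prop} {g : Fin n → Fin n → ℝ}
    {f : Net T → Net T → ℝ} {tr : ℕ → Rope} (h0 : C f tr)
    (hF : FlowSim num s f g) (hT : Forest s (K + K + 1) tr)
    (hself : ∀ f tr, C f tr → f v v = 0)
    (hwt : ∀ f tr u, C f tr → 0 < (if pull then f u v else f v u) →
      (if pull then f u v else f v u) ≤ (tr (num v + num v + if pull then 1 else 0)).wt)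
    (hstep : ∀ f tr u, C f tr → v.Near u → 0 < (if pull then f u v else f v u) → u ≠ v →
      C (addFlow f (if pull then u else v) (if pull then v else u)
          (-(if pull then f u v else f v u)))
        (moved tr (num v + num v + if pull then 1 else 0) (num u + num u + if pull then 1 else 0)
          (if pull then f u v else f v u)))
    {lam R : ℝ} {Nmax : ℕ} (hN : forestLeaves (K + K + 1) tr + s.nat 57 0 ≤ Nmax)
    (hlam : Real.logb 2 Nmax ≤ lam) (hlam0 : 0 ≤ lam)
    (hR : 0 ≤ R) (hb : forestPot (K + K + 1) tr + (s.nat 57 0 : ℝ) * (4000 + 800 * lam) + 100 + R ≤ b) :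
    (drainCmd pull).wp (fun s' b' => ∃ f' tr', C f' tr' ∧ FlowSim num s' f' g ∧
      Forest s' (K + K + 1) tr' ∧
      (∀ u, v.Near u → (if pull then f' u v else f' v u) ≤ 0) ∧
      forestLeaves (K + K + 1) tr' ≤ forestLeaves (K + K + 1) tr + s.nat 57 0 ∧
      forestPot (K + K + 1) tr' + R ≤ b') s b := by
  classical
  obtain ⟨LI, hLI⟩ : ∃ LI : Store → ℝ → Prop, ∀ s' b', LI s' b' ↔ ∃ f' tr' i, C f' tr' ∧
    FlowSim num s' f' g ∧ Forest s' (K + K + 1) tr' ∧ s'.nat 63 0 = i ∧ i ≤ s.nat 57 0 ∧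
    (∀ i' < i, ∀ u, s.nat 17 i' = num u → (if pull then f' u v else f' v u) ≤ 0) ∧
    forestLeaves (K + K + 1) tr' ≤ forestLeaves (K + K + 1) tr + i ∧
    forestPot (K + K + 1) tr' + ((s.nat 57 0 : ℝ) - i) * (4000 + 800 * lam) + 50 + R ≤ b' :=
    ⟨_, fun _ _ => Iff.rfl⟩
  simp only [drainCmd, block, wp_seq, wp_nset]
  refine Cmd.wp_loop LI ((hLI _ _).2 ⟨f, tr, 0, h0, hF.of_eq (by simp) (by simp),
    hT.of_eq (by simp) (by simp) (by simp) (by simp) (by simp) (by simp), by simp, Nat.zero_le _,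
    by simp, by simp, ?_⟩) ?_ ?_ ?_
  · simp
    linarith
  · intro s' b' hI
    obtain ⟨f', tr', i, -, -, -, -, hi, -, -, h⟩ := (hLI _ _).1 hI
    have e1 : (0 : ℝ) ≤ s.nat 57 0 - i := sub_nonneg.2 (by exact_mod_cast hi)
    have e2 := forestPot_nonneg (K + K + 1) tr'
    have e3 : (0 : ℝ) ≤ ((s.nat 57 0 : ℝ) - i) * (4000 + 800 * lam) :=
      mul_nonneg e1 (by linarith)
    linarith
  · rintro s' b' so hI hc
    obtain ⟨f', tr', i, hC, hF', hT', h63, hi, hiv, hle, hb'⟩ := (hLI _ _).1 hI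
    have e0 : s'.nat 0 = s.nat 0 := by cases pull <;> exact (so.nat 0 rfl).trans (by simp)
    have e17 : s'.nat 17 = s.nat 17 := by cases pull <;> exact (so.nat 17 rfl).trans (by simp)
    have e57 : s'.nat 57 = s.nat 57 := by cases pull <;> exact (so.nat 57 rfl).trans (by simp)
    have e61 : s'.nat 61 = s.nat 61 := by cases pull <;> exact (so.nat 61 rfl).trans (by simp)
    have e62 : s'.nat 62 = s.nat 62 := by cases pull <;> exact (so.nat 62 rfl).trans (by simp)
    have e10 : s'.nat 10 = s.nat 10 := by cases pull <;> exact (so.nat 10 rfl).trans (by simp)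
    simp [h63, e57] at hc
    obtain ⟨u, hu, hui⟩ := hctx.cand i (by omega)
    have hi1 : (1 : ℝ) ≤ s.nat 57 0 - i := by
      have : (i : ℝ) + 1 ≤ s.nat 57 0 := by exact_mod_cast hc
      linarith
    have hmul : ((s.nat 57 0 : ℝ) - i) * (4000 + 800 * lam)
        = ((s.nat 57 0 : ℝ) - ((i + 1 : ℕ) : ℝ)) * (4000 + 800 * lam) + (4000 + 800 * lam) := by
      push_cast; ring
    have hself' := hself f' tr' hC
    have hnv := (num v).2
    have hnu := (num u).2
    have key : ∀ (s₂ : Store) (b₂ : ℝ), s₂.nat 10 = s'.nat 10 → s₂.real 2 = s'.real 2 →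
        Forest s₂ (K + K + 1) tr' → s₂.nat 63 0 = i + 1 →
        s₂.nat 55 0 = n + num (if pull then u else v) →
        s₂.nat 56 0 = n + num (if pull then v else u) →
        s₂.nat 49 0 = (num v + num v + if pull then 1 else 0) →
        s₂.nat 50 0 = (num u + num u + if pull then 1 else 0) →
        s₂.real 6 0 = (if pull then f' u v else f' v u) →
        s₂.real 7 0 = -(if pull then f' u v else f' v u) →
        0 < (if pull then f' u v else f' v u) → b' - 200 ≤ b₂ →
        addEdge.wp (moveCmd.wp LI) s₂ b₂ := by
      intro s₂ b₂ k10 k2 kT k63 k55 k56 k49 k50 k6 k7 hpos hb₂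
      have huv : u ≠ v := by
        rintro rfl
        cases pull <;> simp [hself'] at hpos
      have huv' : (num u : ℕ) ≠ num v := fun h => huv (num_val_inj.1 h)
      refine Cmd.wp_conseq (addEdge_net (f := f') (g := g) (u := if pull then u else v)
        (w := if pull then v else u) ?_ (hF'.of_eq k10 k2) k55 k56 k7) ?_
      · unfold Offsets; rw [k10, e10]; exact hctx.off
      rintro s₃ b₃ so₃ ⟨hF₃, hb₃⟩
      have hc57 : (s.nat 57 0 : ℝ) - ((i + 1 : ℕ) : ℝ) ≥ 0 := by push_cast; linarith
      have hrest : 0 ≤ ((s.nat 57 0 : ℝ) - ((i + 1 : ℕ) : ℝ)) * (4000 + 800 * lam) :=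
        mul_nonneg hc57 (by linarith)
      refine Cmd.wp_conseq (moveCmd_amortized (M := K + K + 1) (tr := tr')
        (src := num v + num v + if pull then 1 else 0)
        (dst := num u + num u + if pull then 1 else 0)
        (t := if pull then f' u v else f' v u) (lam := lam) (Nmax := Nmax)
        (R := ((s.nat 57 0 : ℝ) - ((i + 1 : ℕ) : ℝ)) * (4000 + 800 * lam) + 50 + R)
        (kT.of_eq (so₃.nat 18 rfl) (so₃.nat 19 rfl) (so₃.nat 20 rfl) (so₃.nat 21 rfl)
          (so₃.nat 40 rfl) (so₃.real 3 rfl)) (by rw [so₃.nat 49 rfl, k49])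
        (by rw [so₃.nat 50 rfl, k50]) (by split_ifs <;> omega) (by split_ifs <;> omega)
        (by split_ifs <;> omega) (by rw [so₃.real 6 rfl, k6]) hpos.le (hwt f' tr' u hC hpos)
        (by omega) hlam (by linarith) (by linarith)) ?_
      rintro s₄ b₄ so₄ ⟨hT₄, hb₄⟩
      refine (hLI _ _).2 ⟨_, _, i + 1, hstep f' tr' u hC hu hpos huv,
        hF₃.of_eq (so₄.nat 10 rfl) (so₄.real 2 rfl), hT₄,
        by rw [so₄.nat 63 rfl, so₃.nat 63 rfl, k63], hc, ?_, ?_, by linarith⟩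
      · intro i' hi' u' hu'
        -- Clearing the flow of `u` leaves all other flow at `v` as it was, so earlier candidates
        -- stay cleared.
        have hval : (if pull then addFlow f' (if pull then u else v) (if pull then v else u)
            (-(if pull then f' u v else f' v u)) u' v
            else addFlow f' (if pull then u else v) (if pull then v else u)
            (-(if pull then f' u v else f' v u)) v u')
            = (if pull then f' u' v else f' v u')
              - (if u' = u then (if pull then f' u v else f' v u) else 0) := by
          cases pull
          · by_cases h : u' = u <;> simp [addFlow_apply, h, huv.symm, sub_eq_add_neg]
          · by_cases h : u' = u <;> simp [addFlow_apply, h, huv.symm, sub_eq_add_neg]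
        rw [hval]
        by_cases h : u' = u
        · rw [if_pos h, h]
          linarith
        · rw [if_neg h, sub_zero]
          rcases Nat.lt_succ_iff_lt_or_eq.1 hi' with h3 | rfl
          · exact hiv i' h3 u' hu'
          · rw [hui, num_val_inj] at hu'
            exact absurd hu'.symm h
      · rw [forestLeaves_moved (by split_ifs <;> omega) (by split_ifs <;> omega)
          (by split_ifs <;> omega)]
        omega
    have done : ∀ (s₂ : Store) (b₂ : ℝ), s₂.nat 10 = s'.nat 10 → s₂.real 2 = s'.real 2 →
        Forest s₂ (K + K + 1) tr' → s₂.nat 63 0 = i + 1 →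
        (if pull then f' u v else f' v u) ≤ 0 → b' - 200 ≤ b₂ → LI s₂ b₂ := by
      intro s₂ b₂ k10 k2 kT k63 hneg hb₂
      refine (hLI _ _).2 ⟨f', tr', i + 1, hC, hF'.of_eq k10 k2, kT, k63, hc, ?_, by omega,
        by linarith⟩
      intro i' hi' u' hu'
      rcases Nat.lt_succ_iff_lt_or_eq.1 hi' with h3 | rfl
      · exact hiv i' h3 u' hu'
      · rw [hui, num_val_inj] at hu'
        exact hu' ▸ hneg
    have en1 : s'.real 2 (s'.nat 10 (n + num u) + (n + num v)) = f' u v := hF'.net u v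
    have en2 : s'.real 2 (s'.nat 10 (n + num v) + (n + num u)) = f' v u := hF'.net v u
    simp only [wp_seq, wp_nset, wp_ite, wp_rset, wp_skip]
    cases pull
    · simp only [Bool.false_eq_true, if_false] at key done
      simp [h63, e17, hui, e0, hctx.n_eq, e61, e62, hctx.id_eq, hctx.num_eq, en2]
      refine ⟨fun hneg => done _ _ (by simp) (by simp)
        (hT'.of_eq (by simp) (by simp) (by simp) (by simp) (by simp) (by simp)) (by simp) hneg
        (by linarith), fun hpos => key _ _ (by simp) (by simp)
        (hT'.of_eq (by simp) (by simp) (by simp) (by simp) (by simp) (by simp)) (by simp) (by simp)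
        (by simp) (by simp) (by simp) (by simp) (by simp) hpos (by linarith)⟩
    · simp only [if_true] at key done
      simp [h63, e17, hui, e0, hctx.n_eq, e61, e62, hctx.id_eq, hctx.num_eq, en1]
      refine ⟨fun hneg => done _ _ (by simp) (by simp)
        (hT'.of_eq (by simp) (by simp) (by simp) (by simp) (by simp) (by simp)) (by simp) hneg
        (by linarith), fun hpos => key _ _ (by simp) (by simp)
        (hT'.of_eq (by simp) (by simp) (by simp) (by simp) (by simp) (by simp)) (by simp) (by simp)
        (by simp) (by simp) (by simp) (by simp) (by simp) hpos (by linarith)⟩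
  · rintro s' b' so hI hc
    obtain ⟨f', tr', i, hC, hF', hT', h63, hi, hiv, hle, hb'⟩ := (hLI _ _).1 hI
    have e57 : s'.nat 57 = s.nat 57 := by cases pull <;> exact (so.nat 57 rfl).trans (by simp)
    simp [h63, e57] at hc
    obtain rfl : i = s.nat 57 0 := by omega
    refine ⟨f', tr', hC, hF', hT', fun u hu => ?_, hle, ?_⟩
    · obtain ⟨i', hi', hui⟩ := hctx.near u hu
      exact hiv i' hi' u hui
    · simp at hb' ⊢
      linarith

end Drain

/-! ### Processing one net point. -/

section Net

variable {n d : ℕ} {P : Fin n → EuclideanSpace ℝ (Fin d)} {k : ℕ} {T : Quadtree P k} {K : ℕ}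
  {num : Net T ≃ Fin K} {μ : Fin n → ℝ} {B : ℝ} {order : List (Net T)}

lemma Trees.wt_nt {pt nt : Net T → List (Fin n × ℝ)} {tr : ℕ → Rope} (h : Trees num pt nt tr)
    (v : Net T) : (tr (num v + num v)).wt = weight (nt v) := by
  have := (num v).2
  rw [← Rope.weight_toList (h.nonneg _ (by omega)), h.nt, weight_toNat]

lemma Trees.wt_pt {pt nt : Net T → List (Fin n × ℝ)} {tr : ℕ → Rope} (h : Trees num pt nt tr)
    (v : Net T) : (tr (num v + num v + 1)).wt = weight (pt v) := by
  have := (num v).2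
  rw [← Rope.weight_toList (h.nonneg _ (by omega)), h.pt, weight_toNat]

lemma moved_nonneg {tr : ℕ → Rope} {M : ℕ} (h : ∀ i < M, (tr i).Nonneg) {src dst : ℕ} {t : ℝ}
    (hs : src < M) (hd : dst < M) (h0 : 0 ≤ t) (h1 : t ≤ (tr src).wt) :
    ∀ i < M, (moved tr src dst t i).Nonneg := by
  intro i hi
  obtain ⟨e1, e2⟩ := Rope.split_nonneg (h src hs) h0 h1
  rw [moved_apply]
  split_ifs
  · exact ⟨e1, h dst hd⟩
  · exact e2
  · exact h i hi

open Classical in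
-- The sequences of the net point with number `i` occupy the slots `2 * i` and `2 * i + 1`, so
-- parity separates the two kinds and distinct numbers separate the net points.
lemma Trees.move_pt {pt nt : Net T → List (Fin n × ℝ)} {tr : ℕ → Rope} (h : Trees num pt nt tr)
    {u v : Net T} (huv : u ≠ v) {t : ℝ} (h0 : 0 ≤ t) (h1 : t ≤ weight (pt v)) :
    Trees num (Function.update (Function.update pt v (prefixSplit (pt v) t).2) u
        ((prefixSplit (pt v) t).1 ++ pt u)) nt
      (moved tr (num v + num v + 1) (num u + num u + 1) t) := by
  have hv := (num v).2
  have hu := (num u).2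
  rw [← h.wt_pt] at h1
  have hsp := Rope.split_toList (h.nonneg (num v + num v + 1) (by omega)) h0 h1
  rw [h.pt, prefixSplit_toNat, Prod.ext_iff] at hsp
  simp only at hsp
  refine ⟨?_, moved_nonneg h.nonneg (by omega) (by omega) h0 h1, fun x => ?_, fun x => ?_⟩
  · rw [moved_apply, if_neg (by omega), if_neg (by omega), h.zero]
  · rw [moved_apply, if_neg (by omega), if_neg (by omega), h.nt]
  · have e : ∀ y : Net T, (num x + num x + 1 : ℕ) = num y + num y + 1 ↔ x = y := fun y => by
      rw [← num_val_inj (num := num)]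
      omega
    rw [moved_apply]
    simp only [e]
    by_cases hxu : x = u
    · subst hxu
      simp [Rope.toList_node, hsp.1, h.pt]
    · rw [if_neg hxu, Function.update_of_ne hxu]
      by_cases hxv : x = v
      · subst hxv
        simp [hsp.2]
      · rw [if_neg hxv, Function.update_of_ne hxv, h.pt]

open Classical in
lemma Trees.move_nt {pt nt : Net T → List (Fin n × ℝ)} {tr : ℕ → Rope} (h : Trees num pt nt tr)
    {u v : Net T} (huv : u ≠ v) {t : ℝ} (h0 : 0 ≤ t) (h1 : t ≤ weight (nt v)) :
    Trees num pt (Function.update (Function.update nt v (prefixSplit (nt v) t).2) u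
        ((prefixSplit (nt v) t).1 ++ nt u))
      (moved tr (num v + num v) (num u + num u) t) := by
  have hv := (num v).2
  have hu := (num u).2
  rw [← h.wt_nt] at h1
  have hsp := Rope.split_toList (h.nonneg (num v + num v) (by omega)) h0 h1
  rw [h.nt, prefixSplit_toNat, Prod.ext_iff] at hsp
  simp only at hsp
  refine ⟨?_, moved_nonneg h.nonneg (by omega) (by omega) h0 h1, fun x => ?_, fun x => ?_⟩
  · rw [moved_apply, if_neg (by omega), if_neg (by omega), h.zero]
  · have e : ∀ y : Net T, (num x + num x : ℕ) = num y + num y ↔ x = y := fun y => by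
      rw [← num_val_inj (num := num)]
      omega
    rw [moved_apply]
    simp only [e]
    by_cases hxu : x = u
    · subst hxu
      simp [Rope.toList_node, hsp.1, h.nt]
    · rw [if_neg hxu, Function.update_of_ne hxu]
      by_cases hxv : x = v
      · subst hxv
        simp [hsp.2]
      · rw [if_neg hxv, Function.update_of_ne hxv, h.nt]
  · rw [moved_apply, if_neg (by omega), if_neg (by omega), h.pt]

/-- Instance of `drainCmd_wp` where `C` says that the current state is reachable by steps of the
second loop. Reachability gives `Inv`, and thereby the weight bound that makes the split exact. -/
lemma pullCmd_wp (ho : ChildrenFirst order) {s : Store} {b : ℝ} {v : Net T} {rest : List (Net T)}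
    {f : Net T → Net T → ℝ} {g : Fin n → Fin n → ℝ} {pt nt : Net T → List (Fin n × ℝ)}
    {tr : ℕ → Rope} (hctx : NetCtx num s v) (hF : FlowSim num s f g)
    (hT : Forest s (K + K + 1) tr) (hTr : Trees num pt nt tr)
    (hinv : Inv μ B order ⟨v :: rest, .pull, f, g, pt, nt⟩) {lam R : ℝ} {Nmax : ℕ}
    (hN : forestLeaves (K + K + 1) tr + s.nat 57 0 ≤ Nmax)
    (hlam : Real.logb 2 Nmax ≤ lam) (hlam0 : 0 ≤ lam) (hR : 0 ≤ R)
    (hb : forestPot (K + K + 1) tr + (s.nat 57 0 : ℝ) * (4000 + 800 * lam) + 100 + R ≤ b) :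
    (drainCmd true).wp (fun s' b' => ∃ f' pt' tr',
      Relation.ReflTransGen Step ⟨v :: rest, .pull, f, g, pt, nt⟩
        ⟨v :: rest, .push, f', g, pt', nt⟩ ∧ FlowSim num s' f' g ∧
      Forest s' (K + K + 1) tr' ∧ Trees num pt' nt tr' ∧
      forestLeaves (K + K + 1) tr' ≤ forestLeaves (K + K + 1) tr + s.nat 57 0 ∧
      forestPot (K + K + 1) tr' + R ≤ b') s b := by
  refine Cmd.wp_conseq (drainCmd_wp true hctx (C := fun f' tr' => ∃ pt',
    Relation.ReflTransGen Step ⟨v :: rest, .pull, f, g, pt, nt⟩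
      ⟨v :: rest, .pull, f', g, pt', nt⟩ ∧ Trees num pt' nt tr') ⟨pt, .refl, hTr⟩ hF hT ?_ ?_ ?_
    hN hlam hlam0 hR hb) ?_
  · rintro f' tr' ⟨pt', h1, -⟩
    exact (hinv.reachable ho h1).self v
  · rintro f' tr' u ⟨pt', h1, h2⟩ hpos
    simp only [if_true] at hpos ⊢
    rw [h2.wt_pt]
    exact (hinv.reachable ho h1).weight_pt hpos
  · rintro f' tr' u ⟨pt', h1, h2⟩ hnear hpos huv
    simp only [if_true] at hpos ⊢
    exact ⟨_, h1.tail (.pull u _ hnear hpos rfl),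
      h2.move_pt huv hpos.le ((hinv.reachable ho h1).weight_pt hpos)⟩
  · rintro s' b' - ⟨f', tr', ⟨pt', h1, h2⟩, h3, h4, h5, h6, h7⟩
    refine ⟨f', pt', tr', h1.tail (.pull_exit ?_), h3, h4, h2, h6, h7⟩
    rintro ⟨u, hu, hpos⟩
    exact absurd (h5 u hu) (not_le.2 hpos)

lemma pushCmd_wp (ho : ChildrenFirst order) {s : Store} {b : ℝ} {v : Net T} {rest : List (Net T)}
    {f : Net T → Net T → ℝ} {g : Fin n → Fin n → ℝ} {pt nt : Net T → List (Fin n × ℝ)}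
    {tr : ℕ → Rope} (hctx : NetCtx num s v) (hF : FlowSim num s f g)
    (hT : Forest s (K + K + 1) tr) (hTr : Trees num pt nt tr)
    (hinv : Inv μ B order ⟨v :: rest, .push, f, g, pt, nt⟩) {lam R : ℝ} {Nmax : ℕ}
    (hN : forestLeaves (K + K + 1) tr + s.nat 57 0 ≤ Nmax)
    (hlam : Real.logb 2 Nmax ≤ lam) (hlam0 : 0 ≤ lam) (hR : 0 ≤ R)
    (hb : forestPot (K + K + 1) tr + (s.nat 57 0 : ℝ) * (4000 + 800 * lam) + 100 + R ≤ b) :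
    (drainCmd false).wp (fun s' b' => ∃ f' nt' tr',
      Relation.ReflTransGen Step ⟨v :: rest, .push, f, g, pt, nt⟩
        ⟨v :: rest, .pair, f', g, pt, nt'⟩ ∧ FlowSim num s' f' g ∧
      Forest s' (K + K + 1) tr' ∧ Trees num pt nt' tr' ∧
      forestLeaves (K + K + 1) tr' ≤ forestLeaves (K + K + 1) tr + s.nat 57 0 ∧
      forestPot (K + K + 1) tr' + R ≤ b') s b := by
  refine Cmd.wp_conseq (drainCmd_wp false hctx (C := fun f' tr' => ∃ nt',
    Relation.ReflTransGen Step ⟨v :: rest, .push, f, g, pt, nt⟩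
      ⟨v :: rest, .push, f', g, pt, nt'⟩ ∧ Trees num pt nt' tr') ⟨nt, .refl, hTr⟩ hF hT ?_ ?_ ?_
    hN hlam hlam0 hR hb) ?_
  · rintro f' tr' ⟨pt', h1, -⟩
    exact (hinv.reachable ho h1).self v
  · rintro f' tr' u ⟨pt', h1, h2⟩ hpos
    simp only [Bool.false_eq_true, if_false, add_zero] at hpos ⊢
    rw [h2.wt_nt]
    exact (hinv.reachable ho h1).weight_nt
  · rintro f' tr' u ⟨pt', h1, h2⟩ hnear hpos huv
    simp only [Bool.false_eq_true, if_false, add_zero] at hpos ⊢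
    exact ⟨_, h1.tail (.push u _ hnear hpos rfl),
      h2.move_nt huv hpos.le ((hinv.reachable ho h1).weight_nt)⟩
  · rintro s' b' - ⟨f', tr', ⟨pt', h1, h2⟩, h3, h4, h5, h6, h7⟩
    refine ⟨f', pt', tr', h1.tail (.push_exit ?_), h3, h4, h2, h6, h7⟩
    rintro ⟨u, hu, hpos⟩
    exact absurd (h5 u hu) (not_le.2 hpos)

/-! ### The last loop -/

lemma arr₂_drop {a : ℕ → ℕ} {r : ℕ → ℝ} {c i : ℕ} (h : i < c) :
    (arr₂ a r c).drop i = (a i, r i) :: (arr₂ a r c).drop (i + 1) := by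
  rw [List.drop_eq_getElem_cons (by simpa [arr₂] using h)]
  simp [arr₂]

lemma arr₂_drop_congr {a a' : ℕ → ℕ} {r r' : ℕ → ℝ} {c i : ℕ} (h : ∀ j, i ≤ j → a' j = a j)
    (h' : ∀ j, i ≤ j → r' j = r j) : (arr₂ a' r' c).drop i = (arr₂ a r c).drop i := by
  refine List.ext_getElem (by simp [arr₂]) fun j hj _ => ?_
  simp [arr₂, h (i + j) (by omega), h' (i + j) (by omega)]

lemma arr₂_drop_self (a : ℕ → ℕ) (r : ℕ → ℝ) (c : ℕ) : (arr₂ a r c).drop c = [] := by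
  simp [arr₂]

/-- Sends the flow in real variable `9` from the point `65` to the point `66`. -/
def sendCmd : Cmd := block [
  setVar 55 (var 65), setVar 56 (var 66), setRvar 7 (rvar 9), addEdge,
  .nset 27 (var 59) (var 65), .nset 28 (var 59) (var 66), setVar 59 (.add (var 59) (.lit 1))]

/-- The log may list a pair repeatedly and in either direction. It only has to cover all pairs with
flow, so that the output need not scan the whole matrix. -/
lemma sendCmd_wp {s : Store} {b : ℝ} {f : Net T → Net T → ℝ} {g : Fin n → Fin n → ℝ} {p q : Fin n}
    {δ : ℝ} (hoff : Offsets s (n + K)) (hF : FlowSim num s f g) (hL : LogSim n s g)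
    (hp : s.nat 65 0 = p) (hq : s.nat 66 0 = q) (hδ : s.real 9 0 = δ) :
    sendCmd.wp (fun s' b' => FlowSim num s' f (addFlow g p q δ) ∧ LogSim n s' (addFlow g p q δ) ∧
      s'.nat 59 0 = s.nat 59 0 + 1 ∧ b - 100 ≤ b') s b := by
  simp only [sendCmd, block, wp_seq, wp_nset, wp_rset]
  refine Cmd.wp_conseq (addEdge_point (f := f) (g := g) (p := p) (q := q) (δ := δ)
    (fun i hi => by simpa using hoff i hi)
    (hF.of_eq (by simp) (by simp)) (by simp [hp]) (by simp [hq]) (by simp [hδ])) ?_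
  rintro s₁ b₁ so₁ ⟨h1, c1⟩
  have a59 : s₁.nat 59 = s.nat 59 := (so₁.nat 59 rfl).trans (by simp)
  have a27 : s₁.nat 27 = s.nat 27 := (so₁.nat 27 rfl).trans (by simp)
  have a28 : s₁.nat 28 = s.nat 28 := (so₁.nat 28 rfl).trans (by simp)
  have a65 : s₁.nat 65 0 = p := by rw [so₁.nat 65 rfl]; simp [hp]
  have a66 : s₁.nat 66 0 = q := by rw [so₁.nat 66 rfl]; simp [hq]
  simp only [wp_seq, wp_nset]
  refine ⟨h1.of_eq (by simp) (by simp), ⟨fun i hi => ?_, fun x y hxy => ?_⟩, by simp [a59], ?_⟩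
  · simp [a59] at hi
    simp [a59, a65, a66, a27, a28]
    rcases Nat.lt_or_eq_of_le hi with h | rfl
    · rw [if_neg h.ne, if_neg h.ne]
      exact hL.lt i h
    · simp
  · have hcase : g x y ≠ 0 ∨ (x = p ∧ y = q) ∨ (x = q ∧ y = p) := by
      by_contra! hcon
      apply hxy
      rw [addFlow_apply, if_neg (fun h => hcon.2.1 h.1 h.2), if_neg (fun h => hcon.2.2 h.1 h.2),
        hcon.1]
      ring
    rcases hcase with h | h
    · obtain ⟨i, hi, hor⟩ := hL.mem x y h
      refine ⟨i, ?_, ?_⟩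
      · simp [a59]
        omega
      · simpa [a59, a65, a66, a27, a28, hi.ne] using hor
    · refine ⟨s.nat 59 0, by simp [a59], ?_⟩
      simp [a59, a65, a66]
      rcases h with ⟨rfl, rfl⟩ | ⟨rfl, rfl⟩ <;> simp
  · simp at c1 ⊢
    linarith

def pairCmd : Cmd := block [
  setVar 46 (.get 21 (.add (var 61) (var 61))), flattenCmd 25 4 52,
  setVar 46 (.get 21 (.add (.add (var 61) (var 61)) (.lit 1))), flattenCmd 26 5 53,
  .nset 21 (.add (var 61) (var 61)) (.get 21 (.add (.get 0 (.lit 2)) (.get 0 (.lit 2)))),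
  .nset 21 (.add (.add (var 61) (var 61)) (.lit 1))
    (.get 21 (.add (.get 0 (.lit 2)) (.get 0 (.lit 2)))),
  setVar 63 (.lit 0), setVar 64 (.lit 0),
  .loop (.conj (.nle (.add (var 63) (.lit 1)) (var 52)) (.nle (.add (var 64) (.lit 1)) (var 53)))
    (block [
      setVar 65 (.get 25 (var 63)), setVar 66 (.get 26 (var 64)),
      .ite (.rle (.get 4 (var 63)) (.get 5 (var 64)))
        (block [
          setRvar 9 (.get 4 (var 63)),
          .ite (.rle (.get 5 (var 64)) (.get 4 (var 63))) (setVar 64 (.add (var 64) (.lit 1)))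
            (.rset 5 (var 64) (.sub (.get 5 (var 64)) (rvar 9))),
          setVar 63 (.add (var 63) (.lit 1))])
        (block [
          setRvar 9 (.get 5 (var 64)),
          .rset 4 (var 63) (.sub (.get 4 (var 63)) (rvar 9)),
          setVar 64 (.add (var 64) (.lit 1))]),
      sendCmd])]

open Classical in
-- The potential of the two dissolved ropes pays for flattening them, for the pairings, and for
-- `300` credits left with every new log entry.
lemma pairCmd_wp {s : Store} {b : ℝ} {v : Net T} {rest : List (Net T)}
    {f : Net T → Net T → ℝ} {g : Fin n → Fin n → ℝ} {pt nt : Net T → List (Fin n × ℝ)}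
    {tr : ℕ → Rope} (ho : ChildrenFirst order) (hctx : NetCtx num s v) (hF : FlowSim num s f g)
    (hL : LogSim n s g) (hT : Forest s (K + K + 1) tr) (hTr : Trees num pt nt tr)
    (hinv : Inv μ B order ⟨v :: rest, .pair, f, g, pt, nt⟩) {R : ℝ} (hR : 0 ≤ R)
    (hb : forestPot (K + K + 1) tr + 10000 + 300 * (s.nat 59 0 : ℝ) + R ≤ b) :
    pairCmd.wp (fun s' b' => ∃ g' pt' nt' tr',
      Relation.ReflTransGen Step ⟨v :: rest, .pair, f, g, pt, nt⟩
        ⟨rest, .cancel, f, g', pt', nt'⟩ ∧ FlowSim num s' f g' ∧ LogSim n s' g' ∧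
      Forest s' (K + K + 1) tr' ∧ Trees num pt' nt' tr' ∧
      forestLeaves (K + K + 1) tr' ≤ forestLeaves (K + K + 1) tr ∧
      forestPot (K + K + 1) tr' + 300 * (s'.nat 59 0 : ℝ) + R ≤ b') s b := by
  have hv := (num v).2
  set vN : ℕ := ((num v : Fin K) : ℕ) with hvN
  set r₁ := tr (vN + vN) with hr₁
  set r₂ := tr (vN + vN + 1) with hr₂
  -- Both slots are reset to the empty rope in slot `K + K` before the pairing begins; from then on
  -- the sequences live in plain arrays.
  set tr' := Function.update (Function.update tr (vN + vN) (.leaf 0 0)) (vN + vN + 1) (.leaf 0 0)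
    with htr'
  have hpot : forestPot (K + K + 1) tr' + r₁.pot 160 2000 + r₂.pot 160 2000
      = forestPot (K + K + 1) tr := by
    rw [htr', forestPot_update (by omega), forestPot_update (by omega),
      Function.update_of_ne (by omega)]
    simp only [Rope.pot]
    ring
  have hleaves : forestLeaves (K + K + 1) tr' ≤ forestLeaves (K + K + 1) tr := by
    have e1 := forestLeaves_update (tr := tr) (M := K + K + 1) (i := vN + vN) (by omega)
      (.leaf 0 0)
    have e2 := forestLeaves_update (tr := Function.update tr (vN + vN) (.leaf 0 0))
      (M := K + K + 1) (i := vN + vN + 1) (by omega) (.leaf 0 0)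
    rw [Function.update_of_ne (by omega)] at e2
    have e3 := (tr (vN + vN)).leaves_pos
    have e4 := (tr (vN + vN + 1)).leaves_pos
    simp only [Rope.leaves] at e1 e2
    rw [htr']
    omega
  have hp1 := r₁.leaves_le_pot
  have hp2 := r₂.leaves_le_pot
  have hl1 := Rope.cast_leaves_pos r₁
  have hl2 := Rope.cast_leaves_pos r₂
  have hpos' := forestPot_nonneg (K + K + 1) tr'
  have hcnt : (0 : ℝ) ≤ s.nat 59 0 := Nat.cast_nonneg _
  simp only [pairCmd, block, wp_seq, wp_nset]
  refine Cmd.wp_conseq (flattenCmd_wp (t := r₁) (N := s.nat 40 0)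
    (Or.inl ⟨rfl, rfl, rfl⟩) ?_ ?_) ?_
  · simpa [hctx.num_eq] using (hT (vN + vN) (by omega)).1.mono
      (.of_eq (by simp) (by simp) (by simp) (by simp) _) le_rfl
  · simp
    linarith
  rintro s₁ b₁ so₁ ⟨a1, c1⟩
  have hT₁ : Forest s₁ (K + K + 1) tr := hT.of_eq ((so₁.nat 18 rfl).trans (by simp))
    ((so₁.nat 19 rfl).trans (by simp)) ((so₁.nat 20 rfl).trans (by simp))
    ((so₁.nat 21 rfl).trans (by simp)) ((so₁.nat 40 rfl).trans (by simp))
    ((so₁.real 3 rfl).trans (by simp))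
  have k1 : ∀ a ∈ [0, 10, 17, 57, 59, 61, 62, 27, 28], s₁.nat a = s.nat a := by
    intro a ha
    fin_cases ha <;> exact (so₁.nat _ rfl).trans (by simp)
  have k1r : s₁.real 2 = s.real 2 := (so₁.real 2 rfl).trans (by simp)
  have n61 : s₁.nat 61 0 = vN := by rw [k1 61 (by simp), hctx.num_eq]
  simp only [wp_seq, wp_nset]
  refine Cmd.wp_conseq (flattenCmd_wp (t := r₂) (N := s₁.nat 40 0)
    (Or.inr ⟨rfl, rfl, rfl⟩) ?_ ?_) ?_
  · simpa [n61] using (hT₁ (vN + vN + 1) (by omega)).1.mono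
      (.of_eq (by simp) (by simp) (by simp) (by simp) _) le_rfl
  · simp at c1 ⊢
    linarith
  rintro s₂ b₂ so₂ ⟨a2, c2⟩
  have hT₂ : Forest s₂ (K + K + 1) tr := hT₁.of_eq ((so₂.nat 18 rfl).trans (by simp))
    ((so₂.nat 19 rfl).trans (by simp)) ((so₂.nat 20 rfl).trans (by simp))
    ((so₂.nat 21 rfl).trans (by simp)) ((so₂.nat 40 rfl).trans (by simp))
    ((so₂.real 3 rfl).trans (by simp))
  have k2 : ∀ a ∈ [0, 10, 17, 57, 59, 61, 62, 27, 28], s₂.nat a = s.nat a := by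
    intro a ha
    rw [← k1 a ha]
    fin_cases ha <;> exact (so₂.nat _ rfl).trans (by simp)
  have k2r : s₂.real 2 = s.real 2 := ((so₂.real 2 rfl).trans (by simp)).trans k1r
  replace a1 : arr₂ (s₂.nat 25) (s₂.real 4) (s₂.nat 52 0) = r₁.toList := by
    rw [← a1, so₂.nat 25 rfl, so₂.real 4 rfl, so₂.nat 52 rfl]
    simp
  set N₁ := s₂.nat 52 0 with hN₁
  set N₂ := s₂.nat 53 0 with hN₂
  have hN₁le : (N₁ : ℝ) ≤ r₁.leaves := by
    have := r₁.length_toList_le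
    rw [← a1] at this
    simp only [arr₂, List.length_map, List.length_range] at this
    exact_mod_cast this
  have hN₂le : (N₂ : ℝ) ≤ r₂.leaves := by
    have := r₂.length_toList_le
    rw [← a2] at this
    simp only [arr₂, List.length_map, List.length_range] at this
    exact_mod_cast this
  rw [hTr.nt] at a1
  rw [hTr.pt] at a2
  have n61' : s₂.nat 61 0 = vN := by rw [k2 61 (by simp), hctx.num_eq]
  have nK : s₂.nat 0 2 = K := by rw [k2 0 (by simp), hctx.K_eq]
  simp only [wp_seq, wp_nset]
  -- The parts of the arrays from the pointers on are the current sequences; a partly used node is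
  -- kept with its weight reduced in place.
  obtain ⟨LI, hLI⟩ : ∃ LI : Store → ℝ → Prop, ∀ s' b', LI s' b' ↔ ∃ g' NL PL i j,
    Relation.ReflTransGen Step ⟨v :: rest, .pair, f, g, pt, nt⟩
      ⟨v :: rest, .pair, f, g', Function.update pt v PL, Function.update nt v NL⟩ ∧
    FlowSim num s' f g' ∧ LogSim n s' g' ∧ s'.nat 63 0 = i ∧ s'.nat 64 0 = j ∧
    (arr₂ (s'.nat 25) (s'.real 4) N₁).drop i = NL.map toNat ∧
    (arr₂ (s'.nat 26) (s'.real 5) N₂).drop j = PL.map toNat ∧ i ≤ N₁ ∧ j ≤ N₂ ∧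
    forestPot (K + K + 1) tr' + 300 * (s'.nat 59 0 : ℝ) + 600 * ((N₁ : ℝ) + N₂ - i - j) + 50 + R
      ≤ b' := ⟨_, fun _ _ => Iff.rfl⟩
  refine Cmd.wp_loop LI ((hLI _ _).2 ⟨g, nt v, pt v, 0, 0, ?_, ?_, ?_, by simp, by simp, ?_, ?_,
    Nat.zero_le _, Nat.zero_le _, ?_⟩) ?_ ?_ ?_
  · rw [Function.update_eq_self, Function.update_eq_self]
  · exact hF.of_eq (by simp [k2]) (by simp [k2r])
  · exact hL.of_eq (by simp [k2]) (by simp [k2]) (by simp [k2])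
  · simpa using a1
  · simpa using a2
  · simp [k2] at c1 c2 ⊢
    linarith
  · intro s' b' hI
    obtain ⟨g', NL, PL, i, j, -, -, -, -, -, -, -, hi, hj, h⟩ := (hLI _ _).1 hI
    have e1 : (i : ℝ) ≤ N₁ := by exact_mod_cast hi
    have e2 : (j : ℝ) ≤ N₂ := by exact_mod_cast hj
    have e3 : (0 : ℝ) ≤ s'.nat 59 0 := Nat.cast_nonneg _
    linarith
  · rintro s' b' so hI hc
    obtain ⟨g', NL, PL, i, j, hreach, hF', hL', h63, h64, hNL, hPL, hi, hj, hb'⟩ := (hLI _ _).1 hI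
    have e52 : s'.nat 52 0 = N₁ := by rw [so.nat 52 rfl]; simp [hN₁]
    have e53 : s'.nat 53 0 = N₂ := by rw [so.nat 53 rfl]; simp [hN₂]
    have e10 : s'.nat 10 = s.nat 10 := (so.nat 10 rfl).trans (by simp [k2])
    simp [h63, h64, e52, e53] at hc
    obtain ⟨hi1, hj1⟩ := hc
    rw [arr₂_drop hi1] at hNL
    rw [arr₂_drop hj1] at hPL
    obtain ⟨⟨p, a⟩, NB, rfl, hpa, hNB⟩ := List.map_eq_cons_iff.1 hNL.symm
    obtain ⟨⟨q, a'⟩, PB, rfl, hqa, hPB⟩ := List.map_eq_cons_iff.1 hPL.symm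
    simp only [toNat, Prod.mk.injEq] at hpa hqa
    have key : ∀ (s₃ : Store) (b₃ : ℝ) (i₃ j₃ : ℕ), s₃.nat 10 = s'.nat 10 →
        s₃.real 2 = s'.real 2 → s₃.nat 59 = s'.nat 59 → s₃.nat 27 = s'.nat 27 →
        s₃.nat 28 = s'.nat 28 → s₃.nat 65 0 = p → s₃.nat 66 0 = q →
        s₃.real 9 0 = min a a' → s₃.nat 63 0 = i₃ → s₃.nat 64 0 = j₃ →
        (arr₂ (s₃.nat 25) (s₃.real 4) N₁).drop i₃
          = (if a - min a a' = 0 then NB else (p, a - min a a') :: NB).map toNat →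
        (arr₂ (s₃.nat 26) (s₃.real 5) N₂).drop j₃
          = (if a' - min a a' = 0 then PB else (q, a' - min a a') :: PB).map toNat →
        i₃ ≤ N₁ → j₃ ≤ N₂ → i + j + 1 ≤ i₃ + j₃ → b' - 150 ≤ b₃ → sendCmd.wp LI s₃ b₃ := by
      intro s₃ b₃ i₃ j₃ m10 m2 m59 m27 m28 m65 m66 m9 m63 m64 mN mP mi mj mij mb
      refine Cmd.wp_conseq (sendCmd_wp (f := f) (g := g') (p := p) (q := q) ?_ (hF'.of_eq m10 m2)
        (hL'.of_eq m59 m27 m28) m65 m66 m9) ?_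
      · unfold Offsets; rw [m10, e10]; exact hctx.off
      rintro s₄ b₄ so₄ ⟨q1, q2, q3, q4⟩
      -- The program resolves the free choice of nodes by always pairing the first ones, hence the
      -- empty prefixes.
      have hstep := hreach.tail (Step.pair (rest := rest) p q a a' (min a a') [] NB [] PB
        (by simp) (by simp) rfl)
      simp only [Function.update_idem, List.nil_append] at hstep
      refine (hLI _ _).2 ⟨_, _, _, i₃, j₃, hstep, q1, q2, by rw [so₄.nat 63 rfl, m63],
        by rw [so₄.nat 64 rfl, m64], ?_, ?_, mi, mj, ?_⟩
      · rw [so₄.nat 25 rfl, so₄.real 4 rfl, mN]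
      · rw [so₄.nat 26 rfl, so₄.real 5 rfl, mP]
      · rw [q3, m59]
        have : (i : ℝ) + j + 1 ≤ i₃ + j₃ := by exact_mod_cast mij
        push_cast
        linarith
    simp only [wp_seq, wp_nset, wp_ite, wp_rset]
    simp [h63, h64, ← hpa.1, ← hpa.2, ← hqa.1, ← hqa.2]
    refine ⟨fun h1 => ⟨fun h2 => ?_, fun h2 => ?_⟩, fun h1 => ?_⟩
    · have e : a = a' := le_antisymm h1 h2
      refine key _ _ (i + 1) (j + 1) (by simp) (by simp) (by simp) (by simp) (by simp) (by simp)
        (by simp) (by simp [h1]) (by simp) (by simp) ?_ ?_ hi1 hj1 (by omega) (by linarith)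
      · rw [min_eq_left h1, sub_self, if_pos rfl, hNB]
        exact arr₂_drop_congr (by simp) (by simp)
      · rw [min_eq_right h2, sub_self, if_pos rfl, hPB]
        exact arr₂_drop_congr (by simp) (by simp)
    · refine key _ _ (i + 1) j (by simp) (by simp) (by simp) (by simp) (by simp) (by simp)
        (by simp) (by simp [h1]) (by simp) (by simp [h64]) ?_ ?_ hi1 hj (by omega) (by linarith)
      · rw [min_eq_left h1, sub_self, if_pos rfl, hNB]
        exact arr₂_drop_congr (by simp) (by simp)
      · rw [min_eq_left h1, if_neg (by linarith), arr₂_drop hj1, List.map_cons, hPB]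
        congr 1
        · simp [toNat, hqa.1]
        · refine arr₂_drop_congr (by simp) fun x hx => ?_
          have : x ≠ j := by omega
          simp [this]
    · refine key _ _ i (j + 1) (by simp) (by simp) (by simp) (by simp) (by simp) (by simp)
        (by simp) (by simp [h1.le]) (by simp [h63]) (by simp) ?_ ?_ hi hj1 (by omega) (by linarith)
      · rw [min_eq_right h1.le, if_neg (by linarith), arr₂_drop hi1, List.map_cons, hNB]
        congr 1
        · simp [toNat, hpa.1]
        · refine arr₂_drop_congr (by simp) fun x hx => ?_
          have : x ≠ i := by omega
          simp [this]
      · rw [min_eq_right h1.le, sub_self, if_pos rfl, hPB]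
        exact arr₂_drop_congr (by simp) (by simp)
  · rintro s' b' so hI hc
    obtain ⟨g', NL, PL, i, j, hreach, hF', hL', h63, h64, hNL, hPL, hi, hj, hb'⟩ := (hLI _ _).1 hI
    have e52 : s'.nat 52 0 = N₁ := by rw [so.nat 52 rfl]; simp [hN₁]
    have e53 : s'.nat 53 0 = N₂ := by rw [so.nat 53 rfl]; simp [hN₂]
    have hcase : i = N₁ ∨ j = N₂ := by
      simp only [BExp.holds, NExp.eval, h63, h64, e52, e53] at hc
      by_contra! hcon
      exact hc ⟨by omega, by omega⟩
    have hemp : Function.update nt v NL v = [] ∨ Function.update pt v PL v = [] := by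
      rw [Function.update_self, Function.update_self]
      rcases hcase with rfl | rfl
      · rw [arr₂_drop_self] at hNL
        exact Or.inl (List.map_eq_nil_iff.1 hNL.symm)
      · rw [arr₂_drop_self] at hPL
        exact Or.inr (List.map_eq_nil_iff.1 hPL.symm)
    obtain ⟨-, h1, h2⟩ := (hinv.reachable ho hreach).pair_exit hemp
    rw [Function.update_self] at h1 h2
    subst h1
    subst h2
    refine ⟨g', _, _, tr', hreach.tail (Step.pair_exit hemp), hF', hL', ?_, ?_, hleaves, ?_⟩
    · have hT₃ : ∀ x < K + K + 1, (tr' x).At s₂ (s₂.nat 40 0)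
          (if x = vN + vN ∨ x = vN + vN + 1 then s₂.nat 21 (K + K) else s₂.nat 21 x) ∧
          (tr' x).Nonneg := by
        intro x hx
        have h0 := hT₂ (K + K) (by omega)
        rw [hTr.zero] at h0
        rw [htr']
        by_cases hx1 : x = vN + vN + 1
        · rw [hx1, Function.update_self, if_pos (Or.inr rfl)]
          exact h0
        · rw [Function.update_of_ne hx1]
          by_cases hx2 : x = vN + vN
          · rw [hx2, Function.update_self, if_pos (Or.inl rfl)]
            exact h0
          · rw [Function.update_of_ne hx2, if_neg (by omega)]
            exact hT₂ x hx
      intro x hx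
      have e21 : s'.nat 21 x
          = if x = vN + vN ∨ x = vN + vN + 1 then s₂.nat 21 (K + K) else s₂.nat 21 x := by
        rw [so.nat 21 rfl]
        simp [n61', nK]
        by_cases hx1 : x = vN + vN + 1
        · simp [hx1]
        · simp [hx1]
      have e40 : s'.nat 40 0 = s₂.nat 40 0 := by rw [so.nat 40 rfl]; simp
      rw [e21, e40]
      refine ⟨(hT₃ x hx).1.mono (.of_eq ?_ ?_ ?_ ?_ _) le_rfl, (hT₃ x hx).2⟩
      · exact (so.nat 18 rfl).trans (by simp)
      · exact (so.nat 19 rfl).trans (by simp)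
      · exact (so.nat 20 rfl).trans (by simp)
      · exact (so.real 3 rfl).trans (by simp)
    · have hleaf : (Rope.leaf 0 0).toList = [] := by simp [Rope.toList]
      refine ⟨?_, fun x hx => ?_, fun x => ?_, fun x => ?_⟩
      · rw [htr', Function.update_of_ne (by omega), Function.update_of_ne (by omega), hTr.zero]
      · rw [htr']
        by_cases hx1 : x = vN + vN + 1
        · rw [hx1, Function.update_self]
          exact le_refl (0 : ℝ)
        · rw [Function.update_of_ne hx1]
          by_cases hx2 : x = vN + vN
          · rw [hx2, Function.update_self]
            exact le_refl (0 : ℝ)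
          · rw [Function.update_of_ne hx2]
            exact hTr.nonneg x hx
      · rw [htr', Function.update_of_ne (by omega)]
        by_cases hx : x = v
        · subst hx
          rw [Function.update_self, Function.update_self, hleaf]
          rfl
        · have : (num x : ℕ) ≠ vN := fun h => hx (num_val_inj.1 h)
          rw [Function.update_of_ne (by omega), Function.update_of_ne hx, hTr.nt]
      · by_cases hx : x = v
        · subst hx
          rw [htr', Function.update_self, Function.update_self, hleaf]
          rfl
        · have : (num x : ℕ) ≠ vN := fun h => hx (num_val_inj.1 h)
          rw [htr', Function.update_of_ne (by omega), Function.update_of_ne (by omega),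
            Function.update_of_ne hx, hTr.pt]
    · have e1 : (i : ℝ) ≤ N₁ := by exact_mod_cast hi
      have e2 : (j : ℝ) ≤ N₂ := by exact_mod_cast hj
      simp
      linarith

/-- Processes the net point `61`. -/
def netCmd : Cmd := block [
  setVar 62 (.add (var 0) (var 61)), cancelCmd, drainCmd true, drainCmd false, pairCmd]

/-- `hctx` is stated for every memory that agrees on the listed arrays, because the context is
needed anew at the start of each of the four loops. -/
lemma netCmd_wp {s : Store} {b : ℝ} {v : Net T} {rest : List (Net T)}
    {f : Net T → Net T → ℝ} {g : Fin n → Fin n → ℝ} {pt nt : Net T → List (Fin n × ℝ)}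
    {tr : ℕ → Rope} (ho : ChildrenFirst order)
    (hctx : ∀ s' : Store, (∀ a ∈ [0, 3, 10, 13, 14, 17, 57, 61], s'.nat a = s.nat a) →
      s'.nat 62 0 = n + num v → NetCtx num s' v)
    (hn : s.nat 0 0 = n) (hv : s.nat 61 0 = num v) (hF : FlowSim num s f g)
    (hL : LogSim n s g) (hT : Forest s (K + K + 1) tr) (hTr : Trees num pt nt tr)
    (hinv : Inv μ B order ⟨v :: rest, .cancel, f, g, pt, nt⟩) {lam R : ℝ} {Nmax : ℕ}
    (hN : forestLeaves (K + K + 1) tr + 2 * s.nat 57 0 ≤ Nmax)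
    (hlam : Real.logb 2 Nmax ≤ lam) (hlam0 : 0 ≤ lam) (hR : 0 ≤ R)
    (hb : forestPot (K + K + 1) tr + 300 * (s.nat 59 0 : ℝ)
      + ((s.nat 57 0 : ℝ) + 1) * (20000 + 1600 * lam) + R ≤ b) :
    netCmd.wp (fun s' b' => ∃ f' g' pt' nt' tr',
      Relation.ReflTransGen Step ⟨v :: rest, .cancel, f, g, pt, nt⟩
        ⟨rest, .cancel, f', g', pt', nt'⟩ ∧ FlowSim num s' f' g' ∧ LogSim n s' g' ∧
      Forest s' (K + K + 1) tr' ∧ Trees num pt' nt' tr' ∧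
      forestLeaves (K + K + 1) tr' ≤ forestLeaves (K + K + 1) tr + 2 * s.nat 57 0 ∧
      forestPot (K + K + 1) tr' + 300 * (s'.nat 59 0 : ℝ) + R ≤ b') s b := by
  have h57 : (0 : ℝ) ≤ s.nat 57 0 := Nat.cast_nonneg _
  have h59 : (0 : ℝ) ≤ s.nat 59 0 := Nat.cast_nonneg _
  have hX : (0 : ℝ) ≤ (s.nat 57 0 : ℝ) * (4000 + 800 * lam) := mul_nonneg h57 (by linarith)
  -- The budget splits into one share for each of the two moving loops and a remainder, which covers
  -- cancelling and the fixed costs.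
  have hXX : ((s.nat 57 0 : ℝ) + 1) * (20000 + 1600 * lam)
      = 2 * ((s.nat 57 0 : ℝ) * (4000 + 800 * lam)) + 12000 * (s.nat 57 0 : ℝ) + 20000 + 1600 * lam
      := by ring
  have hp := forestPot_nonneg (K + K + 1) tr
  simp only [netCmd, block, wp_seq, wp_nset]
  refine Cmd.wp_conseq (cancelCmd_wp ho (R := forestPot (K + K + 1) tr + 300 * (s.nat 59 0 : ℝ)
    + 2 * ((s.nat 57 0 : ℝ) * (4000 + 800 * lam)) + 15000 + R)
    (hctx _ (by simp) (by simp [hn, hv])) (hF.of_eq (by simp) (by simp)) hinv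
    (by linarith) ?_) ?_
  · simp
    linarith
  rintro s₁ b₁ so₁ ⟨f₁, r₁, hF₁, hb₁⟩
  have k1 : ∀ a ∈ [0, 3, 10, 13, 14, 17, 57, 61, 18, 19, 20, 21, 40, 59, 27, 28], s₁.nat a = s.nat a := by
    intro a ha
    fin_cases ha <;> exact (so₁.nat _ rfl).trans (by simp)
  have k62 : s₁.nat 62 0 = n + num v := by rw [so₁.nat 62 rfl]; simp [hn, hv]
  have hT₁ : Forest s₁ (K + K + 1) tr := hT.of_eq (k1 _ (by simp)) (k1 _ (by simp))
    (k1 _ (by simp)) (k1 _ (by simp)) (k1 _ (by simp)) ((so₁.real 3 rfl).trans (by simp))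
  have k57 : s₁.nat 57 = s.nat 57 := k1 _ (by simp)
  rw [wp_seq]
  refine Cmd.wp_conseq (pullCmd_wp ho (lam := lam) (Nmax := Nmax)
    (R := 300 * (s.nat 59 0 : ℝ) + (s.nat 57 0 : ℝ) * (4000 + 800 * lam) + 14000 + R)
    (hctx _ (fun a ha => k1 a ((by decide : ∀ a ∈ [0, 3, 10, 13, 14, 17, 57, 61],
      a ∈ [0, 3, 10, 13, 14, 17, 57, 61, 18, 19, 20, 21, 40, 59, 27, 28]) a ha)) k62) hF₁ hT₁ hTr
    (hinv.reachable ho r₁) (by rw [k57]; omega) hlam hlam0 (by linarith)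
    (by rw [k57]; linarith)) ?_
  rintro s₂ b₂ so₂ ⟨f₂, pt₂, tr₂, r₂, hF₂, hT₂, hTr₂, hl₂, hb₂⟩
  have k2 : ∀ a ∈ [0, 3, 10, 13, 14, 17, 57, 61, 59, 27, 28], s₂.nat a = s.nat a := by
    intro a ha
    rw [← k1 a ((by decide : ∀ a ∈ [0, 3, 10, 13, 14, 17, 57, 61, 59, 27, 28],
      a ∈ [0, 3, 10, 13, 14, 17, 57, 61, 18, 19, 20, 21, 40, 59, 27, 28]) a ha)]
    fin_cases ha <;> exact so₂.nat _ rfl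
  have k62' : s₂.nat 62 0 = n + num v := by rw [so₂.nat 62 rfl, k62]
  have k57' : s₂.nat 57 = s.nat 57 := k2 _ (by simp)
  rw [k57] at hl₂
  rw [wp_seq]
  refine Cmd.wp_conseq (pushCmd_wp ho (lam := lam) (Nmax := Nmax)
    (R := 300 * (s.nat 59 0 : ℝ) + 13000 + R)
    (hctx _ (fun a ha => k2 a ((by decide : ∀ a ∈ [0, 3, 10, 13, 14, 17, 57, 61],
      a ∈ [0, 3, 10, 13, 14, 17, 57, 61, 59, 27, 28]) a ha)) k62') hF₂ hT₂ hTr₂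
    (hinv.reachable ho (r₁.trans r₂)) (by rw [k57']; omega) hlam hlam0 (by linarith)
    (by rw [k57']; linarith)) ?_
  rintro s₃ b₃ so₃ ⟨f₃, nt₃, tr₃, r₃, hF₃, hT₃, hTr₃, hl₃, hb₃⟩
  have k3 : ∀ a ∈ [0, 3, 10, 13, 14, 17, 57, 61, 59, 27, 28], s₃.nat a = s.nat a := by
    intro a ha
    rw [← k2 a ha]
    fin_cases ha <;> exact so₃.nat _ rfl
  have k62'' : s₃.nat 62 0 = n + num v := by rw [so₃.nat 62 rfl, k62']
  rw [k57'] at hl₃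
  refine Cmd.wp_conseq (pairCmd_wp ho (R := R)
    (hctx _ (fun a ha => k3 a ((by decide : ∀ a ∈ [0, 3, 10, 13, 14, 17, 57, 61],
      a ∈ [0, 3, 10, 13, 14, 17, 57, 61, 59, 27, 28]) a ha)) k62'') hF₃
    (hL.of_eq (k3 _ (by simp)) (k3 _ (by simp)) (k3 _ (by simp))) hT₃ hTr₃
    (hinv.reachable ho ((r₁.trans r₂).trans r₃)) hR (by rw [k3 59 (by simp)]; linarith)) ?_
  rintro s₄ b₄ so₄ ⟨g₄, pt₄, nt₄, tr₄, r₄, hF₄, hL₄, hT₄, hTr₄, hl₄, hb₄⟩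
  exact ⟨f₃, g₄, pt₄, nt₄, tr₄, ((r₁.trans r₂).trans r₃).trans r₄, hF₄, hL₄, hT₄, hTr₄, by omega,
    hb₄⟩

end Net

/-! ### Processing the net points of one cell. -/

section CellLoop

variable {n d : ℕ} {P : Fin n → EuclideanSpace ℝ (Fin d)} {k : ℕ} {T : Quadtree P k} {K : ℕ}
  {num : Net T ≃ Fin K} {μ : Fin n → ℝ} {B : ℝ} {order : List (Net T)}

/-- A subcell contains an input point, and that point lies in only one piece of the parent cell. -/
lemma isParent_unique (hn : 2 ≤ n) (hP : Function.Injective P) (hT : T.Nested) {s t t' : Net T}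
    (h : s.IsParent t) (h' : s.IsParent t') : t = t' := by
  obtain ⟨p, -, hp⟩ := s.2
  obtain ⟨⟨c, j⟩, ht⟩ := t
  obtain ⟨⟨c', j'⟩, ht'⟩ := t'
  have hc : c = c' := by
    have := h.1.symm.trans h'.1
    simpa [Net.owner] using this
  subst hc
  have := Cell.piece_unique (sound hn hP hT c).side_pos (h.2 hp) (h'.2 hp)
  subst this
  rfl

lemma parent?_eq_some (hn : 2 ≤ n) (hP : Function.Injective P) (hT : T.Nested) (s t : Net T) :
    s.parent? = some t ↔ s.IsParent t := by
  unfold Net.parent?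
  constructor
  · intro h
    split_ifs at h with h1
    exact (Option.some.inj h) ▸ h1.choose_spec
  · intro h
    have h1 : ∃ t, s.IsParent t := ⟨t, h⟩
    rw [dif_pos h1]
    exact congrArg some (isParent_unique hn hP hT h1.choose_spec h)

/-- The memory represents the configuration. -/
structure Sim (num : Net T ≃ Fin K) (s : Store) (c : Config T) (tr : ℕ → Rope) : Prop where
  phase : c.phase = .cancel
  flow : FlowSim num s c.netFlow c.pointFlow
  log : LogSim n s c.pointFlow
  forest : Forest s (K + K + 1) tr
  trees : Trees num c.pt c.nt tr

lemma Sim.of_eq {s s' : Store} {c : Config T} {tr : ℕ → Rope} (h : Sim num s c tr)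
    (hnat : ∀ a ∈ [10, 18, 19, 20, 21, 27, 28, 40, 59], s'.nat a = s.nat a)
    (hreal : ∀ a ∈ [2, 3], s'.real a = s.real a) : Sim num s' c tr :=
  ⟨h.phase, h.flow.of_eq (hnat _ (by simp)) (hreal _ (by simp)),
    h.log.of_eq (hnat _ (by simp)) (hnat _ (by simp)) (hnat _ (by simp)),
    h.forest.of_eq (hnat _ (by simp)) (hnat _ (by simp)) (hnat _ (by simp)) (hnat _ (by simp))
      (hnat _ (by simp)) (hreal _ (by simp)), h.trees⟩

/-- The credits stored in the ropes and in the log. -/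
noncomputable def credits (K : ℕ) (s : Store) (tr : ℕ → Rope) : ℝ :=
  forestPot (K + K + 1) tr + 300 * (s.nat 59 0 : ℝ)

lemma credits_nonneg (K : ℕ) (s : Store) (tr : ℕ → Rope) : 0 ≤ credits K s tr :=
  add_nonneg (forestPot_nonneg _ _) (by positivity)

lemma netCmd_sim {s : Store} {b : ℝ} {v : Net T} {rest : List (Net T)} {c : Config T}
    {tr : ℕ → Rope} (ho : ChildrenFirst order)
    (hctx : ∀ s' : Store, (∀ a ∈ [0, 3, 10, 13, 14, 17, 57, 61], s'.nat a = s.nat a) →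
      s'.nat 62 0 = n + num v → NetCtx num s' v)
    (hn : s.nat 0 0 = n) (hv : s.nat 61 0 = num v) (hS : Sim num s c tr)
    (htodo : c.todo = v :: rest) (hinv : Inv μ B order c) {lam R : ℝ} {Nmax : ℕ}
    (hN : forestLeaves (K + K + 1) tr + 2 * s.nat 57 0 ≤ Nmax)
    (hlam : Real.logb 2 Nmax ≤ lam) (hlam0 : 0 ≤ lam) (hR : 0 ≤ R)
    (hb : credits K s tr + ((s.nat 57 0 : ℝ) + 1) * (20000 + 1600 * lam) + R ≤ b) :
    netCmd.wp (fun s' b' => ∃ c' tr', Relation.ReflTransGen Step c c' ∧ c'.todo = rest ∧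
      Sim num s' c' tr' ∧
      forestLeaves (K + K + 1) tr' ≤ forestLeaves (K + K + 1) tr + 2 * s.nat 57 0 ∧
      credits K s' tr' + R ≤ b') s b := by
  obtain ⟨todo, phase, f, g, pt, nt⟩ := c
  obtain ⟨hp, h1, h2, h3, h4⟩ := hS
  simp only at hp htodo h1 h2 h3 h4
  subst hp
  subst htodo
  refine Cmd.wp_conseq (netCmd_wp ho hctx hn hv h1 h2 h3 h4 hinv hN hlam hlam0 hR hb) ?_
  rintro s' b' - ⟨f', g', pt', nt', tr', q1, q2, q3, q4, q5, q6, q7⟩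
  exact ⟨_, tr', q1, rfl, ⟨rfl, q2, q3, q4, q5⟩, q6, q7⟩

/-- The part of the memory that remains the same while the cells are processed. The net points of
every cell are in a linked list. -/
structure Static (num : Net T ≃ Fin K) (blk : Fin T.numCells → List (Net T)) (s : Store) :
    Prop where
  n_eq : s.nat 0 0 = n
  K_eq : s.nat 0 2 = K
  off : Offsets s (n + K)
  parent : ∀ v : Net T, s.nat 3 (num v) = match v.parent? with
    | none => 0
    | some u => (num u : ℕ) + 1
  chain : ∀ c : Fin T.numCells, Chain (s.nat 14) (s.nat 13 c) ((blk c).map fun v => (num v : ℕ))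

lemma Static.of_eq {blk : Fin T.numCells → List (Net T)} {s s' : Store} (h : Static num blk s)
    (hnat : ∀ a ∈ [0, 3, 10, 13, 14], s'.nat a = s.nat a) : Static num blk s' := by
  refine ⟨?_, ?_, ?_, ?_, ?_⟩
  · rw [hnat 0 (by simp), h.n_eq]
  · rw [hnat 0 (by simp), h.K_eq]
  · unfold Offsets; rw [hnat 10 (by simp)]; exact h.off
  · rw [hnat 3 (by simp)]; exact h.parent
  · rw [hnat 13 (by simp), hnat 14 (by simp)]; exact h.chain

/-- The net point and its parent. -/
noncomputable def candidates (num : Net T ≃ Fin K) (v : Net T) : List ℕ :=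
  (num v : ℕ) :: match v.parent? with
    | none => []
    | some u => [(num u : ℕ)]

lemma mem_candidates {v : Net T} {x : ℕ} :
    x ∈ candidates num v ↔ x = num v ∨ ∃ u, v.parent? = some u ∧ x = num u := by
  unfold candidates
  cases v.parent? <;> simp

lemma length_candidates_le (v : Net T) : (candidates num v).length ≤ 2 := by
  unfold candidates
  cases v.parent? <;> simp

/-- Collects the net points of the cell `67` and their parents, and processes the net points. -/
def cellCmd : Cmd := block [
  setVar 57 (.lit 0), setVar 68 (.get 13 (var 67)),
  walk 14 68 69 (block [
    .nset 17 (var 57) (var 69), setVar 57 (.add (var 57) (.lit 1)),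
    .ite (.nle (.lit 1) (.get 3 (var 69)))
      (block [.nset 17 (var 57) (.sub (.get 3 (var 69)) (.lit 1)),
        setVar 57 (.add (var 57) (.lit 1))])
      .skip]),
  setVar 68 (.get 13 (var 67)),
  walk 14 68 61 netCmd]

/-- The array of candidates is the concatenation over the visited net points. Duplicates are not
removed, which keeps at most two entries per net point. -/
lemma collect_wp {blk : Fin T.numCells → List (Net T)} {s : Store} {b : ℝ} {c : Fin T.numCells}
    (hst : Static num blk s) (h57 : s.nat 57 0 = 0) (h68 : s.nat 68 0 = s.nat 13 c)
    {R : ℝ} (hR : 0 ≤ R) (hb : 100 * ((blk c).length : ℝ) + 20 + R ≤ b) :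
    (walk 14 68 69 (block [
      .nset 17 (var 57) (var 69), setVar 57 (.add (var 57) (.lit 1)),
      .ite (.nle (.lit 1) (.get 3 (var 69)))
        (block [.nset 17 (var 57) (.sub (.get 3 (var 69)) (.lit 1)),
          setVar 57 (.add (var 57) (.lit 1))])
        .skip])).wp (fun s' b' => arr (s'.nat 17) (s'.nat 57 0) = (blk c).flatMap (candidates num) ∧
          R ≤ b') s b := by
  refine Cmd.wp_conseq (walk_wp (by decide) (by decide) (by decide) (by decide) (by decide)
    (fun L s' b' => ∃ D Q : List (Net T), D ++ Q = blk c ∧ L = Q.map (fun v => (num v : ℕ)) ∧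
      arr (s'.nat 17) (s'.nat 57 0) = D.flatMap (candidates num) ∧
      100 * (Q.length : ℝ) + 20 + R ≤ b') ?_ ?_ (L := (blk c).map fun v => (num v : ℕ)) ?_ ?_ ?_) ?_
  · rintro L s' b' v ⟨D, Q, h1, h2, h3, h4⟩
    exact ⟨⟨D, Q, h1, h2, by simpa using h3, h4⟩, ⟨D, Q, h1, h2, by simpa using h3, h4⟩⟩
  · rintro L s' b' ⟨D, Q, h1, h2, h3, h4⟩
    have : (0 : ℝ) ≤ Q.length := Nat.cast_nonneg _
    linarith
  · exact ⟨[], blk c, rfl, rfl, by simp [h57, arr], hb⟩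
  · rw [h68]
    exact hst.chain c
  · rintro y L s' b' so - hy ⟨D, Q, h1, h2, h3, h4⟩
    obtain ⟨v, Q', rfl, hv, hQ⟩ := List.map_eq_cons_iff.1 h2.symm
    have e3 : s'.nat 3 = s.nat 3 := so.nat 3 rfl
    have hp := hst.parent v
    simp only [block, wp_seq, wp_nset, wp_ite, wp_skip]
    simp [e3, hy, ← hv]
    simp only [List.length_cons] at h4
    push_cast at h4
    have ecand : candidates num v = (num v : ℕ) :: match v.parent? with
      | none => []
      | some u => [(num u : ℕ)] := rfl
    constructor
    · intro h5
      refine ⟨D ++ [v], Q', by simpa using h1, hQ.symm, ?_, by linarith⟩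
      cases hpar : v.parent? with
      | none =>
        rw [hpar] at hp
        simp only at hp
        omega
      | some u =>
        rw [hpar] at hp ecand
        simp only at hp ecand
        simp only [arr_succ, List.flatMap_append, List.flatMap_singleton, ecand]
        rw [← h3, List.append_assoc]
        congr 1
        · refine arr_congr fun i hi => ?_
          simp [hi.ne, (Nat.lt_succ_of_lt hi).ne]
        · simp [hp]
    · intro h5
      refine ⟨D ++ [v], Q', by simpa using h1, hQ.symm, ?_, by linarith⟩
      cases hpar : v.parent? with
      | some u =>
        rw [hpar] at hp
        simp only at hp
        omega
      | none =>
        rw [hpar] at ecand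
        simp only at ecand
        simp only [arr_succ, List.flatMap_append, List.flatMap_singleton, ecand]
        rw [← h3]
        congr 1
        · refine arr_congr fun i hi => ?_
          simp [hi.ne]
        · simp
  · rintro s' b' - ⟨D, Q, h1, h2, h3, h4⟩
    obtain rfl : Q = [] := List.map_eq_nil_iff.1 h2.symm
    rw [List.append_nil] at h1
    rw [h1] at h3
    simp at h4
    exact ⟨h3, by linarith⟩

/-- The same array of candidates serves every net point of the cell, because `Near` depends on `v`
only through its cell. -/
lemma netCtx_of_candidates {blk : Fin T.numCells → List (Net T)} {s : Store} {c : Fin T.numCells}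
    {v : Net T} (hst : Static num blk s) (hblk : ∀ v, v ∈ blk c ↔ v.owner = c)
    (hpar : ∀ u w : Net T, u.parent? = some w ↔ u.IsParent w) (hv : v ∈ blk c)
    (harr : arr (s.nat 17) (s.nat 57 0) = (blk c).flatMap (candidates num))
    (h61 : s.nat 61 0 = num v) (h62 : s.nat 62 0 = n + num v) : NetCtx num s v := by
  have hvc := (hblk v).1 hv
  refine ⟨hst.n_eq, hst.K_eq, hst.off, h61, h62, fun i hi => ?_, fun u hu => ?_⟩
  · have h1 : s.nat 17 i ∈ (blk c).flatMap (candidates num) := by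
      rw [← harr]
      exact mem_arr.2 ⟨i, hi, rfl⟩
    obtain ⟨w, hw, h2⟩ := List.mem_flatMap.1 h1
    have hwc := (hblk w).1 hw
    rcases mem_candidates.1 h2 with h3 | ⟨u, h3, h4⟩
    · exact ⟨w, Or.inl (hwc.trans hvc.symm), h3⟩
    · exact ⟨u, Or.inr ⟨w, hwc.trans hvc.symm, (hpar w u).1 h3⟩, h4⟩
  · have h1 : (num u : ℕ) ∈ arr (s.nat 17) (s.nat 57 0) := by
      rw [harr]
      rcases hu with h2 | ⟨w, h2, h3⟩
      · exact List.mem_flatMap.2 ⟨u, (hblk u).2 (h2.trans hvc), mem_candidates.2 (Or.inl rfl)⟩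
      · exact List.mem_flatMap.2 ⟨w, (hblk w).2 (h2.trans hvc),
          mem_candidates.2 (Or.inr ⟨u, (hpar w u).2 h3, rfl⟩)⟩
    exact mem_arr.1 h1

/-- The number of operations for a cell with at most `q` net points. -/
noncomputable def cellCost (q : ℕ) (lam : ℝ) : ℝ :=
  100 * q + 100 + q * ((2 * q + 1) * (20000 + 1600 * lam) + 30)

lemma cellCost_nonneg (q : ℕ) {lam : ℝ} (h : 0 ≤ lam) : 0 ≤ cellCost q lam := by
  unfold cellCost
  positivity

/-- A cell has at most `q` net points and `2 * q` candidates. Each net point adds at most two leaves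
per candidate, hence `4 * q * q` new leaves for the cell. -/
lemma cellCmd_wp {blk : Fin T.numCells → List (Net T)} {s : Store} {b : ℝ} {cl : Fin T.numCells}
    {rest : List (Net T)} {c : Config T} {tr : ℕ → Rope} {q : ℕ} (ho : ChildrenFirst order)
    (hst : Static num blk s) (hblk : ∀ v, v ∈ blk cl ↔ v.owner = cl)
    (hpar : ∀ u w : Net T, u.parent? = some w ↔ u.IsParent w) (hq : (blk cl).length ≤ q)
    (h67 : s.nat 67 0 = cl) (hS : Sim num s c tr) (htodo : c.todo = blk cl ++ rest)
    (hinv : Inv μ B order c) {lam R : ℝ} {Nmax : ℕ}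
    (hN : forestLeaves (K + K + 1) tr + 4 * q * q ≤ Nmax)
    (hlam : Real.logb 2 Nmax ≤ lam) (hlam0 : 0 ≤ lam) (hR : 0 ≤ R)
    (hb : credits K s tr + cellCost q lam + R ≤ b) :
    cellCmd.wp (fun s' b' => ∃ c' tr', Relation.ReflTransGen Step c c' ∧ c'.todo = rest ∧
      Sim num s' c' tr' ∧
      forestLeaves (K + K + 1) tr' ≤ forestLeaves (K + K + 1) tr + 4 * q * q ∧
      credits K s' tr' + R ≤ b') s b := by
  unfold cellCost at hb
  set X : ℝ := (2 * q + 1) * (20000 + 1600 * lam) + 30 with hX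
  have hX0 : 0 ≤ X := by positivity
  have hq' : ((blk cl).length : ℝ) ≤ q := by exact_mod_cast hq
  have hqX : ((blk cl).length : ℝ) * X ≤ q * X := mul_le_mul_of_nonneg_right hq' hX0
  have hqX0 : 0 ≤ (q : ℝ) * X := by positivity
  have hcred := credits_nonneg K s tr
  unfold cellCmd
  simp only [block, wp_seq, wp_nset]
  refine Cmd.wp_conseq (collect_wp (c := cl) (R := credits K s tr + 60 + q * X + R)
    (hst.of_eq (by simp)) (by simp) (by simp [h67]) (by linarith) ?_) ?_
  · simp
    linarith
  rintro s₁ b₁ so₁ ⟨harr, hb₁⟩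
  have k1 : ∀ a ∈ [0, 3, 10, 13, 14, 18, 19, 20, 21, 27, 28, 40, 59], s₁.nat a = s.nat a := by
    intro a ha
    fin_cases ha <;> exact (so₁.nat _ rfl).trans (by simp)
  have k67 : s₁.nat 67 0 = cl := by rw [so₁.nat 67 rfl]; simp [h67]
  have kr : ∀ a ∈ [2, 3], s₁.real a = s.real a := by
    intro a ha
    fin_cases ha <;> exact (so₁.real _ rfl).trans (by simp)
  have hst₁ : Static num blk s₁ := hst.of_eq fun a ha => k1 a ((by decide :
    ∀ a ∈ [0, 3, 10, 13, 14], a ∈ [0, 3, 10, 13, 14, 18, 19, 20, 21, 27, 28, 40, 59]) a ha)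
  have hS₁ : Sim num s₁ c tr := hS.of_eq (fun a ha => k1 a ((by decide :
    ∀ a ∈ [10, 18, 19, 20, 21, 27, 28, 40, 59],
      a ∈ [0, 3, 10, 13, 14, 18, 19, 20, 21, 27, 28, 40, 59]) a ha)) kr
  have hc1 : credits K s₁ tr = credits K s tr := by
    unfold credits
    rw [k1 59 (by simp)]
  have h57 : s₁.nat 57 0 ≤ 2 * q := by
    have h1 : ∀ L : List (Net T), (L.flatMap (candidates num)).length ≤ 2 * L.length := by
      intro L
      induction L with
      | nil => simp
      | cons x L ih =>
        have := length_candidates_le (num := num) x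
        simp only [List.flatMap_cons, List.length_append, List.length_cons]
        omega
    have h2 := h1 (blk cl)
    rw [← harr, length_arr] at h2
    omega
  have h57' : (s₁.nat 57 0 : ℝ) ≤ 2 * q := by exact_mod_cast h57
  simp only [wp_seq, wp_nset]
  refine Cmd.wp_conseq (walk_wp (by decide) (by decide) (by decide) (by decide) (by decide)
    (fun L s' b' => ∃ c' tr' Q, Q <:+ blk cl ∧ L = Q.map (fun v => (num v : ℕ)) ∧
      Relation.ReflTransGen Step c c' ∧ c'.todo = Q ++ rest ∧ Sim num s' c' tr' ∧
      forestLeaves (K + K + 1) tr' + 4 * q * Q.length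
        ≤ forestLeaves (K + K + 1) tr + 4 * q * (blk cl).length ∧
      credits K s' tr' + Q.length * X + 20 + R ≤ b') ?_ ?_
      (L := (blk cl).map fun v => (num v : ℕ)) ?_ ?_ ?_) ?_
  · rintro L s' b' v ⟨c', tr', Q, h1, h2, h3, h4, h5, h6, h7⟩
    have e : ∀ a, a = 68 ∨ a = 61 → Sim num (s'.setNat a 0 v) c' tr' ∧
        credits K (s'.setNat a 0 v) tr' = credits K s' tr' := by
      rintro a (rfl | rfl)
      · exact ⟨h5.of_eq (by simp) (by simp), by simp [credits]⟩
      · exact ⟨h5.of_eq (by simp) (by simp), by simp [credits]⟩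
    refine ⟨⟨c', tr', Q, h1, h2, h3, h4, (e 68 (by simp)).1, h6, ?_⟩,
      ⟨c', tr', Q, h1, h2, h3, h4, (e 61 (by simp)).1, h6, ?_⟩⟩
    · rw [(e 68 (by simp)).2]; exact h7
    · rw [(e 61 (by simp)).2]; exact h7
  · rintro L s' b' ⟨c', tr', Q, h1, h2, h3, h4, h5, h6, h7⟩
    have := credits_nonneg K s' tr'
    have : (0 : ℝ) ≤ Q.length * X := by positivity
    linarith
  · refine ⟨c, tr, blk cl, List.suffix_rfl, rfl, .refl, htodo, hS₁.of_eq (by simp) (by simp), le_rfl,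
      ?_⟩
    have : credits K (s₁.setNat 68 ((NExp.lit 0).eval s₁) ((NExp.get 13 (var 67)).eval s₁)) tr
        = credits K s₁ tr := by simp [credits]
    rw [this, hc1]
    simp
    linarith
  · simpa [k67] using hst₁.chain cl
  · rintro y L s' b' so - hy ⟨c', tr', Q, h1, h2, h3, h4, h5, h6, h7⟩
    obtain ⟨v, Q', rfl, hv, hQ⟩ := List.map_eq_cons_iff.1 h2.symm
    have k2 : ∀ a ∈ [0, 3, 10, 13, 14, 17, 57], s'.nat a = s₁.nat a := by
      intro a ha
      fin_cases ha <;> exact (so.nat _ rfl).trans (by simp)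
    simp only [List.length_cons] at h6 h7
    have hQ0 : (0 : ℝ) ≤ Q'.length * X := by positivity
    have h57'' : ((s'.nat 57 0 : ℝ) + 1) * (20000 + 1600 * lam) ≤ X - 30 := by
      rw [k2 57 (by simp), hX]
      have : (0 : ℝ) ≤ 20000 + 1600 * lam := by positivity
      nlinarith
    have h57n : s'.nat 57 0 ≤ 2 * q := by rw [k2 57 (by simp)]; exact h57
    have hsub := h1.length_le
    simp only [List.length_cons] at hsub
    have hmul : q * (blk cl).length ≤ q * q := Nat.mul_le_mul_left _ hq
    have hle : forestLeaves (K + K + 1) tr' + 2 * s'.nat 57 0 ≤ Nmax := by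
      have e1 : q * (Q'.length + 1) = q * Q'.length + q := by ring
      rw [mul_assoc] at h6 hN
      nlinarith
    refine Cmd.wp_conseq (netCmd_sim (v := v) (rest := Q' ++ rest) (c := c') (tr := tr')
      (R := Q'.length * X + 30 + R - 5) ho ?_ ?_ ?_ h5 ?_ (hinv.reachable ho h3) hle hlam hlam0
      (by linarith) ?_) ?_
    · intro s'' hs'' h62
      refine netCtx_of_candidates (c := cl) (hst₁.of_eq fun a ha => ?_) hblk hpar
        (h1.subset (by simp)) ?_ ?_ h62
      · rw [hs'' a ((by decide : ∀ a ∈ [0, 3, 10, 13, 14],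
          a ∈ [0, 3, 10, 13, 14, 17, 57, 61]) a ha)]
        fin_cases ha <;> exact (so.nat _ rfl).trans (by simp)
      · rw [hs'' 17 (by simp), hs'' 57 (by simp), k2 17 (by simp), k2 57 (by simp), harr]
      · rw [hs'' 61 (by simp), hy, hv]
    · rw [k2 0 (by simp), hst₁.n_eq]
    · rw [hy, hv]
    · simpa using h4
    · push_cast at h7
      linarith
    · rintro s'' b'' - ⟨c'', tr'', q1, q2, q3, q4, q5⟩
      refine ⟨c'', tr'', Q', (List.suffix_cons v Q').trans h1, hQ.symm, h3.trans q1, q2, q3, ?_,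
        by linarith⟩
      have e1 : q * (Q'.length + 1) = q * Q'.length + q := by ring
      rw [mul_assoc] at h6 ⊢
      rw [mul_assoc] at h6 ⊢
      omega
  · rintro s' b' - ⟨c', tr', Q, h1, h2, h3, h4, h5, h6, h7⟩
    obtain rfl : Q = [] := List.map_eq_nil_iff.1 h2.symm
    refine ⟨c', tr', h3, by simpa using h4, h5, ?_, ?_⟩
    · have hmul : q * (blk cl).length ≤ q * q := Nat.mul_le_mul_left _ hq
      simp only [List.length_nil, mul_zero] at h6
      rw [mul_assoc] at h6 ⊢
      omega
    · simp at h7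
      linarith

end CellLoop

/-! ### Processing all cells in postorder. -/

section MainLoop

variable {n d : ℕ} {P : Fin n → EuclideanSpace ℝ (Fin d)} {k : ℕ} {T : Quadtree P k} {K : ℕ}
  {num : Net T ≃ Fin K} {μ : Fin n → ℝ} {B : ℝ} {order : List (Net T)}

/-- Processes the cells in array `16`, from the last to the first. -/
def mainCmd : Cmd := .loop (.nle (.lit 1) (var 58)) (block [
  setVar 58 (.sub (var 58) (.lit 1)), setVar 67 (.get 16 (var 58)), cellCmd])

lemma mainCmd_wp {blk : Fin T.numCells → List (Net T)} {s : Store} {b : ℝ}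
    {cells : List (Fin T.numCells)} {c : Config T} {tr : ℕ → Rope} {q : ℕ}
    (ho : ChildrenFirst order) (hst : Static num blk s)
    (hblk : ∀ cl v, v ∈ blk cl ↔ v.owner = cl)
    (hpar : ∀ u w : Net T, u.parent? = some w ↔ u.IsParent w) (hq : ∀ cl, (blk cl).length ≤ q)
    (hcells : (arr (s.nat 16) (s.nat 58 0)).reverse = cells.map Fin.val)
    (hS : Sim num s c tr) (htodo : c.todo = cells.flatMap blk)
    (hinv : Inv μ B order c) {lam R : ℝ} {Nmax : ℕ}
    (hN : forestLeaves (K + K + 1) tr + 4 * q * q * cells.length ≤ Nmax)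
    (hlam : Real.logb 2 Nmax ≤ lam) (hlam0 : 0 ≤ lam) (hR : 0 ≤ R)
    (hb : credits K s tr + cells.length * (cellCost q lam + 30) + 10 + R ≤ b) :
    mainCmd.wp (fun s' b' => ∃ c' tr', Relation.ReflTransGen Step c c' ∧ c'.todo = [] ∧
      Sim num s' c' tr' ∧ credits K s' tr' + R ≤ b') s b := by
  have hX := cellCost_nonneg q hlam0
  obtain ⟨LI, hLI⟩ : ∃ LI : Store → ℝ → Prop, ∀ s' b', LI s' b' ↔ ∃ (c' : Config T) (tr' : ℕ → Rope)
    (rest : List (Fin T.numCells)),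
    (arr (s.nat 16) (s'.nat 58 0)).reverse = rest.map Fin.val ∧
    Relation.ReflTransGen Step c c' ∧ c'.todo = rest.flatMap blk ∧ Sim num s' c' tr' ∧
    forestLeaves (K + K + 1) tr' + 4 * q * q * rest.length ≤ Nmax ∧
    credits K s' tr' + rest.length * (cellCost q lam + 30) + 10 + R ≤ b' :=
    ⟨_, fun _ _ => Iff.rfl⟩
  refine Cmd.wp_loop LI ((hLI _ _).2 ⟨c, tr, cells, hcells, .refl, htodo, hS, hN, hb⟩) ?_ ?_ ?_
  · intro s' b' h
    obtain ⟨c', tr', rest, -, -, -, -, -, h⟩ := (hLI _ _).1 h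
    have := credits_nonneg K s' tr'
    have : 0 ≤ (rest.length : ℝ) * (cellCost q lam + 30) := by positivity
    linarith
  · intro s' b' so h hc
    obtain ⟨c', tr', rest, h1, h2, h3, h4, h5, h6⟩ := (hLI _ _).1 h
    have k1 : ∀ a ∈ [0, 3, 10, 13, 14, 16], s'.nat a = s.nat a := by
      intro a ha
      fin_cases ha <;> exact so.nat _ rfl
    obtain ⟨i, hi⟩ : ∃ i, s'.nat 58 0 = i + 1 := by
      simp at hc
      exact ⟨s'.nat 58 0 - 1, by omega⟩
    -- Reading the array backwards makes its last entry the first cell still to be processed.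
    rw [hi, arr_succ, List.reverse_append, List.reverse_singleton, List.singleton_append] at h1
    obtain ⟨cl, rest, rfl, hcl, hrest⟩ := List.map_eq_cons_iff.1 h1.symm
    simp only [List.length_cons, List.flatMap_cons] at h3 h5 h6
    push_cast at h6
    have e : 4 * q * q * (rest.length + 1) = 4 * q * q * rest.length + 4 * q * q := by ring
    simp only [block, wp_seq, wp_nset]
    refine Cmd.wp_conseq (cellCmd_wp (cl := cl) (rest := rest.flatMap blk) (c := c') (tr := tr')
      (R := rest.length * (cellCost q lam + 30) + 10 + R) (lam := lam) (Nmax := Nmax) ho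
      (hst.of_eq fun a ha => ?_) (hblk cl) hpar (hq cl) ?_ (h4.of_eq (by simp) (by simp)) h3
      (hinv.reachable ho h2) (by omega) hlam hlam0 (by positivity) ?_) ?_
    · fin_cases ha <;> simp [k1]
    · simp [k1, hi, hcl]
    · have : credits K ((s'.setNat 58 0 i).setNat 67 0 (s'.nat 16 i)) tr' = credits K s' tr' := by
        simp [credits]
      simp [hi, this]
      linarith
    · rintro s'' b'' so'' ⟨c'', tr'', q1, q2, q3, q4, q5⟩
      refine (hLI _ _).2 ⟨c'', tr'', rest, ?_, h2.trans q1, q2, q3, by omega, by linarith⟩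
      rw [so''.nat 58 rfl]
      simp [hi, hrest]
  · intro s' b' so h hc
    obtain ⟨c', tr', rest, h1, h2, h3, h4, h5, h6⟩ := (hLI _ _).1 h
    have hi : s'.nat 58 0 = 0 := by
      simp at hc
      omega
    rw [hi] at h1
    obtain rfl : rest = [] := List.map_eq_nil_iff.1 h1.symm
    refine ⟨c', tr', h2, h3, h4, ?_⟩
    simp at h6 ⊢
    linarith

end MainLoop

/-! ### Computing a postorder of the cells. -/

section Traversal

variable {n d : ℕ} {P : Fin n → EuclideanSpace ℝ (Fin d)} {k : ℕ} {T : Quadtree P k}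

lemma PostorderForest.append {rs rs' L L' : List (Fin T.numCells)} (h : PostorderForest T rs L)
    (h' : PostorderForest T rs' L') : PostorderForest T (rs ++ rs') (L ++ L') := by
  induction h with
  | nil => exact h'
  | cons h1 h2 h3 _ _ ih =>
    rw [List.cons_append, List.append_assoc, List.cons_append]
    exact .cons h1 h2 h3 ih

lemma PostorderForest.exists_append {rs rs' L : List (Fin T.numCells)}
    (h : PostorderForest T (rs ++ rs') L) : ∃ L₁ L₂, L = L₁ ++ L₂ ∧ PostorderForest T rs L₁ ∧
      PostorderForest T rs' L₂ := by
  induction rs generalizing L with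
  | nil => exact ⟨[], L, rfl, .nil, h⟩
  | cons c rs ih =>
    cases h with
    | cons h1 h2 h3 h4 =>
      obtain ⟨L₁, L₂, rfl, h5, h6⟩ := ih h4
      exact ⟨_, L₂, by simp, .cons h1 h2 h3 h5, h6⟩

lemma PostorderForest.length_le_length {rs L : List (Fin T.numCells)}
    (h : PostorderForest T rs L) : rs.length ≤ L.length := by
  induction h with
  | nil => simp
  | cons _ _ _ _ _ ih =>
    simp only [List.length_cons, List.length_append]
    omega

lemma PostorderForest.exists_forest (hn : 2 ≤ n) (hP : Function.Injective P) (hT : T.Nested)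
    (rs : List (Fin T.numCells)) : ∃ L, PostorderForest T rs L := by
  classical
  let ch : Fin T.numCells → List (Fin T.numCells) := fun c =>
    (univ.filter fun a => T.parent a = some c).toList
  have hch : ∀ c a, a ∈ ch c ↔ T.parent a = some c := fun c a => by simp [ch]
  exact exists_postorder (ch := ch) (parent_wellFounded hn hP hT) (fun c a => (hch c a).1) .nil
    (fun c rs L L' h h' => .cons (nodup_toList _) (hch c) h h') rs

/-- The elements of `Fin N` with key `κ`, in decreasing order. -/
def finBucket (N : ℕ) (key : ℕ → ℕ) (κ : ℕ) : List (Fin N) :=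
  ((List.finRange N).filter fun j : Fin N => key j = κ).reverse

lemma mem_finBucket {N : ℕ} {key : ℕ → ℕ} {κ : ℕ} {j : Fin N} :
    j ∈ finBucket N key κ ↔ key j = κ := by
  simp [finBucket]

lemma nodup_finBucket (N : ℕ) (key : ℕ → ℕ) (κ : ℕ) : (finBucket N key κ).Nodup :=
  List.nodup_reverse.2 ((List.nodup_finRange N).filter _)

lemma map_finBucket (N : ℕ) (key : ℕ → ℕ) (κ : ℕ) :
    (finBucket N key κ).map Fin.val = bucket key N κ := by
  unfold finBucket bucket
  rw [List.map_reverse, ← List.map_coe_finRange_eq_range, List.filter_map]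
  rfl

/-- Puts the cells in preorder to array `16`. -/
def traverseCmd : Cmd := block [
  .nset 15 (.lit 0) (.sub (.get 11 (.lit 0)) (.lit 1)), setVar 70 (.lit 1), setVar 58 (.lit 0),
  .loop (.nle (.lit 1) (var 70)) (block [
    setVar 70 (.sub (var 70) (.lit 1)), setVar 71 (.get 15 (var 70)),
    .nset 16 (var 58) (var 71), setVar 58 (.add (var 58) (.lit 1)),
    setVar 72 (.get 11 (.add (var 71) (.lit 1))),
    walk 12 72 73 (block [.nset 15 (var 70) (var 73), setVar 70 (.add (var 70) (.lit 1))])])]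

lemma pushAll_wp {s : Store} {b : ℝ} {L : List ℕ} (hL : Chain (s.nat 12) (s.nat 72 0) L)
    {R : ℝ} (hR : 0 ≤ R) (hb : 40 * (L.length : ℝ) + 5 + R ≤ b) :
    (walk 12 72 73 (block [.nset 15 (var 70) (var 73), setVar 70 (.add (var 70) (.lit 1))])).wp
      (fun s' b' => arr (s'.nat 15) (s'.nat 70 0) = arr (s.nat 15) (s.nat 70 0) ++ L ∧ R ≤ b')
      s b := by
  refine Cmd.wp_conseq (walk_wp (by decide) (by decide) (by decide) (by decide) (by decide)
    (fun L' s' b' => arr (s'.nat 15) (s'.nat 70 0) ++ L' = arr (s.nat 15) (s.nat 70 0) ++ L ∧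
      40 * (L'.length : ℝ) + 5 + R ≤ b') ?_ ?_ ⟨rfl, hb⟩ hL ?_) ?_
  · rintro L' s' b' v ⟨h1, h2⟩
    exact ⟨⟨by simpa using h1, h2⟩, ⟨by simpa using h1, h2⟩⟩
  · rintro L' s' b' ⟨-, h⟩
    have : (0 : ℝ) ≤ L'.length := Nat.cast_nonneg _
    linarith
  · rintro y L' s' b' - - hy ⟨h1, h2⟩
    simp only [List.length_cons] at h2
    push_cast at h2
    simp only [block, wp_seq, wp_nset]
    simp [hy]
    refine ⟨?_, by linarith⟩
    rw [arr_succ, ← h1, List.append_assoc]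
    congr 1
    · exact arr_congr fun i hi => by simp [hi.ne]
    · simp
  · rintro s' b' - ⟨h1, h2⟩
    simp at h1 h2
    exact ⟨h1, by linarith⟩

/-- Popping a cell, emitting it and pushing its children produces an order whose reversal is a
postorder, so no return information is needed on the stack. -/
lemma traverseCmd_wp (hn : 2 ≤ n) (hP : Function.Injective P) (hT : T.Nested) {s : Store} {b : ℝ}
    {key : ℕ → ℕ} (hkey : ∀ c : Fin T.numCells, key c = match T.parent c with
      | none => 0
      | some a => (a : ℕ) + 1)
    (hch : ∀ κ, Chain (s.nat 12) (s.nat 11 κ) (bucket key T.numCells κ))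
    {R : ℝ} (hR : 0 ≤ R) (hb : 400 * (n * chainBound n k) + 50 + R ≤ b) :
    traverseCmd.wp (fun s' b' => ∃ cells, PostorderForest T [T.root] cells ∧
      (arr (s'.nat 16) (s'.nat 58 0)).reverse = cells.map Fin.val ∧ R ≤ b') s b := by
  set N := T.numCells
  set LB : ℝ := 2 * n * chainBound n k with hLB
  let ch : Fin N → List (Fin N) := fun c => finBucket N key (c + 1)
  have hchmem : ∀ c a, a ∈ ch c ↔ T.parent a = some c := by
    intro c a
    rw [mem_finBucket, hkey]
    cases h : T.parent a with
    | none => simp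
    | some x => simp [Fin.ext_iff]
  have hroot : finBucket N key 0 = [T.root] := by
    -- Key zero means no parent, and a cell without parent reaches the root only by the empty path.
    have h1 : ∀ a, a ∈ finBucket N key 0 ↔ a = T.root := by
      intro a
      rw [mem_finBucket, hkey]
      constructor
      · intro h
        rcases Relation.ReflTransGen.cases_head (T.reaches_root a) with h2 | ⟨c, h2, -⟩
        · exact h2
        · simp [h2] at h
      · rintro rfl
        simp [T.parent_root]
    exact List.perm_singleton.1 ((List.perm_ext_iff_of_nodup (nodup_finBucket _ _ _) (by simp)).2
      (by simpa using h1))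
  have hex := PostorderForest.exists_forest hn hP hT
  have h11 : s.nat 11 0 = T.root + 1 := by
    have := hch 0
    rw [← map_finBucket, hroot] at this
    exact this.1
  -- Any postorder of the stacked subtrees, followed by the reversed output, is a postorder of the
  -- whole tree. Hence cells emitted and stacked together never exceed `LB`, and credits can be
  -- allotted per emission and per push.
  obtain ⟨LI, hLI⟩ : ∃ LI : Store → ℝ → Prop, ∀ s' b', LI s' b' ↔ ∃ rs out : List (Fin N),
    arr (s'.nat 15) (s'.nat 70 0) = rs.map Fin.val ∧
    arr (s'.nat 16) (s'.nat 58 0) = out.map Fin.val ∧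
    (∀ L, PostorderForest T rs L → PostorderForest T [T.root] (L ++ out.reverse)) ∧
    100 * (LB - out.length) + 100 * (LB - out.length - rs.length) + 20 + R ≤ b' :=
    ⟨_, fun _ _ => Iff.rfl⟩
  have hlen : ∀ rs out : List (Fin N),
      (∀ L, PostorderForest T rs L → PostorderForest T [T.root] (L ++ out.reverse)) →
      (out.length : ℝ) + rs.length ≤ LB := by
    intro rs out h
    obtain ⟨L, hL⟩ := hex rs
    have h1 := (h L hL).length_root_le hn hP hT
    have h2 : (rs.length : ℝ) ≤ L.length := by exact_mod_cast hL.length_le_length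
    rw [List.length_append, List.length_reverse] at h1
    push_cast at h1
    linarith
  simp only [traverseCmd, block, wp_seq, wp_nset]
  refine Cmd.wp_loop LI ((hLI _ _).2 ⟨[T.root], [], ?_, ?_, ?_, ?_⟩) ?_ ?_ ?_
  · simp [arr, h11]
  · simp [arr]
  · intro L hL
    simpa using hL
  · simp
    linarith
  · intro s' b' h
    obtain ⟨rs, out, -, -, h1, h2⟩ := (hLI _ _).1 h
    have := hlen rs out h1
    have : (0 : ℝ) ≤ rs.length := Nat.cast_nonneg _
    linarith
  · intro s' b' so h hc
    obtain ⟨rs₀, out, h1, h2, h3, h4⟩ := (hLI _ _).1 h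
    obtain ⟨i, hi⟩ : ∃ i, s'.nat 70 0 = i + 1 := by
      simp at hc
      exact ⟨s'.nat 70 0 - 1, by omega⟩
    rw [hi, arr_succ] at h1
    obtain ⟨rs, rs', rfl, hrs, hrs'⟩ := List.map_eq_append_iff.1 h1.symm
    obtain ⟨c, rfl⟩ : ∃ c, rs' = [c] := by
      have := congrArg List.length hrs'
      simp at this
      exact List.length_eq_one_iff.1 this
    simp at hrs'
    have e11 : s'.nat 11 = s.nat 11 := (so.nat 11 rfl).trans (by simp)
    have e12 : s'.nat 12 = s.nat 12 := (so.nat 12 rfl).trans (by simp)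
    simp only [List.length_append, List.length_singleton] at h4
    push_cast at h4
    have hlen0 := hlen _ _ h3
    simp only [List.length_append, List.length_singleton] at hlen0
    push_cast at hlen0
    simp only [wp_seq, wp_nset]
    have h3' : ∀ L, PostorderForest T (rs ++ ch c) L →
        PostorderForest T [T.root] (L ++ (out ++ [c]).reverse) := by
      intro L hL
      obtain ⟨L₁, L₂, rfl, g1, g2⟩ := hL.exists_append
      have := h3 _ (g1.append (.cons (nodup_finBucket _ _ _) (hchmem c) g2 .nil))
      simpa using this
    have hlen' := hlen _ _ h3'
    simp only [List.length_append, List.length_singleton] at hlen'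
    push_cast at hlen'
    refine Cmd.wp_conseq (pushAll_wp (L := (ch c).map Fin.val)
      (R := 100 * (LB - (out.length + 1)) + 100 * (LB - (out.length + 1) - (rs.length + (ch c).length))
        + 20 + R) ?_ ?_ ?_) ?_
    · have := hch (c + 1)
      rw [← map_finBucket] at this
      simpa [e11, e12, hi, ← hrs'] using this
    · have : (0 : ℝ) ≤ (ch c).length := Nat.cast_nonneg _
      have : (0 : ℝ) ≤ rs.length := Nat.cast_nonneg _
      linarith
    · simp 
      have : (0 : ℝ) ≤ (ch c).length := Nat.cast_nonneg _
      linarith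
    · rintro s'' b'' so'' ⟨q1, q2⟩
      refine (hLI _ _).2 ⟨rs ++ ch c, out ++ [c], ?_, ?_, h3', ?_⟩
      · rw [q1, List.map_append, hrs]
        congr 1
        simp [hi]
      · rw [so''.nat 16 rfl, so''.nat 58 rfl, List.map_append, ← h2]
        simp [hi, arr_succ, hrs']
        exact arr_congr fun i hi => by simp [hi.ne]
      · simp only [List.length_append, List.length_singleton]
        push_cast
        linarith
  · intro s' b' so h hc
    obtain ⟨rs, out, h1, h2, h3, h4⟩ := (hLI _ _).1 h
    have hi : s'.nat 70 0 = 0 := by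
      simp at hc
      omega
    rw [hi] at h1
    obtain rfl : rs = [] := List.map_eq_nil_iff.1 h1.symm
    have := hlen _ _ h3
    refine ⟨out.reverse, by simpa using h3 [] .nil, by rw [h2, List.map_reverse], ?_⟩
    simp at h4 this ⊢
    linarith

end Traversal

/-! ### Loading the flow into the matrix. -/

section Loading

/-- Computes the offsets of the rows of the flow matrix. -/
def offsetsCmd : Cmd := block [
  setVar 54 (.add (.get 0 (.lit 0)) (.get 0 (.lit 2))), setVar 74 (.lit 0), setVar 75 (.lit 0),
  .loop (.nle (.add (var 74) (.lit 1)) (var 54)) (block [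
    .nset 10 (var 74) (var 75), setVar 75 (.add (var 75) (var 54)),
    setVar 74 (.add (var 74) (.lit 1))])]

/-- Only the offsets are computed, in linear time. The quadratically many entries need no
initialization, as the memory starts out zero. -/
lemma offsetsCmd_wp {s : Store} {b : ℝ} {W : ℕ} (hW : s.nat 0 0 + s.nat 0 2 = W)
    {R : ℝ} (hR : 0 ≤ R) (hb : 40 * (W : ℝ) + 40 + R ≤ b) :
    offsetsCmd.wp (fun s' b' => Offsets s' W ∧ R ≤ b') s b := by
  obtain ⟨LI, hLI⟩ : ∃ LI : Store → ℝ → Prop, ∀ s' b', LI s' b' ↔ ∃ i ≤ W,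
    s'.nat 74 0 = i ∧ s'.nat 75 0 = i * W ∧ (∀ j < i, s'.nat 10 j = j * W) ∧
    40 * ((W : ℝ) - i) + 10 + R ≤ b' := ⟨_, fun _ _ => Iff.rfl⟩
  simp only [offsetsCmd, block, wp_seq, wp_nset]
  refine Cmd.wp_loop LI ((hLI _ _).2 ⟨0, Nat.zero_le _, by simp, by simp, by simp, ?_⟩) ?_ ?_ ?_
  · simp
    linarith
  · intro s' b' h
    obtain ⟨i, hi, -, -, -, h⟩ := (hLI _ _).1 h
    have : (i : ℝ) ≤ W := by exact_mod_cast hi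
    linarith
  · intro s' b' so h hc
    obtain ⟨i, hi, h1, h2, h3, h4⟩ := (hLI _ _).1 h
    have e54 : s'.nat 54 0 = W := by rw [so.nat 54 rfl]; simpa using hW
    simp [h1, e54] at hc
    simp only [wp_seq, wp_nset]
    refine (hLI _ _).2 ⟨i + 1, hc, by simp [h1], ?_, ?_, ?_⟩
    · simp [h2, e54]
      ring
    · intro j hj
      by_cases hji : j = i
      · simp [h1, h2, hji]
      · simp [h1, hji, h3 j (by omega)]
    · simp
      linarith
  · intro s' b' so h hc
    obtain ⟨i, hi, h1, h2, h3, h4⟩ := (hLI _ _).1 h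
    have e54 : s'.nat 54 0 = W := by rw [so.nat 54 rfl]; simpa using hW
    simp [h1, e54] at hc
    obtain rfl : i = W := by omega
    refine ⟨h3, ?_⟩
    simp at h4 ⊢
    linarith

variable {n d : ℕ} {P : Fin n → EuclideanSpace ℝ (Fin d)} {k : ℕ} {T : Quadtree P k} {K : ℕ}
  {num : Net T ≃ Fin K}

lemma vertexId_lt (u : Vert T) : vertexId num u < n + K := by
  cases u with
  | inl p => have := p.2; simp only [vertexId]; omega
  | inr v => have := (num v).2; simp only [vertexId]; omega

lemma vertexId_inj {u v : Vert T} : vertexId num u = vertexId num v ↔ u = v := by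
  constructor
  · intro h
    cases u with
    | inl p =>
      have := p.2
      cases v with
      | inl q =>
        simp only [vertexId] at h
        rw [Fin.ext h]
      | inr v =>
        simp only [vertexId] at h
        omega
    | inr u =>
      cases v with
      | inl q =>
        have := q.2
        simp only [vertexId] at h
        omega
      | inr v =>
        simp only [vertexId, Nat.add_left_cancel_iff] at h
        rw [num_val_inj.1 h]
  · rintro rfl
    rfl

/-- The edges in the memory. -/
structure Edges (num : Net T ≃ Fin K) {m : ℕ} (E : Fin m → Vert T × Vert T) (s : Store) : Prop where
  count : s.nat 0 3 = m
  tail : ∀ e : Fin m, s.nat 4 e = vertexId num (E e).1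
  head : ∀ e : Fin m, s.nat 5 e = vertexId num (E e).2

lemma Edges.of_eq {m : ℕ} {E : Fin m → Vert T × Vert T} {s s' : Store} (h : Edges num E s)
    (h0 : s'.nat 0 = s.nat 0) (h4 : s'.nat 4 = s.nat 4) (h5 : s'.nat 5 = s.nat 5) :
    Edges num E s' := by
  refine ⟨?_, ?_, ?_⟩
  · rw [h0, h.count]
  · rw [h4]; exact h.tail
  · rw [h5]; exact h.head

/-- Writes the flow to the flow matrix. -/
def loadCmd : Cmd := block [
  setVar 74 (.lit 0),
  .loop (.nle (.add (var 74) (.lit 1)) (.get 0 (.lit 3))) (block [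
    setVar 55 (.get 4 (var 74)), setVar 56 (.get 5 (var 74)), setRvar 7 (.get 0 (var 74)),
    setVar 74 (.add (var 74) (.lit 1)), addEdge])]

open Classical in
-- After `i` edges the matrix holds the partial sums of `flowBetween`. The pairs of a point and a
-- net point are loaded too, but are read only while the initial nodes are made.
lemma loadCmd_wp {m : ℕ} {E : Fin m → Vert T × Vert T} {f : Fin m → ℝ} {s : Store} {b : ℝ}
    (hE : Edges num E s) (hf : ∀ e : Fin m, s.real 0 e = f e) (hoff : Offsets s (n + K))
    (h2 : ∀ i, s.real 2 i = 0) {R : ℝ} (hR : 0 ≤ R) (hb : 100 * (m : ℝ) + 30 + R ≤ b) :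
    loadCmd.wp (fun s' b' => (∀ u v : Vert T,
      s'.entry (vertexId num u) (vertexId num v) = flowBetween E f u v) ∧ R ≤ b') s b := by
  let term : Fin m → Vert T → Vert T → ℝ := fun e u v =>
    (if E e = (u, v) then f e else 0) - (if E e = (v, u) then f e else 0)
  obtain ⟨LI, hLI⟩ : ∃ LI : Store → ℝ → Prop, ∀ s' b', LI s' b' ↔ ∃ i ≤ m,
    s'.nat 74 0 = i ∧ (∀ u v : Vert T, s'.entry (vertexId num u) (vertexId num v)
      = ∑ e : Fin m, if (e : ℕ) < i then term e u v else 0) ∧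
    100 * ((m : ℝ) - i) + 10 + R ≤ b' := ⟨_, fun _ _ => Iff.rfl⟩
  simp only [loadCmd, block, wp_seq, wp_nset]
  refine Cmd.wp_loop LI ((hLI _ _).2 ⟨0, Nat.zero_le _, by simp, ?_, ?_⟩) ?_ ?_ ?_
  · intro u v
    simp [Store.entry, h2]
  · simp
    linarith
  · intro s' b' h
    obtain ⟨i, hi, -, -, h⟩ := (hLI _ _).1 h
    have : (i : ℝ) ≤ m := by exact_mod_cast hi
    linarith
  · intro s' b' so h hc
    obtain ⟨i, hi, h1, h3, h4⟩ := (hLI _ _).1 h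
    have k1 : ∀ a ∈ [0, 4, 5, 10], s'.nat a = s.nat a := by
      intro a ha
      fin_cases ha <;> exact (so.nat _ rfl).trans (by simp)
    have kr : s'.real 0 = s.real 0 := so.real 0 rfl
    simp [h1, k1, hE.count] at hc
    simp only [wp_seq, wp_nset, wp_rset]
    have t1 := hE.tail ⟨i, hc⟩
    have t2 := hE.head ⟨i, hc⟩
    have t3 := hf ⟨i, hc⟩
    simp only at t1 t2 t3
    refine Cmd.wp_conseq (addEdge_wp (W := n + K) (x := vertexId num (E ⟨i, hc⟩).1)
      (y := vertexId num (E ⟨i, hc⟩).2) (δ := f ⟨i, hc⟩) ?_ (by simp [h1, k1, t1])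
      (by simp [h1, k1, t2]) (by simp [h1, kr, t3]) (vertexId_lt _) (vertexId_lt _)) ?_
    · unfold Offsets
      simp [k1]
      exact hoff
    · rintro s'' b'' so'' ⟨q1, q2⟩
      refine (hLI _ _).2 ⟨i + 1, hc, ?_, fun u v => ?_, ?_⟩
      · rw [so''.nat 74 rfl]
        simp [h1]
      · have hsplit : ∀ e : Fin m, (if (e : ℕ) < i + 1 then term e u v else 0)
            = (if (e : ℕ) < i then term e u v else 0)
              + if e = ⟨i, hc⟩ then term e u v else 0 := by
          intro e
          by_cases he : e = ⟨i, hc⟩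
          · subst he
            simp
          · have he' : (e : ℕ) ≠ i := fun h => he (Fin.ext h)
            have : (e : ℕ) < i + 1 ↔ (e : ℕ) < i := by omega
            simp [he, this]
        rw [q1 _ (vertexId_lt u) _ (vertexId_lt v), sum_congr rfl fun e _ => hsplit e,
          sum_add_distrib, sum_ite_eq' univ, if_pos (mem_univ _), ← h3, add_sub_assoc]
        congr 1
        simp only [term, vertexId_inj, Prod.ext_iff]
        congr 1
        · exact if_congr (by rw [eq_comm, @eq_comm _ v]) rfl rfl
        · exact if_congr (by rw [and_comm, eq_comm, @eq_comm _ u]) rfl rfl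
      · simp at q2
        push_cast
        linarith
  · intro s' b' so h hc
    obtain ⟨i, hi, h1, h3, h4⟩ := (hLI _ _).1 h
    have e0 : s'.nat 0 = s.nat 0 := (so.nat 0 rfl).trans (by simp)
    simp [h1, e0, hE.count] at hc
    obtain rfl : i = m := by omega
    refine ⟨fun u v => ?_, ?_⟩
    · rw [h3]
      refine sum_congr rfl fun e _ => ?_
      simp only [if_pos e.2, term]
      congr!
    · simp at h4 ⊢
      linarith

end Loading

/-! ### Creating the initial sequences. -/

section Leaves

/-- The forest after a leaf of positive weight has been put in front of a rope. -/
noncomputable def pushed (tr : ℕ → Rope) (i p : ℕ) (w : ℝ) : ℕ → Rope :=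
  if 0 < w then Function.update tr i (.node (.leaf p w) (tr i)) else tr

lemma forestLeaves_pushed {M : ℕ} {tr : ℕ → Rope} {i : ℕ} (hi : i < M) (p : ℕ) (w : ℝ) :
    forestLeaves M (pushed tr i p w) ≤ forestLeaves M tr + 1 := by
  unfold pushed
  split_ifs
  · have := forestLeaves_update (tr := tr) hi (.node (.leaf p w) (tr i))
    simp only [Rope.leaves] at this
    omega
  · omega

lemma forestPot_pushed {M : ℕ} {tr : ℕ → Rope} {i Nmax : ℕ} {lam : ℝ} (hi : i < M) (p : ℕ) (w : ℝ)
    (hN : forestLeaves M tr + 1 ≤ Nmax) (hlam : Real.logb 2 Nmax ≤ lam) (hlam0 : 0 ≤ lam) :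
    forestPot M (pushed tr i p w) ≤ forestPot M tr + (160 * lam + 2000) := by
  unfold pushed
  split_ifs
  · rw [forestPot_update hi]
    simp only [Rope.pot, Rope.leaves]
    have h1 := leaves_le_forestLeaves (tr := tr) hi
    have h2 : Real.logb 2 (((1 : ℕ) : ℝ) + (tr i).leaves) ≤ Real.logb 2 Nmax := by
      refine Real.logb_le_logb_of_le one_lt_two (by positivity) ?_
      have : 1 + (tr i).leaves ≤ Nmax := by omega
      exact_mod_cast this
    linarith
  · linarith

/-- Puts a leaf for the point in `55` in front of the rope in the slot `e`, if the flow from the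
vertex in `x` to that in `y` is positive. -/
def pushFlowCmd (x y : ℕ) (e : NExp) : Cmd := block [
  setVar 46 (var 55), setRvar 8 (entryExp (var x) (var y)),
  .ite (.rle (rvar 8) .zero) .skip (block [setVar 49 e, pushLeaf])]

lemma pushFlowCmd_wp {x y : ℕ} {e : NExp} (hx : x ≠ 46) (hy : y ≠ 46)
    (he : e = var 76 ∨ e = .add (var 76) (.lit 1)) {s : Store} {b : ℝ}
    {M : ℕ} {tr : ℕ → Rope} {i p : ℕ} {w : ℝ} (hF : Forest s M tr) (hi : e.eval s = i)
    (hiM : i < M) (hp : s.nat 55 0 = p) (hw : s.entry (s.nat x 0) (s.nat y 0) = w) :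
    (pushFlowCmd x y e).wp (fun s' b' => Forest s' M (pushed tr i p w) ∧ b - 300 ≤ b') s b := by
  simp only [pushFlowCmd, block, wp_seq, wp_nset, wp_rset, wp_ite, wp_skip]
  unfold Store.entry at hw
  have hw' : (((s.setNat 46 0 (s.nat 55 0)).setReal 8 0
      (s.real 2 (s.nat 10 (s.nat x 0) + s.nat y 0)))).real 8 0 = w := by simp [hw]
  simp [hx, hy, hw]
  constructor
  · intro h
    rw [pushed, if_neg (not_lt.2 h)]
    exact ⟨hF.of_eq (by simp) (by simp) (by simp) (by simp) (by simp) (by simp), by linarith⟩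
  · intro h
    rw [pushed, if_pos h]
    refine Cmd.wp_conseq (pushLeaf_wp (M := M) (tr := tr) (i := i) (p := p) (w := w)
      (hF.of_eq (by simp) (by simp) (by simp) (by simp) (by simp) (by simp)) ?_ hiM (by simp [hp])
      (by simp) h.le) ?_
    · rcases he with rfl | rfl <;> simpa using hi
    · rintro s' b' - ⟨h1, h2⟩
      refine ⟨h1, ?_⟩
      have : (e.cost : ℝ) ≤ 10 := by
        rcases he with rfl | rfl <;> norm_num [NExp.cost]
      linarith

variable {n d : ℕ} {P : Fin n → EuclideanSpace ℝ (Fin d)} {k : ℕ} {T : Quadtree P k} {K : ℕ}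
  {num : Net T ≃ Fin K}

open Classical in
noncomputable def pushNode (L : Net T → List (Fin n × ℝ)) (v : Net T) (p : Fin n) (w : ℝ) :
    Net T → List (Fin n × ℝ) :=
  if 0 < w then Function.update L v ((p, w) :: L v) else L

lemma Trees.pushed_nt {pt nt : Net T → List (Fin n × ℝ)} {tr : ℕ → Rope} (h : Trees num pt nt tr)
    (v : Net T) (p : Fin n) (w : ℝ) :
    Trees num pt (pushNode nt v p w) (pushed tr (num v + num v) p w) := by
  classical
  unfold pushed pushNode
  split_ifs with hw
  · have hv := (num v).2
    refine ⟨?_, fun i hi => ?_, fun u => ?_, fun u => ?_⟩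
    · rw [Function.update_of_ne (by omega), h.zero]
    · by_cases hiv : i = num v + num v
      · rw [hiv, Function.update_self]
        exact ⟨hw.le, h.nonneg _ (hiv ▸ hi)⟩
      · rw [Function.update_of_ne hiv]
        exact h.nonneg i hi
    · by_cases huv : u = v
      · subst huv
        rw [Function.update_self, Function.update_self]
        simp [Rope.toList, h.nt, toNat, not_le.2 hw]
      · have : (num u : ℕ) ≠ num v := fun e => huv (num_val_inj.1 e)
        rw [Function.update_of_ne huv, Function.update_of_ne (by omega), h.nt]
    · rw [Function.update_of_ne (by omega), h.pt]
  · exact h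

lemma Trees.pushed_pt {pt nt : Net T → List (Fin n × ℝ)} {tr : ℕ → Rope} (h : Trees num pt nt tr)
    (v : Net T) (p : Fin n) (w : ℝ) :
    Trees num (pushNode pt v p w) nt (pushed tr (num v + num v + 1) p w) := by
  classical
  unfold pushed pushNode
  split_ifs with hw
  · have hv := (num v).2
    refine ⟨?_, fun i hi => ?_, fun u => ?_, fun u => ?_⟩
    · rw [Function.update_of_ne (by omega), h.zero]
    · by_cases hiv : i = num v + num v + 1
      · rw [hiv, Function.update_self]
        exact ⟨hw.le, h.nonneg _ (hiv ▸ hi)⟩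
      · rw [Function.update_of_ne hiv]
        exact h.nonneg i hi
    · rw [Function.update_of_ne (by omega), h.nt]
    · by_cases huv : u = v
      · subst huv
        rw [Function.update_self, Function.update_self]
        simp [Rope.toList, h.pt, toNat, not_le.2 hw]
      · have : (num u : ℕ) ≠ num v := fun e => huv (num_val_inj.1 e)
        rw [Function.update_of_ne huv, Function.update_of_ne (by omega), h.pt]
  · exact h

/-- Creates the nodes for the edge between the point in `55` and the net point with the identifier
in `56`. -/
def leavesCmd : Cmd := block [
  setVar 76 (.add (.sub (var 56) (.get 0 (.lit 0))) (.sub (var 56) (.get 0 (.lit 0)))),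
  pushFlowCmd 55 56 (var 76), pushFlowCmd 56 55 (.add (var 76) (.lit 1))]

/-- Both directions of the flow are tried; at most one is positive for an antisymmetric `φ`, but
allowing two new leaves avoids that assumption. -/
lemma leavesCmd_wp {s : Store} {b : ℝ} {pt nt : Net T → List (Fin n × ℝ)} {tr : ℕ → Rope}
    {p : Fin n} {v : Net T} {φ : Vert T → Vert T → ℝ} (h0 : s.nat 0 0 = n)
    (hF : Forest s (K + K + 1) tr) (hT : Trees num pt nt tr) (hp : s.nat 55 0 = p)
    (hv : s.nat 56 0 = n + num v)
    (hφ : ∀ u v : Vert T, s.entry (vertexId num u) (vertexId num v) = φ u v)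
    {lam R : ℝ} {Nmax : ℕ} (hN : forestLeaves (K + K + 1) tr + 2 ≤ Nmax)
    (hlam : Real.logb 2 Nmax ≤ lam) (hlam0 : 0 ≤ lam)
    (hb : forestPot (K + K + 1) tr + (320 * lam + 4700) + R ≤ b) :
    leavesCmd.wp (fun s' b' => ∃ tr', Forest s' (K + K + 1) tr' ∧
      Trees num (pushNode pt v p (φ (.inr v) (.inl p))) (pushNode nt v p (φ (.inl p) (.inr v))) tr' ∧
      forestLeaves (K + K + 1) tr' ≤ forestLeaves (K + K + 1) tr + 2 ∧
      forestPot (K + K + 1) tr' + R ≤ b') s b := by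
  have hvK := (num v).2
  simp only [leavesCmd, block, wp_seq, wp_nset]
  have e1 := hφ (.inl p) (.inr v)
  have e2 := hφ (.inr v) (.inl p)
  simp only [vertexId] at e1 e2
  refine Cmd.wp_conseq (pushFlowCmd_wp (M := K + K + 1) (tr := tr) (i := num v + num v) (p := p)
    (w := φ (.inl p) (.inr v)) (by decide) (by decide) (Or.inl rfl)
    (hF.of_eq (by simp) (by simp) (by simp) (by simp) (by simp) (by simp)) (by simp [hv, h0])
    (by omega) (by simp [hp]) ?_) ?_
  · rw [← e1, Store.entry_congr (s := s) (by simp) (by simp)]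
    simp [hp, hv]
  rintro s₁ b₁ so₁ ⟨hF₁, hb₁⟩
  have n1 := forestLeaves_pushed (M := K + K + 1) (tr := tr) (i := num v + num v) (by omega) p
    (φ (.inl p) (.inr v))
  have m1 := forestPot_pushed (M := K + K + 1) (tr := tr) (i := num v + num v) (Nmax := Nmax)
    (by omega) p (φ (.inl p) (.inr v)) (by omega) hlam hlam0
  have hT₁ := hT.pushed_nt v p (φ (.inl p) (.inr v))
  set tr₁ := pushed tr (num v + num v) p (φ (.inl p) (.inr v))
  have k : ∀ a ∈ [10, 55, 56], s₁.nat a = s.nat a := by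
    intro a ha
    fin_cases ha <;> exact (so₁.nat _ rfl).trans (by simp)
  have k76 : s₁.nat 76 0 = num v + num v := by
    rw [so₁.nat 76 rfl]
    simp [hv, h0]
  refine Cmd.wp_conseq (pushFlowCmd_wp (M := K + K + 1) (tr := tr₁) (i := num v + num v + 1) (p := p)
    (w := φ (.inr v) (.inl p)) (by decide) (by decide) (Or.inr rfl)
    hF₁ (by simp [k76]) (by omega) (by simp [k, hp]) ?_) ?_
  · rw [← e2, Store.entry_congr (s := s) (k _ (by simp)) ((so₁.real 2 rfl).trans (by simp))]
    simp [k, hp, hv]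
  rintro s₂ b₂ so₂ ⟨hF₂, hb₂⟩
  have n2 := forestLeaves_pushed (M := K + K + 1) (tr := tr₁) (i := num v + num v + 1) (by omega) p
    (φ (.inr v) (.inl p))
  have m2 := forestPot_pushed (M := K + K + 1) (tr := tr₁) (i := num v + num v + 1) (Nmax := Nmax)
    (by omega) p (φ (.inr v) (.inl p)) (by omega) hlam hlam0
  refine ⟨_, hF₂, hT₁.pushed_pt v p _, by omega, ?_⟩
  simp at hb₁
  linarith

/-- The edge joins an input point and a net point. -/
def Joins {m : ℕ} (E : Fin m → Vert T × Vert T) (e : Fin m) (p : Fin n) (v : Net T) : Prop :=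
  E e = (.inl p, .inr v) ∨ E e = (.inr v, .inl p)

/-- The sequences contain nodes for the first edges. -/
def Collected {m : ℕ} (E : Fin m → Vert T × Vert T) (i : ℕ) (φ : Fin n → Net T → ℝ)
    (L : Net T → List (Fin n × ℝ)) : Prop :=
  ∀ v, (L v).Nodup ∧ ∀ p w, (p, w) ∈ L v ↔ (∃ e : Fin m, e < i ∧ Joins E e p v) ∧ w = φ p v ∧ 0 < w

lemma Joins.unique {m : ℕ} {E : Fin m → Vert T × Vert T} {e : Fin m} {p q : Fin n} {v u : Net T}
    (h : Joins E e p v) (h' : Joins E e q u) : q = p ∧ u = v := by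
  rcases h with h | h <;> rcases h' with h' | h' <;> rw [h] at h' <;> simp at h'
  · exact ⟨h'.1.symm, h'.2.symm⟩
  · exact ⟨h'.2.symm, h'.1.symm⟩

lemma Collected.skip {m : ℕ} {E : Fin m → Vert T × Vert T} {i : ℕ} {φ : Fin n → Net T → ℝ}
    {L : Net T → List (Fin n × ℝ)} (h : Collected E i φ L)
    (hi : ∀ e : Fin m, e = i → ∀ p v, ¬ Joins E e p v) : Collected E (i + 1) φ L := by
  intro v
  refine ⟨(h v).1, fun p w => ?_⟩
  rw [(h v).2]
  refine and_congr_left' ⟨?_, ?_⟩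
  · rintro ⟨e, h1, h2⟩
    exact ⟨e, by omega, h2⟩
  · rintro ⟨e, h1, h2⟩
    rcases Nat.lt_succ_iff_lt_or_eq.1 h1 with h3 | h3
    · exact ⟨e, h3, h2⟩
    · exact absurd h2 (hi e h3 p v)

/-- The pair is joined by no other edge, so the new node cannot repeat an old one. -/
lemma Collected.push {m : ℕ} {E : Fin m → Vert T × Vert T} {i : Fin m} {φ : Fin n → Net T → ℝ}
    {L : Net T → List (Fin n × ℝ)} (h : Collected E i φ L) {p : Fin n} {v : Net T}
    (hi : Joins E i p v) (huniq : ∀ e, Joins E e p v → e = i) :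
    Collected E (i + 1) φ (pushNode L v p (φ p v)) := by
  have key : ∀ u q, (∃ e : Fin m, (e : ℕ) < i + 1 ∧ Joins E e q u) ↔
      (∃ e : Fin m, e < i ∧ Joins E e q u) ∨ u = v ∧ q = p := by
    intro u q
    constructor
    · rintro ⟨e, h1, h2⟩
      rcases Nat.lt_succ_iff_lt_or_eq.1 h1 with h3 | h3
      · exact Or.inl ⟨e, h3, h2⟩
      · obtain rfl := Fin.ext h3
        exact Or.inr (hi.unique h2).symm
    · rintro (⟨e, h1, h2⟩ | ⟨rfl, rfl⟩)
      · exact ⟨e, Nat.lt_succ_of_lt h1, h2⟩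
      · exact ⟨i, Nat.lt_succ_self _, hi⟩
  classical
  intro u
  unfold pushNode
  split_ifs with hw
  · by_cases huv : u = v
    · subst huv
      rw [Function.update_self]
      refine ⟨List.nodup_cons.2 ⟨fun hmem => ?_, (h u).1⟩, fun q w => ?_⟩
      · obtain ⟨⟨e, h1, h2⟩, -⟩ := ((h u).2 _ _).1 hmem
        rw [huniq e h2] at h1
        exact lt_irrefl _ h1
      · rw [List.mem_cons, (h u).2, key, Prod.mk.injEq]
        constructor
        · rintro (⟨rfl, rfl⟩ | ⟨h1, h2⟩)
          · exact ⟨Or.inr ⟨rfl, rfl⟩, rfl, hw⟩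
          · exact ⟨Or.inl h1, h2⟩
        · rintro ⟨h1 | ⟨-, rfl⟩, h2⟩
          · exact Or.inr ⟨h1, h2⟩
          · exact Or.inl ⟨rfl, h2.1⟩
    · rw [Function.update_of_ne huv]
      refine ⟨(h u).1, fun q w => ?_⟩
      rw [(h u).2, key]
      simp [huv]
  · refine ⟨(h u).1, fun q w => ?_⟩
    rw [(h u).2, key]
    refine ⟨fun h1 => ⟨Or.inl h1.1, h1.2⟩, ?_⟩
    rintro ⟨h1 | ⟨rfl, rfl⟩, h2, h3⟩
    · exact ⟨h1, h2, h3⟩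
    · rw [h2] at h3
      exact absurd h3 hw

end Leaves

/-! ### Creating the nodes of all edges. -/

section Setup

variable {n d : ℕ} {P : Fin n → EuclideanSpace ℝ (Fin d)} {k : ℕ} {T : Quadtree P k} {K : ℕ}
  {num : Net T ≃ Fin K}

/-- Creates the nodes for all edges between input points and net points. -/
def growCmd : Cmd := block [
  setVar 74 (.lit 0),
  .loop (.nle (.add (var 74) (.lit 1)) (.get 0 (.lit 3))) (block [
    setVar 55 (.get 4 (var 74)), setVar 56 (.get 5 (var 74)), setVar 74 (.add (var 74) (.lit 1)),
    .ite (.nle (.add (var 55) (.lit 1)) (.get 0 (.lit 0))) leavesCmd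
      (.ite (.nle (.add (var 56) (.lit 1)) (.get 0 (.lit 0)))
        (block [setVar 77 (var 55), setVar 55 (var 56), setVar 56 (var 77), leavesCmd]) .skip)])]

lemma Collected.zero {m : ℕ} {E : Fin m → Vert T × Vert T} {φ : Fin n → Net T → ℝ} :
    Collected E 0 φ fun _ => [] := fun _ => ⟨List.nodup_nil, by simp⟩

lemma growCmd_wp {m : ℕ} {E : Fin m → Vert T × Vert T} {s : Store} {b : ℝ}
    {φ : Vert T → Vert T → ℝ} (hor : IsOrientation (sparseGraph T) E) (hE : Edges num E s)
    (h0 : s.nat 0 0 = n) (hφ : ∀ u v : Vert T, s.entry (vertexId num u) (vertexId num v) = φ u v)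
    (hF : Forest s (K + K + 1) fun _ => .leaf 0 0) {lam R : ℝ} {Nmax : ℕ}
    (hN : K + K + 1 + 2 * m ≤ Nmax) (hlam : Real.logb 2 Nmax ≤ lam) (hlam0 : 0 ≤ lam) (hR : 0 ≤ R)
    (hb : m * (320 * lam + 4800) + 30 + R ≤ b) :
    growCmd.wp (fun s' b' => ∃ pt nt tr, Forest s' (K + K + 1) tr ∧ Trees num pt nt tr ∧
      Collected E m (fun p v => φ (.inr v) (.inl p)) pt ∧
      Collected E m (fun p v => φ (.inl p) (.inr v)) nt ∧
      forestLeaves (K + K + 1) tr ≤ K + K + 1 + 2 * m ∧ forestPot (K + K + 1) tr + R ≤ b') s b := by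
  -- The list of edges contains each adjacent pair once, in one of the two orientations.
  have huniq : ∀ (e i : Fin m) (p : Fin n) (v : Net T), Joins E i p v → Joins E e p v → e = i := by
    intro e i p v hi he
    have hadj : (sparseGraph T).Adj (.inl p) (.inr v) := by
      have := hor.1 i
      rcases hi with h | h <;> rw [h] at this
      · exact this
      · exact this.symm
    exact (hor.2 _ _ hadj).unique he hi
  obtain ⟨LI, hLI⟩ : ∃ LI : Store → ℝ → Prop, ∀ s' b', LI s' b' ↔ ∃ i ≤ m, ∃ pt nt tr,
    s'.nat 74 0 = i ∧ Forest s' (K + K + 1) tr ∧ Trees num pt nt tr ∧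
    Collected E i (fun p v => φ (.inr v) (.inl p)) pt ∧
    Collected E i (fun p v => φ (.inl p) (.inr v)) nt ∧
    forestLeaves (K + K + 1) tr ≤ K + K + 1 + 2 * i ∧
    forestPot (K + K + 1) tr + ((m : ℝ) - i) * (320 * lam + 4800) + 10 + R ≤ b' :=
    ⟨_, fun _ _ => Iff.rfl⟩
  simp only [growCmd, block, wp_seq, wp_nset]
  refine Cmd.wp_loop LI ((hLI _ _).2 ⟨0, Nat.zero_le _, fun _ => [], fun _ => [], fun _ => .leaf 0 0,
    by simp, hF.of_eq (by simp) (by simp) (by simp) (by simp) (by simp) (by simp),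
    ⟨rfl, fun _ _ => le_rfl, fun _ => by simp [Rope.toList], fun _ => by simp [Rope.toList]⟩,
    Collected.zero, Collected.zero, by simp [forestLeaves, Rope.leaves], ?_⟩) ?_ ?_ ?_
  · simp [forestPot, Rope.pot]
    linarith
  · intro s' b' h
    obtain ⟨i, hi, pt, nt, tr, -, -, -, -, -, -, h⟩ := (hLI _ _).1 h
    have : (i : ℝ) ≤ m := by exact_mod_cast hi
    have := forestPot_nonneg (K + K + 1) tr
    have : 0 ≤ ((m : ℝ) - i) * (320 * lam + 4800) := mul_nonneg (by linarith) (by linarith)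
    linarith
  · intro s' b' so h hc
    obtain ⟨i, hi, pt, nt, tr, h1, h2, h3, h4, h5, h6, h7⟩ := (hLI _ _).1 h
    have k1 : ∀ a ∈ [0, 4, 5, 10], s'.nat a = s.nat a := by
      intro a ha
      fin_cases ha <;> exact (so.nat _ rfl).trans (by simp)
    have kr : s'.real 2 = s.real 2 := so.real 2 rfl
    simp [h1, k1, hE.count] at hc
    have t1 := hE.tail ⟨i, hc⟩
    have t2 := hE.head ⟨i, hc⟩
    simp only at t1 t2
    have hadj := hor.1 ⟨i, hc⟩
    have e1 : ((m : ℝ) - i) * (320 * lam + 4800)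
        = ((m : ℝ) - (i + 1 : ℕ)) * (320 * lam + 4800) + (320 * lam + 4800) := by
      push_cast
      ring
    have hrest : 0 ≤ ((m : ℝ) - (i + 1 : ℕ)) * (320 * lam + 4800) := by
      have : ((i + 1 : ℕ) : ℝ) ≤ m := by exact_mod_cast hc
      exact mul_nonneg (by linarith) (by linarith)
    rw [e1] at h7
    have join : ∀ (s₁ : Store) (b₁ : ℝ) (p : Fin n) (v : Net T), Joins E ⟨i, hc⟩ p v →
        s₁.nat 55 0 = p → s₁.nat 56 0 = n + num v → s₁.nat 74 0 = i + 1 →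
        (∀ a ∈ [0, 10, 18, 19, 20, 21, 40], s₁.nat a = s'.nat a) →
        (∀ a ∈ [2, 3], s₁.real a = s'.real a) →
        b' - 60 ≤ b₁ → leavesCmd.wp LI s₁ b₁ := by
      intro s₁ b₁ p v hj h55 h56 h74 kn krr hb₁
      refine Cmd.wp_conseq (leavesCmd_wp (num := num) (φ := φ) (p := p) (v := v) (lam := lam)
        (Nmax := Nmax) (R := ((m : ℝ) - (i + 1 : ℕ)) * (320 * lam + 4800) + 10 + R) ?_
        (h2.of_eq (kn _ (by simp)) (kn _ (by simp)) (kn _ (by simp)) (kn _ (by simp))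
          (kn _ (by simp)) (krr _ (by simp))) h3 h55 h56 (fun u w => ?_) (by omega) hlam hlam0
        (by linarith)) ?_
      · rw [kn 0 (by simp), k1 0 (by simp), h0]
      · rw [← hφ, Store.entry_congr ((kn 10 (by simp)).trans (k1 10 (by simp)))
          ((krr 2 (by simp)).trans kr)]
      · rintro s₂ b₂ so₂ ⟨tr', q1, q2, q3, q4⟩
        refine (hLI _ _).2 ⟨i + 1, hc, _, _, tr', ?_, q1, q2,
          h4.push (i := ⟨i, hc⟩) hj fun e he => huniq _ _ _ _ hj he,
          h5.push (i := ⟨i, hc⟩) hj fun e he => huniq _ _ _ _ hj he, by omega, by linarith⟩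
        rw [so₂.nat 74 rfl, h74]
    simp only [wp_seq, wp_nset, wp_ite, wp_skip]
    simp [h1, k1, t1, t2, h0]
    have hlt : ∀ p : Fin n, vertexId num (.inl p : Vert T) < n := fun p => p.2
    have hge : ∀ v : Net T, ¬ vertexId num (.inr v : Vert T) < n := fun v => by
      simp [vertexId]
    -- Identifiers below `n` belong to input points, which is how the program tells the kinds of
    -- edges apart; two input points are never adjacent.
    rcases hEi : E ⟨i, hc⟩ with ⟨u | u, v | v⟩
    · rw [hEi] at hadj
      exact absurd hadj adj_inl
    · refine ⟨fun _ => join _ _ u v (Or.inl hEi) (by simp [vertexId]) (by simp [vertexId]) (by simp)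
        (fun a ha => ?_) (fun a ha => by simp) (by linarith), fun h => absurd (hlt u) (not_lt.2 h)⟩
      fin_cases ha <;> simp
    · refine ⟨fun h => absurd h (hge u), fun _ => ⟨fun _ => join _ _ v u (Or.inr hEi)
        (by simp [vertexId]) (by simp [vertexId]) (by simp) (fun a ha => ?_) (fun a ha => by simp)
        (by linarith), fun h => absurd (hlt v) (not_lt.2 h)⟩⟩
      fin_cases ha <;> simp
    · refine ⟨fun h => absurd h (hge u), fun _ => ⟨fun h => absurd h (hge v), fun _ => ?_⟩⟩
      have hno : ∀ e : Fin m, (e : ℕ) = i → ∀ p v, ¬ Joins E e p v := by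
        intro e he p w hj
        obtain rfl : e = ⟨i, hc⟩ := Fin.ext he
        unfold Joins at hj
        rw [hEi] at hj
        simp at hj
      exact (hLI _ _).2 ⟨i + 1, hc, pt, nt, tr, by simp,
        h2.of_eq (by simp) (by simp) (by simp) (by simp) (by simp) (by simp), h3, h4.skip hno,
        h5.skip hno, by omega, by linarith⟩
  · intro s' b' so h hc
    obtain ⟨i, hi, pt, nt, tr, h1, h2, h3, h4, h5, h6, h7⟩ := (hLI _ _).1 h
    have e0 : s'.nat 0 = s.nat 0 := (so.nat 0 rfl).trans (by simp)
    simp [h1, e0, hE.count] at hc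
    obtain rfl : i = m := by omega
    refine ⟨pt, nt, tr, h2, h3, h4, h5, h6, ?_⟩
    simp at h7 ⊢
    linarith

end Setup

/-! ### The initial configuration. -/

section Initial

variable {n d : ℕ} {P : Fin n → EuclideanSpace ℝ (Fin d)} {k : ℕ} {T : Quadtree P k} {K : ℕ}

/-- Creates the initial configuration. -/
def setupCmd : Cmd := block [
  offsetsCmd, setVar 40 (.lit 1), bucketCmd 1 1 11 12, bucketCmd 2 2 13 14, traverseCmd, loadCmd,
  growCmd]

/-- The net points of a cell. -/
def blocks (num : Net T ≃ Fin K) (key : ℕ → ℕ) (c : Fin T.numCells) : List (Net T) :=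
  (finBucket K key c).map num.symm

lemma mem_blocks {num : Net T ≃ Fin K} {key : ℕ → ℕ} (hkey : ∀ v : Net T, key (num v) = v.owner)
    (c : Fin T.numCells) (v : Net T) : v ∈ blocks num key c ↔ v.owner = c := by
  simp only [blocks, List.mem_map, mem_finBucket]
  constructor
  · rintro ⟨j, hj, rfl⟩
    have := hkey (num.symm j)
    rw [num.apply_symm_apply, hj] at this
    exact (Fin.ext this).symm
  · rintro rfl
    exact ⟨num v, hkey v, num.symm_apply_apply v⟩

lemma nodup_blocks (num : Net T ≃ Fin K) (key : ℕ → ℕ) (c : Fin T.numCells) :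
    (blocks num key c).Nodup :=
  (nodup_finBucket _ _ _).map num.symm.injective

lemma map_blocks (num : Net T ≃ Fin K) (key : ℕ → ℕ) (c : Fin T.numCells) :
    ((blocks num key c).map fun v => (num v : ℕ)) = bucket key K c := by
  rw [blocks, List.map_map, ← map_finBucket]
  exact List.map_congr_left fun j _ => by simp

lemma length_blocks_le {num : Net T ≃ Fin K} {key : ℕ → ℕ}
    (hkey : ∀ v : Net T, key (num v) = v.owner) (c : Fin T.numCells) :
    (blocks num key c).length ≤ (2 ^ k) ^ d := by
  classical
  rw [← List.toFinset_card_of_nodup (nodup_blocks num key c)]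
  refine le_trans (le_of_eq ?_) (card_owner_le c)
  rw [Fintype.card_subtype]
  congr 1
  ext v
  simp [mem_blocks hkey]

/-- The program fixes the order of the net points by its bucket lists and the traversal; this choice
defines the initial configuration of the run that it simulates. -/
lemma setupCmd_wp (hn : 2 ≤ n) (hP : Function.Injective P) (hT : T.Nested) (num : Net T ≃ Fin K)
    {m : ℕ} {E : Fin m → Vert T × Vert T} (hE : IsOrientation (sparseGraph T) E) (f : Fin m → ℝ)
    {b lam R : ℝ} {Nmax : ℕ}
    (hN : K + K + 1 + 2 * m ≤ Nmax) (hlam : Real.logb 2 Nmax ≤ lam) (hlam0 : 0 ≤ lam) (hR : 0 ≤ R)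
    (hb : 40 * n + 90 * K + 50 * T.numCells + 400 * (n * chainBound n k)
      + m * (320 * lam + 4900) + 500 + R ≤ b) :
    setupCmd.wp (fun s' b' => ∃ (c : Config T) (tr : ℕ → Rope) (cells : List (Fin T.numCells))
        (blk : Fin T.numCells → List (Net T)),
      c.IsInitial E f ∧ c.todo = cells.flatMap blk ∧ PostorderForest T [T.root] cells ∧
      (arr (s'.nat 16) (s'.nat 58 0)).reverse = cells.map Fin.val ∧ Static num blk s' ∧
      (∀ cl v, v ∈ blk cl ↔ v.owner = cl) ∧ (∀ cl, (blk cl).length ≤ (2 ^ k) ^ d) ∧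
      Sim num s' c tr ∧ s'.nat 59 0 = 0 ∧ s'.nat 6 0 = 0 ∧
      forestLeaves (K + K + 1) tr ≤ K + K + 1 + 2 * m ∧ forestPot (K + K + 1) tr + R ≤ b')
    (inputStore T num E f) b := by
  set s₀ := inputStore T num E f with hs₀
  have hkey1 : ∀ c : Fin T.numCells, s₀.nat 1 c = match T.parent c with
      | none => 0
      | some a => (a : ℕ) + 1 := fun c => by
    simp only [hs₀, inputStore, c.2, dif_pos, Fin.eta]
  have hkey2 : ∀ v : Net T, s₀.nat 2 (num v) = v.owner := fun v => by
    simp only [hs₀, inputStore, (num v).2, dif_pos, Fin.eta, num.symm_apply_apply]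
  have hpar : ∀ v : Net T, s₀.nat 3 (num v) = match v.parent? with
      | none => 0
      | some u => (num u : ℕ) + 1 := fun v => by
    simp only [hs₀, inputStore, (num v).2, dif_pos, Fin.eta, num.symm_apply_apply]
  have hedges : Edges num E s₀ := by
    refine ⟨rfl, fun e => ?_, fun e => ?_⟩
    · simp only [hs₀, inputStore, e.2, dif_pos, Fin.eta]
    · simp only [hs₀, inputStore, e.2, dif_pos, Fin.eta]
  have hflow : ∀ e : Fin m, s₀.real 0 e = f e := fun e => by
    simp only [hs₀, inputStore, e.2, dif_pos, Fin.eta]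
  have hz : ∀ a, 5 < a → ∀ i, s₀.nat a i = 0 := by
    intro a ha i
    match a, ha with
    | a + 6, _ => rfl
  have hzr : ∀ a, 0 < a → ∀ i, s₀.real a i = 0 := by
    intro a ha i
    match a, ha with
    | a + 1, _ => rfl
  have c0 : s₀.nat 0 0 = n := rfl
  have c1 : s₀.nat 0 1 = T.numCells := rfl
  have c2 : s₀.nat 0 2 = K := rfl
  clear_value s₀
  have hB := four_le_chainBound (n := n) (k := k) hn
  have hB0 : 0 ≤ (n : ℝ) * chainBound n k := by positivity
  have hm0 : (0 : ℝ) ≤ m * (320 * lam + 4800) := by positivity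
  have hK0 : (0 : ℝ) ≤ K := Nat.cast_nonneg _
  have hm1 : (0 : ℝ) ≤ m := Nat.cast_nonneg _
  have hc0 : (0 : ℝ) ≤ T.numCells := Nat.cast_nonneg _
  simp only [setupCmd, block, wp_seq]
  refine Cmd.wp_conseq (offsetsCmd_wp (W := n + K) (R := b - 40 * (n + K) - 40)
    (by rw [c0, c2]) (by linarith) (by push_cast; linarith)) ?_
  rintro s₁ b₁ so₁ ⟨hoff, hb₁⟩
  have k1 : ∀ a ∈ [0, 1, 2, 3, 4, 5, 6, 11, 13, 18, 20, 21, 27, 28, 59], s₁.nat a = s₀.nat a := by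
    intro a ha
    fin_cases ha <;> exact so₁.nat _ rfl
  have r1 : ∀ a ∈ [0, 2, 3], s₁.real a = s₀.real a := by
    intro a ha
    fin_cases ha <;> exact so₁.real _ rfl
  simp only [wp_seq, wp_nset]
  refine Cmd.wp_conseq (bucketCmd_wp (Or.inl ⟨rfl, rfl, rfl⟩) (fun κ => ?_) ?_) ?_
  · simp [k1, hz]
  · simp [k1, c1]
    linarith
  rintro s₂ b₂ so₂ ⟨ch₂, hb₂⟩
  have k2 : ∀ a ∈ [0, 1, 2, 3, 4, 5, 6, 13, 18, 20, 21, 27, 28, 59], s₂.nat a = s₀.nat a := by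
    intro a ha
    fin_cases ha <;> exact (so₂.nat _ rfl).trans (by simp [k1])
  have r2 : ∀ a ∈ [0, 2, 3], s₂.real a = s₀.real a := by
    intro a ha
    fin_cases ha <;> exact (so₂.real _ rfl).trans (by simp [r1])
  have a2 : s₂.nat 10 = s₁.nat 10 := (so₂.nat 10 rfl).trans (by simp)
  have b2 : s₂.nat 40 0 = 1 := by rw [so₂.nat 40 rfl]; simp
  simp [k1, c1] at ch₂ hb₂
  rw [wp_seq]
  refine Cmd.wp_conseq (bucketCmd_wp (Or.inr ⟨rfl, rfl, rfl⟩) (fun κ => ?_) ?_) ?_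
  · simp [k2, hz]
  · simp [k2, c2]
    linarith
  rintro s₃ b₃ so₃ ⟨ch₃, hb₃⟩
  have k3 : ∀ a ∈ [0, 1, 2, 3, 4, 5, 6, 18, 20, 21, 27, 28, 59], s₃.nat a = s₀.nat a := by
    intro a ha
    fin_cases ha <;> exact (so₃.nat _ rfl).trans (by simp [k2])
  have r3 : ∀ a ∈ [0, 2, 3], s₃.real a = s₀.real a := by
    intro a ha
    fin_cases ha <;> exact (so₃.real _ rfl).trans (by simp [r2])
  have a3 : s₃.nat 10 = s₁.nat 10 := (so₃.nat 10 rfl).trans a2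
  have b3 : s₃.nat 40 = s₂.nat 40 := so₃.nat 40 rfl
  rw [k2 0 (by simp), c2] at hb₃
  rw [k2 0 (by simp), k2 2 (by simp), c2] at ch₃
  rw [wp_seq]
  refine Cmd.wp_conseq (traverseCmd_wp hn hP hT (key := s₀.nat 1) (R := b₃ - 400 * (n * chainBound n k)
    - 50) hkey1 (fun κ => ?_) (by linarith) (by linarith)) ?_
  · rw [so₃.nat 11 rfl, so₃.nat 12 rfl]
    exact ch₂ κ
  rintro s₄ b₄ so₄ ⟨cells, hpost, hcells, hb₄⟩
  have k4 : ∀ a ∈ [0, 1, 2, 3, 4, 5, 6, 18, 20, 21, 27, 28, 59], s₄.nat a = s₀.nat a := by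
    intro a ha
    fin_cases ha <;> exact (so₄.nat _ rfl).trans (by simp [k3])
  have r4 : ∀ a ∈ [0, 2, 3], s₄.real a = s₀.real a := by
    intro a ha
    fin_cases ha <;> exact (so₄.real _ rfl).trans (by simp [r3])
  have a4 : s₄.nat 10 = s₁.nat 10 := (so₄.nat 10 rfl).trans a3
  have b4 : s₄.nat 40 0 = 1 := by rw [so₄.nat 40 rfl, b3, b2]
  have ch₄ : ∀ κ, Chain (s₄.nat 14) (s₄.nat 13 κ) (bucket (s₀.nat 2) K κ) := fun κ => by
    rw [so₄.nat 14 rfl, so₄.nat 13 rfl]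
    exact ch₃ κ
  rw [wp_seq]
  refine Cmd.wp_conseq (loadCmd_wp (num := num) (E := E) (f := f) (R := b₄ - 100 * m - 30)
    (hedges.of_eq (k4 _ (by simp)) (k4 _ (by simp)) (k4 _ (by simp)))
    (fun e => by rw [r4 0 (by simp), hflow]) ?_ (fun i => by rw [r4 2 (by simp), hzr _ (by simp)])
    (by linarith) (by linarith)) ?_
  · unfold Offsets
    rw [a4]
    exact hoff
  rintro s₅ b₅ so₅ ⟨hent, hb₅⟩
  have k5 : ∀ a ∈ [0, 1, 2, 3, 4, 5, 6, 18, 20, 21, 27, 28, 59], s₅.nat a = s₀.nat a := by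
    intro a ha
    fin_cases ha <;> exact (so₅.nat _ rfl).trans (by simp [k4])
  have b5 : s₅.nat 40 0 = 1 := by rw [so₅.nat 40 rfl, b4]
  refine Cmd.wp_conseq (growCmd_wp (num := num) (E := E) (φ := flowBetween E f) (R := R + 10)
    (lam := lam) (Nmax := Nmax) hE
    (hedges.of_eq (k5 _ (by simp)) (k5 _ (by simp)) (k5 _ (by simp))) (by rw [k5 0 (by simp), c0])
    hent (fun i _ => ⟨?_, le_rfl⟩) hN hlam hlam0 (by linarith) (by linarith)) ?_
  -- All slots point to address `0` of the zero memory, which reads as an empty leaf; sharing it is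
  -- safe because allocation starts at address `1`.
  · refine ⟨?_, ?_, ?_, ?_⟩
    · rw [b5, k5 21 (by simp), hz _ (by simp)]
      exact one_pos
    · rw [k5 18 (by simp), hz _ (by simp)]
    · rw [k5 20 (by simp), hz _ (by simp)]
    · rw [so₅.real 3 rfl, r4 3 (by simp), hzr _ (by simp)]
  rintro s₆ b₆ so₆ ⟨pt, nt, tr, q1, q2, q3, q4, q5, q6⟩
  have k6 : ∀ a ∈ [0, 3, 6, 27, 28, 59], s₆.nat a = s₀.nat a := by
    intro a ha
    fin_cases ha <;> exact (so₆.nat _ rfl).trans (by simp [k5])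
  have a6 : s₆.nat 10 = s₁.nat 10 := by rw [so₆.nat 10 rfl, so₅.nat 10 rfl, a4]
  have hent₆ : ∀ u v : Vert T, s₆.entry (vertexId num u) (vertexId num v) = flowBetween E f u v :=
    fun u v => by rw [← hent, Store.entry_congr (so₆.nat 10 rfl) (so₆.real 2 rfl)]
  have hpp : ∀ p q : Fin n, flowBetween E f (.inl p : Vert T) (.inl q) = 0 := by
    intro p q
    by_contra hcon
    obtain ⟨e, he | he⟩ := flowBetween_ne_zero hcon
    · have := hE.1 e
      rw [he] at this
      exact adj_inl this
    · have := hE.1 e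
      rw [he] at this
      exact adj_inl this
  refine ⟨⟨cells.flatMap (blocks num (s₀.nat 2)), .cancel, fun u v => flowBetween E f (.inr u) (.inr v),
    fun _ _ => 0, pt, nt⟩, tr, cells, blocks num (s₀.nat 2), ⟨⟨cells, cells.map (blocks num (s₀.nat 2)),
    hpost, ?_, rfl⟩, rfl, fun _ _ => rfl, fun _ _ => rfl, fun v => ⟨(q4 v).1, fun p w => ?_⟩,
    fun v => ⟨(q3 v).1, fun p w => ?_⟩⟩, rfl, hpost, ?_, ⟨?_, ?_, ?_, fun v => ?_, fun c => ?_⟩,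
    mem_blocks hkey2, length_blocks_le hkey2, ⟨rfl, ⟨fun u v => ?_, fun p q => ?_⟩, ⟨?_, ?_⟩, q1, q2⟩,
    ?_, ?_, q5, by linarith⟩
  · rw [List.forall₂_map_right_iff, List.forall₂_same]
    exact fun c _ => ⟨nodup_blocks _ _ _, mem_blocks hkey2 c⟩
  · rw [(q4 v).2]
    refine ⟨fun h => h.2, fun h => ⟨?_, h⟩⟩
    -- Positive flow forces an edge in the list, so having looked at all edges is no restriction.
    obtain ⟨e, he⟩ := flowBetween_ne_zero (h.1 ▸ h.2.ne')
    exact ⟨e, e.2, he⟩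
  · rw [(q3 v).2]
    refine ⟨fun h => h.2, fun h => ⟨?_, h⟩⟩
    obtain ⟨e, he⟩ := flowBetween_ne_zero (h.1 ▸ h.2.ne')
    exact ⟨e, e.2, he.symm⟩
  · rw [so₆.nat 16 rfl, so₆.nat 58 rfl, so₅.nat 16 rfl, so₅.nat 58 rfl, hcells]
  · rw [k6 0 (by simp), c0]
  · rw [k6 0 (by simp), c2]
  · unfold Offsets
    rw [a6]
    exact hoff
  · rw [k6 3 (by simp), hpar]
  · rw [map_blocks, so₆.nat 14 rfl, so₆.nat 13 rfl, so₅.nat 14 rfl, so₅.nat 13 rfl]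
    exact ch₄ c
  · exact hent₆ (.inr u) (.inr v)
  · exact (hent₆ (.inl p) (.inl q)).trans (hpp p q)
  · intro i hi
    rw [k6 59 (by simp), hz _ (by simp)] at hi
    exact absurd hi (Nat.not_lt_zero _)
  · intro p q h
    exact absurd rfl h
  · rw [k6 59 (by simp), hz _ (by simp)]
  · rw [k6 6 (by simp), hz _ (by simp)]

end Initial

/-! ### Listing the support of the result. -/

section Output

variable {n W : ℕ} {g : Fin n → Fin n → ℝ}

/-- Appends the pair in `55` and `56` to the output if it carries positive flow, and removes its
flow from the matrix. -/
def emitCmd : Cmd := .ite (.rle (entryExp (var 55) (var 56)) .zero) .skip (block [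
  .nset 7 (var 6) (var 55), .nset 8 (var 6) (var 56),
  .rset 1 (var 6) (entryExp (var 55) (var 56)), setVar 6 (.add (var 6) (.lit 1)),
  .rset 2 (.add (.get 10 (var 55)) (var 56)) .zero])

/-- A pair with positive flow is either still in the matrix or in the output. -/
structure Emitted (W : ℕ) (g : Fin n → Fin n → ℝ) (s : Store) : Prop where
  off : Offsets s W
  entry : ∀ p q : Fin n, s.entry p q = g p q ∧ (∀ j < s.nat 6 0, ¬ (s.nat 7 j = p ∧ s.nat 8 j = q)) ∨
    s.entry p q = 0 ∧ ∃! j, j < s.nat 6 0 ∧ s.nat 7 j = p ∧ s.nat 8 j = q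
  list : ∀ j < s.nat 6 0, ∃ p q : Fin n, s.nat 7 j = p ∧ s.nat 8 j = q ∧ 0 < g p q ∧
    s.real 1 j = g p q

lemma Emitted.of_eq {s s' : Store} (h : Emitted W g s)
    (hnat : ∀ a ∈ [6, 7, 8, 10], s'.nat a = s.nat a) (hreal : ∀ a ∈ [1, 2], s'.real a = s.real a) :
    Emitted W g s' := by
  refine ⟨?_, fun p q => ?_, ?_⟩
  · unfold Offsets; rw [hnat 10 (by simp)]; exact h.off
  · rw [Store.entry_congr (hnat 10 (by simp)) (hreal 2 (by simp)), hnat 6 (by simp),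
      hnat 7 (by simp), hnat 8 (by simp)]
    exact h.entry p q
  · rw [hnat 6 (by simp), hnat 7 (by simp), hnat 8 (by simp), hreal 1 (by simp)]
    exact h.list

/-- Erasing the entry on output makes later occurrences of the pair in the log ineffective, so
nothing is listed twice. -/
lemma emitCmd_wp {s : Store} {b : ℝ} (hnW : n ≤ W) (hI : Emitted W g s) {p q : Fin n}
    (hp : s.nat 55 0 = p) (hq : s.nat 56 0 = q) :
    emitCmd.wp (fun s' b' => Emitted W g s' ∧ s'.entry p q ≤ 0 ∧
      (∀ x y : Fin n, s.entry x y ≤ 0 → s'.entry x y ≤ 0) ∧ b - 80 ≤ b') s b := by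
  have hW : ∀ x : Fin n, (x : ℕ) < W := fun x => x.2.trans_le hnW
  simp only [emitCmd, block, wp_seq, wp_nset, wp_rset, wp_ite, wp_skip]
  simp [hp, hq]
  have hent : s.real 2 (s.nat 10 p + q) = s.entry p q := rfl
  rw [hent]
  constructor
  · intro h
    exact ⟨hI, h, by linarith⟩
  · intro h
    have hg : s.entry p q = g p q ∧ ∀ j < s.nat 6 0, ¬ (s.nat 7 j = p ∧ s.nat 8 j = q) := by
      rcases hI.entry p q with h1 | h1
      · exact h1
      · rw [h1.1] at h
        exact absurd h (lt_irrefl _)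
    set c := s.nat 6 0 with hc
    have hidx : ∀ x y : Fin n, s.nat 10 x + y = s.nat 10 p + q ↔ x = p ∧ y = q := fun x y => by
      rw [hI.off.index_eq (hW x) (hW p) (hW y) (hW q), Fin.val_inj, Fin.val_inj]
    have key : ∀ (s' : Store), s'.nat 10 = s.nat 10 →
        s'.real 2 = Function.update (s.real 2) (s.nat 10 p + q) 0 →
        ∀ x y : Fin n, s'.entry x y = if x = p ∧ y = q then 0 else s.entry x y := by
      intro s' e1 e2 x y
      unfold Store.entry
      rw [e1, e2, Function.update_apply]
      exact if_congr (hidx x y) rfl rfl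
    have hkey := key ((((((s.setNat 7 c p).setNat 8 c q).setReal 1 c (s.entry p q)).setNat 6 0
      (c + 1)).setReal 2 (s.nat 10 p + q) 0)) (by simp) (by ext; simp [Store.setReal, Function.update_apply])
    refine ⟨⟨?_, fun x y => ?_, fun j hj => ?_⟩, ?_, fun x y hxy => ?_, by linarith⟩
    · unfold Offsets
      simpa using (show ∀ i < W, s.nat 10 i = i * W from hI.off)
    · rw [hkey]
      by_cases hxy : x = p ∧ y = q
      · right
        obtain ⟨rfl, rfl⟩ := hxy
        refine ⟨by simp, c, by simp, ?_⟩
        rintro j ⟨h1, h2, h3⟩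
        by_contra hjc
        simp [hjc] at h1 h2 h3
        exact hg.2 j (by omega) ⟨h2, h3⟩
      · rw [if_neg hxy]
        have hmem : ∀ j, (j < c + 1 ∧ (if j = c then (p : ℕ) else s.nat 7 j) = x ∧
            (if j = c then (q : ℕ) else s.nat 8 j) = y) ↔ (j < c ∧ s.nat 7 j = x ∧ s.nat 8 j = y) := by
          intro j
          by_cases hjc : j = c
          · subst hjc
            simp
            intro h1 h2
            exact hxy ⟨(Fin.ext h1).symm, (Fin.ext h2).symm⟩
          · have : j < c + 1 ↔ j < c := by omega
            simp [hjc, this]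
        rcases hI.entry x y with ⟨h1, h2⟩ | ⟨h1, j, h2, h3⟩
        · left
          refine ⟨h1, fun j hj hcon => ?_⟩
          have := (hmem j).1 ⟨by simpa using hj, by simpa using hcon⟩
          exact h2 j this.1 this.2
        · right
          refine ⟨h1, j, ?_, fun j' hj' => ?_⟩
          · simpa using (hmem j).2 h2
          · exact h3 j' ((hmem j').1 (by simpa using hj'))
    · by_cases hjc : j = c
      · subst hjc
        exact ⟨p, q, by simp, by simp, hg.1 ▸ h, by simpa using hg.1⟩
      · obtain ⟨x, y, h1, h2, h3, h4⟩ := hI.list j (by simp at hj; omega)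
        exact ⟨x, y, by simpa [hjc] using h1, by simpa [hjc] using h2, h3, by simpa [hjc] using h4⟩
    · rw [hkey]
      simp
    · rw [hkey]
      split_ifs
      · exact le_rfl
      · exact hxy

/-- Lists the pairs with positive flow. -/
def outputCmd : Cmd := block [
  setVar 74 (.lit 0),
  .loop (.nle (.add (var 74) (.lit 1)) (var 59)) (block [
    setVar 55 (.get 27 (var 74)), setVar 56 (.get 28 (var 74)), emitCmd,
    setVar 55 (.get 28 (var 74)), setVar 56 (.get 27 (var 74)), emitCmd,
    setVar 74 (.add (var 74) (.lit 1))])]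

/-- Every log entry is tried in both directions, since the log does not know the sign of the final
flow. The credits stored with the entries pay for the pass. -/
lemma outputCmd_wp {s : Store} {b : ℝ} (hnW : n ≤ W) (hoff : Offsets s W)
    (hent : ∀ p q : Fin n, s.entry p q = g p q) (hL : LogSim n s g) (h6 : s.nat 6 0 = 0)
    (hb : 300 * (s.nat 59 0 : ℝ) + 30 ≤ b) :
    outputCmd.wp (fun s' b' => Lists s' (fun p q => if 0 < g p q then g p q else 0) ∧ 0 ≤ b')
      s b := by
  obtain ⟨LI, hLI⟩ : ∃ LI : Store → ℝ → Prop, ∀ s' b', LI s' b' ↔ ∃ i ≤ s.nat 59 0,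
    s'.nat 74 0 = i ∧ Emitted W g s' ∧
    (∀ j < i, ∀ p q : Fin n, s.nat 27 j = p ∧ s.nat 28 j = q ∨ s.nat 27 j = q ∧ s.nat 28 j = p →
      s'.entry p q ≤ 0) ∧
    300 * ((s.nat 59 0 : ℝ) - i) + 10 ≤ b' := ⟨_, fun _ _ => Iff.rfl⟩
  simp only [outputCmd, block, wp_seq, wp_nset]
  refine Cmd.wp_loop LI ((hLI _ _).2 ⟨0, Nat.zero_le _, by simp, ?_, by simp, ?_⟩) ?_ ?_ ?_
  · refine Emitted.of_eq (s := s) ⟨hoff, fun p q => Or.inl ⟨hent p q, ?_⟩, ?_⟩ (by simp) (by simp)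
    · simp [h6]
    · simp [h6]
  · simp
    linarith
  · intro s' b' h
    obtain ⟨i, hi, -, -, -, h⟩ := (hLI _ _).1 h
    have : (i : ℝ) ≤ s.nat 59 0 := by exact_mod_cast hi
    linarith
  · intro s' b' so h hc
    obtain ⟨i, hi, h1, h2, h3, h4⟩ := (hLI _ _).1 h
    have k1 : ∀ a ∈ [27, 28, 59], s'.nat a = s.nat a := by
      intro a ha
      fin_cases ha <;> exact (so.nat _ rfl).trans (by simp)
    simp [h1, k1] at hc
    obtain ⟨hp, hq⟩ := hL.lt i hc
    simp only [wp_seq, wp_nset]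
    refine Cmd.wp_conseq (emitCmd_wp hnW (p := ⟨_, hp⟩) (q := ⟨_, hq⟩)
      (h2.of_eq (by simp) (by simp)) (by simp [h1, k1]) (by simp [h1, k1])) ?_
    rintro s₁ b₁ so₁ ⟨hI₁, e₁, m₁, c₁⟩
    have k74 : s₁.nat 74 0 = i := by rw [so₁.nat 74 rfl]; simp [h1]
    have k2 : ∀ a ∈ [27, 28, 59], s₁.nat a = s.nat a := by
      intro a ha
      fin_cases ha <;> exact (so₁.nat _ rfl).trans (by simp [k1])
    simp only [wp_seq, wp_nset]
    refine Cmd.wp_conseq (emitCmd_wp hnW (p := ⟨_, hq⟩) (q := ⟨_, hp⟩)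
      (hI₁.of_eq (by simp) (by simp)) (by simp [k74, k2]) (by simp [k74, k2])) ?_
    rintro s₂ b₂ so₂ ⟨hI₂, e₂, m₂, c₂⟩
    have k74' : s₂.nat 74 0 = i := by rw [so₂.nat 74 rfl]; simp [k74]
    simp only [wp_nset]
    have mono₁ : ∀ x y : Fin n, s'.entry x y ≤ 0 → s₁.entry x y ≤ 0 := fun x y h =>
      m₁ x y (by rwa [Store.entry_congr (s := s') (by simp) (by simp)])
    have mono₂ : ∀ x y : Fin n, s₁.entry x y ≤ 0 → s₂.entry x y ≤ 0 := fun x y h =>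
      m₂ x y (by rwa [Store.entry_congr (s := s₁) (by simp) (by simp)])
    refine (hLI _ _).2 ⟨i + 1, hc, by simp [k74'], hI₂.of_eq (by simp) (by simp),
      fun j hj p q hpq => ?_, ?_⟩
    · rw [Store.entry_congr (s := s₂) (by simp) (by simp)]
      rcases Nat.lt_succ_iff_lt_or_eq.1 hj with hj | rfl
      · exact mono₂ _ _ (mono₁ _ _ (h3 j hj p q hpq))
      · rcases hpq with ⟨x1, x2⟩ | ⟨x1, x2⟩
        · have := mono₂ _ _ e₁
          simpa only [x1, x2] using this
        · simpa only [x1, x2] using e₂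
    · simp at c₁ c₂
      simp
      linarith
  · intro s' b' so h hc
    obtain ⟨i, hi, h1, h2, h3, h4⟩ := (hLI _ _).1 h
    have k1 : s'.nat 59 = s.nat 59 := (so.nat _ rfl).trans (by simp)
    simp [h1, k1] at hc
    obtain rfl : i = s.nat 59 0 := by omega
    refine ⟨⟨fun j hj => ?_, fun p q hpq => ?_⟩, ?_⟩
    · obtain ⟨p, q, x1, x2, x3, x4⟩ := h2.list j hj
      exact ⟨p, q, x1, x2, (if_pos x3).trans_ne x3.ne', x4.trans (if_pos x3).symm⟩
    · have hpos : 0 < g p q := by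
        by_contra hcon
        exact hpq (if_neg hcon)
      obtain ⟨i, x1, x2⟩ := hL.mem p q hpos.ne'
      have := h3 i x1 p q x2
      -- A positive entry cannot have stayed in the matrix: its pair is in the log, and after the
      -- pass such entries are nonpositive.
      rcases h2.entry p q with h | h
      · rw [h.1] at this
        exact absurd hpos (not_lt.2 this)
      · exact h.2
    · simp at h4 ⊢
      linarith

end Output

/-! ### Arithmetic of the running time. -/

section Numerics

lemma one_le_logb_div_eps {n : ℕ} (hn : 2 ≤ n) (k : ℕ) : 1 ≤ Real.logb 2 (n / eps k) := by
  have hn' : (2 : ℝ) ≤ n := by exact_mod_cast hn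
  have h1 : (1 : ℝ) ≤ 2 ^ k := one_le_pow₀ one_le_two
  rw [Real.le_logb_iff_rpow_le one_lt_two (by unfold eps; positivity), Real.rpow_one, eps,
    div_inv_eq_mul]
  nlinarith

/-- The bound is `4 + 2 + 8 * Λ` with `Λ` the binary logarithm of `n / ε₀`. As `n ≥ 2` gives `Λ ≥
1`, the constants are absorbed. -/
lemma chainBound_le {n : ℕ} (hn : 2 ≤ n) (k : ℕ) :
    chainBound n k ≤ 14 * Real.logb 2 (n / eps k) := by
  have hn' : (2 : ℝ) ≤ n := by exact_mod_cast hn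
  have hn0 : (0 : ℝ) < n := by linarith
  have h1 : (1 : ℝ) ≤ 2 ^ k := one_le_pow₀ one_le_two
  have hX := one_le_logb_div_eps hn k
  have h2 : 3 * (n : ℝ) ^ 8 / eps k ≤ 2 ^ 2 * (n / eps k) ^ 8 := by
    unfold eps
    rw [div_inv_eq_mul, div_inv_eq_mul, mul_pow]
    have h3 : (2 : ℝ) ^ k ≤ (2 ^ k) ^ 8 := le_self_pow₀ h1 (by norm_num)
    have h4 : (0 : ℝ) ≤ n ^ 8 := by positivity
    nlinarith [mul_le_mul_of_nonneg_left h3 h4]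
  have h3 : Real.logb 2 (3 * (n : ℝ) ^ 8 / eps k) ≤ 2 + 8 * Real.logb 2 (n / eps k) := by
    refine (Real.logb_le_logb_of_le one_lt_two (by unfold eps; positivity) h2).trans ?_
    rw [Real.logb_mul (by norm_num) (by unfold eps; positivity), Real.logb_pow, Real.logb_pow,
      Real.logb_self_eq_one one_lt_two]
    norm_num
  unfold chainBound
  linarith

/-- A bound for the logarithm of the number of nodes. -/
noncomputable def depthBound (d n k : ℕ) : ℝ :=
  Real.logb 2 (33 * (n * chainBound n k) * ((2 ^ k) ^ d * (2 ^ k) ^ d))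

lemma one_le_nodes {n : ℕ} (hn : 2 ≤ n) (d k : ℕ) :
    8 ≤ (n : ℝ) * chainBound n k ∧ (1 : ℝ) ≤ (2 ^ k) ^ d := by
  have hn' : (2 : ℝ) ≤ n := by exact_mod_cast hn
  have hC := four_le_chainBound (n := n) (k := k) hn
  exact ⟨by nlinarith, one_le_pow₀ (one_le_pow₀ one_le_two)⟩

lemma one_le_depthBound {n : ℕ} (hn : 2 ≤ n) (d k : ℕ) : 1 ≤ depthBound d n k := by
  obtain ⟨h1, h2⟩ := one_le_nodes hn d k
  have h3 : (1 : ℝ) ≤ (2 ^ k) ^ d * (2 ^ k) ^ d := by nlinarith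
  rw [depthBound, Real.le_logb_iff_rpow_le one_lt_two (by positivity), Real.rpow_one]
  nlinarith

/-- All quantities under the logarithm are polynomial in `X = n / ε₀`, with degree depending on `d`;
this is where the constant of the theorem becomes linear in `d`. -/
lemma depthBound_le {n : ℕ} (hn : 2 ≤ n) (d k : ℕ) :
    depthBound d n k ≤ (2 * d + 11) * Real.logb 2 (n / eps k) := by
  have hn' : (2 : ℝ) ≤ n := by exact_mod_cast hn
  have hn0 : (0 : ℝ) < n := by linarith
  have h1 : (1 : ℝ) ≤ 2 ^ k := one_le_pow₀ one_le_two
  have hX := one_le_logb_div_eps hn k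
  obtain ⟨h2, h3⟩ := one_le_nodes hn d k
  have hC := chainBound_le hn k
  set X : ℝ := n / eps k with hXdef
  have hXe : X = n * 2 ^ k := by rw [hXdef, eps, div_inv_eq_mul]
  have hnX : (n : ℝ) ≤ X := by rw [hXe]; nlinarith
  have hkX : (2 : ℝ) ^ k ≤ X := by rw [hXe]; nlinarith
  have hX0 : 0 < X := hn0.trans_le hnX
  have hlog : Real.logb 2 X ≤ X := by
    rw [Real.logb_le_iff_le_rpow one_lt_two hX0]
    -- Bernoulli's inequality, `1 + X ≤ 2 ^ X`.
    have h4 : (1 : ℝ) + X * 1 ≤ (1 + 1) ^ X :=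
      one_add_mul_self_le_rpow_one_add (by norm_num) (by linarith)
    norm_num at h4 ⊢
    linarith
  -- The constant `2 ^ 9` covers `33 * 14 = 462`.
  have h5 : 33 * (n * chainBound n k) * ((2 ^ k) ^ d * (2 ^ k) ^ d) ≤ 2 ^ 9 * X ^ (2 * d + 2) := by
    have h6 : ((2 : ℝ) ^ k) ^ d ≤ X ^ d := pow_le_pow_left₀ (by positivity) hkX d
    have h7 : (n : ℝ) * chainBound n k ≤ X * (14 * X) :=
      mul_le_mul hnX (hC.trans (by linarith)) (by linarith [four_le_chainBound (n := n) (k := k) hn])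
        hX0.le
    have h8 : ((2 : ℝ) ^ k) ^ d * (2 ^ k) ^ d ≤ X ^ d * X ^ d :=
      mul_le_mul h6 h6 (by positivity) (by positivity)
    have h9 : (n * chainBound n k) * (((2 : ℝ) ^ k) ^ d * (2 ^ k) ^ d)
        ≤ X * (14 * X) * (X ^ d * X ^ d) :=
      mul_le_mul h7 h8 (by positivity) (by positivity)
    have h10 : X * (14 * X) * (X ^ d * X ^ d) = 14 * X ^ (2 * d + 2) := by ring
    have h11 : 0 ≤ X ^ (2 * d + 2) := by positivity
    rw [h10] at h9
    linarith
  have h6 : depthBound d n k ≤ 9 + (2 * d + 2) * Real.logb 2 X := by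
    refine (Real.logb_le_logb_of_le one_lt_two (by positivity) h5).trans ?_
    rw [Real.logb_mul (by norm_num) (by positivity), Real.logb_pow, Real.logb_pow,
      Real.logb_self_eq_one one_lt_two]
    push_cast
    linarith
  linarith

/-- A bound for the number of operations. -/
noncomputable def totalCost (d n k N K m : ℕ) : ℝ :=
  40 * n + 90 * K + 50 * N + 400 * (n * chainBound n k) + m * (320 * depthBound d n k + 4900) + 500 +
    2 * n * chainBound n k * (cellCost ((2 ^ k) ^ d) (depthBound d n k) + 30) + 50

/-- Here `S` stands for `n * chainBound n k`, `q` for the number of subcells of a cell and `l` for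
the depth bound. Everything is dominated by `S * q² * l` as all three are at least one. -/
lemma totalCost_aux {n N K m S q l : ℝ} (hq : 1 ≤ q) (hl : 1 ≤ l) (hS : 8 ≤ S) (hn : n ≤ S)
    (hN : N ≤ 2 * S) (hK : K ≤ N * q) (hm : m ≤ 5 * (N * (q * q))) :
    40 * n + 90 * K + 50 * N + 400 * S + m * (320 * l + 4900) + 500 +
      2 * S * (100 * q + 100 + q * ((2 * q + 1) * (20000 + 1600 * l) + 30) + 30) + 50
      ≤ 200000 * (S * (q * q) * l) := by
  have hqq : q ≤ q * q := by nlinarith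
  have hQl : q * q ≤ q * q * l := by nlinarith
  have hSQ : S ≤ S * (q * q) := by nlinarith
  have hSQl : S * (q * q) ≤ S * (q * q) * l := by nlinarith
  have hKY : N * q ≤ 2 * S * (q * q) := mul_le_mul hN hqq (by linarith) (by linarith)
  have hmS : N * (q * q) ≤ 2 * S * (q * q) := mul_le_mul_of_nonneg_right hN (by linarith)
  have hmY : m * (320 * l + 4900) ≤ 10 * (S * (q * q)) * (5220 * l) :=
    mul_le_mul (by linarith) (by linarith) (by linarith) (by positivity)
  have e2 : q * (2 * q + 1) * (20000 + 1600 * l) ≤ 3 * (q * q) * (21600 * l) :=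
    mul_le_mul (by nlinarith) (by linarith) (by linarith) (by positivity)
  have hcell : 100 * q + 100 + q * ((2 * q + 1) * (20000 + 1600 * l) + 30) + 30
      ≤ 65060 * (q * q * l) := by linarith
  have hcellY := mul_le_mul_of_nonneg_left hcell (show 0 ≤ 2 * S by linarith)
  generalize 100 * q + 100 + q * ((2 * q + 1) * (20000 + 1600 * l) + 30) + 30 = X at *
  linarith

lemma totalCost_le {d n k N K m : ℕ} (hn : 2 ≤ n) (hN : (N : ℝ) ≤ 2 * n * chainBound n k)
    (hK : K ≤ N * (2 ^ k) ^ d) (hm : m ≤ 5 * (N * ((2 ^ k) ^ d * (2 ^ k) ^ d))) :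
    totalCost d n k N K m
      ≤ 11200000 * (2 * d + 11) * n * (eps k ^ (2 * d))⁻¹ * Real.log (n / eps k) ^ 2 := by
  obtain ⟨h1, h2⟩ := one_le_nodes hn d k
  have hl := one_le_depthBound hn d k
  have hn' : (2 : ℝ) ≤ n := by exact_mod_cast hn
  have hC := four_le_chainBound (n := n) (k := k) hn
  have hΛ := one_le_logb_div_eps hn k
  have hK' : (K : ℝ) ≤ N * (2 ^ k) ^ d := by exact_mod_cast hK
  have hm' : (m : ℝ) ≤ 5 * (N * ((2 ^ k) ^ d * (2 ^ k) ^ d)) := by exact_mod_cast hm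
  have hCΛ := chainBound_le hn k
  have hlΛ := depthBound_le hn d k
  have heps : (eps k ^ (2 * d))⁻¹ = (2 ^ k) ^ d * (2 ^ k) ^ d := by
    rw [eps, inv_pow, inv_inv]
    ring
  have hΛ2 : Real.logb 2 (n / eps k) ^ 2 ≤ 4 * Real.log (n / eps k) ^ 2 := by
    have h3 := Real.log_two_gt_d9
    have h4 : Real.logb 2 (n / eps k) * Real.log 2 = Real.log (n / eps k) := by
      rw [Real.logb]
      field_simp
    rw [← h4, mul_pow]
    -- Changing from binary to natural logarithms costs a factor `4`, since `log 2 > 1 / 2`. With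
    -- `14` from `chainBound_le` this makes `56`, and `200000 * 56 = 11200000`.
    have h5 : 1 ≤ 4 * Real.log 2 ^ 2 := by nlinarith
    nlinarith [sq_nonneg (Real.logb 2 (n / eps k))]
  have hd : (0 : ℝ) ≤ 2 * d + 11 := by positivity
  rw [heps]
  unfold totalCost cellCost
  push_cast
  generalize depthBound d n k = l at *
  generalize chainBound n k = C at *
  generalize Real.logb 2 (n / eps k) = Λ at *
  generalize Real.log (n / eps k) = M at *
  generalize ((2 : ℝ) ^ k) ^ d = q at *
  have hsum := totalCost_aux (n := n) (S := n * C) h2 hl h1 (by nlinarith) (by linarith) hK' hm'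
  have hCl : C * l ≤ 14 * Λ * ((2 * d + 11) * Λ) :=
    mul_le_mul hCΛ hlΛ (by linarith) (by linarith)
  have hCl' : C * l ≤ 56 * (2 * d + 11) * M ^ 2 := by
    have := mul_le_mul_of_nonneg_left hΛ2 hd
    linarith
  have hnq : 0 ≤ (n : ℝ) * (q * q) := by positivity
  have h := mul_le_mul_of_nonneg_left hCl' hnq
  rw [mul_assoc (2 : ℝ) n C]
  refine hsum.trans ?_
  linarith

end Numerics

/-! ### The complete program. -/

section Program

variable {n d : ℕ} {P : Fin n → EuclideanSpace ℝ (Fin d)} {k : ℕ} {T : Quadtree P k} {K : ℕ}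

/-- The program. -/
def rerouteCmd : Cmd := block [setupCmd, mainCmd, outputCmd]

lemma not_step_of_todo {c : Config T} (h : c.todo = []) (c' : Config T) : ¬ Step c c' := by
  intro hs
  cases hs <;> simp at h

lemma rerouteCmd_wp (hn : 2 ≤ n) (hP : Function.Injective P) (hT : T.Nested) (num : Net T ≃ Fin K)
    {μ : Fin n → ℝ} {m : ℕ} {E : Fin m → Vert T × Vert T} (hE : IsOrientation (sparseGraph T) E)
    {f : Fin m → ℝ} (hf : (incidence E).mulVec f = demand μ) (hN : (T.numCells : ℝ) ≤ 2 * n * chainBound n k)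
    (hK : K ≤ T.numCells * (2 ^ k) ^ d)
    (hm : m ≤ 5 * (T.numCells * ((2 ^ k) ^ d * (2 ^ k) ^ d))) :
    rerouteCmd.wp (fun s' b' => (∃ c₀ c : Config T, c₀.IsInitial E f ∧
      Relation.ReflTransGen Step c₀ c ∧ (∀ c', ¬ Step c c') ∧ Lists s' c.result) ∧ 0 ≤ b')
      (inputStore T num E f) (totalCost d n k T.numCells K m) := by
  obtain ⟨h1, h2⟩ := one_le_nodes hn d k
  set lam := depthBound d n k with hlamdef
  set C := chainBound n k with hC
  set q : ℕ := (2 ^ k) ^ d with hq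
  have hqr : ((q : ℕ) : ℝ) = (2 ^ k) ^ d := by rw [hq]; push_cast; rfl
  have hq1 : (1 : ℝ) ≤ q := by rw [hqr]; exact h2
  have hlam1 : 1 ≤ lam := one_le_depthBound hn d k
  have hlam0 : 0 ≤ lam := by linarith
  have hS0 : 0 ≤ 2 * n * C := by linarith
  -- Leaves that can ever exist: one per slot, two per edge, and `4 * q * q` per processed cell.
  -- With the bounds on cells, net points and edges, the terms contribute `4 + 1 + 20 + 8 = 33`
  -- multiples of `n * C * q²`, the constant in `depthBound`.
  set Nmax : ℕ := K + K + 1 + 2 * m + 4 * q * q * ⌊2 * n * C⌋₊ with hNmax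
  have hlam : Real.logb 2 Nmax ≤ lam := by
    rw [hlamdef, depthBound, ← hqr]
    refine Real.logb_le_logb_of_le one_lt_two ?_ ?_
    · rw [hNmax]
      positivity
    · have hqq : (q : ℝ) ≤ q * q := by nlinarith
      have g1 : (K : ℝ) ≤ T.numCells * q := by exact_mod_cast hK
      have g2 : (m : ℝ) ≤ 5 * (T.numCells * (q * q)) := by exact_mod_cast hm
      have g3 : (⌊2 * n * C⌋₊ : ℝ) ≤ 2 * n * C := Nat.floor_le hS0
      have g4 : (T.numCells : ℝ) * q ≤ 2 * n * C * (q * q) :=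
        mul_le_mul hN hqq (by linarith) hS0
      have g5 : (T.numCells : ℝ) * (q * q) ≤ 2 * n * C * (q * q) :=
        mul_le_mul_of_nonneg_right hN (by linarith)
      have g6 : (q : ℝ) * q * ⌊2 * n * C⌋₊ ≤ q * q * (2 * n * C) :=
        mul_le_mul_of_nonneg_left g3 (by linarith)
      have g7 : 1 ≤ n * C * (q * q) := by nlinarith
      rw [hNmax]
      push_cast
      linarith
  have hcost := cellCost_nonneg q hlam0
  simp only [rerouteCmd, block]
  rw [wp_seq]
  refine Cmd.wp_conseq (setupCmd_wp hn hP hT num hE f (lam := lam) (Nmax := Nmax)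
    (R := 2 * n * C * (cellCost q lam + 30) + 50) (by omega) hlam hlam0 (by positivity) ?_) ?_
  · unfold totalCost
    linarith
  rintro s₁ b₁ - ⟨c, tr, cells, blk, i1, i2, i3, i4, i5, i6, i7, i8, i9, i10, i11, i12⟩
  have hlen : (cells.length : ℝ) ≤ 2 * n * C := i3.length_root_le hn hP hT
  have hlen' : cells.length ≤ ⌊2 * n * C⌋₊ := Nat.le_floor hlen
  have hmul : 4 * q * q * cells.length ≤ 4 * q * q * ⌊2 * n * C⌋₊ := Nat.mul_le_mul_left _ hlen'
  have hcredit : credits K s₁ tr = forestPot (K + K + 1) tr := by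
    simp [credits, i9]
  have hmulr : (cells.length : ℝ) * (cellCost q lam + 30) ≤ 2 * n * C * (cellCost q lam + 30) :=
    mul_le_mul_of_nonneg_right hlen (by linarith)
  rw [wp_seq]
  refine Cmd.wp_conseq (mainCmd_wp (q := q) (lam := lam) (Nmax := Nmax) (R := 40) i1.1.childrenFirst
    i5 i6 (parent?_eq_some hn hP hT) i7 i4 i8 i2 (i1.inv hE hf) (by omega) hlam hlam0 (by norm_num)
    (by rw [hcredit]; linarith)) ?_
  rintro s₂ b₂ so₂ ⟨c', tr', r1, r2, r3, r4⟩
  refine Cmd.wp_conseq (outputCmd_wp (W := n + K) (g := c'.pointFlow) (Nat.le_add_right _ _) ?_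
    r3.flow.point r3.log ?_ ?_) ?_
  · unfold Offsets
    rw [so₂.nat 10 rfl]
    exact i5.off
  · rw [so₂.nat 6 rfl, i10]
  · have := forestPot_nonneg (K + K + 1) tr'
    unfold credits at r4
    linarith
  · rintro s₃ b₃ - ⟨x1, x2⟩
    exact ⟨⟨c, c', i1, r1, not_step_of_todo r2, x1⟩, x2⟩

end Program

end TransportRecovery

open TransportRecovery
/-- There is a real RAM program such that in every dimension `d`, for every feasible flow `f` on the
sparse graph: all runs of the rerouting algorithm terminate and end with a transportation map of
cost at most that of `f`; and the program, given `f`, halts with the outcome of such a run after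
`O(n * ε₀ ^ (-2d) * log (n / ε₀) ^ 2)` operations. -/
theorem mainTheorem6 :
    ∃ prog : Cmd, ∀ d : ℕ, ∃ K₀ : ℝ,
      ∀ (n k : ℕ) (P : Fin n → EuclideanSpace ℝ (Fin d)) (μ : Fin n → ℝ) (T : Quadtree P k)
        (m : ℕ) (E : Fin m → Vert T × Vert T) (f : Fin m → ℝ),
        2 ≤ n → Function.Injective P → ∑ p, μ p = 0 → T.Nested →
        IsOrientation (sparseGraph T) E → (incidence E).mulVec f = demand μ →
        (∀ c₀ : Config T, c₀.IsInitial E f →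
          Acc (fun c' c => Step c c') c₀ ∧
          ∀ c, Relation.ReflTransGen Step c₀ c → (∀ c', ¬ Step c c') →
            c.todo = [] ∧ IsTransportationMap μ c.result ∧
              transportCost P c.result ≤ flowCost (location T) E f) ∧
        ∀ (K : ℕ) (num : Net T ≃ Fin K),
          ∃ (s : Store) (t : ℕ), Exec prog (inputStore T num E f) s t ∧
            (t : ℝ) ≤ K₀ * n * (eps k ^ (2 * d))⁻¹ * Real.log (n / eps k) ^ 2 ∧
            ∃ c₀ c : Config T, c₀.IsInitial E f ∧ Relation.ReflTransGen Step c₀ c ∧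
              (∀ c', ¬ Step c c') ∧ Lists s c.result := by
  refine ⟨rerouteCmd, fun d => ⟨11200000 * (2 * d + 11), ?_⟩⟩
  intro n k P μ T m E f hn hP _ hT hE hf
  refine ⟨fun c₀ h => run_correct hE hf h, fun K num => ?_⟩
  -- A postorder lists every cell, so its length bounds the number of cells; that is its only use
  -- here.
  obtain ⟨L, hL⟩ := PostorderForest.exists_forest hn hP hT [T.root]
  have hN : (T.numCells : ℝ) ≤ 2 * n * chainBound n k :=
    le_trans (by exact_mod_cast hL.numCells_le) (hL.length_root_le hn hP hT)
  have hK : K ≤ T.numCells * (2 ^ k) ^ d := by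
    have := card_net_le (T := T)
    rwa [Fintype.card_congr num, Fintype.card_fin] at this
  have hm := card_edges_le hn hP hT hE
  obtain ⟨s, t, h1, h2, h3⟩ := Cmd.wp_iff _ _ _ _ (rerouteCmd_wp hn hP hT num hE hf hN hK hm)
  exact ⟨s, t, h1, (sub_nonneg.1 h3).trans (totalCost_le hn hN hK hm), h2⟩
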